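/- **Plus constructions with groupoid compatible pointings.** Let $\mathcal C$ be a category. The (symmetric) monoidal category $\mathcal C^{\boxtimes+,\mathrm{gcp}}$ has as objects the words (formal $\boxtimes$-products) in the morphisms of $\mathcal C$. Its morphisms are generated, under composition, $\boxtimes$ and the constraints of a (symmetric) monoidal category, by the isomorphisms $(\sigma\Downarrow\sigma'):\phi\to\sigma'\phi\sigma^{-1}$, by $\gamma_{\phi_1,\phi_0}:\phi_1\boxtimes\phi_0\to\phi_1\circ\phi_0$, and by $i_\sigma:\mathbf 1\to\sigma$ for every isomorphism $\sigma$. The relations are: the $(\sigma\Downarrow\sigma')$ compose as in $\mathrm{Iso}(\mathcal C\downarrow\mathcal C)$; $\gamma$ is equivariant and associative; $(\sigma\Downarrow\sigma')i_\tau=i_{\sigma'\tau\sigma^{-1}}$; and $\gamma(\mathrm{id}_\phi\boxtimes i_\sigma)=(\sigma^{-1}\Downarrow\mathrm{id})$, $\gamma(i_\sigma\boxtimes\mathrm{id}_\phi)=(\mathrm{id}\Downarrow\sigma)$ modulo unit constraints. Let $\mathcal M$ be a monoidal category. $\mathcal M^{nc+,\mathrm{gcp}}$ is obtained from the symmetric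 monoidal category $\mathcal M^{\boxtimes+,\mathrm{gcp}}$ by adjoining morphisms $\mu_{\phi,\psi}:\phi\boxtimes\psi\to\phi\otimes\psi$ subject to: equivariance; associativity; interchange with $\gamma$; $\mu(i_\sigma\boxtimes i_{\sigma'})=i_{\sigma\otimes\sigma'}$; $i_{\mathrm{id}_{\mathbf 1}}$ is a two-sided unit for $\mu$ (modulo unit constraints); and, if $\mathcal M$ is taken as a symmetric monoidal category, compatibility with the commutativity constraints. $\mathcal M^{loc+,\mathrm{gcp}}$ is obtained by also inverting all $\mu_{\phi,\psi}$. For symmetric $\mathcal M$, $\mathcal M^{+,\mathrm{gcp}}$ has the morphisms of $\mathcal M$ as objects and $\otimes$ as its product, with unit $\mathrm{id}_{\mathbf 1}$ and the constraints of $\mathcal M$; it is generated by the $(\sigma\Downarrow\sigma')$, $\gamma$ and $i_\sigma$ with the relations above, interchange and $i_\sigma\otimes i_{\sigma'}=i_{\sigma\otimes\sigma'}$. **Bimodule monoids.** Let $\mathcal E$ be a symmetric monoidal category with coproducts that are preserved by $\otimes$ in each variable, and with the coends over $\mathrm{Iso}(\mathcal C)$ resp. $\mathrm{Iso}(\mathcal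 M)$. A unital $\mathrm{Iso}(\mathcal C)$-bimodule monoid in $\mathcal E$ is a functor $\rho:\mathrm{Iso}(\mathcal C)^{op}\times\mathrm{Iso}(\mathcal C)\to\mathcal E$ that is a unital monoid for the plethysm product $(\rho\circ\rho)(X,Z)=\int^{Y}\rho(Y,Z)\otimes\rho(X,Y)$; its unit is $u:\coprod_{\sigma\in\mathrm{Iso}(X,Y)}\mathbf 1\to\rho(X,Y)$. It is lax monoidal if it has equivariant associative products $\mu:\rho(X,Y)\otimes\rho(X',Y')\to\rho(X\otimes X',Y\otimes Y')$ satisfying interchange with the composition and $\mu(u_\sigma\otimes u_{\sigma'})=u_{\sigma\otimes\sigma'}$, with $u_{\mathrm{id}_{\mathbf 1}}$ as unit; and symmetric if $\mu$ is compatible with commutativity constraints. $\mathrm{Hom}_{\mathcal C}$ (lax monoidal and, for symmetric $\mathcal M$, symmetric in the case of $\mathrm{Hom}_{\mathcal M}$) is the bimodule monoid $(X,Y)\mapsto\coprod_{\phi:X\to Y}\mathbf 1$. A counital monoid over $\mathrm{Hom}_{\mathcal C}$ is a unital bimodule monoid $\rho$ with a morphism $b:\rho\to\mathrm{Hom}_{\mathcal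 C}$ and decompositions $\rho(X,Y)=\coprod_{\phi}D(\phi)$, $b=\coprod_\phi\epsilon(\phi)$, $\epsilon(\phi):D(\phi)\to\mathbf 1$, respected by all operations; morphisms are those over $\mathrm{Hom}_{\mathcal C}$ which respect the decompositions. The same definition is used in the (symmetric) lax monoidal case over $\mathrm{Hom}_{\mathcal M}$. A lax monoidal monoid over $\mathrm{Hom}_{\mathcal M}$ is called strong if the maps $D(\phi)\otimes D(\psi)\to D(\phi\otimes\psi)$ induced by $\mu$ are isomorphisms. A counital functor is a strong monoidal functor with a monoidal natural transformation to the constant functor $\mathcal T=\mathbf 1$. **Splittings.** Let $D(\phi)$ be the values of a functor $D$ on the letters $\phi$, or the summands of a counital monoid $\rho$; elements are morphisms from $\mathbf 1$. A splitting consists of sets $I(\sigma)$ of elements of $D(\sigma)$ and decompositions $D(\sigma)=\big(\coprod_{I(\sigma)}\mathbf 1\big)\amalg D^{red}(\sigma)$ for all isomorphisms $\sigma$, such that: every element of $D(\sigma)$ with a two-sided inverse in $D(\sigma^{-1})$ lies in the first summand, and no such element lies in $D^{red}(\sigma)$; products of elements of $I(\sigma)$ and $I(\tau)$ lie in $I(\sigma\tau)$,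 and multiplication by a fixed element on either side is a bijection; and the element $u_\sigma$ (resp. $D(i_\sigma)$) is the inclusion of a direct summand $\mathbf 1$ of $\coprod_{I(\sigma)}\mathbf 1$. A functor is split if it has a splitting; $\rho$ is isomorphism split if it has one in which all elements of all $I(\sigma)$ are invertible. **Theorem.** (a) Let $\mathcal E$ be as above, and such that the inclusions of summands into coproducts are monomorphisms. Then there are equivalences of categories between 1. counital strong monoidal (resp. symmetric monoidal) functors $\mathcal C^{\boxtimes+,\mathrm{gcp}}\to\mathcal E$, where $\mathcal C^{\boxtimes+,\mathrm{gcp}}$ is the monoidal (resp. symmetric monoidal) version, and counital unital $\mathrm{Iso}(\mathcal C)$-bimodule monoids over $\mathrm{Hom}_{\mathcal C}$; 2. counital strong symmetric monoidal functors $\mathcal M^{nc+,\mathrm{gcp}}\to\mathcal E$ and counital unital lax monoidal $\mathrm{Iso}(\mathcal M)$-bimodule monoids over $\mathrm{Hom}_{\mathcal M}$; 3. counital strong symmetric monoidal functors $\mathcal M^{loc+,\mathrm{gcp}}\to\mathcal E$ and counital unital strong monoidal $\mathrm{Iso}(\mathcal M)$-bimodule monoids over $\mathrm{Hom}_{\mathcal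 M}$; 4. for symmetric $\mathcal M$: counital strong symmetric monoidal functors $\mathcal M^{+,\mathrm{gcp}}\to\mathcal E$ and counital unital strong symmetric monoidal $\mathrm{Iso}(\mathcal M)$-bimodule monoids over $\mathrm{Hom}_{\mathcal M}$; in 2 and 3, if $\mathcal M$ is taken as a symmetric monoidal category, the bimodule monoids are the symmetric ones. Under these equivalences the values of a functor on the letters $\phi$ are isomorphic to the summands $D(\phi)$, compatibly with counits, compositions, units and $\mu$; and the split functors correspond to the isomorphism split bimodule monoids. (b) If $\mathcal E$ is Cartesian monoidal with pullbacks and with coproducts that are disjoint and universal, then the same equivalences hold with all strong (symmetric) monoidal functors and with all unital (lax monoidal, resp. strong) bimodule monoids in the slice category over $\mathrm{Hom}_{\mathcal C}$ resp. $\mathrm{Hom}_{\mathcal M}$, where $D(\phi)=\{\phi\}\times_{\mathrm{Hom}(X,Y)}\rho(X,Y)$. Under them the values of a functor on the letters $\phi$ are these fibres, compatibly with all operations. -/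

import Mathlib

open CategoryTheory CategoryTheory.Limits CategoryTheory.MonoidalCategory Opposite

universe w v u vE uE

set_option linter.unusedSectionVars false

namespace PlusConstruction

/-! ## Monoidal categories presented by generators and relations

`Term I T G s` consists of the formal morphisms that one obtains from generating morphisms `G`
between objects of `O`, where `O` carries a unit object `I` and a tensor operation `T`, by formal
composition, formal tensor product and the structural morphisms of a monoidal category; if
`s = true`, formal symmetries are added. -/

section Presentations

/-- Formal morphisms generated by `G` under the operations of a (symmetric) monoidal category. -/
inductive Term {O : Type w} (I : O) (T : O → O → O) (G : O → O → Type w) (s : Bool) :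
    O → O → Type w
  | gen {X Y : O} (g : G X Y) : Term I T G s X Y
  | id (X : O) : Term I T G s X X
  | comp {X Y Z : O} (f : Term I T G s X Y) (g : Term I T G s Y Z) : Term I T G s X Z
  | tensor {X Y X' Y' : O} (f : Term I T G s X Y) (g : Term I T G s X' Y') :
      Term I T G s (T X X') (T Y Y')
  | assocHom (X Y Z : O) : Term I T G s (T (T X Y) Z) (T X (T Y Z))
  | assocInv (X Y Z : O) : Term I T G s (T X (T Y Z)) (T (T X Y) Z)
  | leftHom (X : O) : Term I T G s (T I X) X
  | leftInv (X : O) : Term I T G s X (T I X)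
  | rightHom (X : O) : Term I T G s (T X I) X
  | rightInv (X : O) : Term I T G s X (T X I)
  | braid (h : s = true) (X Y : O) : Term I T G s (T X Y) (T Y X)

/-- A family of relations between parallel formal morphisms. -/
abbrev TermRel {O : Type w} (I : O) (T : O → O → O) (G : O → O → Type w) (s : Bool) :=
  ∀ ⦃X Y : O⦄, Term I T G s X Y → Term I T G s X Y → Prop

variable {O : Type w} {I : O} {T : O → O → O} {G : O → O → Type w} {s : Bool}

/-- The smallest congruence that contains `R` and the axioms of a (symmetric) monoidal category. -/
inductive MonoidalClosure (R : TermRel I T G s) : TermRel I T G s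
  | of {X Y : O} {f g : Term I T G s X Y} : R f g → MonoidalClosure R f g
  | refl {X Y : O} (f : Term I T G s X Y) : MonoidalClosure R f f
  | symm {X Y : O} {f g : Term I T G s X Y} : MonoidalClosure R f g → MonoidalClosure R g f
  | trans {X Y : O} {f g h : Term I T G s X Y} :
      MonoidalClosure R f g → MonoidalClosure R g h → MonoidalClosure R f h
  | comp {X Y Z : O} {f f' : Term I T G s X Y} {g g' : Term I T G s Y Z} :
      MonoidalClosure R f f' → MonoidalClosure R g g' →
        MonoidalClosure R (f.comp g) (f'.comp g')
  | tensor {X Y X' Y' : O} {f f' : Term I T G s X Y} {g g' : Term I T G s X' Y'} :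
      MonoidalClosure R f f' → MonoidalClosure R g g' →
        MonoidalClosure R (f.tensor g) (f'.tensor g')
  | id_comp {X Y : O} (f : Term I T G s X Y) : MonoidalClosure R ((Term.id X).comp f) f
  | comp_id {X Y : O} (f : Term I T G s X Y) : MonoidalClosure R (f.comp (Term.id Y)) f
  | assoc {W X Y Z : O} (f : Term I T G s W X) (g : Term I T G s X Y) (h : Term I T G s Y Z) :
      MonoidalClosure R ((f.comp g).comp h) (f.comp (g.comp h))
  | tensor_id (X Y : O) :
      MonoidalClosure R ((Term.id X).tensor (Term.id Y)) (Term.id (T X Y))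
  | tensor_comp {X Y Z X' Y' Z' : O} (f : Term I T G s X Y) (g : Term I T G s Y Z)
      (f' : Term I T G s X' Y') (g' : Term I T G s Y' Z') :
      MonoidalClosure R ((f.tensor f').comp (g.tensor g')) ((f.comp g).tensor (f'.comp g'))
  | assoc_hom_inv (X Y Z : O) :
      MonoidalClosure R ((Term.assocHom X Y Z).comp (Term.assocInv X Y Z)) (Term.id _)
  | assoc_inv_hom (X Y Z : O) :
      MonoidalClosure R ((Term.assocInv X Y Z).comp (Term.assocHom X Y Z)) (Term.id _)
  | assoc_natural {X Y X' Y' X'' Y'' : O} (f : Term I T G s X Y) (f' : Term I T G s X' Y')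
      (f'' : Term I T G s X'' Y'') :
      MonoidalClosure R (((f.tensor f').tensor f'').comp (Term.assocHom Y Y' Y''))
        ((Term.assocHom X X' X'').comp (f.tensor (f'.tensor f'')))
  | left_hom_inv (X : O) :
      MonoidalClosure R ((Term.leftHom X).comp (Term.leftInv X)) (Term.id _)
  | left_inv_hom (X : O) :
      MonoidalClosure R ((Term.leftInv X).comp (Term.leftHom X)) (Term.id _)
  | left_natural {X Y : O} (f : Term I T G s X Y) :
      MonoidalClosure R (((Term.id I).tensor f).comp (Term.leftHom Y))
        ((Term.leftHom X).comp f)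
  | right_hom_inv (X : O) :
      MonoidalClosure R ((Term.rightHom X).comp (Term.rightInv X)) (Term.id _)
  | right_inv_hom (X : O) :
      MonoidalClosure R ((Term.rightInv X).comp (Term.rightHom X)) (Term.id _)
  | right_natural {X Y : O} (f : Term I T G s X Y) :
      MonoidalClosure R ((f.tensor (Term.id I)).comp (Term.rightHom Y))
        ((Term.rightHom X).comp f)
  | pentagon (W X Y Z : O) :
      MonoidalClosure R
        (((Term.assocHom W X Y).tensor (Term.id Z)).comp
          ((Term.assocHom W (T X Y) Z).comp ((Term.id W).tensor (Term.assocHom X Y Z))))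
        ((Term.assocHom (T W X) Y Z).comp (Term.assocHom W X (T Y Z)))
  | triangle (X Y : O) :
      MonoidalClosure R ((Term.assocHom X I Y).comp ((Term.id X).tensor (Term.leftHom Y)))
        ((Term.rightHom X).tensor (Term.id Y))
  | braid_braid (h : s = true) (X Y : O) :
      MonoidalClosure R ((Term.braid h X Y).comp (Term.braid h Y X)) (Term.id _)
  | braid_natural (h : s = true) {X Y X' Y' : O} (f : Term I T G s X Y)
      (f' : Term I T G s X' Y') :
      MonoidalClosure R ((f.tensor f').comp (Term.braid h Y Y'))
        ((Term.braid h X X').comp (f'.tensor f))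
  | hexagon (h : s = true) (X Y Z : O) :
      MonoidalClosure R
        ((Term.assocHom X Y Z).comp ((Term.braid h X (T Y Z)).comp (Term.assocHom Y Z X)))
        (((Term.braid h X Y).tensor (Term.id Z)).comp
          ((Term.assocHom Y X Z).comp ((Term.id Y).tensor (Term.braid h X Z))))
  | hexagon_inv (h : s = true) (X Y Z : O) :
      MonoidalClosure R
        ((Term.assocInv X Y Z).comp ((Term.braid h (T X Y) Z).comp (Term.assocInv Z X Y)))
        (((Term.id X).tensor (Term.braid h Y Z)).comp
          ((Term.assocInv X Z Y).comp ((Term.braid h X Z).tensor (Term.id Y))))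

/-- The exchange of the two middle factors of a fourfold product. -/
def Term.middleSwap (X X' Y Y' : O) :
    Term I T G true (T (T X X') (T Y Y')) (T (T X Y) (T X' Y')) :=
  (Term.assocHom X X' (T Y Y')).comp <|
    ((Term.id X).tensor (Term.assocInv X' Y Y')).comp <|
    ((Term.id X).tensor ((Term.braid rfl X' Y).tensor (Term.id Y'))).comp <|
    ((Term.id X).tensor (Term.assocHom Y X' Y')).comp <|
    Term.assocInv X Y (T X' Y')

/-- Formal morphisms up to the congruence generated by `R`. -/
def termSetoid (R : TermRel I T G s) (X Y : O) : Setoid (Term I T G s X Y) :=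
  ⟨fun f g => MonoidalClosure R f g, .refl, .symm, .trans⟩

/-- The monoidal category with objects `O` that is presented by the generators `G` and the
relations `R`; for `s = true` it is the symmetric monoidal category presented by them. -/
def Presented (_R : TermRel I T G s) : Type w := O

variable {R : TermRel I T G s}

instance : Category.{w} (Presented R) where
  Hom X Y := Quotient (termSetoid R X Y)
  id X := Quotient.mk _ (Term.id X)
  comp := Quotient.map₂ Term.comp (fun _ _ hf _ _ hg => MonoidalClosure.comp hf hg)
  id_comp := by
    rintro X Y ⟨f⟩
    exact Quotient.sound (.id_comp f)
  comp_id := by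
    rintro X Y ⟨f⟩
    exact Quotient.sound (.comp_id f)
  assoc := by
    rintro W X Y Z ⟨f⟩ ⟨g⟩ ⟨h⟩
    exact Quotient.sound (.assoc f g h)

/-- The morphism of the presented category that a formal morphism represents. -/
def Presented.mk (R : TermRel I T G s) {X Y : O} (f : Term I T G s X Y) :
    @Quiver.Hom (Presented R) _ X Y := Quotient.mk (termSetoid R X Y) f

instance : MonoidalCategoryStruct (Presented R) where
  tensorObj X Y := T X Y
  tensorUnit := I
  tensorHom := Quotient.map₂ Term.tensor (fun _ _ hf _ _ hg => MonoidalClosure.tensor hf hg)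
  whiskerLeft X _ _ f := Quotient.map (fun f => (Term.id X).tensor f)
    (fun _ _ h => MonoidalClosure.tensor (.refl _) h) f
  whiskerRight f Y := Quotient.map (fun f => f.tensor (Term.id Y))
    (fun _ _ h => MonoidalClosure.tensor h (.refl _)) f
  associator X Y Z := ⟨Quotient.mk _ (Term.assocHom X Y Z), Quotient.mk _ (Term.assocInv X Y Z),
    Quotient.sound (.assoc_hom_inv X Y Z), Quotient.sound (.assoc_inv_hom X Y Z)⟩
  leftUnitor X := ⟨Quotient.mk _ (Term.leftHom X), Quotient.mk _ (Term.leftInv X),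
    Quotient.sound (.left_hom_inv X), Quotient.sound (.left_inv_hom X)⟩
  rightUnitor X := ⟨Quotient.mk _ (Term.rightHom X), Quotient.mk _ (Term.rightInv X),
    Quotient.sound (.right_hom_inv X), Quotient.sound (.right_inv_hom X)⟩

instance : MonoidalCategory (Presented R) :=
  MonoidalCategory.ofTensorHom
    (id_tensorHom_id := fun X Y => Quotient.sound (.tensor_id X Y))
    (id_tensorHom := by
      rintro X Y Z ⟨f⟩
      rfl)
    (tensorHom_id := by
      rintro X Y ⟨f⟩ Z
      rfl)
    (tensorHom_comp_tensorHom := by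
      rintro X₁ Y₁ Z₁ X₂ Y₂ Z₂ ⟨f₁⟩ ⟨f₂⟩ ⟨g₁⟩ ⟨g₂⟩
      exact Quotient.sound (.tensor_comp f₁ g₁ f₂ g₂))
    (associator_naturality := by
      rintro X₁ X₂ X₃ Y₁ Y₂ Y₃ ⟨f₁⟩ ⟨f₂⟩ ⟨f₃⟩
      exact Quotient.sound (.assoc_natural f₁ f₂ f₃))
    (leftUnitor_naturality := by
      rintro X Y ⟨f⟩
      exact Quotient.sound (.left_natural f))
    (rightUnitor_naturality := by
      rintro X Y ⟨f⟩
      exact Quotient.sound (.right_natural f))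
    (pentagon := fun W X Y Z => Quotient.sound (.pentagon W X Y Z))
    (triangle := fun X Y => Quotient.sound (.triangle X Y))

section Symmetric

variable {R : TermRel I T G true}

instance : SymmetricCategory (Presented R) where
  braiding X Y := ⟨Quotient.mk _ (Term.braid rfl X Y), Quotient.mk _ (Term.braid rfl Y X),
    Quotient.sound (.braid_braid rfl X Y), Quotient.sound (.braid_braid rfl Y X)⟩
  braiding_naturality_right := by
    rintro X Y Z ⟨f⟩
    exact Quotient.sound (.braid_natural rfl (Term.id X) f)
  braiding_naturality_left := by
    rintro X Y ⟨f⟩ Z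
    exact Quotient.sound (.braid_natural rfl f (Term.id Z))
  hexagon_forward X Y Z := Quotient.sound (.hexagon rfl X Y Z)
  hexagon_reverse X Y Z := Quotient.sound (.hexagon_inv rfl X Y Z)
  symmetry X Y := Quotient.sound (.braid_braid rfl X Y)

end Symmetric

end Presentations

/-! ## The plus constructions with groupoid compatible pointings -/

section Plus

/-- The isomorphism `(a ⇓ b)` of arrows from `φ` to `φ'` that is given by a commutative square. -/
abbrev square {C : Type u} [Category.{v} C] {X Y X' Y' : C} {φ : X ⟶ Y} {φ' : X' ⟶ Y'}
    (a : X ≅ X') (b : Y ≅ Y') (h : a.hom ≫ φ' = φ ≫ b.hom) : Arrow.mk φ ≅ Arrow.mk φ' :=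
  Arrow.isoMk a b h

/-- The generators common to all plus constructions: objects given by morphisms of `C`, the
isomorphisms `(a ⇓ b)`, the compositions `γ`, and the adjoined pointings `i_σ`. -/
structure PlusOps (C : Type u) [Category.{v} C] {O : Type w} (I : O) (T : O → O → O)
    (G : O → O → Type w) where
  letter : Arrow C → O
  iso {f g : Arrow C} (e : f ≅ g) : G (letter f) (letter g)
  comp {X Y Z : C} (φ₁ : Y ⟶ Z) (φ₀ : X ⟶ Y) :
    G (T (letter (Arrow.mk φ₁)) (letter (Arrow.mk φ₀))) (letter (Arrow.mk (φ₀ ≫ φ₁)))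
  unit {X Y : C} (σ : X ≅ Y) : G I (letter (Arrow.mk σ.hom))

/-- The relations of the plus construction: the isomorphisms of arrows compose as in
`Iso (C ↓ C)`, and `γ` is equivariant (inner and outer equivariance in one equation)
and associative. -/
inductive PlusRel {C : Type u} [Category.{v} C] {O : Type w} {I : O} {T : O → O → O}
    {G : O → O → Type w} {s : Bool} (K : PlusOps C I T G) : TermRel I T G s
  | iso_id (f : Arrow C) : PlusRel K (.gen (K.iso (Iso.refl f))) (.id (K.letter f))
  | iso_comp {f g h : Arrow C} (e : f ≅ g) (e' : g ≅ h) :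
      PlusRel K (.gen (K.iso (e ≪≫ e'))) (.comp (.gen (K.iso e)) (.gen (K.iso e')))
  | equivariance {X Y Z X' Y' Z' : C} (a : X ≅ X') (b : Y ≅ Y') (c : Z ≅ Z')
      (φ₁ : Y ⟶ Z) (φ₁' : Y' ⟶ Z') (φ₀ : X ⟶ Y) (φ₀' : X' ⟶ Y')
      (h₁ : b.hom ≫ φ₁' = φ₁ ≫ c.hom) (h₀ : a.hom ≫ φ₀' = φ₀ ≫ b.hom) :
      PlusRel K
        (.comp (.tensor (.gen (K.iso (square b c h₁))) (.gen (K.iso (square a b h₀))))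
          (.gen (K.comp φ₁' φ₀')))
        (.comp (.gen (K.comp φ₁ φ₀))
          (.gen (K.iso (square a c (φ := φ₀ ≫ φ₁) (φ' := φ₀' ≫ φ₁')
            (by rw [← Category.assoc, h₀, Category.assoc, h₁, Category.assoc])))))
  | assoc {W X Y Z : C} (φ₂ : Y ⟶ Z) (φ₁ : X ⟶ Y) (φ₀ : W ⟶ X) :
      PlusRel K
        (.comp (.tensor (.gen (K.comp φ₂ φ₁)) (.id (K.letter (Arrow.mk φ₀))))
          (.comp (.gen (K.comp (φ₁ ≫ φ₂) φ₀))
            (.gen (K.iso (square (Iso.refl W) (Iso.refl Z) (φ := φ₀ ≫ φ₁ ≫ φ₂)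
              (φ' := (φ₀ ≫ φ₁) ≫ φ₂) (by simp))))))
        (.comp (.assocHom _ _ _)
          (.comp (.tensor (.id (K.letter (Arrow.mk φ₂))) (.gen (K.comp φ₁ φ₀)))
            (.gen (K.comp φ₂ (φ₀ ≫ φ₁)))))

/-- The relations for the pointings `i_σ : 𝟙 ⟶ σ`: compatibility with the groupoid action and with
composition on the right and on the left. -/
inductive PointingRel {C : Type u} [Category.{v} C] {O : Type w} {I : O} {T : O → O → O}
    {G : O → O → Type w} {s : Bool} (K : PlusOps C I T G) : TermRel I T G s
  | equivariance {X Y X' Y' : C} (τ : X ≅ Y) (τ' : X' ≅ Y') (a : X ≅ X') (b : Y ≅ Y')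
      (h : a.hom ≫ τ'.hom = τ.hom ≫ b.hom) :
      PointingRel K (.comp (.gen (K.unit τ)) (.gen (K.iso (square a b h)))) (.gen (K.unit τ'))
  | right {X Y Z : C} (φ : Y ⟶ Z) (σ : X ≅ Y) :
      PointingRel K
        (.comp (.rightInv _)
          (.comp (.tensor (.id (K.letter (Arrow.mk φ))) (.gen (K.unit σ)))
            (.gen (K.comp φ σ.hom))))
        (.gen (K.iso (square σ.symm (Iso.refl Z) (φ := φ) (φ' := σ.hom ≫ φ) (by simp))))
  | left {X Y Z : C} (σ : Y ≅ Z) (φ : X ⟶ Y) :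
      PointingRel K
        (.comp (.leftInv _)
          (.comp (.tensor (.gen (K.unit σ)) (.id (K.letter (Arrow.mk φ))))
            (.gen (K.comp σ.hom φ))))
        (.gen (K.iso (square (Iso.refl X) σ (φ := φ) (φ' := φ ≫ σ.hom) (by simp))))

/-- The images of the generating objects and of the generators `γ`, `i_σ` in a monoidal category
obtained by a plus construction. -/
structure PlusMorphisms (C : Type u) [Category.{v} C] (P : Type w) [Category.{w} P]
    [MonoidalCategory P] where
  letter : Arrow C → P
  comp {X Y Z : C} (φ₁ : Y ⟶ Z) (φ₀ : X ⟶ Y) :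
    letter (Arrow.mk φ₁) ⊗ letter (Arrow.mk φ₀) ⟶ letter (Arrow.mk (φ₀ ≫ φ₁))
  unit {X Y : C} (σ : X ≅ Y) : 𝟙_ P ⟶ letter (Arrow.mk σ.hom)

/-- The generators of a presentation as morphisms of the presented category. -/
def PlusOps.morphisms {C : Type u} [Category.{v} C] {O : Type w} {I : O} {T : O → O → O}
    {G : O → O → Type w} {s : Bool} (K : PlusOps C I T G) (R : TermRel I T G s) :
    PlusMorphisms C (Presented R) where
  letter f := K.letter f
  comp φ₁ φ₀ := Presented.mk R (.gen (K.comp φ₁ φ₀))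
  unit σ := Presented.mk R (.gen (K.unit σ))

/-- Bracketed words in the letters `A`, the objects of the free monoidal category `A^⊠`. -/
inductive Word (A : Type w) : Type w
  | empty : Word A
  | letter (a : A) : Word A
  | box (x y : Word A) : Word A

/-- The generators of `C^{⊠+,gcp}`. -/
inductive PlusGen (C : Type u) [Category.{v} C] :
    Word (Arrow C) → Word (Arrow C) → Type (max u v)
  | iso {f g : Arrow C} (e : f ≅ g) : PlusGen C (.letter f) (.letter g)
  | comp {X Y Z : C} (φ₁ : Y ⟶ Z) (φ₀ : X ⟶ Y) :
      PlusGen C (.box (.letter (Arrow.mk φ₁)) (.letter (Arrow.mk φ₀)))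
        (.letter (Arrow.mk (φ₀ ≫ φ₁)))
  | unit {X Y : C} (σ : X ≅ Y) : PlusGen C .empty (.letter (Arrow.mk σ.hom))

/-- The generators of `C^{⊠+,gcp}` with their roles. -/
def plusOps (C : Type u) [Category.{v} C] :
    PlusOps C (Word.empty (A := Arrow C)) Word.box (PlusGen C) where
  letter := .letter
  iso := .iso
  comp := .comp
  unit := .unit

/-- The relations of `C^{⊠+,gcp}`. -/
def plusRel (C : Type u) [Category.{v} C] (s : Bool) :
    TermRel (Word.empty (A := Arrow C)) Word.box (PlusGen C) s :=
  fun _ _ f g => PlusRel (plusOps C) f g ∨ PointingRel (plusOps C) f g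

/-- The plus construction `C^{⊠+,gcp}` of a category: the monoidal version for `s = false`, the
symmetric monoidal version for `s = true`. -/
abbrev CPlusGcp (C : Type u) [Category.{v} C] (s : Bool) := Presented (plusRel C s)

section Monoidal

variable (M : Type u) [Category.{v} M] [MonoidalCategory M]

/-- The monoidal product of two morphisms, as an operation on arrows. -/
abbrev arrowTensor {M : Type u} [Category.{v} M] [MonoidalCategory M] (f g : Arrow M) : Arrow M :=
  Arrow.mk (f.hom ⊗ₘ g.hom)

/-- The monoidal product `(a ⊗ a' ⇓ b ⊗ b')` of isomorphisms of arrows. -/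
abbrev arrowTensorIso {M : Type u} [Category.{v} M] [MonoidalCategory M] {f g f' g' : Arrow M}
    (e : f ≅ g) (e' : f' ≅ g') : arrowTensor f f' ≅ arrowTensor g g' :=
  Arrow.isoMk (Arrow.leftFunc.mapIso e ⊗ᵢ Arrow.leftFunc.mapIso e')
    (Arrow.rightFunc.mapIso e ⊗ᵢ Arrow.rightFunc.mapIso e')
    (by
      change (e.hom.left ⊗ₘ e'.hom.left) ≫ (g.hom ⊗ₘ g'.hom) =
        (f.hom ⊗ₘ f'.hom) ≫ (e.hom.right ⊗ₘ e'.hom.right)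
      rw [tensorHom_comp_tensorHom, tensorHom_comp_tensorHom]
      exact congrArg₂ _ (Arrow.w e.hom) (Arrow.w e'.hom))

/-- The associativity constraint on arrows. -/
abbrev arrowAssoc {M : Type u} [Category.{v} M] [MonoidalCategory M] (f g h : Arrow M) :
    arrowTensor (arrowTensor f g) h ≅ arrowTensor f (arrowTensor g h) :=
  Arrow.isoMk (α_ f.left g.left h.left) (α_ f.right g.right h.right) (by simp)

/-- The left unit constraint on arrows. -/
abbrev arrowLeftUnitor {M : Type u} [Category.{v} M] [MonoidalCategory M] (f : Arrow M) :
    arrowTensor (Arrow.mk (𝟙 (𝟙_ M))) f ≅ f :=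
  Arrow.isoMk (λ_ f.left) (λ_ f.right) (by simp)

/-- The right unit constraint on arrows. -/
abbrev arrowRightUnitor {M : Type u} [Category.{v} M] [MonoidalCategory M] (f : Arrow M) :
    arrowTensor f (Arrow.mk (𝟙 (𝟙_ M))) ≅ f :=
  Arrow.isoMk (ρ_ f.left) (ρ_ f.right) (by simp)

/-- The commutativity constraint on arrows. -/
abbrev arrowBraiding {M : Type u} [Category.{v} M] [MonoidalCategory M] [SymmetricCategory M]
    (f g : Arrow M) : arrowTensor f g ≅ arrowTensor g f :=
  Arrow.isoMk (β_ f.left g.left) (β_ f.right g.right) (by simp)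

/-- The identification of `(φ₀ ⊗ ψ₀) ≫ (φ₁ ⊗ ψ₁)` with `(φ₀ ≫ φ₁) ⊗ (ψ₀ ≫ ψ₁)`. -/
abbrev arrowInterchange {M : Type u} [Category.{v} M] [MonoidalCategory M] {X Y Z X' Y' Z' : M}
    (φ₁ : Y ⟶ Z) (φ₀ : X ⟶ Y) (ψ₁ : Y' ⟶ Z') (ψ₀ : X' ⟶ Y') :
    Arrow.mk ((φ₀ ⊗ₘ ψ₀) ≫ (φ₁ ⊗ₘ ψ₁)) ≅ Arrow.mk ((φ₀ ≫ φ₁) ⊗ₘ (ψ₀ ≫ ψ₁)) :=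
  square (Iso.refl _) (Iso.refl _) (by simp)

/-- The generators of the noncommutative plus construction: those of the plus construction
together with `μ_{φ,ψ} : φ ⊠ ψ ⟶ φ ⊗ ψ`. -/
structure NcOps (M : Type u) [Category.{v} M] [MonoidalCategory M] {O : Type w} (I : O)
    (T : O → O → O) (G : O → O → Type w) extends PlusOps M I T G where
  mu (f g : Arrow M) : G (T (letter f) (letter g)) (letter (arrowTensor f g))

/-- The additional relations of the nc plus construction: `μ` is equivariant and associative and
satisfies the internal interchange relation with `γ`; and the pointings are multiplicative for `μ`
with `i_{id}` at the monoidal unit acting as the unit for `μ`. -/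
inductive NcRel {M : Type u} [Category.{v} M] [MonoidalCategory M] {O : Type w} {I : O}
    {T : O → O → O} {G : O → O → Type w} (K : NcOps M I T G) : TermRel I T G true
  | equivariance {f g f' g' : Arrow M} (e : f ≅ g) (e' : f' ≅ g') :
      NcRel K
        (.comp (.tensor (.gen (K.iso e)) (.gen (K.iso e'))) (.gen (K.mu g g')))
        (.comp (.gen (K.mu f f')) (.gen (K.iso (arrowTensorIso e e'))))
  | assoc (f g h : Arrow M) :
      NcRel K
        (.comp (.tensor (.gen (K.mu f g)) (.id (K.letter h)))
          (.comp (.gen (K.mu (arrowTensor f g) h)) (.gen (K.iso (arrowAssoc f g h)))))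
        (.comp (.assocHom _ _ _)
          (.comp (.tensor (.id (K.letter f)) (.gen (K.mu g h)))
            (.gen (K.mu f (arrowTensor g h)))))
  | interchange {X Y Z X' Y' Z' : M} (φ₁ : Y ⟶ Z) (φ₀ : X ⟶ Y) (ψ₁ : Y' ⟶ Z') (ψ₀ : X' ⟶ Y') :
      NcRel K
        (.comp (.tensor (.gen (K.comp φ₁ φ₀)) (.gen (K.comp ψ₁ ψ₀)))
          (.gen (K.mu (Arrow.mk (φ₀ ≫ φ₁)) (Arrow.mk (ψ₀ ≫ ψ₁)))))
        (.comp (.middleSwap _ _ _ _)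
          (.comp (.tensor (.gen (K.mu (Arrow.mk φ₁) (Arrow.mk ψ₁)))
              (.gen (K.mu (Arrow.mk φ₀) (Arrow.mk ψ₀))))
            (.comp (.gen (K.comp (φ₁ ⊗ₘ ψ₁) (φ₀ ⊗ₘ ψ₀)))
              (.gen (K.iso (arrowInterchange φ₁ φ₀ ψ₁ ψ₀))))))
  | unit_tensor {X Y X' Y' : M} (σ : X ≅ Y) (σ' : X' ≅ Y') :
      NcRel K
        (.comp (.leftInv I)
          (.comp (.tensor (.gen (K.unit σ)) (.gen (K.unit σ')))
            (.gen (K.mu (Arrow.mk σ.hom) (Arrow.mk σ'.hom)))))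
        (.gen (K.unit (σ ⊗ᵢ σ')))
  | unit_left (f : Arrow M) :
      NcRel K
        (.comp (.leftInv (K.letter f))
          (.comp (.tensor (.gen (K.unit (Iso.refl (𝟙_ M)))) (.id (K.letter f)))
            (.comp (.gen (K.mu (Arrow.mk (𝟙 (𝟙_ M))) f)) (.gen (K.iso (arrowLeftUnitor f))))))
        (.id (K.letter f))
  | unit_right (f : Arrow M) :
      NcRel K
        (.comp (.rightInv (K.letter f))
          (.comp (.tensor (.id (K.letter f)) (.gen (K.unit (Iso.refl (𝟙_ M)))))
            (.comp (.gen (K.mu f (Arrow.mk (𝟙 (𝟙_ M))))) (.gen (K.iso (arrowRightUnitor f))))))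
        (.id (K.letter f))

/-- The compatibility of `μ` with the commutativity constraints. -/
inductive CommRel {M : Type u} [Category.{v} M] [MonoidalCategory M] [SymmetricCategory M]
    {O : Type w} {I : O} {T : O → O → O} {G : O → O → Type w} (K : NcOps M I T G) :
    TermRel I T G true
  | comm (f g : Arrow M) :
      CommRel K
        (.comp (.gen (K.mu f g)) (.gen (K.iso (arrowBraiding f g))))
        (.comp (.braid rfl _ _) (.gen (K.mu g f)))

/-- The generators of `M^{nc+,gcp}`. -/
inductive NcGen : Word (Arrow M) → Word (Arrow M) → Type (max u v)
  | plus {x y : Word (Arrow M)} (g : PlusGen M x y) : NcGen x y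
  | mu (f g : Arrow M) : NcGen (.box (.letter f) (.letter g)) (.letter (arrowTensor f g))

/-- The generators of `M^{loc+,gcp}`: those of `M^{nc+,gcp}` and formal inverses of the `μ`. -/
inductive LocGen : Word (Arrow M) → Word (Arrow M) → Type (max u v)
  | nc {x y : Word (Arrow M)} (g : NcGen M x y) : LocGen x y
  | muInv (f g : Arrow M) : LocGen (.letter (arrowTensor f g)) (.box (.letter f) (.letter g))

/-- The generators of `M^{nc+,gcp}` with their roles. -/
def ncOps : NcOps M (Word.empty (A := Arrow M)) Word.box (NcGen M) where
  letter := .letter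
  iso e := .plus (.iso e)
  comp φ₁ φ₀ := .plus (.comp φ₁ φ₀)
  unit σ := .plus (.unit σ)
  mu := .mu

/-- The generators of `M^{loc+,gcp}` with their roles. -/
def locOps : NcOps M (Word.empty (A := Arrow M)) Word.box (LocGen M) where
  letter := .letter
  iso e := .nc (.plus (.iso e))
  comp φ₁ φ₀ := .nc (.plus (.comp φ₁ φ₀))
  unit σ := .nc (.plus (.unit σ))
  mu f g := .nc (.mu f g)

/-- The relations that make `μ` invertible. -/
inductive LocRel : TermRel (Word.empty (A := Arrow M)) Word.box (LocGen M) true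
  | mu_muInv (f g : Arrow M) :
      LocRel (.comp (.gen (.nc (.mu f g))) (.gen (.muInv f g))) (.id _)
  | muInv_mu (f g : Arrow M) :
      LocRel (.comp (.gen (.muInv f g)) (.gen (.nc (.mu f g)))) (.id _)

/-- The relations of `M^{nc+,gcp}` for a monoidal category `M`. -/
def ncRel : TermRel (Word.empty (A := Arrow M)) Word.box (NcGen M) true :=
  fun _ _ f g => PlusRel (ncOps M).toPlusOps f g ∨ PointingRel (ncOps M).toPlusOps f g ∨
    NcRel (ncOps M) f g

/-- The relations of `M^{loc+,gcp}` for a monoidal category `M`. -/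
def locRel : TermRel (Word.empty (A := Arrow M)) Word.box (LocGen M) true :=
  fun _ _ f g => PlusRel (locOps M).toPlusOps f g ∨ PointingRel (locOps M).toPlusOps f g ∨
    NcRel (locOps M) f g ∨ LocRel M f g

/-- `M^{nc+,gcp}` for a monoidal category `M`. -/
abbrev NcPlusGcp := Presented (ncRel M)

/-- `M^{loc+,gcp}` for a monoidal category `M`. -/
abbrev LocPlusGcp := Presented (locRel M)

end Monoidal

section Symmetric

variable (M : Type u) [Category.{v} M] [MonoidalCategory M] [SymmetricCategory M]

/-- The relations of `M^{nc+,gcp}` for a symmetric monoidal category `M`. -/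
def symNcRel : TermRel (Word.empty (A := Arrow M)) Word.box (NcGen M) true :=
  fun _ _ f g => ncRel M f g ∨ CommRel (ncOps M) f g

/-- The relations of `M^{loc+,gcp}` for a symmetric monoidal category `M`. -/
def symLocRel : TermRel (Word.empty (A := Arrow M)) Word.box (LocGen M) true :=
  fun _ _ f g => locRel M f g ∨ CommRel (locOps M) f g

/-- `M^{nc+,gcp}` for a symmetric monoidal category `M`. -/
abbrev SymNcPlusGcp := Presented (symNcRel M)

/-- `M^{loc+,gcp}` for a symmetric monoidal category `M`. -/
abbrev SymLocPlusGcp := Presented (symLocRel M)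

/-- The generators of `M^{+,gcp}`, between objects that are the morphisms of `M`. -/
inductive StrongGen : Arrow M → Arrow M → Type (max u v)
  | iso {f g : Arrow M} (e : f ≅ g) : StrongGen f g
  | comp {X Y Z : M} (φ₁ : Y ⟶ Z) (φ₀ : X ⟶ Y) :
      StrongGen (arrowTensor (Arrow.mk φ₁) (Arrow.mk φ₀)) (Arrow.mk (φ₀ ≫ φ₁))
  | unit {X Y : M} (σ : X ≅ Y) : StrongGen (Arrow.mk (𝟙 (𝟙_ M))) (Arrow.mk σ.hom)

/-- The generators of `M^{+,gcp}` with their roles. The unit object is `id_𝟙`, the monoidal product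
is `⊗`. -/
def strongOps : PlusOps M (Arrow.mk (𝟙 (𝟙_ M))) arrowTensor (StrongGen M) where
  letter f := f
  iso := .iso
  comp := .comp
  unit := .unit

/-- The additional relations of `M^{+,gcp}`: the monoidal product and the constraints are those of
the symmetric monoidal groupoid `(Iso (M ↓ M), ⊗)`, the interchange relation holds, and
`i_{σ ⊗ σ'} = i_σ ⊗ i_σ'`. -/
inductive StrongRel : TermRel (Arrow.mk (𝟙 (𝟙_ M))) arrowTensor (StrongGen M) true
  | iso_tensor {f g f' g' : Arrow M} (e : f ≅ g) (e' : f' ≅ g') :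
      StrongRel (.tensor (.gen (.iso e)) (.gen (.iso e'))) (.gen (.iso (arrowTensorIso e e')))
  | assoc (f g h : Arrow M) :
      StrongRel (.assocHom f g h) (.gen (.iso (arrowAssoc f g h)))
  | leftUnitor (f : Arrow M) : StrongRel (.leftHom f) (.gen (.iso (arrowLeftUnitor f)))
  | rightUnitor (f : Arrow M) : StrongRel (.rightHom f) (.gen (.iso (arrowRightUnitor f)))
  | braiding (f g : Arrow M) : StrongRel (.braid rfl f g) (.gen (.iso (arrowBraiding f g)))
  | interchange {X Y Z X' Y' Z' : M} (φ₁ : Y ⟶ Z) (φ₀ : X ⟶ Y) (ψ₁ : Y' ⟶ Z') (ψ₀ : X' ⟶ Y') :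
      StrongRel
        (.tensor (.gen (.comp φ₁ φ₀)) (.gen (.comp ψ₁ ψ₀)))
        (.comp (.middleSwap (Arrow.mk φ₁) (Arrow.mk φ₀) (Arrow.mk ψ₁) (Arrow.mk ψ₀))
          (.comp (.gen (.comp (φ₁ ⊗ₘ ψ₁) (φ₀ ⊗ₘ ψ₀)))
            (.gen (.iso (arrowInterchange φ₁ φ₀ ψ₁ ψ₀)))))
  | unit_tensor {X Y X' Y' : M} (σ : X ≅ Y) (σ' : X' ≅ Y') :
      StrongRel
        (.comp (.leftInv (Arrow.mk (𝟙 (𝟙_ M)))) (.tensor (.gen (.unit σ)) (.gen (.unit σ'))))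
        (.gen (.unit (σ ⊗ᵢ σ')))

/-- The relations of `M^{+,gcp}`. -/
def strongRel : TermRel (Arrow.mk (𝟙 (𝟙_ M))) arrowTensor (StrongGen M) true :=
  fun _ _ f g => PlusRel (strongOps M) f g ∨ PointingRel (strongOps M) f g ∨ StrongRel M f g

/-- `M^{+,gcp}` for a symmetric monoidal category `M`. -/
abbrev StrongPlusGcp := Presented (strongRel M)

end Symmetric

end Plus

/-! ## Functor categories -/

section Functors

open Functor.LaxMonoidal

variable (P : Type u) [Category.{v} P] [MonoidalCategory P]
  (E : Type uE) [Category.{vE} E] [MonoidalCategory E]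

/-- A lax monoidal functor is strong if its structure morphisms are invertible. -/
def isStrongFunctor : ObjectProperty (LaxMonoidalFunctor P E) :=
  fun F => IsIso (ε F.toFunctor) ∧ ∀ X Y, IsIso (μ F.toFunctor X Y)

/-- Strong monoidal functors `P ⥤ E` and monoidal natural transformations. -/
abbrev StrongFunctor := (isStrongFunctor P E).FullSubcategory

/-- The monoidal structure of the constant functor at the unit object. -/
abbrev trivialLaxMonoidal : ((Functor.const P).obj (𝟙_ E)).LaxMonoidal :=
  .ofTensorHom (𝟙 _) (fun _ _ => (λ_ (𝟙_ E)).hom)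
    (μ_natural := by intros; simp)
    (associativity := by intros; simp [unitors_equal])
    (left_unitality := by intros; simp)
    (right_unitality := by intros; simp [unitors_equal])

/-- The trivial functor `𝒯 : P ⥤ E`, constant at the unit object. -/
def trivialFunctor : StrongFunctor P E where
  obj := { toFunctor := (Functor.const P).obj (𝟙_ E), laxMonoidal := trivialLaxMonoidal P E }
  property := ⟨inferInstanceAs (IsIso (𝟙 (𝟙_ E))),
    fun _ _ => inferInstanceAs (IsIso (λ_ (𝟙_ E)).hom)⟩

/-- Counital strong monoidal functors, that is strong monoidal functors together with a monoidal
natural transformation to the trivial functor. -/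
abbrev CounitalFunctor := Over (trivialFunctor P E)

variable [BraidedCategory P] [BraidedCategory E]

/-- A lax braided functor is strong if its structure morphisms are invertible. -/
def isStrongSymmetricFunctor : ObjectProperty (LaxBraidedFunctor P E) :=
  fun F => IsIso (ε F.toFunctor) ∧ ∀ X Y, IsIso (μ F.toFunctor X Y)

/-- Strong symmetric monoidal functors `P ⥤ E` and monoidal natural transformations. -/
abbrev StrongSymmetricFunctor := (isStrongSymmetricFunctor P E).FullSubcategory

/-- The constant functor at the unit object is symmetric monoidal. -/
abbrev trivialLaxBraided : ((Functor.const P).obj (𝟙_ E)).LaxBraided where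
  toLaxMonoidal := trivialLaxMonoidal P E
  braided _ _ := by
    change (λ_ (𝟙_ E)).hom ≫ 𝟙 _ = (β_ (𝟙_ E) (𝟙_ E)).hom ≫ (λ_ (𝟙_ E)).hom
    rw [braiding_leftUnitor, unitors_equal, Category.comp_id]

/-- The trivial functor `𝒯 : P ⥤ E`, as a symmetric monoidal functor. -/
def trivialSymmetricFunctor : StrongSymmetricFunctor P E where
  obj := { toFunctor := (Functor.const P).obj (𝟙_ E), laxBraided := trivialLaxBraided P E }
  property := ⟨inferInstanceAs (IsIso (𝟙 (𝟙_ E))),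
    fun _ _ => inferInstanceAs (IsIso (λ_ (𝟙_ E)).hom)⟩

/-- Counital strong symmetric monoidal functors. -/
abbrev CounitalSymmetricFunctor := Over (trivialSymmetricFunctor P E)

end Functors

/-! ## Bimodules and plethysm -/

section Bimodules

/-- `Iso(C)`-bimodules in `E`, that is functors `Iso(C)ᵒᵖ × Iso(C) ⥤ E`. -/
abbrev Bimodule (C : Type u) [Category.{v} C] (E : Type uE) [Category.{vE} E] :=
  (Core C)ᵒᵖ ⥤ Core C ⥤ E

variable {C : Type u} [Category.{v} C] {E : Type uE} [Category.{vE} E]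

/-- The value `ρ(X, Y)`. -/
abbrev Bimodule.at (ρ : Bimodule C E) (X Y : C) : E := (ρ.obj (op ⟨X⟩)).obj ⟨Y⟩

/-- An isomorphism as a morphism of `Iso(C)`. -/
abbrev coreMap {X Y : C} (σ : X ≅ Y) : Core.mk X ⟶ Core.mk Y := ⟨σ⟩

/-- The action `(a ⇓ b)` of the isomorphisms on `ρ`. -/
abbrev Bimodule.act (ρ : Bimodule C E) {X X' Y Y' : C} (a : X ≅ X') (b : Y ≅ Y') :
    ρ.at X Y ⟶ ρ.at X' Y' :=
  (ρ.map (coreMap a.symm).op).app ⟨Y⟩ ≫ (ρ.obj (op ⟨X'⟩)).map (coreMap b)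

/-- A component of a morphism of bimodules. -/
abbrev Bimodule.comp {ρ ρ' : Bimodule C E} (f : ρ ⟶ ρ') (X Y : C) : ρ.at X Y ⟶ ρ'.at X Y :=
  (f.app (op ⟨X⟩)).app ⟨Y⟩

lemma Bimodule.act_comp {ρ ρ' : Bimodule C E} (f : ρ ⟶ ρ') {X X' Y Y' : C} (a : X ≅ X')
    (b : Y ≅ Y') :
    ρ.act a b ≫ Bimodule.comp f X' Y' = Bimodule.comp f X Y ≫ ρ'.act a b := by
  simp only [Bimodule.act, Bimodule.comp, Category.assoc, NatTrans.naturality]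
  rw [← NatTrans.comp_app_assoc, f.naturality, NatTrans.comp_app_assoc]

lemma Bimodule.act_refl_left (ρ : Bimodule C E) {X Y Y' : C} (b : Y ≅ Y') :
    ρ.act (Iso.refl X) b = (ρ.obj (op ⟨X⟩)).map (coreMap b) := by
  have : coreMap (Iso.refl X) = 𝟙 (Core.mk X) := rfl
  simp [Bimodule.act, this]

lemma Bimodule.act_refl_right (ρ : Bimodule C E) {X X' Y : C} (a : X ≅ X') :
    ρ.act a (Iso.refl Y) = (ρ.map (coreMap a.symm).op).app ⟨Y⟩ := by
  have : coreMap (Iso.refl Y) = 𝟙 (Core.mk Y) := rfl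
  simp [Bimodule.act, this]

section Plethysm

variable [MonoidalCategory E]

/-- The bifunctor `(Y, Y') ↦ P(Y, Z) ⊗ Q(X, Y')`. -/
abbrev plethysmIntegrand (P Q : Bimodule C E) (X : (Core C)ᵒᵖ) (Z : Core C) :
    (Core C)ᵒᵖ ⥤ Core C ⥤ E :=
  P.flip.obj Z ⋙ curriedTensor E ⋙ (Functor.whiskeringLeft _ _ _).obj (Q.obj X)

/-- A family of morphisms `P(Y, Z) ⊗ Q(X, Y) ⟶ R(X, Z)` is equivariant. -/
def IsEquivariant {P Q R : Bimodule C E} (m : ∀ X Y Z : C, P.at Y Z ⊗ Q.at X Y ⟶ R.at X Z) : Prop :=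
  ∀ {X Y Z X' Y' Z' : C} (a : X ≅ X') (b : Y ≅ Y') (c : Z ≅ Z'),
    (P.act b c ⊗ₘ Q.act a b) ≫ m X' Y' Z' = m X Y Z ≫ R.act a c

lemma IsEquivariant.middle {P Q R : Bimodule C E}
    {m : ∀ X Y Z : C, P.at Y Z ⊗ Q.at X Y ⟶ R.at X Z} (hm : IsEquivariant m) (X Z : C)
    {Y Y' : C} (b : Y ≅ Y') :
    (P.map (coreMap b).op).app ⟨Z⟩ ▷ Q.at X Y ≫ m X Y Z =
      P.at Y' Z ◁ (Q.obj (op ⟨X⟩)).map (coreMap b) ≫ m X Y' Z := by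
  have h := hm (Iso.refl X) b (Iso.refl Z)
  rw [Bimodule.act_refl_left, Bimodule.act_refl_right, Bimodule.act_refl_left] at h
  have h₁ : coreMap (Iso.refl Z) = 𝟙 _ := rfl
  have h₂ : (coreMap b).op ≫ (coreMap b.symm).op = 𝟙 (op (Core.mk Y')) :=
    congrArg Quiver.Hom.op (Groupoid.inv_comp (coreMap b))
  have h₃ : (P.map (coreMap b).op).app ⟨Z⟩ ≫ (P.map (coreMap b.symm).op).app ⟨Z⟩ = 𝟙 _ := by
    rw [← NatTrans.comp_app, ← P.map_comp, h₂, P.map_id, NatTrans.id_app]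
  rw [h₁, (R.obj _).map_id, Category.comp_id] at h
  rw [← h, MonoidalCategory.tensorHom_def, Category.assoc, ← comp_whiskerRight_assoc, h₃,
    id_whiskerRight, Category.id_comp]

lemma IsEquivariant.left {P Q R : Bimodule C E}
    {m : ∀ X Y Z : C, P.at Y Z ⊗ Q.at X Y ⟶ R.at X Z} (hm : IsEquivariant m) (X Y : C)
    {Z Z' : C} (c : Z ≅ Z') :
    (P.obj (op ⟨Y⟩)).map (coreMap c) ▷ Q.at X Y ≫ m X Y Z' =
      m X Y Z ≫ (R.obj (op ⟨X⟩)).map (coreMap c) := by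
  have h := hm (Iso.refl X) (Iso.refl Y) c
  rw [Bimodule.act_refl_left, Bimodule.act_refl_left, Bimodule.act_refl_left] at h
  have h₁ : coreMap (Iso.refl Y) = 𝟙 _ := rfl
  rwa [h₁, (Q.obj _).map_id, tensorHom_id] at h

lemma IsEquivariant.right {P Q R : Bimodule C E}
    {m : ∀ X Y Z : C, P.at Y Z ⊗ Q.at X Y ⟶ R.at X Z} (hm : IsEquivariant m) (Y Z : C)
    {X X' : C} (a : X ≅ X') :
    P.at Y Z ◁ (Q.map (coreMap a).op).app ⟨Y⟩ ≫ m X Y Z =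
      m X' Y Z ≫ (R.map (coreMap a).op).app ⟨Z⟩ := by
  have h := hm a.symm (Iso.refl Y) (Iso.refl Z)
  rw [Bimodule.act_refl_right, Bimodule.act_refl_right, Bimodule.act_refl_right] at h
  have h₁ : (coreMap (Iso.refl Y).symm).op = 𝟙 _ := rfl
  rwa [h₁, P.map_id, NatTrans.id_app, id_tensorHom] at h

variable [∀ F : (Core C)ᵒᵖ ⥤ Core C ⥤ E, HasCoend F]

/-- The plethysm product, or relative tensor product, of bimodules
`(X, Z) ↦ ∫^Y P(Y, Z) ⊗ Q(X, Y)`. -/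
noncomputable def plethysm (P Q : Bimodule C E) : Bimodule C E where
  obj X :=
    { obj := fun Z => coend (plethysmIntegrand P Q X Z)
      map := fun c => coend.map (Functor.whiskerRight (P.flip.map c) _)
      map_id := fun Z => by apply coend.hom_ext; intro; simp
      map_comp := fun f g => by apply coend.hom_ext; intro; simp }
  map a :=
    { app := fun Z => coend.map (Functor.whiskerLeft _ (Functor.whiskerLeft _
        ((Functor.whiskeringLeft _ _ _).map (Q.map a))))
      naturality := fun Z Z' c => by apply coend.hom_ext; intro; simp [whisker_exchange_assoc] }
  map_id X := by ext Z; simp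
  map_comp f g := by ext Z; simp

/-- The canonical morphism `P(Y, Z) ⊗ Q(X, Y) ⟶ (P ∘ Q)(X, Z)`. -/
noncomputable abbrev plethysmι (P Q : Bimodule C E) (X Y Z : C) :
    P.at Y Z ⊗ Q.at X Y ⟶ (plethysm P Q).at X Z :=
  coend.ι (plethysmIntegrand P Q (op ⟨X⟩) ⟨Z⟩) ⟨Y⟩

/-- The components of `plethysmDesc`. -/
noncomputable def plethysmDescApp {P Q R : Bimodule C E}
    (m : ∀ X Y Z : C, P.at Y Z ⊗ Q.at X Y ⟶ R.at X Z) (hm : IsEquivariant m)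
    (X : (Core C)ᵒᵖ) (Z : Core C) : coend (plethysmIntegrand P Q X Z) ⟶ (R.obj X).obj Z :=
  coend.desc (fun Y => m X.unop.of Y.of Z.of) (fun _ _ b => hm.middle X.unop.of Z.of b.iso)

lemma plethysmDescApp_ι {P Q R : Bimodule C E}
    (m : ∀ X Y Z : C, P.at Y Z ⊗ Q.at X Y ⟶ R.at X Z) (hm : IsEquivariant m)
    (X : (Core C)ᵒᵖ) (Y Z : Core C) :
    coend.ι (plethysmIntegrand P Q X Z) Y ≫ plethysmDescApp m hm X Z = m X.unop.of Y.of Z.of :=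
  coend.ι_desc _ _ _

/-- The morphism out of a plethysm product that is given by an equivariant family of morphisms
`P(Y, Z) ⊗ Q(X, Y) ⟶ R(X, Z)`. -/
noncomputable def plethysmDesc {P Q R : Bimodule C E}
    (m : ∀ X Y Z : C, P.at Y Z ⊗ Q.at X Y ⟶ R.at X Z) (hm : IsEquivariant m) :
    plethysm P Q ⟶ R where
  app X :=
    { app := plethysmDescApp m hm X
      naturality := fun Z Z' c => by
        apply coend.hom_ext
        intro Y
        dsimp only [plethysm]
        rw [coend.ι_map_assoc, plethysmDescApp_ι, reassoc_of% (plethysmDescApp_ι m hm X Y Z)]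
        exact hm.left X.unop.of Y.of c.iso }
  naturality X X' a := by
    ext Z
    apply coend.hom_ext
    intro Y
    dsimp only [plethysm, NatTrans.comp_app]
    rw [coend.ι_map_assoc, plethysmDescApp_ι, reassoc_of% (plethysmDescApp_ι m hm X Y Z)]
    exact hm.right Y.of Z.of a.unop.iso

lemma plethysmι_desc {P Q R : Bimodule C E}
    (m : ∀ X Y Z : C, P.at Y Z ⊗ Q.at X Y ⟶ R.at X Z) (hm : IsEquivariant m) (X Y Z : C) :
    plethysmι P Q X Y Z ≫ Bimodule.comp (plethysmDesc m hm) X Z = m X Y Z :=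
  plethysmDescApp_ι m hm _ _ _

end Plethysm

end Bimodules

/-! ## Copowers of the unit object -/

section Copowers

variable (E : Type uE) [Category.{vE} E] [MonoidalCategory E]

/-- The tensor product preserves coproducts (indexed by types in `Type v`) in both variables. -/
class TensorPreservesCoproducts : Prop where
  left (A : E) (J : Type v) : PreservesColimitsOfShape (Discrete J) (tensorLeft A)
  right (A : E) (J : Type v) : PreservesColimitsOfShape (Discrete J) (tensorRight A)

variable [HasCoproducts.{v} E]

/-- The copower `S ⊙ 𝟙`, that is the coproduct of copies of the unit object indexed by `S`. -/
noncomputable abbrev copow (S : Type v) : E := ∐ fun _ : S => 𝟙_ E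

/-- The inclusion of the copy of the unit object with index `s`. -/
noncomputable abbrev copowι {S : Type v} (s : S) : 𝟙_ E ⟶ copow E S :=
  Sigma.ι (fun _ : S => 𝟙_ E) s

variable [TensorPreservesCoproducts.{v} E]

variable {E}

lemma tensor_hom_ext {J : Type v} {K : Type v} {A : E}
    {X : J → E} {Y : K → E} {f g : (∐ X) ⊗ (∐ Y) ⟶ A}
    (h : ∀ j k, (Sigma.ι X j ⊗ₘ Sigma.ι Y k) ≫ f = (Sigma.ι X j ⊗ₘ Sigma.ι Y k) ≫ g) : f = g := by
  have := TensorPreservesCoproducts.right (E := E) (∐ Y) J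
  refine (isColimitOfPreserves (tensorRight (∐ Y)) (colimit.isColimit (Discrete.functor X))).hom_ext
    fun ⟨j⟩ => ?_
  have := TensorPreservesCoproducts.left (E := E) (X j) K
  refine (isColimitOfPreserves (tensorLeft (X j)) (colimit.isColimit (Discrete.functor Y))).hom_ext
    fun ⟨k⟩ => ?_
  have := h j k
  simpa [MonoidalCategory.tensorHom_def'] using this

lemma exists_tensor_desc {J : Type v} {K : Type v} {A : E}
    {X : J → E} {Y : K → E} (f : ∀ j k, X j ⊗ Y k ⟶ A) :
    ∃ g : (∐ X) ⊗ (∐ Y) ⟶ A, ∀ j k, (Sigma.ι X j ⊗ₘ Sigma.ι Y k) ≫ g = f j k := by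
  have := TensorPreservesCoproducts.right (E := E) (∐ Y) J
  have := fun j => TensorPreservesCoproducts.left (E := E) (X j) K
  let hX := isColimitOfPreserves (tensorRight (∐ Y)) (colimit.isColimit (Discrete.functor X))
  let hY := fun j =>
    isColimitOfPreserves (tensorLeft (X j)) (colimit.isColimit (Discrete.functor Y))
  let g := fun j => (hY j).desc ⟨A, Discrete.natTrans fun ⟨k⟩ => f j k⟩
  have hg : ∀ j k, (X j ◁ Sigma.ι Y k) ≫ g j = f j k := fun j k => (hY j).fac _ ⟨k⟩
  refine ⟨hX.desc ⟨A, Discrete.natTrans fun ⟨j⟩ => g j⟩, fun j k => ?_⟩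
  rw [MonoidalCategory.tensorHom_def', Category.assoc]
  have : (Sigma.ι X j ▷ (∐ Y)) ≫ hX.desc ⟨A, Discrete.natTrans fun ⟨j⟩ => g j⟩ = g j :=
    hX.fac _ ⟨j⟩
  rw [this, hg]

/-- The morphism `(S ⊙ 𝟙) ⊗ (T ⊙ 𝟙) ⟶ W ⊙ 𝟙` that is induced by a map `S → T → W`. -/
noncomputable def copowMul {S T W : Type v} (m : S → T → W) :
    copow E S ⊗ copow E T ⟶ copow E W :=
  (exists_tensor_desc fun s t => (λ_ (𝟙_ E)).hom ≫ copowι E (m s t)).choose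

lemma copowι_copowMul {S T W : Type v} (m : S → T → W) (s : S) (t : T) :
    (copowι E s ⊗ₘ copowι E t) ≫ copowMul m = (λ_ (𝟙_ E)).hom ≫ copowι E (m s t) :=
  (exists_tensor_desc fun s t => (λ_ (𝟙_ E)).hom ≫ copowι E (m s t)).choose_spec s t

end Copowers

/-! ## Unital bimodule monoids -/

section BimoduleMonoids

variable (C : Type u) [Category.{v} C] (E : Type uE) [Category.{vE} E] [MonoidalCategory E]
  [HasCoproducts.{v} E]

/-- The bimodule of sets `(X, Y) ↦ Hom(X, Y)`. -/
def homSet : Bimodule C (Type v) :=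
  (Core.inclusion C).op ⋙ coyoneda ⋙ (Functor.whiskeringLeft _ _ _).obj (Core.inclusion C)

/-- The bimodule of sets `(X, Y) ↦ Iso(X, Y)`. -/
def isoSet : Bimodule C (Type v) := coyoneda

/-- The inclusion of the isomorphisms into all morphisms. -/
def isoInclusion : isoSet C ⟶ homSet C where
  app X := { app := fun Y => ↾fun σ : X.unop ⟶ Y => σ.iso.hom }

variable {C}

/-- The free bimodule `S ⊙ E` on a bimodule of sets. -/
noncomputable def freeBimodule (S : Bimodule C (Type v)) : Bimodule C E :=
  S ⋙ (Functor.whiskeringRight _ _ _).obj (sigmaConst.obj (𝟙_ E))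

variable (C)

/-- `Hom_C`, as a bimodule in `E`. -/
noncomputable abbrev homBimodule : Bimodule C E := freeBimodule E (homSet C)

/-- `Hom_{Iso(C)}`, as a bimodule in `E`. This is the unit for the plethysm product. -/
noncomputable abbrev isoBimodule : Bimodule C E := freeBimodule E (isoSet C)

variable {C}

/-- The element of `Hom_C ⊙ E` that is given by a morphism. -/
noncomputable abbrev homι {X Y : C} (φ : X ⟶ Y) : 𝟙_ E ⟶ (homBimodule C E).at X Y :=
  copowι E (S := X ⟶ Y) φ

/-- The element of `Hom_{Iso(C)} ⊙ E` that is given by an isomorphism. -/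
noncomputable abbrev isoι {X Y : C} (σ : X ≅ Y) : 𝟙_ E ⟶ (isoBimodule C E).at X Y :=
  copowι E (S := Core.mk X ⟶ Core.mk Y) ⟨σ⟩

variable {E} in
lemma copowι_map {S T : Type v} (f : S ⟶ T) (s : S) :
    copowι E s ≫ (sigmaConst.obj (𝟙_ E)).map f = copowι E (f s) := by
  simp [copowι, sigmaConst]

variable {E} in
lemma homι_act {X Y X' Y' : C} (φ : X ⟶ Y) (a : X ≅ X') (b : Y ≅ Y') :
    homι E φ ≫ (homBimodule C E).act a b = homι E (a.inv ≫ φ ≫ b.hom) := by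
  have h₁ := copowι_map (E := E) (((homSet C).map
    (Quiver.Hom.op (X := Core.mk X') (Y := Core.mk X) ⟨a.symm⟩)).app ⟨Y⟩) φ
  have h₂ := copowι_map (E := E) (((homSet C).obj (op ⟨X'⟩)).map
    (X := Core.mk Y) (Y := Core.mk Y') ⟨b⟩) (a.inv ≫ φ)
  refine (Category.assoc _ _ _).symm.trans ?_
  refine (congrArg (· ≫ _) h₁).trans (h₂.trans ?_)
  exact congrArg (homι E) (Category.assoc _ _ _)

section Hom

variable {E} [TensorPreservesCoproducts.{v} E]

/-- The composition of morphisms `Hom(Y, Z) ⊗ Hom(X, Y) ⟶ Hom(X, Z)`. -/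
noncomputable def homMul (E : Type uE) [Category.{vE} E] [MonoidalCategory E]
    [HasCoproducts.{v} E] [TensorPreservesCoproducts.{v} E] (X Y Z : C) :
    (homBimodule C E).at Y Z ⊗ (homBimodule C E).at X Y ⟶ (homBimodule C E).at X Z :=
  copowMul (S := Y ⟶ Z) (T := X ⟶ Y) (W := X ⟶ Z) fun φ₁ φ₀ => φ₀ ≫ φ₁

lemma homι_homMul {X Y Z : C} (φ₁ : Y ⟶ Z) (φ₀ : X ⟶ Y) :
    (homι E φ₁ ⊗ₘ homι E φ₀) ≫ homMul E X Y Z = (λ_ (𝟙_ E)).hom ≫ homι E (φ₀ ≫ φ₁) :=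
  copowι_copowMul _ _ _

lemma hom_tensor_ext {X Y X' Y' : C} {A : E}
    {f g : (homBimodule C E).at X Y ⊗ (homBimodule C E).at X' Y' ⟶ A}
    (h : ∀ (φ : X ⟶ Y) (ψ : X' ⟶ Y'),
      (homι E φ ⊗ₘ homι E ψ) ≫ f = (homι E φ ⊗ₘ homι E ψ) ≫ g) : f = g :=
  tensor_hom_ext h

lemma hom_ext {X Y : C} {A : E} {f g : (homBimodule C E).at X Y ⟶ A}
    (h : ∀ φ : X ⟶ Y, homι E φ ≫ f = homι E φ ≫ g) : f = g :=
  Sigma.hom_ext _ _ h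

lemma hom_tensor_ext₃ {X Y X' Y' X'' Y'' : C} {A : E}
    {f g : ((homBimodule C E).at X Y ⊗ (homBimodule C E).at X' Y') ⊗
      (homBimodule C E).at X'' Y'' ⟶ A}
    (h : ∀ (φ : X ⟶ Y) (ψ : X' ⟶ Y') (χ : X'' ⟶ Y''),
      ((homι E φ ⊗ₘ homι E ψ) ⊗ₘ homι E χ) ≫ f =
        ((homι E φ ⊗ₘ homι E ψ) ⊗ₘ homι E χ) ≫ g) : f = g := by
  have := TensorPreservesCoproducts.left (E := E)
    ((homBimodule C E).at X Y ⊗ (homBimodule C E).at X' Y') (X'' ⟶ Y'')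
  refine (isColimitOfPreserves
    (tensorLeft ((homBimodule C E).at X Y ⊗ (homBimodule C E).at X' Y'))
    (colimit.isColimit (Discrete.functor fun _ : X'' ⟶ Y'' => 𝟙_ E))).hom_ext fun ⟨χ⟩ => ?_
  change (_ ◁ homι E χ) ≫ f = (_ ◁ homι E χ) ≫ g
  rw [← cancel_epi (ρ_ _).inv]
  apply hom_tensor_ext
  intro φ ψ
  have := h φ ψ χ
  rw [MonoidalCategory.tensorHom_def, Category.assoc, Category.assoc] at this
  rw [rightUnitor_inv_naturality_assoc, this, ← rightUnitor_inv_naturality_assoc]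

lemma homMul_equivariant :
    IsEquivariant (P := homBimodule C E) (Q := homBimodule C E) (R := homBimodule C E)
      (homMul E) := by
  intro X Y Z X' Y' Z' a b c
  apply hom_tensor_ext
  intro φ ψ
  rw [tensorHom_comp_tensorHom_assoc, homι_act, homι_act, homι_homMul, reassoc_of% @homι_homMul, homι_act]
  simp

end Hom

/-- A bimodule with a composition `γ : ρ ∘ ρ ⟶ ρ` and a unit `u : Hom_{Iso(C)} ⟶ ρ`. -/
structure BimoduleMonoidData (C : Type u) [Category.{v} C] (E : Type uE) [Category.{vE} E]
    [MonoidalCategory E] [HasCoproducts.{v} E] [∀ F : (Core C)ᵒᵖ ⥤ Core C ⥤ E, HasCoend F] where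
  carrier : Bimodule C E
  γ : plethysm carrier carrier ⟶ carrier
  u : isoBimodule C E ⟶ carrier

variable [∀ F : (Core C)ᵒᵖ ⥤ Core C ⥤ E, HasCoend F] {E}

/-- The composition `ρ(Y, Z) ⊗ ρ(X, Y) ⟶ ρ(X, Z)`. -/
noncomputable def BimoduleMonoidData.mul (ρ : BimoduleMonoidData C E) (X Y Z : C) :
    ρ.carrier.at Y Z ⊗ ρ.carrier.at X Y ⟶ ρ.carrier.at X Z :=
  plethysmι ρ.carrier ρ.carrier X Y Z ≫ Bimodule.comp ρ.γ X Z

/-- The element `u_σ` of `ρ(X, Y)`. -/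
noncomputable def BimoduleMonoidData.elt (ρ : BimoduleMonoidData C E) {X Y : C} (σ : X ≅ Y) :
    𝟙_ E ⟶ ρ.carrier.at X Y :=
  isoι E σ ≫ Bimodule.comp ρ.u X Y

variable (C E) in
/-- A unital `Iso(C)`-bimodule monoid in `E`, that is a unital monoid for the plethysm product. -/
structure BimoduleMonoid extends BimoduleMonoidData C E where
  mul_assoc (W X Y Z : C) :
    (toBimoduleMonoidData.mul X Y Z ▷ carrier.at W X) ≫ toBimoduleMonoidData.mul W X Z =
      (α_ _ _ _).hom ≫ (carrier.at Y Z ◁ toBimoduleMonoidData.mul W X Y) ≫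
        toBimoduleMonoidData.mul W Y Z
  one_mul (X : C) {Y Z : C} (σ : Y ≅ Z) :
    (λ_ (carrier.at X Y)).inv ≫ (toBimoduleMonoidData.elt σ ▷ carrier.at X Y) ≫
      toBimoduleMonoidData.mul X Y Z = carrier.act (Iso.refl X) σ
  mul_one {X Y : C} (σ : X ≅ Y) (Z : C) :
    (ρ_ (carrier.at Y Z)).inv ≫ (carrier.at Y Z ◁ toBimoduleMonoidData.elt σ) ≫
      toBimoduleMonoidData.mul X Y Z = carrier.act σ.symm (Iso.refl Z)

/-- A morphism of unital bimodule monoids. -/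
@[ext]
structure BimoduleMonoid.Hom (ρ ρ' : BimoduleMonoid C E) where
  hom : ρ.carrier ⟶ ρ'.carrier
  mul_hom (X Y Z : C) :
    ρ.mul X Y Z ≫ Bimodule.comp hom X Z =
      (Bimodule.comp hom Y Z ⊗ₘ Bimodule.comp hom X Y) ≫ ρ'.mul X Y Z
  elt_hom {X Y : C} (σ : X ≅ Y) : ρ.elt σ ≫ Bimodule.comp hom X Y = ρ'.elt σ

/-- The composition of morphisms of unital bimodule monoids. -/
def BimoduleMonoid.Hom.comp {ρ₁ ρ₂ ρ₃ : BimoduleMonoid C E} (f : BimoduleMonoid.Hom ρ₁ ρ₂)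
    (g : BimoduleMonoid.Hom ρ₂ ρ₃) : BimoduleMonoid.Hom ρ₁ ρ₃ where
  hom := f.hom ≫ g.hom
  mul_hom X Y Z := by
    have hf := f.mul_hom X Y Z
    have hg := g.mul_hom X Y Z
    simp only [Bimodule.comp, NatTrans.comp_app] at hf hg ⊢
    rw [reassoc_of% hf, hg, tensorHom_comp_tensorHom_assoc]
  elt_hom σ := by
    have hf := f.elt_hom σ
    have hg := g.elt_hom σ
    simp only [Bimodule.comp, NatTrans.comp_app] at hf hg ⊢
    rw [reassoc_of% hf, hg]

instance : Category (BimoduleMonoid C E) where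
  Hom := BimoduleMonoid.Hom
  id ρ := { hom := 𝟙 _, mul_hom := by simp [Bimodule.comp], elt_hom := by simp [Bimodule.comp] }
  comp f g := BimoduleMonoid.Hom.comp f g
  id_comp f := BimoduleMonoid.Hom.ext (Category.id_comp f.hom)
  comp_id f := BimoduleMonoid.Hom.ext (Category.comp_id f.hom)
  assoc f g h := BimoduleMonoid.Hom.ext (Category.assoc f.hom g.hom h.hom)

section Hom

variable [TensorPreservesCoproducts.{v} E]

variable (C E) in
/-- The data of `Hom_C` as a unital bimodule monoid in `E`. -/
noncomputable def homMonoidData : BimoduleMonoidData C E where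
  carrier := homBimodule C E
  γ := plethysmDesc (homMul E) homMul_equivariant
  u := Functor.whiskerRight (isoInclusion C) _

lemma homMonoidData_mul (X Y Z : C) : (homMonoidData C E).mul X Y Z = homMul E X Y Z :=
  plethysmι_desc (homMul E) homMul_equivariant X Y Z

lemma homMonoidData_elt {X Y : C} (σ : X ≅ Y) : (homMonoidData C E).elt σ = homι E σ.hom :=
  copowι_map (S := Core.mk X ⟶ Core.mk Y) (T := X ⟶ Y)
    (((isoInclusion C).app (op ⟨X⟩)).app ⟨Y⟩) ⟨σ⟩

variable (C E) in
/-- `Hom_C` as a unital bimodule monoid in `E`. -/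
noncomputable def homMonoid : BimoduleMonoid C E where
  toBimoduleMonoidData := homMonoidData C E
  mul_assoc W X Y Z := by
    simp only [homMonoidData_mul]
    apply hom_tensor_ext₃
    intro φ₂ φ₁ φ₀
    change _ ≫ (homMul E X Y Z ▷ _) ≫ homMul E W X Z =
      _ ≫ (α_ _ _ _).hom ≫ (_ ◁ homMul E W X Y) ≫ homMul E W Y Z
    rw [associator_naturality_assoc, ← id_tensorHom, tensorHom_comp_tensorHom_assoc,
      ← tensorHom_id, tensorHom_comp_tensorHom_assoc, homι_homMul, homι_homMul]
    have h₁ : ((λ_ (𝟙_ E)).hom ≫ homι E (φ₁ ≫ φ₂) ⊗ₘ homι E φ₀ ≫ 𝟙 _) ≫ homMul E W X Z =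
        ((λ_ (𝟙_ E)).hom ▷ 𝟙_ E) ≫ (λ_ (𝟙_ E)).hom ≫ homι E (φ₀ ≫ φ₁ ≫ φ₂) := by
      rw [← homι_homMul (φ₁ ≫ φ₂) φ₀, Category.comp_id, ← tensorHom_id, tensorHom_comp_tensorHom_assoc,
        Category.id_comp]
    have h₂ : (homι E φ₂ ≫ 𝟙 _ ⊗ₘ (λ_ (𝟙_ E)).hom ≫ homι E (φ₀ ≫ φ₁)) ≫ homMul E W Y Z =
        (𝟙_ E ◁ (λ_ (𝟙_ E)).hom) ≫ (λ_ (𝟙_ E)).hom ≫ homι E ((φ₀ ≫ φ₁) ≫ φ₂) := by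
      rw [← homι_homMul φ₂ (φ₀ ≫ φ₁), Category.comp_id, ← id_tensorHom, tensorHom_comp_tensorHom_assoc,
        Category.id_comp]
    refine h₁.trans (Eq.trans ?_ (congrArg _ h₂).symm)
    rw [Category.assoc]
    monoidal
  one_mul X Y Z σ := by
    rw [homMonoidData_mul, homMonoidData_elt]
    apply hom_ext
    intro φ
    change _ ≫ (λ_ _).inv ≫ (_ ▷ _) ≫ homMul E X Y Z = _ ≫ (homBimodule C E).act _ _
    rw [leftUnitor_inv_naturality_assoc, ← tensorHom_def'_assoc, homι_homMul, homι_act]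
    simp
  mul_one σ Z := by
    rw [homMonoidData_mul, homMonoidData_elt]
    apply hom_ext
    intro φ
    change _ ≫ (ρ_ _).inv ≫ (_ ◁ _) ≫ homMul E _ _ Z = _ ≫ (homBimodule C E).act _ _
    rw [rightUnitor_inv_naturality_assoc, ← MonoidalCategory.tensorHom_def_assoc, homι_homMul,
      homι_act]
    simp [unitors_equal]

end Hom

end BimoduleMonoids

/-! ## Lax monoidal bimodule monoids -/

section LaxMonoidal

variable (M : Type u) [Category.{v} M] [MonoidalCategory M]
  (E : Type uE) [Category.{vE} E] [MonoidalCategory E] [BraidedCategory E] [HasCoproducts.{v} E]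
  [∀ F : (Core M)ᵒᵖ ⥤ Core M ⥤ E, HasCoend F]

/-- A unital lax monoidal `Iso(M)`-bimodule monoid: a unital bimodule monoid with an equivariant
and associative product `μ : ρ(X, Y) ⊗ ρ(X', Y') ⟶ ρ(X ⊗ X', Y ⊗ Y')`, which has `u_{id}` at the
monoidal unit as its unit, for which `u` is multiplicative, and which satisfies the
interchange law with the composition. -/
structure LaxMonoidalBimoduleMonoid extends BimoduleMonoid M E where
  tensor (X Y X' Y' : M) : carrier.at X Y ⊗ carrier.at X' Y' ⟶ carrier.at (X ⊗ X') (Y ⊗ Y')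
  act_tensor {X₁ X₂ Y₁ Y₂ X₁' X₂' Y₁' Y₂' : M} (a : X₁ ≅ X₂) (b : Y₁ ≅ Y₂) (a' : X₁' ≅ X₂')
    (b' : Y₁' ≅ Y₂') :
    (carrier.act a b ⊗ₘ carrier.act a' b') ≫ tensor X₂ Y₂ X₂' Y₂' =
      tensor X₁ Y₁ X₁' Y₁' ≫ carrier.act (a ⊗ᵢ a') (b ⊗ᵢ b')
  tensor_assoc (X Y X' Y' X'' Y'' : M) :
    (tensor X Y X' Y' ▷ carrier.at X'' Y'') ≫ tensor (X ⊗ X') (Y ⊗ Y') X'' Y'' ≫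
        carrier.act (α_ X X' X'') (α_ Y Y' Y'') =
      (α_ _ _ _).hom ≫ (carrier.at X Y ◁ tensor X' Y' X'' Y'') ≫
        tensor X Y (X' ⊗ X'') (Y' ⊗ Y'')
  one_tensor (X Y : M) :
    (λ_ (carrier.at X Y)).inv ≫
      (toBimoduleMonoidData.elt (Iso.refl (𝟙_ M)) ▷ carrier.at X Y) ≫
        tensor (𝟙_ M) (𝟙_ M) X Y ≫ carrier.act (λ_ X) (λ_ Y) = 𝟙 _
  tensor_one (X Y : M) :
    (ρ_ (carrier.at X Y)).inv ≫
      (carrier.at X Y ◁ toBimoduleMonoidData.elt (Iso.refl (𝟙_ M))) ≫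
        tensor X Y (𝟙_ M) (𝟙_ M) ≫ carrier.act (ρ_ X) (ρ_ Y) = 𝟙 _
  elt_tensor_elt {X Y X' Y' : M} (σ : X ≅ Y) (σ' : X' ≅ Y') :
    (λ_ (𝟙_ E)).inv ≫ (toBimoduleMonoidData.elt σ ⊗ₘ toBimoduleMonoidData.elt σ') ≫
      tensor X Y X' Y' = toBimoduleMonoidData.elt (σ ⊗ᵢ σ')
  interchange (X Y Z X' Y' Z' : M) :
    (toBimoduleMonoidData.mul X Y Z ⊗ₘ toBimoduleMonoidData.mul X' Y' Z') ≫ tensor X Z X' Z' =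
      tensorμ _ _ _ _ ≫ (tensor Y Z Y' Z' ⊗ₘ tensor X Y X' Y') ≫
        toBimoduleMonoidData.mul (X ⊗ X') (Y ⊗ Y') (Z ⊗ Z')

variable {M E}

/-- A morphism of unital lax monoidal bimodule monoids. -/
@[ext]
structure LaxMonoidalBimoduleMonoid.Hom (ρ ρ' : LaxMonoidalBimoduleMonoid M E) extends
    BimoduleMonoid.Hom ρ.toBimoduleMonoid ρ'.toBimoduleMonoid where
  tensor_hom (X Y X' Y' : M) :
    ρ.tensor X Y X' Y' ≫ Bimodule.comp hom (X ⊗ X') (Y ⊗ Y') =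
      (Bimodule.comp hom X Y ⊗ₘ Bimodule.comp hom X' Y') ≫ ρ'.tensor X Y X' Y'

instance : Category (LaxMonoidalBimoduleMonoid M E) where
  Hom := LaxMonoidalBimoduleMonoid.Hom
  id ρ := { toHom := 𝟙 ρ.toBimoduleMonoid
            tensor_hom := by
              intros
              change _ ≫ 𝟙 _ = (𝟙 _ ⊗ₘ 𝟙 _) ≫ _
              simp }
  comp f g :=
    { toHom := BimoduleMonoid.Hom.comp f.toHom g.toHom
      tensor_hom := fun X Y X' Y' => by
        have hf := f.tensor_hom X Y X' Y'
        have hg := g.tensor_hom X Y X' Y'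
        simp only [Bimodule.comp, BimoduleMonoid.Hom.comp, NatTrans.comp_app] at hf hg ⊢
        rw [reassoc_of% hf, hg, tensorHom_comp_tensorHom_assoc] }
  id_comp f := LaxMonoidalBimoduleMonoid.Hom.ext (Category.id_comp f.hom)
  comp_id f := LaxMonoidalBimoduleMonoid.Hom.ext (Category.comp_id f.hom)
  assoc f g h := LaxMonoidalBimoduleMonoid.Hom.ext (Category.assoc f.hom g.hom h.hom)

/-- A lax monoidal bimodule monoid over a symmetric monoidal category is symmetric if `μ` is
compatible with the commutativity constraints. -/
def LaxMonoidalBimoduleMonoid.IsSymmetric [BraidedCategory M]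
    (ρ : LaxMonoidalBimoduleMonoid M E) : Prop :=
  ∀ X Y X' Y' : M, ρ.tensor X Y X' Y' ≫ ρ.carrier.act (β_ X X') (β_ Y Y') =
    (β_ (ρ.carrier.at X Y) (ρ.carrier.at X' Y')).hom ≫ ρ.tensor X' Y' X Y

variable [TensorPreservesCoproducts.{v} E]

section

/-- The monoidal product of morphisms `Hom(X, Y) ⊗ Hom(X', Y') ⟶ Hom(X ⊗ X', Y ⊗ Y')`. -/
noncomputable def homTensor (E : Type uE) [Category.{vE} E] [MonoidalCategory E]
    [HasCoproducts.{v} E] [TensorPreservesCoproducts.{v} E] (X Y X' Y' : M) :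
    (homBimodule M E).at X Y ⊗ (homBimodule M E).at X' Y' ⟶
      (homBimodule M E).at (X ⊗ X') (Y ⊗ Y') :=
  copowMul (S := X ⟶ Y) (T := X' ⟶ Y') (W := X ⊗ X' ⟶ Y ⊗ Y') fun φ ψ => φ ⊗ₘ ψ

lemma homι_homTensor {X Y X' Y' : M} (φ : X ⟶ Y) (ψ : X' ⟶ Y') :
    (homι E φ ⊗ₘ homι E ψ) ≫ homTensor E X Y X' Y' = (λ_ (𝟙_ E)).hom ≫ homι E (φ ⊗ₘ ψ) :=
  copowι_copowMul _ _ _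

lemma hom_tensor_ext₄ {X₁ Y₁ X₂ Y₂ X₃ Y₃ X₄ Y₄ : M} {A : E}
    {f g : ((homBimodule M E).at X₁ Y₁ ⊗ (homBimodule M E).at X₂ Y₂) ⊗
      ((homBimodule M E).at X₃ Y₃ ⊗ (homBimodule M E).at X₄ Y₄) ⟶ A}
    (h : ∀ (φ₁ : X₁ ⟶ Y₁) (φ₂ : X₂ ⟶ Y₂) (φ₃ : X₃ ⟶ Y₃) (φ₄ : X₄ ⟶ Y₄),
      ((homι E φ₁ ⊗ₘ homι E φ₂) ⊗ₘ (homι E φ₃ ⊗ₘ homι E φ₄)) ≫ f =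
        ((homι E φ₁ ⊗ₘ homι E φ₂) ⊗ₘ (homι E φ₃ ⊗ₘ homι E φ₄)) ≫ g) : f = g := by
  rw [← cancel_epi (α_ _ _ _).hom]
  have := TensorPreservesCoproducts.left (E := E)
    (((homBimodule M E).at X₁ Y₁ ⊗ (homBimodule M E).at X₂ Y₂) ⊗ (homBimodule M E).at X₃ Y₃)
    (X₄ ⟶ Y₄)
  refine (isColimitOfPreserves
    (tensorLeft (((homBimodule M E).at X₁ Y₁ ⊗ (homBimodule M E).at X₂ Y₂) ⊗
      (homBimodule M E).at X₃ Y₃))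
    (colimit.isColimit (Discrete.functor fun _ : X₄ ⟶ Y₄ => 𝟙_ E))).hom_ext fun ⟨χ⟩ => ?_
  change (_ ◁ homι E χ) ≫ (α_ _ _ _).hom ≫ f = (_ ◁ homι E χ) ≫ (α_ _ _ _).hom ≫ g
  rw [← cancel_epi (ρ_ _).inv]
  apply hom_tensor_ext₃
  intro φ₁ φ₂ φ₃
  have := congrArg (fun t => (α_ _ _ _).hom ≫ t) (h φ₁ φ₂ φ₃ χ)
  rw [← associator_naturality_assoc, ← associator_naturality_assoc,
    MonoidalCategory.tensorHom_def, Category.assoc, Category.assoc] at this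
  rw [rightUnitor_inv_naturality_assoc, this, ← rightUnitor_inv_naturality_assoc]

lemma tensorμ_unit :
    tensorμ (𝟙_ E) (𝟙_ E) (𝟙_ E) (𝟙_ E) ≫ ((λ_ (𝟙_ E)).hom ⊗ₘ (λ_ (𝟙_ E)).hom) =
      ((λ_ (𝟙_ E)).hom ⊗ₘ (λ_ (𝟙_ E)).hom) := by
  have h := tensor_left_unitality (C := E) (𝟙_ E) (𝟙_ E)
  rw [← cancel_epi ((λ_ (𝟙_ E)).inv ▷ (𝟙_ E ⊗ 𝟙_ E)), ← h]
  monoidal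

lemma homTensor_act {X₁ X₂ Y₁ Y₂ X₁' X₂' Y₁' Y₂' : M} (a : X₁ ≅ X₂) (b : Y₁ ≅ Y₂)
    (a' : X₁' ≅ X₂') (b' : Y₁' ≅ Y₂') :
    ((homBimodule M E).act a b ⊗ₘ (homBimodule M E).act a' b') ≫ homTensor E X₂ Y₂ X₂' Y₂' =
      homTensor E X₁ Y₁ X₁' Y₁' ≫ (homBimodule M E).act (a ⊗ᵢ a') (b ⊗ᵢ b') := by
  apply hom_tensor_ext
  intro φ ψ
  rw [tensorHom_comp_tensorHom_assoc, homι_act, homι_act, homι_homTensor,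
    reassoc_of% @homι_homTensor, homι_act]
  simp [tensorHom_comp_tensorHom]

lemma homTensor_assoc (X Y X' Y' X'' Y'' : M) :
    (homTensor E X Y X' Y' ▷ (homBimodule M E).at X'' Y'') ≫
        homTensor E (X ⊗ X') (Y ⊗ Y') X'' Y'' ≫
        (homBimodule M E).act (α_ X X' X'') (α_ Y Y' Y'') =
      (α_ _ _ _).hom ≫ ((homBimodule M E).at X Y ◁ homTensor E X' Y' X'' Y'') ≫
        homTensor E X Y (X' ⊗ X'') (Y' ⊗ Y'') := by
  apply hom_tensor_ext₃
  intro φ ψ χ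
  have h₁ : ((homι E φ ⊗ₘ homι E ψ) ⊗ₘ homι E χ) ≫
      (homTensor E X Y X' Y' ▷ (homBimodule M E).at X'' Y'') =
      ((λ_ (𝟙_ E)).hom ▷ 𝟙_ E) ≫ (homι E (φ ⊗ₘ ψ) ⊗ₘ homι E χ) := by
    rw [← tensorHom_id, ← tensorHom_id, tensorHom_comp_tensorHom, tensorHom_comp_tensorHom,
      homι_homTensor, Category.comp_id, Category.id_comp]
  have h₂ : (homι E φ ⊗ₘ (homι E ψ ⊗ₘ homι E χ)) ≫
      ((homBimodule M E).at X Y ◁ homTensor E X' Y' X'' Y'') =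
      (𝟙_ E ◁ (λ_ (𝟙_ E)).hom) ≫ (homι E φ ⊗ₘ homι E (ψ ⊗ₘ χ)) := by
    rw [← id_tensorHom, ← id_tensorHom, tensorHom_comp_tensorHom, tensorHom_comp_tensorHom,
      homι_homTensor, Category.comp_id, Category.id_comp]
  rw [reassoc_of% h₁, reassoc_of% @homι_homTensor, homι_act, associator_naturality_assoc,
    reassoc_of% h₂, homι_homTensor]
  have : (α_ X X' X'').inv ≫ ((φ ⊗ₘ ψ) ⊗ₘ χ) ≫ (α_ Y Y' Y'').hom = φ ⊗ₘ ψ ⊗ₘ χ := by simp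
  rw [this]
  monoidal

lemma one_homTensor (X Y : M) :
    (λ_ ((homBimodule M E).at X Y)).inv ≫
      (homι E (𝟙 (𝟙_ M)) ▷ (homBimodule M E).at X Y) ≫
        homTensor E (𝟙_ M) (𝟙_ M) X Y ≫ (homBimodule M E).act (λ_ X) (λ_ Y) = 𝟙 _ := by
  apply hom_ext
  intro φ
  rw [leftUnitor_inv_naturality_assoc, ← tensorHom_def'_assoc, reassoc_of% @homι_homTensor, homι_act]
  have : (λ_ X).inv ≫ (𝟙 (𝟙_ M) ⊗ₘ φ) ≫ (λ_ Y).hom = φ := by simp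
  rw [this]
  simp

lemma homTensor_one (X Y : M) :
    (ρ_ ((homBimodule M E).at X Y)).inv ≫
      ((homBimodule M E).at X Y ◁ homι E (𝟙 (𝟙_ M))) ≫
        homTensor E X Y (𝟙_ M) (𝟙_ M) ≫ (homBimodule M E).act (ρ_ X) (ρ_ Y) = 𝟙 _ := by
  apply hom_ext
  intro φ
  rw [rightUnitor_inv_naturality_assoc, ← MonoidalCategory.tensorHom_def_assoc,
    reassoc_of% @homι_homTensor, homι_act]
  have : (ρ_ X).inv ≫ (φ ⊗ₘ 𝟙 (𝟙_ M)) ≫ (ρ_ Y).hom = φ := by simp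
  rw [this]
  simp [unitors_equal]

lemma homι_tensor_homι {X Y X' Y' : M} (σ : X ≅ Y) (σ' : X' ≅ Y') :
    (λ_ (𝟙_ E)).inv ≫ (homι E σ.hom ⊗ₘ homι E σ'.hom) ≫ homTensor E X Y X' Y' =
      homι E (σ ⊗ᵢ σ').hom := by
  rw [homι_homTensor, Iso.inv_hom_id_assoc]
  rfl

lemma homMul_homTensor (X Y Z X' Y' Z' : M) :
    (homMul E X Y Z ⊗ₘ homMul E X' Y' Z') ≫ homTensor E X Z X' Z' =
      tensorμ _ _ _ _ ≫ (homTensor E Y Z Y' Z' ⊗ₘ homTensor E X Y X' Y') ≫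
        homMul E (X ⊗ X') (Y ⊗ Y') (Z ⊗ Z') := by
  apply hom_tensor_ext₄
  intro φ₁ φ₀ ψ₁ ψ₀
  rw [tensorμ_natural_assoc, tensorHom_comp_tensorHom_assoc, homι_homMul, homι_homMul,
    tensorHom_comp_tensorHom_assoc, homι_homTensor, homι_homTensor,
    ← tensorHom_comp_tensorHom_assoc, ← tensorHom_comp_tensorHom_assoc, homι_homTensor,
    homι_homMul, reassoc_of% tensorμ_unit]
  have : (φ₀ ⊗ₘ ψ₀) ≫ (φ₁ ⊗ₘ ψ₁) = (φ₀ ≫ φ₁) ⊗ₘ (ψ₀ ≫ ψ₁) := tensorHom_comp_tensorHom _ _ _ _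
  rw [this]

end

variable (M E) in
/-- `Hom_M` as a unital lax monoidal bimodule monoid in `E`. -/
noncomputable def homLax : LaxMonoidalBimoduleMonoid M E where
  toBimoduleMonoid := homMonoid M E
  tensor := homTensor E
  act_tensor := homTensor_act
  tensor_assoc := homTensor_assoc
  one_tensor X Y := by
    have h := homMonoidData_elt (E := E) (Iso.refl (𝟙_ M))
    exact (congrArg (fun t : 𝟙_ E ⟶ (homBimodule M E).at _ _ => (λ_ _).inv ≫ (t ▷ _) ≫
      homTensor E (𝟙_ M) (𝟙_ M) X Y ≫ (homBimodule M E).act (λ_ X) (λ_ Y)) h).trans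
        (one_homTensor X Y)
  tensor_one X Y := by
    have h := homMonoidData_elt (E := E) (Iso.refl (𝟙_ M))
    exact (congrArg (fun t : 𝟙_ E ⟶ (homBimodule M E).at _ _ => (ρ_ _).inv ≫ (_ ◁ t) ≫
      homTensor E X Y (𝟙_ M) (𝟙_ M) ≫ (homBimodule M E).act (ρ_ X) (ρ_ Y)) h).trans
        (homTensor_one X Y)
  elt_tensor_elt {X Y X' Y'} σ σ' := by
    have h := homMonoidData_elt (E := E) σ
    have h' := homMonoidData_elt (E := E) σ'
    exact (congrArg₂ (fun (t : 𝟙_ E ⟶ (homBimodule M E).at X Y)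
      (t' : 𝟙_ E ⟶ (homBimodule M E).at X' Y') => (λ_ _).inv ≫ (t ⊗ₘ t') ≫
        homTensor E X Y X' Y') h h').trans
          ((homι_tensor_homι σ σ').trans (homMonoidData_elt (E := E) (σ ⊗ᵢ σ')).symm)
  interchange X Y Z X' Y' Z' := by
    have h := homMonoidData_mul (E := E) X Y Z
    have h' := homMonoidData_mul (E := E) X' Y' Z'
    have h'' := homMonoidData_mul (E := E) (X ⊗ X') (Y ⊗ Y') (Z ⊗ Z')
    exact (congrArg₂ (fun (t : (homBimodule M E).at Y Z ⊗ (homBimodule M E).at X Y ⟶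
      (homBimodule M E).at X Z) (t' : (homBimodule M E).at Y' Z' ⊗ (homBimodule M E).at X' Y' ⟶
      (homBimodule M E).at X' Z') => (t ⊗ₘ t') ≫ homTensor E X Z X' Z') h h').trans
        ((homMul_homTensor X Y Z X' Y' Z').trans (congrArg (fun t =>
          tensorμ _ _ _ _ ≫ (homTensor E Y Z Y' Z' ⊗ₘ homTensor E X Y X' Y') ≫ t) h''.symm))

end LaxMonoidal

/-! ## Bimodule monoids over `Hom_C` -/

section OverHom

variable {C : Type u} [Category.{v} C] {E : Type uE} [Category.{vE} E] [MonoidalCategory E]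
  [HasCoproducts.{v} E] [TensorPreservesCoproducts.{v} E]
  [∀ F : (Core C)ᵒᵖ ⥤ Core C ⥤ E, HasCoend F]

/-- A decomposition of a unital bimodule monoid `b : ρ ⟶ Hom_C` over `Hom_C`:
`ρ(X, Y) = ∐_φ D(φ)` with `b = ∐_φ ε(φ)` for counits `ε(φ) : D(φ) ⟶ 𝟙`, such that the action of
the isomorphisms, the composition and the unit respect the coproducts. -/
structure Decomposition (ρ : BimoduleMonoid C E) (b : ρ ⟶ homMonoid C E) where
  D {X Y : C} (φ : X ⟶ Y) : E
  ι {X Y : C} (φ : X ⟶ Y) : D φ ⟶ ρ.carrier.at X Y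
  isColimit (X Y : C) : IsColimit (Cofan.mk (ρ.carrier.at X Y) fun φ : X ⟶ Y => ι φ)
  ε {X Y : C} (φ : X ⟶ Y) : D φ ⟶ 𝟙_ E
  ι_comp {X Y : C} (φ : X ⟶ Y) : ι φ ≫ Bimodule.comp b.hom X Y = ε φ ≫ homι E φ
  exists_act {X Y X' Y' : C} (φ : X ⟶ Y) (a : X ≅ X') (b : Y ≅ Y') :
    ∃ g : D φ ⟶ D (a.inv ≫ φ ≫ b.hom), ι φ ≫ ρ.carrier.act a b = g ≫ ι _
  exists_mul {X Y Z : C} (φ₁ : Y ⟶ Z) (φ₀ : X ⟶ Y) :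
    ∃ g : D φ₁ ⊗ D φ₀ ⟶ D (φ₀ ≫ φ₁), (ι φ₁ ⊗ₘ ι φ₀) ≫ ρ.mul X Y Z = g ≫ ι _
  exists_elt {X Y : C} (σ : X ≅ Y) : ∃ g : 𝟙_ E ⟶ D σ.hom, ρ.elt σ = g ≫ ι _

variable (C E) in
/-- A counital unital bimodule monoid over `Hom_C`: a unital bimodule monoid with a morphism to
`Hom_C` and a decomposition. -/
structure CounitalBimoduleMonoid where
  obj : Over (homMonoid C E)
  dec : Decomposition obj.left obj.hom

/-- Morphisms of counital bimodule monoids over `Hom_C` are the morphisms over `Hom_C` that respect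
the decompositions. -/
@[ext]
structure CounitalBimoduleMonoid.Hom (A B : CounitalBimoduleMonoid C E) where
  hom : A.obj ⟶ B.obj
  exists_hom {X Y : C} (φ : X ⟶ Y) : ∃ g : A.dec.D φ ⟶ B.dec.D φ,
    A.dec.ι φ ≫ Bimodule.comp hom.left.hom X Y = g ≫ B.dec.ι φ

noncomputable instance : Category (CounitalBimoduleMonoid C E) where
  Hom := CounitalBimoduleMonoid.Hom
  id A := ⟨𝟙 _, fun φ => ⟨𝟙 _, (Category.comp_id _).trans (Category.id_comp _).symm⟩⟩
  comp f g := ⟨f.hom ≫ g.hom, fun φ => by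
    obtain ⟨f', hf⟩ := f.exists_hom φ
    obtain ⟨g', hg⟩ := g.exists_hom φ
    refine ⟨f' ≫ g', ?_⟩
    rw [Category.assoc, ← hg, ← reassoc_of% hf]
    rfl⟩
  id_comp f := CounitalBimoduleMonoid.Hom.ext (Category.id_comp f.hom)
  comp_id f := CounitalBimoduleMonoid.Hom.ext (Category.comp_id f.hom)
  assoc f g h := CounitalBimoduleMonoid.Hom.ext (Category.assoc f.hom g.hom h.hom)

end OverHom

section LaxOverHom

variable {M : Type u} [Category.{v} M] [MonoidalCategory M] {E : Type uE} [Category.{vE} E]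
  [MonoidalCategory E] [BraidedCategory E] [HasCoproducts.{v} E] [TensorPreservesCoproducts.{v} E]
  [∀ F : (Core M)ᵒᵖ ⥤ Core M ⥤ E, HasCoend F]

variable (M E) in
/-- A counital unital lax monoidal bimodule monoid over `Hom_M`: the monoidal product is required to
respect the decomposition as well. -/
structure CounitalLaxBimoduleMonoid where
  obj : Over (homLax M E)
  dec : Decomposition obj.left.toBimoduleMonoid obj.hom.toHom
  exists_tensor {X Y X' Y' : M} (φ : X ⟶ Y) (ψ : X' ⟶ Y') :
    ∃ g : dec.D φ ⊗ dec.D ψ ⟶ dec.D (φ ⊗ₘ ψ),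
      (dec.ι φ ⊗ₘ dec.ι ψ) ≫ obj.left.tensor X Y X' Y' = g ≫ dec.ι _

/-- Morphisms of counital lax monoidal bimodule monoids over `Hom_M` are the morphisms over `Hom_M`
that respect the decompositions. -/
@[ext]
structure CounitalLaxBimoduleMonoid.Hom (A B : CounitalLaxBimoduleMonoid M E) where
  hom : A.obj ⟶ B.obj
  exists_hom {X Y : M} (φ : X ⟶ Y) : ∃ g : A.dec.D φ ⟶ B.dec.D φ,
    A.dec.ι φ ≫ Bimodule.comp hom.left.hom X Y = g ≫ B.dec.ι φ

noncomputable instance : Category (CounitalLaxBimoduleMonoid M E) where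
  Hom := CounitalLaxBimoduleMonoid.Hom
  id A := ⟨𝟙 _, fun φ => ⟨𝟙 _, (Category.comp_id _).trans (Category.id_comp _).symm⟩⟩
  comp f g := ⟨f.hom ≫ g.hom, fun φ => by
    obtain ⟨f', hf⟩ := f.exists_hom φ
    obtain ⟨g', hg⟩ := g.exists_hom φ
    refine ⟨f' ≫ g', ?_⟩
    rw [Category.assoc, ← hg, ← reassoc_of% hf]
    rfl⟩
  id_comp f := CounitalLaxBimoduleMonoid.Hom.ext (Category.id_comp f.hom)
  comp_id f := CounitalLaxBimoduleMonoid.Hom.ext (Category.comp_id f.hom)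
  assoc f g h := CounitalLaxBimoduleMonoid.Hom.ext (Category.assoc f.hom g.hom h.hom)

/-- A counital lax monoidal bimodule monoid over `Hom_M` is strong if the products
`D(φ) ⊗ D(ψ) ⟶ D(φ ⊗ ψ)` are isomorphisms. -/
def CounitalLaxBimoduleMonoid.IsStrong : ObjectProperty (CounitalLaxBimoduleMonoid M E) :=
  fun A => ∀ {X Y X' Y' : M} (φ : X ⟶ Y) (ψ : X' ⟶ Y'),
    ∃ g : A.dec.D φ ⊗ A.dec.D ψ ⟶ A.dec.D (φ ⊗ₘ ψ), IsIso g ∧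
      (A.dec.ι φ ⊗ₘ A.dec.ι ψ) ≫ A.obj.left.tensor X Y X' Y' = g ≫ A.dec.ι _

/-- A counital lax monoidal bimodule monoid over `Hom_M` is symmetric if `μ` is compatible with
the commutativity constraints. -/
def CounitalLaxBimoduleMonoid.IsSymmetric [BraidedCategory M] :
    ObjectProperty (CounitalLaxBimoduleMonoid M E) :=
  fun A => A.obj.left.IsSymmetric

/-- Strong symmetric lax monoidal bimodule monoids. -/
def CounitalLaxBimoduleMonoid.IsStrongSymmetric [BraidedCategory M] :
    ObjectProperty (CounitalLaxBimoduleMonoid M E) :=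
  fun A => CounitalLaxBimoduleMonoid.IsStrong A ∧ CounitalLaxBimoduleMonoid.IsSymmetric A

/-- In the Cartesian case, a lax monoidal bimodule monoid over `Hom_M` is strong if `μ` is
fibrewise invertible: `ρ(X, Y) ⊗ ρ(X', Y')` is the pullback of `ρ(X ⊗ X', Y ⊗ Y')` along the
monoidal product `Hom(X, Y) ⊗ Hom(X', Y') ⟶ Hom(X ⊗ X', Y ⊗ Y')`. -/
def IsStrongOverHom : ObjectProperty (Over (homLax M E)) :=
  fun A => ∀ X Y X' Y' : M,
    IsPullback (A.left.tensor X Y X' Y')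
      (Bimodule.comp A.hom.hom X Y ⊗ₘ Bimodule.comp A.hom.hom X' Y')
      (Bimodule.comp A.hom.hom (X ⊗ X') (Y ⊗ Y')) (homTensor E X Y X' Y')

/-- Symmetric lax monoidal bimodule monoids over `Hom_M`. -/
def IsSymmetricOverHom [BraidedCategory M] : ObjectProperty (Over (homLax M E)) :=
  fun A => A.left.IsSymmetric

/-- Strong symmetric lax monoidal bimodule monoids over `Hom_M`. -/
def IsStrongSymmetricOverHom [BraidedCategory M] : ObjectProperty (Over (homLax M E)) :=
  fun A => IsStrongOverHom A ∧ IsSymmetricOverHom A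

end LaxOverHom

/-! ## Splittings -/

section Splittings

/-- A family of objects `D(φ)`, with the relation `IsProd x y z` that the element `z` of
`D(φ₁ ∘ φ₀)` is the composition of the elements `x` of `D(φ₁)` and `y` of `D(φ₀)`, and the
predicate `IsOne σ x` that `x` is the element `u_σ` of `D(σ)`. -/
structure Fibres (C : Type u) [Category.{v} C] (E : Type uE) [Category.{vE} E]
    [MonoidalCategory E] where
  D {X Y : C} (φ : X ⟶ Y) : E
  IsProd {X Y Z : C} {φ₁ : Y ⟶ Z} {φ₀ : X ⟶ Y} (x : 𝟙_ E ⟶ D φ₁) (y : 𝟙_ E ⟶ D φ₀)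
    (z : 𝟙_ E ⟶ D (φ₀ ≫ φ₁)) : Prop
  IsOne {X Y : C} (σ : X ≅ Y) (x : 𝟙_ E ⟶ D σ.hom) : Prop

variable {C : Type u} [Category.{v} C] {E : Type uE} [Category.{vE} E] [MonoidalCategory E]

/-- An element of `D(σ)` is invertible if it has a two-sided inverse in `D(σ⁻¹)`. -/
def Fibres.IsInvertible (𝒟 : Fibres C E) {X Y : C} (σ : X ≅ Y) (x : 𝟙_ E ⟶ 𝒟.D σ.hom) : Prop :=
  ∃ y : 𝟙_ E ⟶ 𝒟.D σ.inv,
    (∃ e : 𝟙_ E ⟶ 𝒟.D (σ.hom ≫ σ.inv), 𝒟.IsOne (σ ≪≫ σ.symm) e ∧ 𝒟.IsProd y x e) ∧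
    (∃ e : 𝟙_ E ⟶ 𝒟.D (σ.inv ≫ σ.hom), 𝒟.IsOne (σ.symm ≪≫ σ) e ∧ 𝒟.IsProd x y e)

/-- A splitting `D(σ) = (I(σ) ⊙ 𝟙) ⊕ R(σ)` for all isomorphisms `σ`. All invertible elements lie in
the first summand `S(σ) = I(σ) ⊙ 𝟙`, and none of them lies in `R(σ)`; the `I(σ)` form a groupoid
over the isomorphisms; and the unit element `u_σ` splits off from `S(σ)`. -/
structure Fibres.Splitting (𝒟 : Fibres C E) where
  I {X Y : C} (σ : X ≅ Y) : Set (𝟙_ E ⟶ 𝒟.D σ.hom)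
  S {X Y : C} (σ : X ≅ Y) : E
  R {X Y : C} (σ : X ≅ Y) : E
  s {X Y : C} (σ : X ≅ Y) : S σ ⟶ 𝒟.D σ.hom
  r {X Y : C} (σ : X ≅ Y) : R σ ⟶ 𝒟.D σ.hom
  isColimit {X Y : C} (σ : X ≅ Y) : IsColimit (BinaryCofan.mk (s σ) (r σ))
  c {X Y : C} (σ : X ≅ Y) (x : I σ) : 𝟙_ E ⟶ S σ
  c_s {X Y : C} (σ : X ≅ Y) (x : I σ) : c σ x ≫ s σ = x.1
  isColimit_c {X Y : C} (σ : X ≅ Y) : IsColimit (Cofan.mk (S σ) (c σ))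
  exists_of_isInvertible {X Y : C} (σ : X ≅ Y) (x : 𝟙_ E ⟶ 𝒟.D σ.hom)
    (hx : 𝒟.IsInvertible σ x) : ∃ y, x = y ≫ s σ
  not_isInvertible {X Y : C} (σ : X ≅ Y) (y : 𝟙_ E ⟶ R σ) : ¬ 𝒟.IsInvertible σ (y ≫ r σ)
  exists_prod {X Y Z : C} (σ : Y ≅ Z) (τ : X ≅ Y) {x : 𝟙_ E ⟶ 𝒟.D σ.hom}
    {y : 𝟙_ E ⟶ 𝒟.D τ.hom} (hx : x ∈ I σ) (hy : y ∈ I τ) :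
    ∃ z ∈ I (τ ≪≫ σ), 𝒟.IsProd x y z
  existsUnique_right {X Y Z : C} (σ : Y ≅ Z) (τ : X ≅ Y) {x : 𝟙_ E ⟶ 𝒟.D σ.hom}
    {z : 𝟙_ E ⟶ 𝒟.D (τ ≪≫ σ).hom} (hx : x ∈ I σ) (hz : z ∈ I (τ ≪≫ σ)) :
    ∃! y, y ∈ I τ ∧ 𝒟.IsProd x y z
  existsUnique_left {X Y Z : C} (σ : Y ≅ Z) (τ : X ≅ Y) {y : 𝟙_ E ⟶ 𝒟.D τ.hom}
    {z : 𝟙_ E ⟶ 𝒟.D (τ ≪≫ σ).hom} (hy : y ∈ I τ) (hz : z ∈ I (τ ≪≫ σ)) :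
    ∃! x, x ∈ I σ ∧ 𝒟.IsProd x y z
  exists_one {X Y : C} (σ : X ≅ Y) :
    ∃ (w : 𝟙_ E ⟶ S σ) (B : E) (j : B ⟶ S σ), 𝒟.IsOne σ (w ≫ s σ) ∧
      Nonempty (IsColimit (BinaryCofan.mk w j))

/-- The objects `D(φ)` of a functor on a plus construction, with the compositions and the
pointings. -/
def PlusMorphisms.fibres {P : Type w} [Category.{w} P] [MonoidalCategory P]
    (K : PlusMorphisms C P) (F : P ⥤ E) [F.LaxMonoidal] : Fibres C E where
  D φ := F.obj (K.letter (Arrow.mk φ))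
  IsProd {_ _ _ φ₁ φ₀} x y z := (λ_ (𝟙_ E)).inv ≫ (x ⊗ₘ y) ≫ Functor.LaxMonoidal.μ F _ _ ≫
    F.map (K.comp φ₁ φ₀) = z
  IsOne σ x := x = Functor.LaxMonoidal.ε F ≫ F.map (K.unit σ)

/-- A functor on a plus construction is split if its objects `D(σ)` have a splitting. -/
def PlusMorphisms.IsSplit {P : Type w} [Category.{w} P] [MonoidalCategory P]
    (K : PlusMorphisms C P) (F : P ⥤ E) [F.LaxMonoidal] : Prop :=
  Nonempty (K.fibres F).Splitting

variable [HasCoproducts.{v} E] [TensorPreservesCoproducts.{v} E]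
  [∀ F : (Core C)ᵒᵖ ⥤ Core C ⥤ E, HasCoend F]

/-- The summands `D(φ)` of a bimodule monoid over `Hom_C`. Elements are multiplied in `ρ`. -/
def Decomposition.fibres {ρ : BimoduleMonoid C E} {b : ρ ⟶ homMonoid C E}
    (d : Decomposition ρ b) : Fibres C E where
  D φ := d.D φ
  IsProd {X Y Z φ₁ φ₀} x y z :=
    (λ_ (𝟙_ E)).inv ≫ (x ≫ d.ι φ₁ ⊗ₘ y ≫ d.ι φ₀) ≫ ρ.mul X Y Z = z ≫ d.ι (φ₀ ≫ φ₁)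
  IsOne σ x := x ≫ d.ι σ.hom = ρ.elt σ

/-- A counital bimodule monoid over `Hom_C` is isomorphism split if `ρ` splits as `(I ⊙ 𝟙) ⊕ ρ'`,
compatibly with the decomposition of `ρ`, where `I` consists of invertible elements. -/
def Decomposition.IsIsomorphismSplit {ρ : BimoduleMonoid C E} {b : ρ ⟶ homMonoid C E}
    (d : Decomposition ρ b) : Prop :=
  ∃ S : d.fibres.Splitting, ∀ {X Y : C} (σ : X ≅ Y), ∀ x ∈ S.I σ, d.fibres.IsInvertible σ x

end Splittings

/-! ## Bimodule monoids realized by functors -/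

section Realizations

open Functor.LaxMonoidal

/-- The images of the generating objects and of the generators `γ`, `i_σ` and `μ` in a monoidal
category obtained by a plus construction of a monoidal category. -/
structure NcMorphisms (M : Type u) [Category.{v} M] [MonoidalCategory M] (P : Type w)
    [Category.{w} P] [MonoidalCategory P] extends PlusMorphisms M P where
  mu (f g : Arrow M) : letter f ⊗ letter g ⟶ letter (arrowTensor f g)

/-- The generators of a presentation as morphisms of the presented category. -/
def NcOps.morphisms {M : Type u} [Category.{v} M] [MonoidalCategory M] {O : Type w} {I : O}
    {T : O → O → O} {G : O → O → Type w} {s : Bool} (K : NcOps M I T G) (R : TermRel I T G s) :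
    NcMorphisms M (Presented R) where
  toPlusMorphisms := K.toPlusOps.morphisms R
  mu f g := Presented.mk R (.gen (K.mu f g))

/-- The generators of `M^{+,gcp}`, for which `μ` is the identity. -/
def strongMorphisms (M : Type u) [Category.{v} M] [MonoidalCategory M] [SymmetricCategory M] :
    NcMorphisms M (StrongPlusGcp M) where
  toPlusMorphisms := (strongOps M).morphisms (strongRel M)
  mu f g := CategoryStruct.id (obj := StrongPlusGcp M) (arrowTensor f g)

section Plain

variable {C : Type u} [Category.{v} C] {E : Type uE} [Category.{vE} E] [MonoidalCategory E]
  [HasCoproducts.{v} E] [∀ F : (Core C)ᵒᵖ ⥤ Core C ⥤ E, HasCoend F]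
  {P : Type w} [Category.{w} P] [MonoidalCategory P]

/-- The morphisms `j(φ) : F(φ) ⟶ ρ(X, Y)` intertwine the images under `F` of the `γ` and `i_σ` with
the composition and the unit of `ρ`. -/
def IsRealization (K : PlusMorphisms C P) (F : P ⥤ E) [F.LaxMonoidal] (ρ : BimoduleMonoid C E)
    (j : ∀ {X Y : C} (φ : X ⟶ Y), F.obj (K.letter (Arrow.mk φ)) ⟶ ρ.carrier.at X Y) : Prop :=
  (∀ {X Y Z : C} (φ₁ : Y ⟶ Z) (φ₀ : X ⟶ Y),
    μ F _ _ ≫ F.map (K.comp φ₁ φ₀) ≫ j (φ₀ ≫ φ₁) = (j φ₁ ⊗ₘ j φ₀) ≫ ρ.mul X Y Z) ∧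
  ∀ {X Y : C} (σ : X ≅ Y), ε F ≫ F.map (K.unit σ) ≫ j σ.hom = ρ.elt σ

variable [TensorPreservesCoproducts.{v} E]

/-- The functor `F` with counits `c` has the summands `D(φ)` of `ρ` as its values (up to
isomorphisms `θ`), compatibly with the counits and with all operations. -/
def IsCounitalRealization (K : PlusMorphisms C P) (F : P ⥤ E) [F.LaxMonoidal]
    (c : ∀ p, F.obj p ⟶ 𝟙_ E) {ρ : BimoduleMonoid C E} {b : ρ ⟶ homMonoid C E}
    (d : Decomposition ρ b)
    (θ : ∀ {X Y : C} (φ : X ⟶ Y), F.obj (K.letter (Arrow.mk φ)) ≅ d.D φ) : Prop :=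
  IsRealization K F ρ (fun φ => (θ φ).hom ≫ d.ι φ) ∧
    ∀ {X Y : C} (φ : X ⟶ Y), (θ φ).hom ≫ d.ε φ = c _

end Plain

section Lax

variable {M : Type u} [Category.{v} M] [MonoidalCategory M]
  {E : Type uE} [Category.{vE} E] [MonoidalCategory E] [BraidedCategory E]
  [HasCoproducts.{v} E] [∀ F : (Core M)ᵒᵖ ⥤ Core M ⥤ E, HasCoend F]
  {P : Type w} [Category.{w} P] [MonoidalCategory P]

/-- The morphisms `j(φ) : F(φ) ⟶ ρ(X, Y)` intertwine the images under `F` of the `μ` with the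
monoidal product of `ρ`. -/
def IsTensorRealization (K : NcMorphisms M P) (F : P ⥤ E) [F.LaxMonoidal]
    (ρ : LaxMonoidalBimoduleMonoid M E)
    (j : ∀ {X Y : M} (φ : X ⟶ Y), F.obj (K.letter (Arrow.mk φ)) ⟶ ρ.carrier.at X Y) : Prop :=
  ∀ {X Y X' Y' : M} (φ : X ⟶ Y) (ψ : X' ⟶ Y'),
    μ F _ _ ≫ F.map (K.mu (Arrow.mk φ) (Arrow.mk ψ)) ≫ j (φ ⊗ₘ ψ) =
      (j φ ⊗ₘ j ψ) ≫ ρ.tensor X Y X' Y'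

end Lax

section Correspondence

variable {C : Type u} [Category.{v} C] {E : Type uE} [Category.{vE} E] [MonoidalCategory E]
  [HasCoproducts.{v} E] [TensorPreservesCoproducts.{v} E]
  [∀ F : (Core C)ᵒᵖ ⥤ Core C ⥤ E, HasCoend F]
  {P : Type w} [Category.{w} P] [MonoidalCategory P]

/-- A functor with counits `c` corresponds to a counital bimodule monoid: its values are the
summands `D(φ)`, and it is split if and only if the bimodule monoid is isomorphism split. -/
def Corresponds (K : PlusMorphisms C P) (F : P ⥤ E) [F.LaxMonoidal] (c : ∀ p, F.obj p ⟶ 𝟙_ E)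
    (A : CounitalBimoduleMonoid C E) : Prop :=
  (∃ θ : ∀ {X Y : C} (φ : X ⟶ Y), F.obj (K.letter (Arrow.mk φ)) ≅ A.dec.D φ,
    IsCounitalRealization K F c A.dec θ) ∧
  (K.IsSplit F ↔ A.dec.IsIsomorphismSplit)

end Correspondence

section LaxCorrespondence

variable {M : Type u} [Category.{v} M] [MonoidalCategory M]
  {E : Type uE} [Category.{vE} E] [MonoidalCategory E] [BraidedCategory E]
  [HasCoproducts.{v} E] [TensorPreservesCoproducts.{v} E]
  [∀ F : (Core M)ᵒᵖ ⥤ Core M ⥤ E, HasCoend F]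
  {P : Type w} [Category.{w} P] [MonoidalCategory P]

/-- A functor with counits `c` corresponds to a counital lax monoidal bimodule monoid. -/
def LaxCorresponds (K : NcMorphisms M P) (F : P ⥤ E) [F.LaxMonoidal] (c : ∀ p, F.obj p ⟶ 𝟙_ E)
    (A : CounitalLaxBimoduleMonoid M E) : Prop :=
  (∃ θ : ∀ {X Y : M} (φ : X ⟶ Y), F.obj (K.letter (Arrow.mk φ)) ≅ A.dec.D φ,
    IsCounitalRealization K.toPlusMorphisms F c A.dec θ ∧
    IsTensorRealization K F A.obj.left (fun φ => (θ φ).hom ≫ A.dec.ι φ)) ∧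
  (K.IsSplit F ↔ A.dec.IsIsomorphismSplit)

end LaxCorrespondence

section CartesianCorrespondence

variable {E : Type uE} [Category.{vE} E] [CartesianMonoidalCategory E]
  [HasCoproducts.{v} E] [TensorPreservesCoproducts.{v} E]
  {P : Type w} [Category.{w} P] [MonoidalCategory P]

/-- In the Cartesian case, a functor corresponds to a bimodule monoid over `Hom_C` if its values
are the fibres `D(φ) = {φ} ×_{Hom(X, Y)} ρ(X, Y)`, compatibly with all operations. -/
def CartesianCorresponds {C : Type u} [Category.{v} C]
    [∀ F : (Core C)ᵒᵖ ⥤ Core C ⥤ E, HasCoend F] (K : PlusMorphisms C P) (F : P ⥤ E)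
    [F.LaxMonoidal] (A : Over (homMonoid C E)) : Prop :=
  ∃ j : ∀ {X Y : C} (φ : X ⟶ Y), F.obj (K.letter (Arrow.mk φ)) ⟶ A.left.carrier.at X Y,
    IsRealization K F A.left j ∧
    ∀ {X Y : C} (φ : X ⟶ Y), IsPullback (j φ) (CartesianMonoidalCategory.toUnit _)
      (Bimodule.comp A.hom.hom X Y) (homι E φ)

/-- In the Cartesian case, a functor corresponds to a lax monoidal bimodule monoid over `Hom_M`. -/
def CartesianLaxCorresponds [BraidedCategory E] {M : Type u} [Category.{v} M] [MonoidalCategory M]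
    [∀ F : (Core M)ᵒᵖ ⥤ Core M ⥤ E, HasCoend F] (K : NcMorphisms M P) (F : P ⥤ E)
    [F.LaxMonoidal] (A : Over (homLax M E)) : Prop :=
  ∃ j : ∀ {X Y : M} (φ : X ⟶ Y), F.obj (K.letter (Arrow.mk φ)) ⟶ A.left.carrier.at X Y,
    IsRealization K.toPlusMorphisms F A.left.toBimoduleMonoid j ∧
    IsTensorRealization K F A.left j ∧
    ∀ {X Y : M} (φ : X ⟶ Y), IsPullback (j φ) (CartesianMonoidalCategory.toUnit _)
      (Bimodule.comp A.hom.hom X Y) (homι E φ)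

/-- All coproducts indexed by types in `Type v` are van Kampen colimits, that is disjoint and
universal. -/
class ExtensiveCoproducts (E : Type uE) [Category.{vE} E] : Prop where
  isVanKampen {J : Type v} (F : Discrete J ⥤ E) (c : Cocone F) (hc : IsColimit c) :
    IsVanKampenColimit c

end CartesianCorrespondence

end Realizations

end PlusConstruction

open PlusConstruction

set_option linter.unusedSectionVars false

/-! Both sides of every equivalence are compared with a third category, that of algebras (`PlusAlg`,
`NcAlg`): families of objects `D(φ)` of `E`, indexed by the morphisms `φ`, with values for the
generators `(σ ⇓ σ')`, `γ`, `i_σ` (and `μ`) that satisfy the defining relations. The family that is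
constant at `𝟙` is the trivial algebra and a counit is a morphism to it, so counital objects belong
to the slice over the trivial algebra. Two fully faithful functors to one category with the same
essential image have equivalent sources (`exists_equivalence_of_essImage`), and the isomorphisms in
the common target compare the values of a functor with the summands of a bimodule monoid.

Functors. A presented monoidal category has the expected universal property. The monoidal structure
of `E` is transported to the indices of a family of objects (`TensorFamily.Pull`), where the tensor
product is strictly the given operation on indices. Formal morphisms are interpreted there without
coherence isomorphisms (`TensorFamily.interpret_sound`), and relations may be checked in `E` because
the evaluation is faithful and strong monoidal. Conversely, a monoidal family of morphisms that is
natural for the generators and the braidings is natural (`Presented.naturality`). Hence evaluation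
at the letters is fully faithful. Its essential image consists of all algebras for `⊠+` and `nc+`,
and of those with invertible `μ` for `loc+`; commutativity is added if `M` is taken as symmetric. In
`M^{+,gcp}` the unit object is `id_𝟙`, so a functor also forces `𝟙 ⟶ D(id_𝟙)` to be invertible. For
an algebra with invertible `μ` and a counit this is automatic (`NcAlg.isIso_unit`).

Bimodule monoids. The inclusions `D(φ) ⟶ ρ(X, Y)` are monomorphisms, so the restrictions of the
operations to the summands are unique and inherit every law of `ρ`. Conversely, the coproducts of
the values of an algebra form a bimodule monoid, since `⊗` preserves coproducts and a map out of a
plethysm product is an equivariant family. Thus `summands` and `laxSummands` are equivalences onto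
the slice over the trivial algebra.

Splittings. The bijectivity of multiplication on the sets `I(σ)` produces an element `e` of `I(id)`
that acts as a left identity on `I(id)`, hence on the coproduct `∐_{I(id)} 𝟙`. The unit element
factors through this coproduct, so `e` equals it, and solving equations in `I` then yields inverses.
Every splitting of a decomposed bimodule monoid therefore consists of invertible elements, and
splittings can be transported between functors and bimodule monoids (`ValueIso.isSplit_iff`).

Cartesian case. The unit object is terminal, so the trivial algebra is terminal and counits are no
additional data. As coproducts are disjoint and universal, a bimodule monoid over `Hom_C` is the
coproduct of its fibres, every decomposition is given by these fibres, and every morphism over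
`Hom_C` respects them. Invertibility of all products `D(φ) ⊗ D(ψ) ⟶ D(φ ⊗ ψ)` becomes the condition
that `μ` is a pullback square. -/

namespace PlusConstruction

/-! ## Algebras over the plus constructions -/

section PlusAlgebras

variable (C : Type u) [Category.{v} C] (E : Type uE) [Category.{vE} E] [MonoidalCategory E]

/-- Values of the generators of a plus construction in a monoidal category. -/
structure PlusData where
  obj : Arrow C → E
  iso {f g : Arrow C} (e : f ≅ g) : obj f ⟶ obj g
  comp {X Y Z : C} (φ₁ : Y ⟶ Z) (φ₀ : X ⟶ Y) :
    obj (Arrow.mk φ₁) ⊗ obj (Arrow.mk φ₀) ⟶ obj (Arrow.mk (φ₀ ≫ φ₁))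
  unit {X Y : C} (σ : X ≅ Y) : 𝟙_ E ⟶ obj (Arrow.mk σ.hom)

variable {C E}

/-- The relations of the plus construction with groupoid compatible pointings. -/
structure PlusData.IsAlgebra (d : PlusData C E) : Prop where
  iso_id (f : Arrow C) : d.iso (Iso.refl f) = 𝟙 _
  iso_comp {f g h : Arrow C} (e : f ≅ g) (e' : g ≅ h) : d.iso (e ≪≫ e') = d.iso e ≫ d.iso e'
  equivariance {X Y Z X' Y' Z' : C} (a : X ≅ X') (b : Y ≅ Y') (c : Z ≅ Z')
    (φ₁ : Y ⟶ Z) (φ₁' : Y' ⟶ Z') (φ₀ : X ⟶ Y) (φ₀' : X' ⟶ Y')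
    (h₁ : b.hom ≫ φ₁' = φ₁ ≫ c.hom) (h₀ : a.hom ≫ φ₀' = φ₀ ≫ b.hom) :
    (d.iso (square b c h₁) ⊗ₘ d.iso (square a b h₀)) ≫ d.comp φ₁' φ₀' =
      d.comp φ₁ φ₀ ≫ d.iso (square a c (φ := φ₀ ≫ φ₁) (φ' := φ₀' ≫ φ₁')
        (by rw [← Category.assoc, h₀, Category.assoc, h₁, Category.assoc]))
  assoc {W X Y Z : C} (φ₂ : Y ⟶ Z) (φ₁ : X ⟶ Y) (φ₀ : W ⟶ X) :
    (d.comp φ₂ φ₁ ⊗ₘ 𝟙 (d.obj (Arrow.mk φ₀))) ≫ d.comp (φ₁ ≫ φ₂) φ₀ ≫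
        d.iso (square (Iso.refl W) (Iso.refl Z) (φ := φ₀ ≫ φ₁ ≫ φ₂)
              (φ' := (φ₀ ≫ φ₁) ≫ φ₂) (by simp)) =
      (α_ _ _ _).hom ≫ (𝟙 (d.obj (Arrow.mk φ₂)) ⊗ₘ d.comp φ₁ φ₀) ≫ d.comp φ₂ (φ₀ ≫ φ₁)
  unit_equivariance {X Y X' Y' : C} (τ : X ≅ Y) (τ' : X' ≅ Y') (a : X ≅ X') (b : Y ≅ Y')
    (h : a.hom ≫ τ'.hom = τ.hom ≫ b.hom) : d.unit τ ≫ d.iso (square a b h) = d.unit τ'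
  unit_right {X Y Z : C} (φ : Y ⟶ Z) (σ : X ≅ Y) :
    (ρ_ _).inv ≫ (𝟙 (d.obj (Arrow.mk φ)) ⊗ₘ d.unit σ) ≫ d.comp φ σ.hom =
      d.iso (square σ.symm (Iso.refl Z) (φ := φ) (φ' := σ.hom ≫ φ) (by simp))
  unit_left {X Y Z : C} (σ : Y ≅ Z) (φ : X ⟶ Y) :
    (λ_ _).inv ≫ (d.unit σ ⊗ₘ 𝟙 (d.obj (Arrow.mk φ))) ≫ d.comp σ.hom φ =
      d.iso (square (Iso.refl X) σ (φ := φ) (φ' := φ ≫ σ.hom) (by simp))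

/-! ### Algebras and monoidal functors -/

section Map

open Functor.LaxMonoidal

variable {Q : Type*} [Category Q] [MonoidalCategory Q]

/-- The image of the values of the generators under a lax monoidal functor. -/
def PlusData.map (d : PlusData C E) (F : E ⥤ Q) [F.LaxMonoidal] : PlusData C Q where
  obj f := F.obj (d.obj f)
  iso e := F.map (d.iso e)
  comp φ₁ φ₀ := μ F _ _ ≫ F.map (d.comp φ₁ φ₀)
  unit σ := ε F ≫ F.map (d.unit σ)

section Lemmas

variable (F : E ⥤ Q) [F.LaxMonoidal]

/-- This lemma and the four after it treat the shapes of composites that occur in the relations: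
each carries `F` past one shape, at the cost of structure morphisms `μ` and `ε`. The same identities
serve to preserve the relations along a lax functor and to reflect them along a faithful strong one.
-/
lemma map_tensor_comp {A B A' B' Z : E} (f : A ⟶ A') (g : B ⟶ B') (h : A' ⊗ B' ⟶ Z) :
    μ F _ _ ≫ F.map ((f ⊗ₘ g) ≫ h) = (F.map f ⊗ₘ F.map g) ≫ μ F _ _ ≫ F.map h := by
  rw [F.map_comp, ← μ_natural_assoc]

lemma map_comp_left {A B A' B' Y Z : E} (f : A ⊗ B ⟶ A') (g : A' ⊗ B' ⟶ Y) (h : Y ⟶ Z) :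
    (μ F A B ⊗ₘ 𝟙 (F.obj B')) ≫ μ F _ _ ≫ F.map ((f ⊗ₘ 𝟙 B') ≫ g ≫ h) =
      ((μ F A B ≫ F.map f) ⊗ₘ 𝟙 (F.obj B')) ≫ (μ F _ _ ≫ F.map g) ≫ F.map h := by
  rw [map_tensor_comp, F.map_id, tensorHom_comp_tensorHom_assoc, Category.id_comp, F.map_comp]
  simp only [Category.assoc]

lemma map_assoc_comp {A B A' B' Z : E} (f : B ⊗ B' ⟶ A') (g : A ⊗ A' ⟶ Z) :
    (μ F A B ⊗ₘ 𝟙 (F.obj B')) ≫ μ F _ _ ≫ F.map ((α_ A B B').hom ≫ (𝟙 A ⊗ₘ f) ≫ g) =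
      (α_ _ _ _).hom ≫ (𝟙 (F.obj A) ⊗ₘ (μ F B B' ≫ F.map f)) ≫ (μ F _ _ ≫ F.map g) := by
  rw [F.map_comp, tensorHom_id, associativity_assoc, map_tensor_comp, F.map_id,
    ← id_tensorHom, tensorHom_comp_tensorHom_assoc, Category.id_comp]

lemma map_rightUnitor_inv_comp {A B Z : E} (f : 𝟙_ E ⟶ B) (g : A ⊗ B ⟶ Z) :
    F.map ((ρ_ A).inv ≫ (𝟙 A ⊗ₘ f) ≫ g) =
      (ρ_ _).inv ≫ (𝟙 (F.obj A) ⊗ₘ (ε F ≫ F.map f)) ≫ μ F _ _ ≫ F.map g := by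
  have h : F.map (ρ_ A).inv = (ρ_ (F.obj A)).inv ≫ (𝟙 _ ⊗ₘ ε F) ≫ μ F _ _ := by
    rw [id_tensorHom, ← cancel_epi (ρ_ (F.obj A)).hom, Iso.hom_inv_id_assoc, right_unitality,
      Category.assoc, Category.assoc, ← F.map_comp, Iso.hom_inv_id, F.map_id, Category.comp_id]
  rw [F.map_comp, h, Category.assoc, Category.assoc, map_tensor_comp, F.map_id,
    tensorHom_comp_tensorHom_assoc, Category.id_comp]

lemma map_leftUnitor_inv_comp {A B Z : E} (f : 𝟙_ E ⟶ B) (g : B ⊗ A ⟶ Z) :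
    F.map ((λ_ A).inv ≫ (f ⊗ₘ 𝟙 A) ≫ g) =
      (λ_ _).inv ≫ ((ε F ≫ F.map f) ⊗ₘ 𝟙 (F.obj A)) ≫ μ F _ _ ≫ F.map g := by
  have h : F.map (λ_ A).inv = (λ_ (F.obj A)).inv ≫ (ε F ⊗ₘ 𝟙 _) ≫ μ F _ _ := by
    rw [tensorHom_id, ← cancel_epi (λ_ (F.obj A)).hom, Iso.hom_inv_id_assoc, left_unitality,
      Category.assoc, Category.assoc, ← F.map_comp, Iso.hom_inv_id, F.map_id, Category.comp_id]
  rw [F.map_comp, h, Category.assoc, Category.assoc, map_tensor_comp, F.map_id,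
    tensorHom_comp_tensorHom_assoc, Category.id_comp]

end Lemmas

theorem PlusData.IsAlgebra.map {d : PlusData C E} (h : d.IsAlgebra) (F : E ⥤ Q)
    [F.LaxMonoidal] : (d.map F).IsAlgebra where
  iso_id f := by simp [PlusData.map, h.iso_id]
  iso_comp e e' := by simp [PlusData.map, h.iso_comp]
  equivariance a b c φ₁ φ₁' φ₀ φ₀' h₁ h₀ := by
    refine (map_tensor_comp F _ _ _).symm.trans ?_
    rw [h.equivariance, F.map_comp, ← Category.assoc]
    rfl
  assoc φ₂ φ₁ φ₀ := by
    refine (map_comp_left F _ _ _).symm.trans ?_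
    rw [h.assoc]
    exact map_assoc_comp F _ _
  unit_equivariance τ τ' a b hh := by
    have := congrArg (fun t => ε F ≫ F.map t) (h.unit_equivariance τ τ' a b hh)
    simpa [PlusData.map] using this
  unit_right φ σ := (map_rightUnitor_inv_comp F _ _).symm.trans (congrArg _ (h.unit_right φ σ))
  unit_left σ φ := (map_leftUnitor_inv_comp F _ _).symm.trans (congrArg _ (h.unit_left σ φ))

/-- The structure morphisms of a strong functor can be cancelled, after which faithfulness reflects
the equation. Relations in the category of indices are thereby reduced to relations in `E`. -/
theorem PlusData.IsAlgebra.of_map {d : PlusData C E} (F : E ⥤ Q)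
    [F.Monoidal] [F.Faithful] (h : (d.map F).IsAlgebra) : d.IsAlgebra where
  iso_id f := F.map_injective ((h.iso_id f).trans (F.map_id _).symm)
  iso_comp e e' := F.map_injective ((h.iso_comp e e').trans (F.map_comp _ _).symm)
  equivariance a b c φ₁ φ₁' φ₀ φ₀' h₁ h₀ := F.map_injective <| by
    rw [← cancel_epi (μ F _ _)]
    refine (map_tensor_comp F _ _ _).trans ((h.equivariance a b c φ₁ φ₁' φ₀ φ₀' h₁ h₀).trans ?_)
    rw [F.map_comp]
    exact Category.assoc _ _ _
  assoc φ₂ φ₁ φ₀ := F.map_injective <| by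
    rw [← cancel_epi (μ F _ _), ← cancel_epi (μ F _ _ ⊗ₘ 𝟙 (F.obj _))]
    exact (map_comp_left F _ _ _).trans ((h.assoc φ₂ φ₁ φ₀).trans (map_assoc_comp F _ _).symm)
  unit_equivariance τ τ' a b hh := F.map_injective <| by
    rw [← cancel_epi (ε F)]
    have := h.unit_equivariance τ τ' a b hh
    simpa [PlusData.map] using this
  unit_right φ σ := F.map_injective ((map_rightUnitor_inv_comp F _ _).trans (h.unit_right φ σ))
  unit_left σ φ := F.map_injective ((map_leftUnitor_inv_comp F _ _).trans (h.unit_left σ φ))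

end Map

variable (C E) in
/-- Algebras in `E` over the plus construction of `C` with groupoid compatible pointings. -/
structure PlusAlg extends PlusData C E where
  isAlgebra : toPlusData.IsAlgebra

/-- A family of morphisms that is compatible with the values of the generators. -/
@[ext]
structure PlusData.Hom (A B : PlusData C E) where
  app (f : Arrow C) : A.obj f ⟶ B.obj f
  iso_app {f g : Arrow C} (e : f ≅ g) : A.iso e ≫ app g = app f ≫ B.iso e
  comp_app {X Y Z : C} (φ₁ : Y ⟶ Z) (φ₀ : X ⟶ Y) :
    A.comp φ₁ φ₀ ≫ app (Arrow.mk (φ₀ ≫ φ₁)) =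
      (app (Arrow.mk φ₁) ⊗ₘ app (Arrow.mk φ₀)) ≫ B.comp φ₁ φ₀
  unit_app {X Y : C} (σ : X ≅ Y) : A.unit σ ≫ app (Arrow.mk σ.hom) = B.unit σ

/-- The identity. -/
def PlusData.Hom.id (A : PlusData C E) : PlusData.Hom A A where
  app _ := 𝟙 _
  iso_app _ := by simp
  comp_app _ _ := by simp
  unit_app _ := by simp

/-- The composition of compatible families of morphisms. -/
def PlusData.Hom.trans {A B D : PlusData C E} (p : PlusData.Hom A B) (q : PlusData.Hom B D) :
    PlusData.Hom A D where
  app f := p.app f ≫ q.app f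
  iso_app e := by rw [← Category.assoc, p.iso_app, Category.assoc, q.iso_app, Category.assoc]
  comp_app φ₁ φ₀ := by
    rw [← Category.assoc, p.comp_app, Category.assoc, q.comp_app, tensorHom_comp_tensorHom_assoc]
  unit_app σ := by rw [← Category.assoc, p.unit_app, q.unit_app]

instance : Category (PlusAlg C E) where
  Hom A B := PlusData.Hom A.toPlusData B.toPlusData
  id A := PlusData.Hom.id A.toPlusData
  comp p q := PlusData.Hom.trans p q
  id_comp _ := PlusData.Hom.ext (funext fun _ => Category.id_comp _)
  comp_id _ := PlusData.Hom.ext (funext fun _ => Category.comp_id _)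
  assoc _ _ _ := PlusData.Hom.ext (funext fun _ => Category.assoc _ _ _)

/-- The inverse of a compatible family of isomorphisms. -/
def PlusData.Hom.symm {A B : PlusData C E} (p : PlusData.Hom A B) (q : ∀ f, B.obj f ⟶ A.obj f)
    (hpq : ∀ f, p.app f ≫ q f = 𝟙 _) (hqp : ∀ f, q f ≫ p.app f = 𝟙 _) : PlusData.Hom B A where
  app := q
  iso_app {f g} e := by
    have h := congrArg (fun t => q f ≫ t ≫ q g) (p.iso_app e)
    simp only [Category.assoc] at h
    rw [hpq, Category.comp_id, reassoc_of% (hqp f)] at h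
    exact h.symm
  comp_app φ₁ φ₀ := by
    have h := congrArg (fun t => (q _ ⊗ₘ q _) ≫ t ≫ q _) (p.comp_app φ₁ φ₀)
    simp only [Category.assoc, tensorHom_comp_tensorHom_assoc] at h
    rw [hpq, Category.comp_id, hqp, hqp, id_tensorHom_id, Category.id_comp] at h
    exact h.symm
  unit_app σ := by rw [← p.unit_app, Category.assoc, hpq, Category.comp_id]

lemma PlusAlg.hom_ext {A B : PlusAlg C E} {p q : A ⟶ B}
    (h : ∀ f, PlusData.Hom.app p f = PlusData.Hom.app q f) : p = q :=
  PlusData.Hom.ext (funext h)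

/-- An isomorphism of algebras from a morphism whose components have inverses. -/
def PlusAlg.isoMk {A B : PlusAlg C E} (p : PlusData.Hom A.toPlusData B.toPlusData)
    (q : ∀ f, B.obj f ⟶ A.obj f)
    (hpq : ∀ f, p.app f ≫ q f = 𝟙 _) (hqp : ∀ f, q f ≫ p.app f = 𝟙 _) : A ≅ B where
  hom := p
  inv := p.symm q hpq hqp
  hom_inv_id := PlusAlg.hom_ext hpq
  inv_hom_id := PlusAlg.hom_ext hqp

variable (C E) in
/-- The trivial algebra, with all values the unit object. -/
abbrev trivialData : PlusData C E where
  obj _ := 𝟙_ E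
  iso _ := 𝟙 _
  comp _ _ := (λ_ (𝟙_ E)).hom
  unit _ := 𝟙 _

variable (C E) in
/-- The trivial algebra, with all values the unit object. -/
def trivialAlg : PlusAlg C E where
  toPlusData := trivialData C E
  isAlgebra :=
    { iso_id _ := rfl
      iso_comp _ _ := (Category.id_comp _).symm
      equivariance := by intros; simp [trivialData]
      assoc := by intros; simp [trivialData, unitors_equal]
      unit_equivariance := by intros; simp [trivialData]
      unit_right := by intros; simp [trivialData, unitors_equal]
      unit_left := by intros; simp [trivialData] }

end PlusAlgebras

/-! ### Algebras with a monoidal product -/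

section NcAlgebras

variable (M : Type u) [Category.{v} M] [MonoidalCategory M] (E : Type uE) [Category.{vE} E]
  [MonoidalCategory E]

/-- Values of the generators of the nc plus construction in a monoidal category. -/
structure NcData extends PlusData M E where
  mu (f g : Arrow M) : obj f ⊗ obj g ⟶ obj (arrowTensor f g)

variable {M E}

/-- The relations of the nc plus construction. -/
structure NcData.IsMultiplicative [BraidedCategory E] (d : NcData M E) : Prop where
  equivariance {f g f' g' : Arrow M} (e : f ≅ g) (e' : f' ≅ g') :
    (d.iso e ⊗ₘ d.iso e') ≫ d.mu g g' = d.mu f f' ≫ d.iso (arrowTensorIso e e')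
  assoc (f g h : Arrow M) :
    (d.mu f g ⊗ₘ 𝟙 (d.obj h)) ≫ d.mu (arrowTensor f g) h ≫ d.iso (arrowAssoc f g h) =
      (α_ _ _ _).hom ≫ (𝟙 (d.obj f) ⊗ₘ d.mu g h) ≫ d.mu f (arrowTensor g h)
  interchange {X Y Z X' Y' Z' : M} (φ₁ : Y ⟶ Z) (φ₀ : X ⟶ Y) (ψ₁ : Y' ⟶ Z') (ψ₀ : X' ⟶ Y') :
    (d.comp φ₁ φ₀ ⊗ₘ d.comp ψ₁ ψ₀) ≫ d.mu (Arrow.mk (φ₀ ≫ φ₁)) (Arrow.mk (ψ₀ ≫ ψ₁)) =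
      tensorμ _ _ _ _ ≫ (d.mu (Arrow.mk φ₁) (Arrow.mk ψ₁) ⊗ₘ d.mu (Arrow.mk φ₀) (Arrow.mk ψ₀)) ≫
        d.comp (φ₁ ⊗ₘ ψ₁) (φ₀ ⊗ₘ ψ₀) ≫ d.iso (arrowInterchange φ₁ φ₀ ψ₁ ψ₀)
  unit_tensor {X Y X' Y' : M} (σ : X ≅ Y) (σ' : X' ≅ Y') :
    (λ_ (𝟙_ E)).inv ≫ (d.unit σ ⊗ₘ d.unit σ') ≫ d.mu (Arrow.mk σ.hom) (Arrow.mk σ'.hom) =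
      d.unit (σ ⊗ᵢ σ')
  unit_left (f : Arrow M) :
    (λ_ (d.obj f)).inv ≫ (d.unit (Iso.refl (𝟙_ M)) ⊗ₘ 𝟙 (d.obj f)) ≫
      d.mu (Arrow.mk (𝟙 (𝟙_ M))) f ≫ d.iso (arrowLeftUnitor f) = 𝟙 _
  unit_right (f : Arrow M) :
    (ρ_ (d.obj f)).inv ≫ (𝟙 (d.obj f) ⊗ₘ d.unit (Iso.refl (𝟙_ M))) ≫
      d.mu f (Arrow.mk (𝟙 (𝟙_ M))) ≫ d.iso (arrowRightUnitor f) = 𝟙 _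

/-- The compatibility of the monoidal product with the commutativity constraints. -/
def NcData.IsCommutative [BraidedCategory E] [SymmetricCategory M] (d : NcData M E) : Prop :=
  ∀ f g : Arrow M, d.mu f g ≫ d.iso (arrowBraiding f g) = (β_ _ _).hom ≫ d.mu g f

/-- The monoidal products are isomorphisms. -/
def NcData.IsStrong (d : NcData M E) : Prop := ∀ f g : Arrow M, IsIso (d.mu f g)

/-! ### Multiplicative algebras and monoidal functors -/

section Map

open Functor.LaxMonoidal

variable {Q : Type*} [Category Q] [MonoidalCategory Q]

/-- The image of the values of the generators under a lax monoidal functor. -/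
def NcData.map (d : NcData M E) (F : E ⥤ Q) [F.LaxMonoidal] : NcData M Q where
  toPlusData := d.toPlusData.map F
  mu f g := μ F _ _ ≫ F.map (d.mu f g)

variable [BraidedCategory E] [BraidedCategory Q]

/-- A lax braided functor respects the middle exchange, because this is built from associators and a
single braiding. -/
lemma map_tensorμ (F : E ⥤ Q) [F.LaxBraided] (A B A' B' : E) :
    (μ F A B ⊗ₘ μ F A' B') ≫ μ F _ _ ≫ F.map (tensorμ A B A' B') =
      tensorμ _ _ _ _ ≫ (μ F A A' ⊗ₘ μ F B B') ≫ μ F _ _ := by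
  -- The braiding acts only within the last three factors. On these the claim follows from
  -- associativity of `μ` and the braided axiom; the outer associators are dealt with afterwards.
  have inner : F.obj B ◁ μ F A' B' ≫ μ F _ _ ≫
      F.map ((α_ B A' B').inv ≫ (β_ B A').hom ▷ B' ≫ (α_ A' B B').hom) =
      (α_ _ _ _).inv ≫ (β_ _ _).hom ▷ F.obj B' ≫ (α_ _ _ _).hom ≫
        F.obj A' ◁ μ F B B' ≫ μ F _ _ := by
    rw [F.map_comp, F.map_comp, associativity_inv_assoc, ← μ_natural_left_assoc,
      ← comp_whiskerRight_assoc, Functor.LaxBraided.braided, comp_whiskerRight_assoc,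
      associativity]
  have step : tensorμ A B A' B' = (α_ A B (A' ⊗ B')).hom ≫
      A ◁ ((α_ B A' B').inv ≫ (β_ B A').hom ▷ B' ≫ (α_ A' B B').hom) ≫
        (α_ A A' (B ⊗ B')).inv := by
    simp [tensorμ]
  have step' : tensorμ (F.obj A) (F.obj B) (F.obj A') (F.obj B') =
      (α_ _ _ _).hom ≫ F.obj A ◁ ((α_ _ _ _).inv ≫ (β_ _ _).hom ▷ _ ≫ (α_ _ _ _).hom) ≫
        (α_ _ _ _).inv := by
    simp [tensorμ]
  rw [step, step', F.map_comp, F.map_comp, MonoidalCategory.tensorHom_def', Category.assoc,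
    associativity_assoc, ← μ_natural_right_assoc]
  have key := congrArg (fun t => F.obj A ◁ t) inner
  simp only [MonoidalCategory.whiskerLeft_comp] at key
  simp only [MonoidalCategory.whiskerLeft_comp, Category.assoc, Functor.map_comp] at key ⊢
  rw [tensor_whiskerLeft_assoc, Iso.inv_hom_id_assoc, reassoc_of% key,
    associativity_inv, MonoidalCategory.tensorHom_def', Category.assoc, tensor_whiskerLeft_assoc,
    Iso.inv_hom_id_assoc]

lemma map_interchange (F : E ⥤ Q) [F.LaxBraided] {A B A' B' Y Y' Z Z' : E}
    (f : A ⊗ A' ⟶ Y) (f' : B ⊗ B' ⟶ Y') (g : Y ⊗ Y' ⟶ Z) (h : Z ⟶ Z') :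
    (μ F A B ⊗ₘ μ F A' B') ≫ μ F _ _ ≫ F.map (tensorμ A B A' B' ≫ (f ⊗ₘ f') ≫ g ≫ h) =
      tensorμ _ _ _ _ ≫ ((μ F _ _ ≫ F.map f) ⊗ₘ (μ F _ _ ≫ F.map f')) ≫
        (μ F _ _ ≫ F.map g) ≫ F.map h := by
  rw [F.map_comp, reassoc_of% map_tensorμ, map_tensor_comp, F.map_comp,
    tensorHom_comp_tensorHom_assoc, Category.assoc]

lemma map_tensor_tensor (F : E ⥤ Q) [F.LaxMonoidal] {A B A' B' Y Y' Z : E}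
    (f : A ⊗ B ⟶ Y) (f' : A' ⊗ B' ⟶ Y') (g : Y ⊗ Y' ⟶ Z) :
    (μ F A B ⊗ₘ μ F A' B') ≫ μ F _ _ ≫ F.map ((f ⊗ₘ f') ≫ g) =
      ((μ F _ _ ≫ F.map f) ⊗ₘ (μ F _ _ ≫ F.map f')) ≫ μ F _ _ ≫ F.map g := by
  rw [map_tensor_comp, tensorHom_comp_tensorHom_assoc]

/-- Splitting `f ⊗ g` into `f ⊗ 𝟙` followed by `𝟙 ⊗ g` reduces this to the unit law of `F` in one
variable and the naturality of `μ`. -/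
lemma map_unit_tensor (F : E ⥤ Q) [F.LaxMonoidal] {A B Z : E} (f : 𝟙_ E ⟶ A) (g : 𝟙_ E ⟶ B)
    (h : A ⊗ B ⟶ Z) :
    ε F ≫ F.map ((λ_ (𝟙_ E)).inv ≫ (f ⊗ₘ g) ≫ h) =
      (λ_ (𝟙_ Q)).inv ≫ ((ε F ≫ F.map f) ⊗ₘ (ε F ≫ F.map g)) ≫ μ F _ _ ≫ F.map h := by
  have h' : f ⊗ₘ g = (f ⊗ₘ 𝟙 _) ≫ (𝟙 _ ⊗ₘ g) := by
    rw [tensorHom_comp_tensorHom, Category.comp_id, Category.id_comp]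
  rw [h', Category.assoc, map_leftUnitor_inv_comp, map_tensor_comp,
    tensorHom_comp_tensorHom_assoc, leftUnitor_inv_naturality_assoc, ← id_tensorHom,
    tensorHom_comp_tensorHom_assoc]
  simp

theorem NcData.IsMultiplicative.map {d : NcData M E} (h : d.IsMultiplicative) (F : E ⥤ Q)
    [F.LaxBraided] : (d.map F).IsMultiplicative where
  equivariance e e' := by
    refine (map_tensor_comp F _ _ _).symm.trans ?_
    rw [h.equivariance, F.map_comp, ← Category.assoc]
    rfl
  assoc f g k := by
    refine (map_comp_left F _ _ _).symm.trans ?_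
    rw [h.assoc]
    exact map_assoc_comp F _ _
  interchange φ₁ φ₀ ψ₁ ψ₀ := by
    refine (map_tensor_tensor F _ _ _).symm.trans ?_
    rw [h.interchange]
    exact map_interchange F _ _ _ _
  unit_tensor σ σ' := (map_unit_tensor F _ _ _).symm.trans
    (congrArg (fun t => ε F ≫ F.map t) (h.unit_tensor σ σ'))
  unit_left f := by
    have := (map_leftUnitor_inv_comp F _ _).symm.trans (congrArg F.map (h.unit_left f))
    simpa [NcData.map, PlusData.map] using this
  unit_right f := by
    have := (map_rightUnitor_inv_comp F _ _).symm.trans (congrArg F.map (h.unit_right f))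
    simpa [NcData.map, PlusData.map] using this

/-- As for the plain relations, with the braided structure of `F` needed for interchange. -/
theorem NcData.IsMultiplicative.of_map {d : NcData M E} (F : E ⥤ Q)
    [F.Braided] [F.Faithful] (h : (d.map F).IsMultiplicative) : d.IsMultiplicative where
  equivariance e e' := F.map_injective <| by
    rw [← cancel_epi (μ F _ _)]
    refine (map_tensor_comp F _ _ _).trans ((h.equivariance e e').trans ?_)
    rw [F.map_comp]
    exact Category.assoc _ _ _
  assoc f g k := F.map_injective <| by
    rw [← cancel_epi (μ F _ _), ← cancel_epi (μ F _ _ ⊗ₘ 𝟙 (F.obj _))]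
    exact (map_comp_left F _ _ _).trans ((h.assoc f g k).trans (map_assoc_comp F _ _).symm)
  interchange φ₁ φ₀ ψ₁ ψ₀ := F.map_injective <| by
    rw [← cancel_epi (μ F _ _), ← cancel_epi (μ F _ _ ⊗ₘ μ F _ _)]
    exact (map_tensor_tensor F _ _ _).trans
      ((h.interchange φ₁ φ₀ ψ₁ ψ₀).trans (map_interchange F _ _ _ _).symm)
  unit_tensor σ σ' := F.map_injective <| by
    rw [← cancel_epi (ε F)]
    exact (map_unit_tensor F _ _ _).trans (h.unit_tensor σ σ')
  unit_left f := F.map_injective <| by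
    rw [map_leftUnitor_inv_comp, F.map_id, F.map_comp]
    simpa [NcData.map, PlusData.map] using h.unit_left f
  unit_right f := F.map_injective <| by
    rw [map_rightUnitor_inv_comp, F.map_id, F.map_comp]
    simpa [NcData.map, PlusData.map] using h.unit_right f

variable [SymmetricCategory M]

theorem NcData.IsCommutative.map {d : NcData M E} (h : d.IsCommutative) (F : E ⥤ Q)
    [F.LaxBraided] : (d.map F).IsCommutative := fun f g => by
  have := congrArg (fun t => μ F _ _ ≫ F.map t) (h f g)
  simp only [F.map_comp] at this
  rw [Functor.LaxBraided.braided_assoc] at this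
  exact (Category.assoc _ _ _).trans this

theorem NcData.IsCommutative.of_map {d : NcData M E} (F : E ⥤ Q)
    [F.Braided] [F.Faithful] (h : (d.map F).IsCommutative) : d.IsCommutative :=
  fun f g => F.map_injective <| by
    rw [← cancel_epi (μ F _ _), F.map_comp, F.map_comp, Functor.LaxBraided.braided_assoc]
    exact (Category.assoc _ _ _).symm.trans (h f g)

end Map

variable [BraidedCategory E]

variable (M E) in
/-- Algebras in `E` over the nc plus construction of `M` with groupoid compatible pointings. -/
structure NcAlg extends NcData M E where
  isAlgebra : toPlusData.IsAlgebra
  isMultiplicative : toNcData.IsMultiplicative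

/-- The underlying algebra over the plus construction. -/
abbrev NcAlg.toPlusAlg (A : NcAlg M E) : PlusAlg M E := ⟨A.toPlusData, A.isAlgebra⟩

/-- A family of morphisms that is compatible with the values of the generators. -/
@[ext]
structure NcAlg.Hom (A B : NcAlg M E) extends PlusData.Hom A.toPlusData B.toPlusData where
  mu_app (f g : Arrow M) :
    A.mu f g ≫ app (arrowTensor f g) = (app f ⊗ₘ app g) ≫ B.mu f g

instance : Category (NcAlg M E) where
  Hom := NcAlg.Hom
  id A := { toHom := PlusData.Hom.id A.toPlusData
            mu_app := fun _ _ => by simp [PlusData.Hom.id] }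
  comp p q := { toHom := PlusData.Hom.trans p.toHom q.toHom
                mu_app := fun f g => by
                  change _ ≫ p.app _ ≫ q.app _ = (p.app _ ≫ q.app _ ⊗ₘ p.app _ ≫ q.app _) ≫ _
                  rw [← Category.assoc, p.mu_app, Category.assoc, q.mu_app,
                    tensorHom_comp_tensorHom_assoc] }
  id_comp _ := NcAlg.Hom.ext (funext fun _ => Category.id_comp _)
  comp_id _ := NcAlg.Hom.ext (funext fun _ => Category.comp_id _)
  assoc _ _ _ := NcAlg.Hom.ext (funext fun _ => Category.assoc _ _ _)

lemma NcAlg.hom_ext {A B : NcAlg M E} {p q : A ⟶ B} (h : ∀ f, p.app f = q.app f) : p = q :=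
  NcAlg.Hom.ext (funext h)

/-- An isomorphism of algebras from a morphism whose components have inverses. -/
def NcAlg.isoMk {A B : NcAlg M E} (p : A ⟶ B) (q : ∀ f, B.obj f ⟶ A.obj f)
    (hpq : ∀ f, p.app f ≫ q f = 𝟙 _) (hqp : ∀ f, q f ≫ p.app f = 𝟙 _) : A ≅ B where
  hom := p
  inv :=
    { toHom := p.toHom.symm q hpq hqp
      mu_app := fun f g => by
        have h := congrArg (fun t => (q _ ⊗ₘ q _) ≫ t ≫ q _) (p.mu_app f g)
        simp only [Category.assoc, tensorHom_comp_tensorHom_assoc] at h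
        rw [hpq, Category.comp_id, hqp, hqp, id_tensorHom_id, Category.id_comp] at h
        exact h.symm }
  hom_inv_id := NcAlg.hom_ext hpq
  inv_hom_id := NcAlg.hom_ext hqp

/-- Left unitality of the tensor product as a monoidal functor of two variables, at the unit
objects, determines `tensorμ` there; the rest contains no braiding and is coherence. This is the
interchange law of the trivial algebra. -/
lemma tensorμ_unitors :
    tensorμ (𝟙_ E) (𝟙_ E) (𝟙_ E) (𝟙_ E) ≫ ((λ_ (𝟙_ E)).hom ⊗ₘ (λ_ (𝟙_ E)).hom) =
      ((λ_ (𝟙_ E)).hom ⊗ₘ (λ_ (𝟙_ E)).hom) := by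
  have h := tensor_left_unitality (C := E) (𝟙_ E) (𝟙_ E)
  rw [← cancel_epi ((λ_ (𝟙_ E)).inv ▷ (𝟙_ E ⊗ 𝟙_ E)), ← h]
  monoidal

variable (M E) in
/-- The trivial algebra, with all values the unit object. -/
def trivialNcAlg : NcAlg M E where
  toPlusData := trivialData M E
  mu _ _ := (λ_ (𝟙_ E)).hom
  isAlgebra := (trivialAlg M E).isAlgebra
  isMultiplicative :=
    { equivariance := by intros; simp [trivialData]
      assoc := by intros; simp [trivialData, unitors_equal]
      interchange := by
        intros
        simp only [trivialData, Category.comp_id]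
        rw [reassoc_of% tensorμ_unitors]
      unit_tensor := by intros; simp [trivialData]
      unit_left := by intros; simp [trivialData]
      unit_right := by intros; simp [trivialData, unitors_equal] }

/-- Conjugation by `e`. Invariance under isomorphism is what lets commutativity, and likewise
strength below, describe an essential image. -/
lemma NcData.IsCommutative.of_iso [SymmetricCategory M] {A B : NcAlg M E} (e : A ≅ B)
    (h : A.IsCommutative) : B.IsCommutative := fun f g => by
  have he : ∀ f, e.inv.app f ≫ e.hom.app f = 𝟙 _ := fun f =>
    congrArg (fun t : B ⟶ B => t.app f) e.inv_hom_id
  have h₁ := congrArg (fun t => (e.inv.app f ⊗ₘ e.inv.app g) ≫ t ≫ e.hom.app _) (h f g)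
  simp only [Category.assoc] at h₁
  rw [e.hom.iso_app, reassoc_of% (e.hom.mu_app f g), tensorHom_comp_tensorHom_assoc, he, he,
    id_tensorHom_id, Category.id_comp] at h₁
  rw [h₁, BraidedCategory.braiding_naturality_assoc, e.hom.mu_app,
    tensorHom_comp_tensorHom_assoc, he, he, id_tensorHom_id, Category.id_comp]

lemma NcData.IsStrong.of_iso {A B : NcAlg M E} (e : A ≅ B)
    (h : A.IsStrong) : B.IsStrong := fun f g => by
  have he : ∀ f, e.inv.app f ≫ e.hom.app f = 𝟙 _ := fun f =>
    congrArg (fun t : B ⟶ B => t.app f) e.inv_hom_id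
  have he' : ∀ f, e.hom.app f ≫ e.inv.app f = 𝟙 _ := fun f =>
    congrArg (fun t : A ⟶ A => t.app f) e.hom_inv_id
  have i : ∀ f, IsIso (e.hom.app f) := fun f => ⟨_, he' f, he f⟩
  have i' : ∀ f, IsIso (e.inv.app f) := fun f => ⟨_, he f, he' f⟩
  have := h f g
  have h₁ : B.mu f g = (e.inv.app f ⊗ₘ e.inv.app g) ≫ A.mu f g ≫ e.hom.app _ := by
    rw [e.hom.mu_app, tensorHom_comp_tensorHom_assoc, he, he, id_tensorHom_id, Category.id_comp]
  rw [h₁]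
  infer_instance

end NcAlgebras


/-! ## The universal property of presented monoidal categories -/

section Interpretation

variable {O : Type w} (I : O) (T : O → O → O) (E : Type uE) [Category.{vE} E] [MonoidalCategory E]

/-- A family of objects of `E` that is compatible with a unit object and a tensor operation on the
index type. -/
structure TensorFamily where
  obj : O → E
  unit : 𝟙_ E ≅ obj I
  tensor (X Y : O) : obj X ⊗ obj Y ≅ obj (T X Y)

variable {I T E}

namespace TensorFamily

variable (N : TensorFamily I T E)

/-- The category of the indices of a family of objects, with the morphisms of these objects. -/
@[nolint unusedArguments]
def Pull (_N : TensorFamily I T E) : Type w := O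

instance : Category.{vE} N.Pull where
  Hom X Y := N.obj X ⟶ N.obj Y
  id X := 𝟙 (N.obj X)
  comp f g := CategoryStruct.comp (obj := E) f g
  id_comp f := Category.id_comp (obj := E) f
  comp_id f := Category.comp_id (obj := E) f
  assoc f g h := Category.assoc (obj := E) f g h

/-- A morphism of `E` between members of the family as a morphism of indices. -/
def homMk {X Y : O} (f : N.obj X ⟶ N.obj Y) : @Quiver.Hom N.Pull _ X Y := f

/-- An isomorphism of `E` between members of the family as an isomorphism of indices. -/
def isoMk {X Y : O} (f : N.obj X ≅ N.obj Y) : @Iso N.Pull _ X Y :=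
  ⟨f.hom, f.inv, f.hom_inv_id, f.inv_hom_id⟩

/-- The evaluation of a family of objects at the indices. -/
def eval : N.Pull ⥤ E where
  obj X := N.obj X
  map f := f

instance : N.eval.Faithful where
  map_injective h := h

/-- On indices the product is `T` itself and the unit is `I` itself. The isomorphisms `N.tensor` and
`N.unit` are hidden in the tensor product of morphisms and in the constraints, so that a formal
morphism from `X` to `Y` can be interpreted between exactly these indices. -/
instance : MonoidalCategoryStruct N.Pull where
  tensorObj X Y := T X Y
  tensorUnit := I
  tensorHom f g := N.homMk ((N.tensor _ _).inv ≫ (N.eval.map f ⊗ₘ N.eval.map g) ≫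
    (N.tensor _ _).hom)
  whiskerLeft X _ _ f := N.homMk ((N.tensor X _).inv ≫ (N.obj X ◁ N.eval.map f) ≫
    (N.tensor X _).hom)
  whiskerRight f Y := N.homMk ((N.tensor _ Y).inv ≫ (N.eval.map f ▷ N.obj Y) ≫
    (N.tensor _ Y).hom)
  associator X Y Z := N.isoMk (((N.tensor (T X Y) Z).symm ≪≫ ((N.tensor X Y).symm ⊗ᵢ .refl _)) ≪≫
    α_ (N.obj X) (N.obj Y) (N.obj Z) ≪≫ ((.refl _ ⊗ᵢ N.tensor Y Z) ≪≫ N.tensor X (T Y Z)))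
  leftUnitor X := N.isoMk (((N.tensor I X).symm ≪≫ (N.unit.symm ⊗ᵢ .refl _)) ≪≫ λ_ (N.obj X))
  rightUnitor X := N.isoMk (((N.tensor X I).symm ≪≫ (.refl _ ⊗ᵢ N.unit.symm)) ≪≫ ρ_ (N.obj X))

/-- The evaluation preserves the monoidal structure. -/
def inducing : Monoidal.InducingFunctorData N.eval where
  μIso X Y := N.tensor X Y
  εIso := N.unit
  whiskerLeft_eq _ _ _ _ := rfl
  whiskerRight_eq _ _ := rfl
  tensorHom_eq _ _ := rfl
  associator_eq _ _ _ := rfl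
  leftUnitor_eq _ := rfl
  rightUnitor_eq _ := rfl

/-- The axioms hold because `N.eval` is faithful and carries the structure to that of `E`. -/
instance : MonoidalCategory N.Pull := Monoidal.induced N.eval N.inducing

instance : N.eval.Monoidal := (Monoidal.fromInducedCoreMonoidal N.eval N.inducing).toMonoidal

section Braided

variable [SymmetricCategory E]

/-- The braiding on the indices. -/
def braiding (X Y : N.Pull) : X ⊗ Y ≅ Y ⊗ X :=
  N.isoMk ((N.tensor X Y).symm ≪≫ β_ (N.obj X) (N.obj Y) ≪≫ N.tensor Y X)

instance : BraidedCategory N.Pull := BraidedCategory.ofFaithful N.eval N.braiding fun X Y =>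
  Iso.hom_inv_id_assoc (N.tensor X Y) _

instance : N.eval.Braided where
  braided X Y := (Iso.hom_inv_id_assoc (N.tensor X Y) _)

instance : SymmetricCategory N.Pull := SymmetricCategory.ofFaithful N.eval

end Braided

variable {G : O → O → Type w} {s : Bool} [SymmetricCategory E]
  (gen : ∀ {X Y : O}, G X Y → (N.obj X ⟶ N.obj Y))

/-- The morphism of indices that is denoted by a formal morphism. -/
def interpret {X Y : O} : Term I T G s X Y → @Quiver.Hom N.Pull _ X Y
  | .gen g => N.homMk (gen g)
  | .id X => CategoryStruct.id (obj := N.Pull) X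
  | .comp f g => CategoryStruct.comp (obj := N.Pull) (interpret f) (interpret g)
  | .tensor f g => MonoidalCategoryStruct.tensorHom (C := N.Pull) (interpret f) (interpret g)
  | .assocHom X Y Z => (MonoidalCategoryStruct.associator (C := N.Pull) X Y Z).hom
  | .assocInv X Y Z => (MonoidalCategoryStruct.associator (C := N.Pull) X Y Z).inv
  | .leftHom X => (MonoidalCategoryStruct.leftUnitor (C := N.Pull) X).hom
  | .leftInv X => (MonoidalCategoryStruct.leftUnitor (C := N.Pull) X).inv
  | .rightHom X => (MonoidalCategoryStruct.rightUnitor (C := N.Pull) X).hom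
  | .rightInv X => (MonoidalCategoryStruct.rightUnitor (C := N.Pull) X).inv
  | .braid _ X Y => (BraidedCategory.braiding (C := N.Pull) X Y).hom

variable {gen} {R : TermRel I T G s}

/-- Every rule of the congruence is an axiom of the symmetric monoidal category `N.Pull`. Where a
rule uses the tensor product with an identity and the axiom uses whiskering, the two are exchanged.
-/
theorem interpret_sound
    (hR : ∀ ⦃X Y : O⦄ (f g : Term I T G s X Y), R f g → N.interpret gen f = N.interpret gen g)
    {X Y : O} {f g : Term I T G s X Y} (h : MonoidalClosure R f g) :
    N.interpret gen f = N.interpret gen g := by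
  induction h with
  | of h => exact hR _ _ h
  | refl => rfl
  | symm _ h => exact h.symm
  | trans _ _ h h' => exact h.trans h'
  | comp _ _ h h' => exact congrArg₂ (CategoryStruct.comp (obj := N.Pull)) h h'
  | tensor _ _ h h' => exact congrArg₂ (MonoidalCategoryStruct.tensorHom (C := N.Pull)) h h'
  | id_comp f => exact Category.id_comp (obj := N.Pull) _
  | comp_id f => exact Category.comp_id (obj := N.Pull) _
  | assoc f g h => exact Category.assoc (obj := N.Pull) _ _ _
  | tensor_id X Y => exact id_tensorHom_id (C := N.Pull) X Y
  | tensor_comp => exact tensorHom_comp_tensorHom (C := N.Pull) _ _ _ _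
  | assoc_hom_inv X Y Z => exact Iso.hom_inv_id (C := N.Pull) _
  | assoc_inv_hom X Y Z => exact Iso.inv_hom_id (C := N.Pull) _
  | assoc_natural => exact associator_naturality (C := N.Pull) _ _ _
  | left_hom_inv => exact Iso.hom_inv_id (C := N.Pull) _
  | left_inv_hom => exact Iso.inv_hom_id (C := N.Pull) _
  | left_natural f =>
    refine Eq.trans ?_ (leftUnitor_naturality (C := N.Pull) (N.interpret gen f))
    exact congrArg (fun t => CategoryStruct.comp (obj := N.Pull) t _)
      (id_tensorHom (C := N.Pull) I (N.interpret gen f))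
  | right_hom_inv => exact Iso.hom_inv_id (C := N.Pull) _
  | right_inv_hom => exact Iso.inv_hom_id (C := N.Pull) _
  | right_natural f =>
    refine Eq.trans ?_ (rightUnitor_naturality (C := N.Pull) (N.interpret gen f))
    exact congrArg (fun t => CategoryStruct.comp (obj := N.Pull) t _)
      (tensorHom_id (C := N.Pull) (N.interpret gen f) I)
  | pentagon W X Y Z =>
    refine Eq.trans ?_ (MonoidalCategory.pentagon (C := N.Pull) W X Y Z)
    exact congrArg₂ (fun t t' => CategoryStruct.comp (obj := N.Pull) t
      (CategoryStruct.comp (obj := N.Pull) _ t')) (tensorHom_id (C := N.Pull) _ _)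
      (id_tensorHom (C := N.Pull) _ _)
  | triangle X Y =>
    refine Eq.trans ?_ ((MonoidalCategory.triangle (C := N.Pull) X Y).trans
      (tensorHom_id (C := N.Pull) _ _).symm)
    exact congrArg (fun t => CategoryStruct.comp (obj := N.Pull) _ t)
      (id_tensorHom (C := N.Pull) _ _)
  | braid_braid h X Y => exact SymmetricCategory.symmetry (C := N.Pull) X Y
  | braid_natural h f f' => exact BraidedCategory.braiding_naturality (C := N.Pull) _ _
  | hexagon h X Y Z =>
    refine Eq.trans (BraidedCategory.hexagon_forward (C := N.Pull) X Y Z) ?_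
    exact congrArg₂ (fun t t' => CategoryStruct.comp (obj := N.Pull) t
      (CategoryStruct.comp (obj := N.Pull) _ t')) (tensorHom_id (C := N.Pull) _ _).symm
      (id_tensorHom (C := N.Pull) _ _).symm
  | hexagon_inv h X Y Z =>
    refine Eq.trans (BraidedCategory.hexagon_reverse (C := N.Pull) X Y Z) ?_
    exact congrArg₂ (fun t t' => CategoryStruct.comp (obj := N.Pull) t
      (CategoryStruct.comp (obj := N.Pull) _ t')) (id_tensorHom (C := N.Pull) _ _).symm
      (tensorHom_id (C := N.Pull) _ _).symm

variable (gen) in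
/-- The functor on a presented category that is given by values of the generators satisfying the
relations. -/
def lift (hR : ∀ ⦃X Y : O⦄ (f g : Term I T G s X Y), R f g →
    N.interpret gen f = N.interpret gen g) : Presented R ⥤ N.Pull where
  obj X := X
  map := Quotient.lift (N.interpret gen) fun _ _ h => N.interpret_sound hR h
  map_id _ := rfl
  map_comp := by
    rintro X Y Z ⟨f⟩ ⟨g⟩
    rfl

section

variable (hR : ∀ ⦃X Y : O⦄ (f g : Term I T G s X Y), R f g →
    N.interpret gen f = N.interpret gen g)

/-- The products and constraints of the presented category go to those of `N.Pull` on the nose, so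
all structure morphisms are identities. The isomorphisms of the family reappear only after
composition with `N.eval`. -/
instance : (N.lift gen hR).LaxMonoidal :=
  .ofTensorHom (CategoryStruct.id (obj := N.Pull) I)
    (fun X Y => CategoryStruct.id (obj := N.Pull) (T X Y))
    (μ_natural := by
      rintro X Y X' Y' ⟨f⟩ ⟨g⟩
      exact (Category.comp_id (obj := N.Pull) _).trans (Category.id_comp (obj := N.Pull) _).symm)
    (associativity := fun X Y Z => by
      have h₁ := id_tensorHom_id (C := N.Pull) (T X Y) Z
      have h₂ := id_tensorHom_id (C := N.Pull) X (T Y Z)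
      refine Eq.trans (congrArg₂ (CategoryStruct.comp (obj := N.Pull)) h₁
        (Category.id_comp (obj := N.Pull) _)) ?_
      refine (Category.id_comp (obj := N.Pull) _).trans ?_
      refine Eq.trans ?_ (congrArg (fun t => CategoryStruct.comp (obj := N.Pull) _
        (CategoryStruct.comp (obj := N.Pull) t _)) h₂.symm)
      refine Eq.trans ?_ (congrArg (CategoryStruct.comp (obj := N.Pull) _)
        (Category.comp_id (obj := N.Pull) _).symm)
      exact (Category.comp_id (obj := N.Pull) _).symm)
    (left_unitality := fun X => by
      have h₁ := id_tensorHom_id (C := N.Pull) I X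
      refine Eq.trans ?_ (congrArg (fun t => CategoryStruct.comp (obj := N.Pull) t
        (CategoryStruct.comp (obj := N.Pull) _ _)) h₁.symm)
      refine Eq.trans ?_ (Category.id_comp (obj := N.Pull) _).symm
      exact (Category.id_comp (obj := N.Pull) _).symm)
    (right_unitality := fun X => by
      have h₁ := id_tensorHom_id (C := N.Pull) X I
      refine Eq.trans ?_ (congrArg (fun t => CategoryStruct.comp (obj := N.Pull) t
        (CategoryStruct.comp (obj := N.Pull) _ _)) h₁.symm)
      refine Eq.trans ?_ (Category.id_comp (obj := N.Pull) _).symm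
      exact (Category.id_comp (obj := N.Pull) _).symm)

lemma comp_eval_ε : Functor.LaxMonoidal.ε (N.lift gen hR ⋙ N.eval) = N.unit.hom :=
  Category.comp_id _

lemma comp_eval_μ (X Y : O) :
    Functor.LaxMonoidal.μ (N.lift gen hR ⋙ N.eval) X Y = (N.tensor X Y).hom :=
  Category.comp_id _

end

instance {R : TermRel I T G true} (hR : ∀ ⦃X Y : O⦄ (f g : Term I T G true X Y), R f g →
    N.interpret gen f = N.interpret gen g) : (N.lift gen hR).LaxBraided where
  braided _ _ := (Category.id_comp (obj := N.Pull) _).trans (Category.comp_id (obj := N.Pull) _).symm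

end TensorFamily

end Interpretation

/-! ### Naturality can be checked on generators -/

section Naturality

open Functor.LaxMonoidal

variable {O : Type w} {I : O} {T : O → O → O} {G : O → O → Type w} {s : Bool}
  {R : TermRel I T G s} {E : Type uE} [Category.{vE} E] [MonoidalCategory E]

/-- Naturality for an isomorphism implies it for the inverse. This covers the inverse constraints
and the formal inverses of `μ`. -/
lemma naturality_inv {P : Type*} [Category P] {F F' : P ⥤ E} {X Y : P} (e : X ≅ Y)
    {τ : F.obj X ⟶ F'.obj X} {τ' : F.obj Y ⟶ F'.obj Y}
    (h : F.map e.hom ≫ τ' = τ ≫ F'.map e.hom) : F.map e.inv ≫ τ = τ' ≫ F'.map e.inv := by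
  rw [← cancel_epi (F.map e.hom), reassoc_of% h, ← F'.map_comp, ← Category.assoc, ← F.map_comp]
  simp

/-- A family of morphisms between the values of strong monoidal functors on a presented monoidal
category is natural if it is monoidal and natural for the generators. -/
theorem Presented.naturality {F F' : Presented R ⥤ E} [F.LaxMonoidal] [F'.LaxMonoidal]
    [IsIso (ε F)] [i : ∀ X Y, IsIso (μ F X Y)]
    (τ : ∀ X : Presented R, F.obj X ⟶ F'.obj X) (hε : ε F ≫ τ (𝟙_ _) = ε F')
    (hμ : ∀ X Y : Presented R, μ F X Y ≫ τ (X ⊗ Y) = (τ X ⊗ₘ τ Y) ≫ μ F' X Y)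
    (hgen : ∀ (X Y : O) (g : G X Y),
      F.map (Presented.mk R (.gen g)) ≫ τ Y = τ X ≫ F'.map (Presented.mk R (.gen g)))
    (hbraid : ∀ (h : s = true) (X Y : O), F.map (Presented.mk R (.braid h X Y)) ≫ τ (T Y X) =
      τ (T X Y) ≫ F'.map (Presented.mk R (.braid h X Y)))
    {X Y : Presented R} (f : X ⟶ Y) : F.map f ≫ τ Y = τ X ≫ F'.map f := by
  -- A monoidal family is natural for the constraints for formal reasons: after precomposition with
  -- the invertible `μ F` and `ε F`, the coherence axioms of `F` and `F'` turn the claim into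
  -- naturality of the constraints of `E`.
  have assoc (X Y Z : Presented R) :
      F.map (α_ X Y Z).hom ≫ τ _ = τ _ ≫ F'.map (α_ X Y Z).hom := by
    rw [← cancel_epi (μ F _ _), ← cancel_epi (μ F _ _ ▷ F.obj Z), associativity_assoc, hμ,
      reassoc_of% (hμ (X ⊗ Y) Z), ← tensorHom_id, tensorHom_comp_tensorHom_assoc, hμ,
      Category.id_comp, ← id_tensorHom, tensorHom_comp_tensorHom_assoc, hμ, Category.id_comp]
    have h₁ : ((τ X ⊗ₘ τ Y) ≫ μ F' X Y ⊗ₘ τ Z) =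
        ((τ X ⊗ₘ τ Y) ⊗ₘ τ Z) ≫ (μ F' X Y ▷ _) := by
      rw [← tensorHom_id, tensorHom_comp_tensorHom, Category.comp_id]
    have h₂ : (τ X ⊗ₘ (τ Y ⊗ₘ τ Z) ≫ μ F' Y Z) =
        (τ X ⊗ₘ (τ Y ⊗ₘ τ Z)) ≫ (_ ◁ μ F' Y Z) := by
      rw [← id_tensorHom, tensorHom_comp_tensorHom, Category.comp_id]
    rw [h₁, h₂, Category.assoc, Category.assoc, associativity, associator_naturality_assoc]
  have left (X : Presented R) : F.map (λ_ X).hom ≫ τ _ = τ _ ≫ F'.map (λ_ X).hom := by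
    rw [← cancel_epi (μ F _ _), ← cancel_epi (ε F ▷ F.obj X), ← left_unitality_assoc,
      reassoc_of% (hμ (𝟙_ _) X), ← tensorHom_id, tensorHom_comp_tensorHom_assoc, hε,
      Category.id_comp, ← leftUnitor_naturality, left_unitality, ← tensorHom_id, ← id_tensorHom,
      tensorHom_comp_tensorHom_assoc, Category.comp_id, Category.id_comp]
  have right (X : Presented R) : F.map (ρ_ X).hom ≫ τ _ = τ _ ≫ F'.map (ρ_ X).hom := by
    rw [← cancel_epi (μ F _ _), ← cancel_epi (F.obj X ◁ ε F), ← right_unitality_assoc,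
      reassoc_of% (hμ X (𝟙_ _)), ← id_tensorHom, tensorHom_comp_tensorHom_assoc, hε,
      Category.id_comp, ← rightUnitor_naturality, right_unitality, ← tensorHom_id, ← id_tensorHom,
      tensorHom_comp_tensorHom_assoc, Category.comp_id, Category.id_comp]
  -- Every morphism is represented by a formal one, so induction over formal morphisms applies.
  suffices H : ∀ {X Y : O} (t : Term I T G s X Y),
      F.map (Presented.mk R t) ≫ τ Y = τ X ≫ F'.map (Presented.mk R t) by
    obtain ⟨t⟩ := f
    exact H t
  intro X Y t
  induction t with
  | gen g => exact hgen _ _ g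
  | id X =>
    exact (congrArg (· ≫ τ X) (F.map_id X)).trans ((Category.id_comp _).trans
      ((Category.comp_id _).symm.trans (congrArg (τ X ≫ ·) (F'.map_id X)).symm))
  | comp f g hf hg =>
    have h₁ := F.map_comp (Presented.mk R f) (Presented.mk R g)
    have h₂ := F'.map_comp (Presented.mk R f) (Presented.mk R g)
    refine (congrArg (· ≫ τ _) h₁).trans (Eq.trans ?_ (congrArg (τ _ ≫ ·) h₂).symm)
    rw [Category.assoc, hg, reassoc_of% hf]
  | @tensor X Y X' Y' f g hf hg =>
    have h₁ := μ_natural F (Presented.mk R f) (Presented.mk R g)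
    have h₂ := μ_natural F' (Presented.mk R f) (Presented.mk R g)
    have : IsIso (μ F X X') := i X X'
    have : Epi (μ F X X') := IsIso.epi_of_iso _
    rw [← cancel_epi (μ F X X')]
    refine (Category.assoc _ _ _).symm.trans ((congrArg (· ≫ τ _) h₁).symm.trans ?_)
    refine (Category.assoc _ _ _).trans ((congrArg (_ ≫ ·) (hμ Y Y')).trans ?_)
    refine Eq.trans ?_ ((congrArg (· ≫ F'.map _) (hμ X X')).symm.trans (Category.assoc _ _ _))
    refine Eq.trans ?_ ((congrArg (_ ≫ ·) h₂).trans (Category.assoc _ _ _).symm)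
    rw [tensorHom_comp_tensorHom_assoc, tensorHom_comp_tensorHom_assoc, hf, hg]
  | assocHom X Y Z => exact assoc X Y Z
  | assocInv X Y Z => exact naturality_inv (MonoidalCategoryStruct.associator (C := Presented R) X Y Z) (assoc X Y Z)
  | leftHom X => exact left X
  | leftInv X => exact naturality_inv (MonoidalCategoryStruct.leftUnitor (C := Presented R) X) (left X)
  | rightHom X => exact right X
  | rightInv X => exact naturality_inv (MonoidalCategoryStruct.rightUnitor (C := Presented R) X) (right X)
  | braid h X Y => exact hbraid h X Y

end Naturality


/-! ## Functors on plus constructions and algebras -/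

section Tautological

variable {C : Type u} [Category.{v} C] {O : Type w} {I : O} {T : O → O → O}
  {G : O → O → Type w} {s : Bool}

/-- The generators as data in the presented category. -/
def PlusOps.data (K : PlusOps C I T G) (R : TermRel I T G s) : PlusData C (Presented R) where
  obj f := K.letter f
  iso e := Presented.mk R (.gen (K.iso e))
  comp φ₁ φ₀ := Presented.mk R (.gen (K.comp φ₁ φ₀))
  unit σ := Presented.mk R (.gen (K.unit σ))

/-- The relations hold in the quotient by construction. `R` is only required to contain them, so
that one statement serves all the presentations. -/
theorem PlusOps.isAlgebra_data (K : PlusOps C I T G) {R : TermRel I T G s}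
    (h : ∀ ⦃X Y : O⦄ (f g : Term I T G s X Y), PlusRel K f g → R f g)
    (h' : ∀ ⦃X Y : O⦄ (f g : Term I T G s X Y), PointingRel K f g → R f g) :
    (K.data R).IsAlgebra where
  iso_id f := Quotient.sound (.of (h _ _ (.iso_id f)))
  iso_comp e e' := Quotient.sound (.of (h _ _ (.iso_comp e e')))
  equivariance a b c φ₁ φ₁' φ₀ φ₀' h₁ h₀ :=
    Quotient.sound (.of (h _ _ (.equivariance a b c φ₁ φ₁' φ₀ φ₀' h₁ h₀)))
  assoc φ₂ φ₁ φ₀ := Quotient.sound (.of (h _ _ (.assoc φ₂ φ₁ φ₀)))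
  unit_equivariance τ τ' a b hh := Quotient.sound (.of (h' _ _ (.equivariance τ τ' a b hh)))
  unit_right φ σ := Quotient.sound (.of (h' _ _ (.right φ σ)))
  unit_left σ φ := Quotient.sound (.of (h' _ _ (.left σ φ)))

variable {M : Type u} [Category.{v} M] [MonoidalCategory M]

/-- The generators as data in the presented category. -/
def NcOps.data (K : NcOps M I T G) (R : TermRel I T G s) : NcData M (Presented R) where
  toPlusData := K.toPlusOps.data R
  mu f g := Presented.mk R (.gen (K.mu f g))

theorem NcOps.isMultiplicative_data (K : NcOps M I T G) {R : TermRel I T G true}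
    (h : ∀ ⦃X Y : O⦄ (f g : Term I T G true X Y), NcRel K f g → R f g) :
    (K.data R).IsMultiplicative where
  equivariance e e' := Quotient.sound (.of (h _ _ (.equivariance e e')))
  assoc e f g := Quotient.sound (.of (h _ _ (.assoc e f g)))
  interchange φ₁ φ₀ ψ₁ ψ₀ := Quotient.sound (.of (h _ _ (.interchange φ₁ φ₀ ψ₁ ψ₀)))
  unit_tensor σ σ' := Quotient.sound (.of (h _ _ (.unit_tensor σ σ')))
  unit_left f := Quotient.sound (.of (h _ _ (.unit_left f)))
  unit_right f := Quotient.sound (.of (h _ _ (.unit_right f)))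

theorem NcOps.isCommutative_data [SymmetricCategory M] (K : NcOps M I T G)
    {R : TermRel I T G true}
    (h : ∀ ⦃X Y : O⦄ (f g : Term I T G true X Y), CommRel K f g → R f g) :
    (K.data R).IsCommutative :=
  fun f g => Quotient.sound (.of (h _ _ (.comm f g)))

end Tautological

/-! ### Relations among the values of the generators -/

section Values

variable {C : Type u} [Category.{v} C] {O : Type w} {I : O} {T : O → O → O}
  {G : O → O → Type w} {s : Bool} {E : Type uE} [Category.{vE} E] [MonoidalCategory E]
  (N : TensorFamily I T E) (gen : ∀ {X Y : O}, G X Y → (N.obj X ⟶ N.obj Y))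

/-- The values of the generators, as morphisms of indices. -/
def PlusOps.pullData (K : PlusOps C I T G) : PlusData C N.Pull where
  obj f := K.letter f
  iso e := N.homMk (gen (K.iso e))
  comp φ₁ φ₀ := N.homMk (gen (K.comp φ₁ φ₀))
  unit σ := N.homMk (gen (K.unit σ))

/-- The values of the generators. -/
def PlusOps.values (K : PlusOps C I T G) : PlusData C E where
  obj f := N.obj (K.letter f)
  iso e := gen (K.iso e)
  comp φ₁ φ₀ := (N.tensor _ _).hom ≫ gen (K.comp φ₁ φ₀)
  unit σ := N.unit.hom ≫ gen (K.unit σ)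

variable {N gen}

/-- The image of `pullData` under the evaluation is `values` by definition, and the evaluation
reflects relations. -/
theorem PlusOps.isAlgebra_pullData {K : PlusOps C I T G} (h : (K.values N gen).IsAlgebra) :
    (K.pullData N gen).IsAlgebra :=
  PlusData.IsAlgebra.of_map N.eval h

variable {M : Type u} [Category.{v} M] [MonoidalCategory M] [SymmetricCategory E]

/-- Interpreting both sides of a relation yields, by definition, the corresponding law of the
algebra `pullData`; no coherence isomorphism intervenes because the product of indices is strict. -/
theorem PlusOps.interpret_plusRel {K : PlusOps C I T G} (h : (K.values N gen).IsAlgebra)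
    {X Y : O} {f g : Term I T G s X Y} (hfg : PlusRel K f g) :
    N.interpret gen f = N.interpret gen g := by
  have h := PlusOps.isAlgebra_pullData h
  cases hfg with
  | iso_id f => exact h.iso_id f
  | iso_comp e e' => exact h.iso_comp e e'
  | equivariance a b c φ₁ φ₁' φ₀ φ₀' h₁ h₀ => exact h.equivariance a b c φ₁ φ₁' φ₀ φ₀' h₁ h₀
  | assoc φ₂ φ₁ φ₀ => exact h.assoc φ₂ φ₁ φ₀

theorem PlusOps.interpret_pointingRel {K : PlusOps C I T G} (h : (K.values N gen).IsAlgebra)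
    {X Y : O} {f g : Term I T G s X Y} (hfg : PointingRel K f g) :
    N.interpret gen f = N.interpret gen g := by
  have h := PlusOps.isAlgebra_pullData h
  cases hfg with
  | equivariance τ τ' a b hh => exact h.unit_equivariance τ τ' a b hh
  | right φ σ => exact h.unit_right φ σ
  | left σ φ => exact h.unit_left σ φ

variable (N gen) in
/-- The values of the generators, as morphisms of indices. -/
def NcOps.pullData (K : NcOps M I T G) : NcData M N.Pull where
  toPlusData := K.toPlusOps.pullData N gen
  mu f g := N.homMk (gen (K.mu f g))

variable (N gen) in
/-- The values of the generators. -/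
def NcOps.values (K : NcOps M I T G) : NcData M E where
  toPlusData := K.toPlusOps.values N gen
  mu f g := (N.tensor _ _).hom ≫ gen (K.mu f g)

/-- The formal middle exchange is written with tensor products by identities, the one of a braided
category with whiskerings. -/
lemma tensorμ_eq {Q : Type*} [Category Q] [MonoidalCategory Q] [BraidedCategory Q]
    (X X' Y Y' : Q) : tensorμ X X' Y Y' = (α_ X X' (Y ⊗ Y')).hom ≫ (𝟙 X ⊗ₘ (α_ X' Y Y').inv) ≫
      (𝟙 X ⊗ₘ ((β_ X' Y).hom ⊗ₘ 𝟙 Y')) ≫ (𝟙 X ⊗ₘ (α_ Y X' Y').hom) ≫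
        (α_ X Y (X' ⊗ Y')).inv := by
  simp [tensorμ]

theorem interpret_middleSwap (X X' Y Y' : O) : N.interpret gen (Term.middleSwap X X' Y Y') =
    tensorμ (C := N.Pull) X X' Y Y' :=
  (tensorμ_eq (Q := N.Pull) X X' Y Y').symm

theorem NcOps.interpret_ncRel {K : NcOps M I T G} (h : (K.values N gen).IsMultiplicative)
    {X Y : O} {f g : Term I T G true X Y} (hfg : NcRel K f g) :
    N.interpret gen f = N.interpret gen g := by
  have h : (K.pullData N gen).IsMultiplicative := NcData.IsMultiplicative.of_map N.eval h
  cases hfg with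
  | equivariance e e' => exact h.equivariance e e'
  | assoc e f g => exact h.assoc e f g
  | interchange φ₁ φ₀ ψ₁ ψ₀ =>
    refine (h.interchange φ₁ φ₀ ψ₁ ψ₀).trans ?_
    exact congrArg (fun t => CategoryStruct.comp (obj := N.Pull) t _)
      (interpret_middleSwap (N := N) (gen := gen) _ _ _ _).symm
  | unit_tensor σ σ' => exact h.unit_tensor σ σ'
  | unit_left f => exact h.unit_left f
  | unit_right f => exact h.unit_right f

theorem NcOps.interpret_commRel [SymmetricCategory M] {K : NcOps M I T G}
    (h : (K.values N gen).IsCommutative)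
    {X Y : O} {f g : Term I T G true X Y} (hfg : CommRel K f g) :
    N.interpret gen f = N.interpret gen g := by
  have h : (K.pullData N gen).IsCommutative := NcData.IsCommutative.of_map N.eval h
  cases hfg with
  | comm f g => exact h f g

/-- The letters and the `(σ ⇓ σ')` agree by definition; for `γ` and `i_σ` the structure morphisms of
the composite functor have to be simplified. The result is an equality, so that algebras are
attained exactly and not only up to isomorphism. -/
theorem PlusOps.data_map_lift {R : TermRel I T G s} (K : PlusOps C I T G)
    (hR : ∀ ⦃X Y : O⦄ (f g : Term I T G s X Y), R f g →
      N.interpret gen f = N.interpret gen g) :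
    (K.data R).map (N.lift gen hR ⋙ N.eval) = K.values N gen := by
  have h₁ : (fun {X Y Z : C} (φ₁ : Y ⟶ Z) (φ₀ : X ⟶ Y) =>
      ((K.data R).map (N.lift gen hR ⋙ N.eval)).comp φ₁ φ₀) =
      fun {X Y Z : C} φ₁ φ₀ => (K.values N gen).comp φ₁ φ₀ := by
    funext X Y Z φ₁ φ₀
    exact congrArg (· ≫ gen (K.comp φ₁ φ₀)) (N.comp_eval_μ hR _ _)
  have h₂ : (fun {X Y : C} (σ : X ≅ Y) => ((K.data R).map (N.lift gen hR ⋙ N.eval)).unit σ) =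
      fun {X Y : C} σ => (K.values N gen).unit σ := by
    funext X Y σ
    exact congrArg (· ≫ gen (K.unit σ)) (N.comp_eval_ε hR)
  exact congrArg₂ (fun a b => PlusData.mk (E := E) (fun f => N.obj (K.letter f))
    (fun e => gen (K.iso e)) a b) h₁ h₂

end Values

/-! ### The evaluation functors -/

section Evaluation

open Functor.LaxMonoidal

variable {P : Type w} [Category.{w} P] [MonoidalCategory P] {E : Type uE} [Category.{vE} E]
  [MonoidalCategory E] {C : Type u} [Category.{v} C]

instance (F : StrongFunctor P E) : IsIso (ε F.obj.toFunctor) := F.property.1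

instance (F : StrongFunctor P E) (X Y : P) : IsIso (μ F.obj.toFunctor X Y) := F.property.2 X Y

/-- A natural transformation of functors maps the values of generators. -/
def PlusData.mapHom (d : PlusData C P) {F F' : P ⥤ E} [F.LaxMonoidal] [F'.LaxMonoidal]
    (τ : F ⟶ F') [τ.IsMonoidal] : PlusData.Hom (d.map F) (d.map F') where
  app f := τ.app (d.obj f)
  iso_app e := τ.naturality _
  comp_app φ₁ φ₀ := by
    refine (Category.assoc _ _ _).trans ((congrArg (_ ≫ ·) (τ.naturality _)).trans ?_)
    refine (Category.assoc _ _ _).symm.trans ((congrArg (· ≫ _)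
      (NatTrans.IsMonoidal.tensor (τ := τ) _ _)).trans (Category.assoc _ _ _))
  unit_app σ := by
    refine (Category.assoc _ _ _).trans ((congrArg (_ ≫ ·) (τ.naturality _)).trans ?_)
    exact (Category.assoc _ _ _).symm.trans (congrArg (· ≫ _) (NatTrans.IsMonoidal.unit (τ := τ)))

variable (E) in
/-- The algebra that a strong monoidal functor defines. -/
def evalPlus (A : PlusAlg C P) : StrongFunctor P E ⥤ PlusAlg C E where
  obj F := ⟨A.toPlusData.map F.obj.toFunctor, A.isAlgebra.map F.obj.toFunctor⟩
  map τ := A.toPlusData.mapHom τ.hom.hom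

variable [BraidedCategory P] [BraidedCategory E]

variable (P E) in
/-- The underlying monoidal functor of a symmetric monoidal functor. -/
def forgetSymmetric : StrongSymmetricFunctor P E ⥤ StrongFunctor P E :=
  (isStrongFunctor P E).lift ((isStrongSymmetricFunctor P E).ι ⋙ LaxBraidedFunctor.forget)
    fun F => F.property

instance : (forgetSymmetric P E).Faithful where
  map_injective {_ _} τ τ' h := by
    have h' := congrArg (fun t => t.hom.hom) h
    apply InducedCategory.hom_ext
    exact LaxBraidedFunctor.hom_ext h'

/-- Compatibility with the braiding is a property of functors and imposes nothing on monoidal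
transformations. -/
instance : (forgetSymmetric P E).Full where
  map_surjective τ := ⟨⟨⟨τ.hom⟩⟩, rfl⟩

variable {M : Type u} [Category.{v} M] [MonoidalCategory M]

variable (E) in
/-- The algebra that a strong symmetric monoidal functor defines. -/
def evalNc (A : NcAlg M P) : StrongSymmetricFunctor P E ⥤ NcAlg M E where
  obj F := ⟨A.toNcData.map F.obj.toFunctor, A.isAlgebra.map F.obj.toFunctor,
    A.isMultiplicative.map F.obj.toFunctor⟩
  map {F F'} τ :=
    let σ : F.obj.toFunctor ⟶ F'.obj.toFunctor := τ.hom.hom.hom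
    haveI : σ.IsMonoidal := τ.hom.hom.isMonoidal
    { toHom := A.toPlusData.mapHom σ
      mu_app := fun f g => by
        refine (Category.assoc _ _ _).trans
          ((congrArg (_ ≫ ·) (σ.naturality _)).trans ?_)
        refine (Category.assoc _ _ _).symm.trans ((congrArg (· ≫ _)
          (NatTrans.IsMonoidal.tensor (τ := σ) _ _)).trans (Category.assoc _ _ _)) }

end Evaluation

/-! ### Construction of monoidal transformations on presented categories -/

section Presented

open Functor.LaxMonoidal

variable {O : Type w} {I : O} {T : O → O → O} {G : O → O → Type w} {s : Bool}
  {R : TermRel I T G s} {E : Type uE} [Category.{vE} E] [MonoidalCategory E]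

theorem Presented.exists_hom {F F' : StrongFunctor (Presented R) E}
    (τ : ∀ X : Presented R, F.obj.obj X ⟶ F'.obj.obj X)
    (hε : ε F.obj.toFunctor ≫ τ (𝟙_ _) = ε F'.obj.toFunctor)
    (hμ : ∀ X Y : Presented R, μ F.obj.toFunctor X Y ≫ τ (X ⊗ Y) =
      (τ X ⊗ₘ τ Y) ≫ μ F'.obj.toFunctor X Y)
    (hgen : ∀ (X Y : O) (g : G X Y), F.obj.map (Presented.mk R (.gen g)) ≫ τ Y =
      τ X ≫ F'.obj.map (Presented.mk R (.gen g)))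
    (hbraid : ∀ (h : s = true) (X Y : O), F.obj.map (Presented.mk R (.braid h X Y)) ≫ τ (T Y X) =
      τ (T X Y) ≫ F'.obj.map (Presented.mk R (.braid h X Y))) :
    ∃ α : F ⟶ F', ∀ X, α.hom.hom.app X = τ X := by
  let α : F.obj.toFunctor ⟶ F'.obj.toFunctor :=
    { app := τ
      naturality := fun _ _ f => Presented.naturality τ hε hμ hgen hbraid f }
  have : α.IsMonoidal := ⟨hε, hμ⟩
  exact ⟨⟨⟨α, this⟩⟩, fun _ => rfl⟩

/-- Naturality for the braidings need not be assumed: both functors are braided and `μ F` can be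
cancelled, so it follows from naturality of the braiding of `E`. -/
theorem Presented.exists_symmetric_hom {R : TermRel I T G true} [BraidedCategory E]
    {F F' : StrongSymmetricFunctor (Presented R) E}
    (τ : ∀ X : Presented R, F.obj.obj X ⟶ F'.obj.obj X)
    (hε : ε F.obj.toFunctor ≫ τ (𝟙_ _) = ε F'.obj.toFunctor)
    (hμ : ∀ X Y : Presented R, μ F.obj.toFunctor X Y ≫ τ (X ⊗ Y) =
      (τ X ⊗ₘ τ Y) ≫ μ F'.obj.toFunctor X Y)
    (hgen : ∀ (X Y : O) (g : G X Y), F.obj.map (Presented.mk R (.gen g)) ≫ τ Y =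
      τ X ≫ F'.obj.map (Presented.mk R (.gen g))) :
    ∃ α : F ⟶ F', ∀ X, α.hom.hom.hom.app X = τ X := by
  obtain ⟨α, hα⟩ := Presented.exists_hom (F := (forgetSymmetric _ _).obj F)
    (F' := (forgetSymmetric _ _).obj F') τ hε hμ hgen (fun _ X Y => by
      have : IsIso (μ F.obj.toFunctor X Y) := F.property.2 X Y
      have : Epi (μ F.obj.toFunctor X Y) := IsIso.epi_of_iso _
      have h₁ := Functor.LaxBraided.braided (F := F.obj.toFunctor) X Y
      have h₂ := Functor.LaxBraided.braided (F := F'.obj.toFunctor) X Y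
      refine (cancel_epi (μ F.obj.toFunctor X Y)).1 ?_
      refine (Category.assoc _ _ _).symm.trans ((congrArg (· ≫ τ _) h₁).trans ?_)
      refine (Category.assoc _ _ _).trans ((congrArg (_ ≫ ·) (hμ Y X)).trans ?_)
      refine Eq.trans ?_ ((congrArg (· ≫ F'.obj.map _) (hμ X Y)).symm.trans (Category.assoc _ _ _))
      refine Eq.trans ?_ ((congrArg (_ ≫ ·) h₂).symm.trans (Category.assoc _ _ _).symm)
      exact (BraidedCategory.braiding_naturality_assoc _ _ _).symm)
  obtain ⟨β, rfl⟩ := (forgetSymmetric _ _).map_surjective α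
  exact ⟨β, hα⟩

end Presented

/-! ### Presentations by words -/

section Words

open Functor.LaxMonoidal

variable {A : Type w} {G : Word A → Word A → Type w} {s : Bool}
  {R : TermRel Word.empty Word.box G s} {E : Type uE} [Category.{vE} E] [MonoidalCategory E]

/-- The inverse of a tensor constraint. -/
noncomputable def μInv (F : Presented R ⥤ E) [F.LaxMonoidal] [∀ X Y, IsIso (μ F X Y)]
    (X Y : Presented R) : F.obj (X ⊗ Y) ⟶ F.obj X ⊗ F.obj Y := inv (μ F X Y)

/-- The extension of a family of morphisms from letters to words. -/
noncomputable def wordHom (F F' : Presented R ⥤ E) [F.LaxMonoidal] [F'.LaxMonoidal]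
    [IsIso (ε F)] [∀ X Y, IsIso (μ F X Y)] (t : ∀ a, F.obj (Word.letter a) ⟶ F'.obj (Word.letter a)) :
    ∀ X : Presented R, F.obj X ⟶ F'.obj X
  | .empty => inv (ε F) ≫ ε F'
  | .letter a => t a
  | .box X Y => μInv F X Y ≫ (wordHom F F' t X ⊗ₘ wordHom F F' t Y) ≫ μ F' X Y

section

variable {F F' : Presented R ⥤ E} [F.LaxMonoidal] [F'.LaxMonoidal]
    [IsIso (ε F)] [hF : ∀ X Y, IsIso (μ F X Y)] {t : ∀ a, F.obj (Word.letter a) ⟶ F'.obj (Word.letter a)}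

lemma ε_wordHom : ε F ≫ wordHom F F' t (𝟙_ _) = ε F' :=
  IsIso.hom_inv_id_assoc (ε F) (ε F')

lemma μ_wordHom (X Y : Presented R) :
    μ F X Y ≫ wordHom F F' t (X ⊗ Y) = (wordHom F F' t X ⊗ₘ wordHom F F' t Y) ≫ μ F' X Y :=
  IsIso.hom_inv_id_assoc (μ F X Y) _

/-- A generator on a two-letter word enters an algebra after precomposition with `μ F`. As this is
invertible, compatibility in the algebra is the same as naturality for the generator. -/
lemma wordHom_naturality_box {a b d : A}
    (c : @Quiver.Hom (Presented R) _ (Word.box (.letter a) (.letter b)) (Word.letter d))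
    (h : (μ F (Word.letter a : Presented R) (Word.letter b : Presented R) ≫ F.map c) ≫ t d =
      (t a ⊗ₘ t b) ≫ μ F' (Word.letter a : Presented R) (Word.letter b : Presented R) ≫ F'.map c) :
    F.map c ≫ wordHom F F' t (Word.letter d) =
      wordHom F F' t (Word.box (.letter a) (.letter b)) ≫ F'.map c := by
  have i : IsIso (μ F (Word.letter a : Presented R) (Word.letter b : Presented R)) := hF _ _
  refine (@cancel_epi _ _ _ _ _ (μ F (Word.letter a : Presented R) (Word.letter b : Presented R))
    (@IsIso.epi_of_iso _ _ _ _ _ i) _ _).1 ?_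
  refine ((Category.assoc _ _ _).symm.trans h).trans ?_
  refine (Category.assoc _ _ _).symm.trans (Eq.trans ?_ (Category.assoc _ _ _))
  exact congrArg (· ≫ F'.map c) (μ_wordHom (t := t) (Word.letter a : Presented R)
    (Word.letter b : Presented R)).symm

lemma wordHom_naturality_empty {d : A}
    (c : @Quiver.Hom (Presented R) _ Word.empty (Word.letter d))
    (h : (ε F ≫ F.map c) ≫ t d = ε F' ≫ F'.map c) :
    F.map c ≫ wordHom F F' t (Word.letter d) = wordHom F F' t Word.empty ≫ F'.map c := by
  refine (IsIso.inv_hom_id_assoc (ε F) _).symm.trans ?_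
  exact (congrArg (inv (ε F) ≫ ·) ((Category.assoc _ _ _).symm.trans h)).trans
    (Category.assoc _ _ _).symm

end

/-- Induction on words: the invertible `ε F` and `μ F` determine a monoidal transformation at the
empty word and at products by its components at the letters. -/
theorem Presented.hom_ext_words {F F' : StrongFunctor (Presented R) E} {α β : F ⟶ F'}
    (h : ∀ a, α.hom.hom.app (Word.letter a) = β.hom.hom.app (Word.letter a)) : α = β := by
  apply InducedCategory.hom_ext
  apply LaxMonoidalFunctor.hom_ext
  apply NatTrans.ext
  funext X
  have hα : ∀ X Y : Presented R, μ F.obj.toFunctor X Y ≫ α.hom.hom.app (X ⊗ Y) = _ :=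
    NatTrans.IsMonoidal.tensor (τ := α.hom.hom)
  have hβ : ∀ X Y : Presented R, μ F.obj.toFunctor X Y ≫ β.hom.hom.app (X ⊗ Y) = _ :=
    NatTrans.IsMonoidal.tensor (τ := β.hom.hom)
  have hα' : ε F.obj.toFunctor ≫ α.hom.hom.app (𝟙_ _) = _ :=
    NatTrans.IsMonoidal.unit (τ := α.hom.hom)
  have hβ' : ε F.obj.toFunctor ≫ β.hom.hom.app (𝟙_ _) = _ :=
    NatTrans.IsMonoidal.unit (τ := β.hom.hom)
  induction X with
  | empty => exact (cancel_epi (ε F.obj.toFunctor)).1 (hα'.trans hβ'.symm)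
  | letter a => exact h a
  | box X Y hX hY =>
    have i : IsIso (μ F.obj.toFunctor X Y) := F.property.2 X Y
    refine (@cancel_epi _ _ _ _ _ (μ F.obj.toFunctor X Y)
      (@IsIso.epi_of_iso _ _ _ _ _ i) _ _).1 ((hα X Y).trans (Eq.trans ?_ (hβ X Y).symm))
    exact congrArg₂ (fun p q => (p ⊗ₘ q) ≫ μ F'.obj.toFunctor X Y) hX hY

/-- The values of words for given values of the letters. -/
def wordObj (D : A → E) : Word A → E
  | .empty => 𝟙_ E
  | .letter a => D a
  | .box X Y => wordObj D X ⊗ wordObj D Y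

/-- The family of the values of words. -/
def wordFamily (D : A → E) : TensorFamily (Word.empty (A := A)) Word.box E where
  obj := wordObj D
  unit := Iso.refl _
  tensor X Y := Iso.refl (wordObj D X ⊗ wordObj D Y)

end Words

/-! ### Extension of algebras from letters to words -/

section WordsPlus

open Functor.LaxMonoidal

variable {C : Type u} [Category.{v} C] {G : Word (Arrow C) → Word (Arrow C) → Type (max u v)}
  {s : Bool} {R : TermRel Word.empty Word.box G s} {E : Type uE} [Category.{vE} E]
  [MonoidalCategory E]

/-- The generators of the plus construction among other generators. -/
def wordOps (emb : ∀ {x y : Word (Arrow C)}, PlusGen C x y → G x y) :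
    PlusOps C (Word.empty (A := Arrow C)) Word.box G where
  letter := .letter
  iso e := emb (.iso e)
  comp φ₁ φ₀ := emb (.comp φ₁ φ₀)
  unit σ := emb (.unit σ)

/-- The embedding `emb` of the generators makes the statement applicable to `⊠+`, `nc+` and `loc+`
alike. -/
lemma wordHom_naturality_plus {emb : ∀ {x y : Word (Arrow C)}, PlusGen C x y → G x y}
    {F F' : Presented R ⥤ E} [F.LaxMonoidal] [F'.LaxMonoidal]
    [IsIso (ε F)] [∀ X Y, IsIso (μ F X Y)]
    (p : PlusData.Hom (((wordOps emb).data R).map F) (((wordOps emb).data R).map F'))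
    {x y : Word (Arrow C)} (g : PlusGen C x y) :
    F.map (Presented.mk R (.gen (emb g))) ≫ wordHom F F' p.app y =
      wordHom F F' p.app x ≫ F'.map (Presented.mk R (.gen (emb g))) := by
  cases g with
  | iso e => exact p.iso_app e
  | comp φ₁ φ₀ => exact wordHom_naturality_box _ (p.comp_app φ₁ φ₀)
  | unit σ => exact wordHom_naturality_empty _ (p.unit_app σ)

/-- The values of the generators that are given by an algebra. -/
def wordGen (D : PlusData C E) : ∀ {x y : Word (Arrow C)}, PlusGen C x y →
    ((wordFamily D.obj).obj x ⟶ (wordFamily D.obj).obj y)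
  | _, _, .iso e => D.iso e
  | _, _, .comp φ₁ φ₀ => D.comp φ₁ φ₀
  | _, _, .unit σ => D.unit σ

/-- The tensor constraints of `wordFamily` are identities, so extending an algebra to words and
reading off its values at the letters changes nothing. -/
lemma wordOps_values (D : PlusData C E) {emb : ∀ {x y : Word (Arrow C)}, PlusGen C x y → G x y}
    {gen : ∀ {x y : Word (Arrow C)}, G x y →
      ((wordFamily D.obj).obj x ⟶ (wordFamily D.obj).obj y)}
    (h : ∀ {x y : Word (Arrow C)} (g : PlusGen C x y), gen (emb g) = wordGen D g) :
    (wordOps emb).values (wordFamily D.obj) gen = D := by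
  have h₁ : (fun {f g : Arrow C} (e : f ≅ g) =>
      ((wordOps emb).values (wordFamily D.obj) gen).iso e) = @D.iso := by
    funext f g e
    exact h (.iso e)
  have h₂ : (fun {X Y Z : C} (φ₁ : Y ⟶ Z) (φ₀ : X ⟶ Y) =>
      ((wordOps emb).values (wordFamily D.obj) gen).comp φ₁ φ₀) = @D.comp := by
    funext X Y Z φ₁ φ₀
    exact (Category.id_comp _).trans (h (.comp φ₁ φ₀))
  have h₃ : (fun {X Y : C} (σ : X ≅ Y) =>
      ((wordOps emb).values (wordFamily D.obj) gen).unit σ) = @D.unit := by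
    funext X Y σ
    exact (Category.id_comp _).trans (h (.unit σ))
  cases D
  exact congr (congrArg₂ (PlusData.mk (E := E) _) h₁ h₂) h₃

end WordsPlus


/-! ## The evaluation functors are fully faithful -/

section Lifts

variable {O : Type w} {I : O} {T : O → O → O} {G : O → O → Type w} {s : Bool}
  {E : Type uE} [Category.{vE} E] [MonoidalCategory E] [SymmetricCategory E]
  (N : TensorFamily I T E) (gen : ∀ {X Y : O}, G X Y → (N.obj X ⟶ N.obj Y))

/-- The strong monoidal functor that is given by values of the generators. -/
def TensorFamily.liftStrong {R : TermRel I T G s}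
    (hR : ∀ ⦃X Y : O⦄ (f g : Term I T G s X Y), R f g →
      N.interpret gen f = N.interpret gen g) : StrongFunctor (Presented R) E where
  obj := .of (N.lift gen hR ⋙ N.eval)
  property :=
    ⟨(N.comp_eval_ε hR).symm ▸ N.unit.isIso_hom,
      fun X Y => (N.comp_eval_μ hR X Y).symm ▸ (N.tensor X Y).isIso_hom⟩

/-- The strong symmetric monoidal functor that is given by values of the generators. -/
def TensorFamily.liftSymmetric {R : TermRel I T G true}
    (hR : ∀ ⦃X Y : O⦄ (f g : Term I T G true X Y), R f g →
      N.interpret gen f = N.interpret gen g) : StrongSymmetricFunctor (Presented R) E where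
  obj := .of (N.lift gen hR ⋙ N.eval)
  property :=
    ⟨(N.comp_eval_ε hR).symm ▸ N.unit.isIso_hom,
      fun X Y => (N.comp_eval_μ hR X Y).symm ▸ (N.tensor X Y).isIso_hom⟩

end Lifts

/-! ### The plus construction of a category -/

section Plus

variable (C : Type u) [Category.{v} C] (s : Bool)
  (E : Type uE) [Category.{vE} E] [MonoidalCategory E] [SymmetricCategory E]

/-- The tautological algebra in the plus construction. -/
def plusAlg : PlusAlg C (CPlusGcp C s) where
  toPlusData := (plusOps C).data (plusRel C s)
  isAlgebra := (plusOps C).isAlgebra_data (fun _ _ _ _ h => .inl h) (fun _ _ _ _ h => .inr h)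

lemma plusAlg_gen {F F' : StrongFunctor (CPlusGcp C s) E}
    (p : (evalPlus E (plusAlg C s)).obj F ⟶ (evalPlus E (plusAlg C s)).obj F')
    (X Y : Word (Arrow C)) (g : PlusGen C X Y) :
    F.obj.map (Presented.mk (plusRel C s) (.gen g)) ≫
      wordHom F.obj.toFunctor F'.obj.toFunctor (PlusData.Hom.app p) Y =
        wordHom F.obj.toFunctor F'.obj.toFunctor (PlusData.Hom.app p) X ≫
          F'.obj.map (Presented.mk (plusRel C s) (.gen g)) :=
  wordHom_naturality_plus (R := plusRel C s) (emb := fun g => g) p g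

instance : (evalPlus E (plusAlg C s)).Faithful where
  map_injective h := Presented.hom_ext_words fun a => congrArg (fun t => PlusData.Hom.app t a) h

/-- A morphism of algebras extends to words and is natural for the generators. In the monoidal
version there are no formal symmetries, so the condition on braidings is vacuous. -/
instance : (evalPlus E (plusAlg C false)).Full where
  map_surjective {F F'} p := by
    obtain ⟨α, hα⟩ := Presented.exists_hom (F := F) (F' := F')
      (wordHom F.obj.toFunctor F'.obj.toFunctor (PlusData.Hom.app p)) ε_wordHom μ_wordHom
      (plusAlg_gen C false E p) (fun h => absurd h Bool.false_ne_true)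
    exact ⟨α, PlusAlg.hom_ext fun f => hα _⟩

/-- Here formal symmetries are present; naturality for them comes from the symmetry of the two
functors, hence the restriction to symmetric functors. -/
instance : (forgetSymmetric (CPlusGcp C true) E ⋙ evalPlus E (plusAlg C true)).Full where
  map_surjective {F F'} p := by
    have : ∀ X Y, IsIso (Functor.LaxMonoidal.μ F.obj.toFunctor X Y) := F.property.2
    have : IsIso (Functor.LaxMonoidal.ε F.obj.toFunctor) := F.property.1
    obtain ⟨α, hα⟩ := Presented.exists_symmetric_hom (F := F) (F' := F')
      (wordHom F.obj.toFunctor F'.obj.toFunctor (PlusData.Hom.app p)) ε_wordHom μ_wordHom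
      (plusAlg_gen C true E (F := (forgetSymmetric _ E).obj F)
        (F' := (forgetSymmetric _ E).obj F') p)
    exact ⟨α, PlusAlg.hom_ext fun f => hα _⟩

variable {C E}

lemma plusOps_values (D : PlusAlg C E) :
    (plusOps C).values (wordFamily D.obj) (wordGen D.toPlusData) = D.toPlusData :=
  wordOps_values D.toPlusData (emb := fun g => g) fun _ => rfl

lemma plusRel_sound (D : PlusAlg C E) ⦃X Y : Word (Arrow C)⦄
    (f g : Term .empty .box (PlusGen C) s X Y) (h : plusRel C s f g) :
    (wordFamily D.obj).interpret (wordGen D.toPlusData) f =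
      (wordFamily D.obj).interpret (wordGen D.toPlusData) g := by
  have hD : ((plusOps C).values (wordFamily D.obj) (wordGen D.toPlusData)).IsAlgebra :=
    (plusOps_values D).symm ▸ D.isAlgebra
  exact h.elim (PlusOps.interpret_plusRel hD) (PlusOps.interpret_pointingRel hD)

lemma PlusAlg.ext_data {A B : PlusAlg C E} (h : A.toPlusData = B.toPlusData) : A = B := by
  cases A; cases B; cases h; rfl

/-- The relations of an algebra are exactly what is needed to define a functor on words with the
given values. -/
lemma exists_evalPlus_eq (D : PlusAlg C E) :
    ∃ F : StrongFunctor (CPlusGcp C s) E, (evalPlus E (plusAlg C s)).obj F = D :=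
  ⟨(wordFamily D.obj).liftStrong (wordGen D.toPlusData) (plusRel_sound s D),
    PlusAlg.ext_data (((plusOps C).data_map_lift _).trans (plusOps_values D))⟩

lemma exists_evalPlus_symmetric_eq (D : PlusAlg C E) :
    ∃ F : StrongSymmetricFunctor (CPlusGcp C true) E,
      (forgetSymmetric _ E ⋙ evalPlus E (plusAlg C true)).obj F = D :=
  ⟨(wordFamily D.obj).liftSymmetric (wordGen D.toPlusData) (plusRel_sound true D),
    PlusAlg.ext_data (((plusOps C).data_map_lift _).trans (plusOps_values D))⟩

end Plus

section NcData

variable {M : Type u} [Category.{v} M] [MonoidalCategory M] {E : Type uE} [Category.{vE} E]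
  [MonoidalCategory E]

/-- The type of `mu` depends on the underlying data, hence the heterogeneous equality; it becomes an
ordinary one once these data are identified. -/
lemma NcData.ext_of_eq {A B : NcData M E} (h : A.toPlusData = B.toPlusData)
    (h' : ∀ f g, A.mu f g ≍ B.mu f g) : A = B := by
  obtain ⟨A, m⟩ := A
  obtain ⟨B, m'⟩ := B
  obtain rfl : A = B := h
  exact congrArg (NcData.mk A) (funext fun f => funext fun g => eq_of_heq (h' f g))

variable {O : Type w} {I : O} {T : O → O → O} {G : O → O → Type w} {s : Bool}
  [SymmetricCategory E] {N : TensorFamily I T E} {gen : ∀ {X Y : O}, G X Y → (N.obj X ⟶ N.obj Y)}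

theorem NcOps.data_map_lift {R : TermRel I T G s} (K : NcOps M I T G)
    (hR : ∀ ⦃X Y : O⦄ (f g : Term I T G s X Y), R f g →
      N.interpret gen f = N.interpret gen g) :
    (K.data R).map (N.lift gen hR ⋙ N.eval) = K.values N gen :=
  NcData.ext_of_eq (K.toPlusOps.data_map_lift hR) fun f g =>
    heq_of_eq (congrArg (· ≫ gen (K.mu f g)) (N.comp_eval_μ hR _ _))

end NcData

/-! ### The plus constructions with adjoined products -/

section NcWords

variable {M : Type u} [Category.{v} M] [MonoidalCategory M]
  {G : Word (Arrow M) → Word (Arrow M) → Type (max u v)}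
  {R : TermRel Word.empty Word.box G true}
  {E : Type uE} [Category.{vE} E] [MonoidalCategory E] [SymmetricCategory E]

/-- The generators of the nc plus construction among other generators. -/
def ncWordOps (emb : ∀ {x y : Word (Arrow M)}, NcGen M x y → G x y) :
    NcOps M (Word.empty (A := Arrow M)) Word.box G where
  toPlusOps := wordOps fun g => emb (.plus g)
  mu f g := emb (.mu f g)

lemma evalNc_faithful {A : NcAlg M (Presented R)} {emb : ∀ {x y : Word (Arrow M)}, NcGen M x y → G x y}
    (hA : A.toNcData = (ncWordOps emb).data R) : (evalNc E A).Faithful where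
  map_injective {F F'} τ τ' h := (forgetSymmetric _ E).map_injective <|
    Presented.hom_ext_words fun a => by
      have : A.obj a = Word.letter a := congrArg (fun d : NcData M (Presented R) => d.obj a) hA
      rw [← this]
      exact congrArg (fun t => PlusData.Hom.app (NcAlg.Hom.toHom t) a) h

/-- The hypothesis `hgen` passes from the generators of `nc+` to all generators. It is trivial for
`nc+` itself, and for `loc+` it accounts for the formal inverses. -/
lemma evalNc_full {A : NcAlg M (Presented R)} {emb : ∀ {x y : Word (Arrow M)}, NcGen M x y → G x y}
    (hA : A.toNcData = (ncWordOps emb).data R)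
    (hgen : ∀ {F F' : Presented R ⥤ E} (τ : ∀ X : Presented R, F.obj X ⟶ F'.obj X),
      (∀ (X Y : Word (Arrow M)) (g : NcGen M X Y), F.map (Presented.mk R (.gen (emb g))) ≫ τ Y =
        τ X ≫ F'.map (Presented.mk R (.gen (emb g)))) →
      ∀ (X Y : Word (Arrow M)) (g : G X Y), F.map (Presented.mk R (.gen g)) ≫ τ Y =
        τ X ≫ F'.map (Presented.mk R (.gen g))) : (evalNc E A).Full where
  map_surjective {F F'} p := by
    have i : ∀ X Y, IsIso (Functor.LaxMonoidal.μ F.obj.toFunctor X Y) := F.property.2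
    have i' : IsIso (Functor.LaxMonoidal.ε F.obj.toFunctor) := F.property.1
    -- Once the proofs are separated from the data, the data can be replaced by the tautological
    -- ones.
    obtain ⟨A, h₁, h₂⟩ := A
    obtain rfl : A = _ := hA
    obtain ⟨α, hα⟩ := Presented.exists_symmetric_hom (F := F) (F' := F')
      (wordHom F.obj.toFunctor F'.obj.toFunctor p.app) ε_wordHom μ_wordHom
      (hgen _ fun X Y g => by
        cases g with
        | plus g =>
          exact wordHom_naturality_plus (R := R) (emb := fun g => emb (.plus g)) p.toHom g
        | mu f g => exact wordHom_naturality_box _ (p.mu_app f g))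
    exact ⟨α, NcAlg.hom_ext fun f => hα _⟩

/-- The values of the generators that are given by an algebra. -/
def ncGen (D : NcData M E) : ∀ {x y : Word (Arrow M)}, NcGen M x y →
    ((wordFamily D.obj).obj x ⟶ (wordFamily D.obj).obj y)
  | _, _, .plus g => wordGen D.toPlusData g
  | _, _, .mu f g => D.mu f g

lemma ncWordOps_values (D : NcData M E)
    {emb : ∀ {x y : Word (Arrow M)}, NcGen M x y → G x y}
    {gen : ∀ {x y : Word (Arrow M)}, G x y →
      ((wordFamily D.obj).obj x ⟶ (wordFamily D.obj).obj y)}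
    (h : ∀ {x y : Word (Arrow M)} (g : NcGen M x y), gen (emb g) = ncGen D g) :
    (ncWordOps emb).values (wordFamily D.obj) gen = D :=
  NcData.ext_of_eq (wordOps_values D.toPlusData (emb := fun g => emb (.plus g)) (gen := gen)
    fun g => h (.plus g)) fun f g => heq_of_eq ((Category.id_comp _).trans (h (.mu f g)))

lemma ncOps_values (D : NcData M E) :
    (ncOps M).values (wordFamily D.obj) (ncGen D) = D :=
  ncWordOps_values D (emb := fun g => g) fun _ => rfl

/-- The values of the generators that are given by an algebra with invertible products. -/
noncomputable def locGen (D : NcData M E) (hD : D.IsStrong) :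
    ∀ {x y : Word (Arrow M)}, LocGen M x y →
      ((wordFamily D.obj).obj x ⟶ (wordFamily D.obj).obj y)
  | _, _, .nc g => ncGen D g
  | _, _, .muInv f g => @inv _ _ _ _ (D.mu f g) (hD f g)

lemma locOps_values (D : NcData M E) (hD : D.IsStrong) :
    (locOps M).values (wordFamily D.obj) (locGen D hD) = D :=
  ncWordOps_values D (emb := fun g => LocGen.nc g) (gen := locGen D hD) fun _ => rfl

lemma NcAlg.ext_data {A B : NcAlg M E} (h : A.toNcData = B.toNcData) : A = B := by
  cases A; cases B; cases h; rfl

section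

variable (M) (E)

/-- The tautological algebra. -/
def ncAlg : NcAlg M (NcPlusGcp M) where
  toNcData := (ncOps M).data (ncRel M)
  isAlgebra := (ncOps M).isAlgebra_data (fun _ _ _ _ h => .inl h) (fun _ _ _ _ h => .inr (.inl h))
  isMultiplicative := (ncOps M).isMultiplicative_data (fun _ _ _ _ h => .inr (.inr h))

/-- The tautological algebra. -/
def locAlg : NcAlg M (LocPlusGcp M) where
  toNcData := (locOps M).data (locRel M)
  isAlgebra := (locOps M).isAlgebra_data (fun _ _ _ _ h => .inl h) (fun _ _ _ _ h => .inr (.inl h))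
  isMultiplicative := (locOps M).isMultiplicative_data (fun _ _ _ _ h => .inr (.inr (.inl h)))

instance : (evalNc E (ncAlg M)).Faithful := evalNc_faithful (emb := fun g => g) rfl

instance : (evalNc E (locAlg M)).Faithful := evalNc_faithful (emb := .nc) rfl

instance : (evalNc E (ncAlg M)).Full := evalNc_full (emb := fun g => g) rfl fun _ h => h

/-- The product of two letters as an isomorphism. -/
def muIso {R : TermRel Word.empty Word.box (LocGen M) true}
    (hR : ∀ ⦃X Y : Word (Arrow M)⦄ (f g : Term .empty .box (LocGen M) true X Y),
      LocRel M f g → R f g) (f g : Arrow M) :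
    @Iso (Presented R) _ (Word.box (.letter f) (.letter g)) (Word.letter (arrowTensor f g)) :=
  ⟨Presented.mk R (.gen (.nc (.mu f g))), Presented.mk R (.gen (.muInv f g)),
    Quotient.sound (.of (hR _ _ (.mu_muInv f g))), Quotient.sound (.of (hR _ _ (.muInv_mu f g)))⟩

variable {M} in
-- The formal inverses are inverse to `μ` in the presented category, so naturality for `μ` suffices.
lemma locGen_naturality {R : TermRel Word.empty Word.box (LocGen M) true}
    (hR : ∀ ⦃X Y : Word (Arrow M)⦄ (f g : Term .empty .box (LocGen M) true X Y),
      LocRel M f g → R f g)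
    {F F' : Presented R ⥤ E} (τ : ∀ X : Presented R, F.obj X ⟶ F'.obj X)
    (h : ∀ (X Y : Word (Arrow M)) (g : NcGen M X Y),
      F.map (Presented.mk R (.gen (.nc g))) ≫ τ Y =
        τ X ≫ F'.map (Presented.mk R (.gen (.nc g))))
    (X Y : Word (Arrow M)) (g : LocGen M X Y) : F.map (Presented.mk R (.gen g)) ≫ τ Y =
        τ X ≫ F'.map (Presented.mk R (.gen g)) := by
  cases g with
  | nc g => exact h _ _ g
  | muInv f g => exact naturality_inv (muIso M hR f g) (h _ _ (.mu f g))

instance : (evalNc E (locAlg M)).Full :=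
  evalNc_full (emb := .nc) rfl (locGen_naturality E fun _ _ _ _ h => .inr (.inr (.inr h)))

end

lemma ncRel_sound (D : NcAlg M E) ⦃X Y : Word (Arrow M)⦄
    (f g : Term .empty .box (NcGen M) true X Y) (h : ncRel M f g) :
    (wordFamily D.obj).interpret (ncGen D.toNcData) f =
      (wordFamily D.obj).interpret (ncGen D.toNcData) g := by
  have hD := ncOps_values D.toNcData
  have h₁ : ((ncOps M).toPlusOps.values (wordFamily D.obj) (ncGen D.toNcData)).IsAlgebra :=
    (congrArg (fun d : NcData M E => d.toPlusData.IsAlgebra) hD).mpr D.isAlgebra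
  have h₂ : ((ncOps M).values (wordFamily D.obj) (ncGen D.toNcData)).IsMultiplicative :=
    hD.symm ▸ D.isMultiplicative
  obtain h | h | h := h
  exacts [PlusOps.interpret_plusRel h₁ h, PlusOps.interpret_pointingRel h₁ h,
    NcOps.interpret_ncRel h₂ h]

/-- Only the two relations of `LocRel` are new; they hold because `muInv` is interpreted as the
inverse of the product of `D`. -/
lemma locRel_sound (D : NcAlg M E) (hD' : D.IsStrong) ⦃X Y : Word (Arrow M)⦄
    (f g : Term .empty .box (LocGen M) true X Y) (h : locRel M f g) :
    (wordFamily D.obj).interpret (locGen D.toNcData hD') f =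
      (wordFamily D.obj).interpret (locGen D.toNcData hD') g := by
  have hD := locOps_values D.toNcData hD'
  have h₁ : ((locOps M).toPlusOps.values (wordFamily D.obj) (locGen D.toNcData hD')).IsAlgebra :=
    (congrArg (fun d : NcData M E => d.toPlusData.IsAlgebra) hD).mpr D.isAlgebra
  have h₂ : ((locOps M).values (wordFamily D.obj) (locGen D.toNcData hD')).IsMultiplicative :=
    hD.symm ▸ D.isMultiplicative
  obtain h | h | h | h := h
  · exact PlusOps.interpret_plusRel h₁ h
  · exact PlusOps.interpret_pointingRel h₁ h
  · exact NcOps.interpret_ncRel h₂ h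
  · cases h with
    | mu_muInv f g => exact @IsIso.hom_inv_id _ _ _ _ (D.mu f g) (hD' f g)
    | muInv_mu f g => exact @IsIso.inv_hom_id _ _ _ _ (D.mu f g) (hD' f g)

lemma exists_evalNc_ncAlg (D : NcAlg M E) :
    ∃ F : StrongSymmetricFunctor (NcPlusGcp M) E, (evalNc E (ncAlg M)).obj F = D :=
  ⟨(wordFamily D.obj).liftSymmetric (ncGen D.toNcData) (ncRel_sound D),
    NcAlg.ext_data (((ncOps M).data_map_lift _).trans (ncOps_values D.toNcData))⟩

lemma exists_evalNc_locAlg (D : NcAlg M E) (hD : D.IsStrong) :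
    ∃ F : StrongSymmetricFunctor (LocPlusGcp M) E, (evalNc E (locAlg M)).obj F = D :=
  ⟨(wordFamily D.obj).liftSymmetric (locGen D.toNcData hD) (locRel_sound D hD),
    NcAlg.ext_data (((locOps M).data_map_lift _).trans (locOps_values D.toNcData hD))⟩

/-- The product in the algebra of `F` is the tensor constraint of `F` followed by the image of an
isomorphism, and both are invertible. -/
lemma isStrong_map_data {R : TermRel Word.empty Word.box (LocGen M) true}
    (hR : ∀ ⦃X Y : Word (Arrow M)⦄ (f g : Term .empty .box (LocGen M) true X Y),
      LocRel M f g → R f g) (F : StrongSymmetricFunctor (Presented R) E) :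
    (((locOps M).data R).map F.obj.toFunctor).IsStrong := fun f g => by
  have h₁ : IsIso (Functor.LaxMonoidal.μ F.obj.toFunctor (Word.letter f : Presented R)
    (Word.letter g : Presented R)) := F.property.2 _ _
  have h₂ : IsIso (F.obj.map (muIso M hR f g).hom) :=
    (F.obj.mapIso (muIso M hR f g)).isIso_hom
  exact @IsIso.comp_isIso _ _ _ _ _ _ _ h₁ h₂

/-! ### The versions for a symmetric monoidal category -/

section Symmetric

variable [SymmetricCategory M]

section

variable (M) (E)

/-- The tautological algebra. -/
def symNcAlg : NcAlg M (SymNcPlusGcp M) where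
  toNcData := (ncOps M).data (symNcRel M)
  isAlgebra := (ncOps M).isAlgebra_data (fun _ _ _ _ h => .inl (.inl h))
    (fun _ _ _ _ h => .inl (.inr (.inl h)))
  isMultiplicative := (ncOps M).isMultiplicative_data (fun _ _ _ _ h => .inl (.inr (.inr h)))

/-- The tautological algebra. -/
def symLocAlg : NcAlg M (SymLocPlusGcp M) where
  toNcData := (locOps M).data (symLocRel M)
  isAlgebra := (locOps M).isAlgebra_data (fun _ _ _ _ h => .inl (.inl h))
    (fun _ _ _ _ h => .inl (.inr (.inl h)))
  isMultiplicative := (locOps M).isMultiplicative_data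
    (fun _ _ _ _ h => .inl (.inr (.inr (.inl h))))

instance : (evalNc E (symNcAlg M)).Faithful := evalNc_faithful (emb := fun g => g) rfl

instance : (evalNc E (symLocAlg M)).Faithful := evalNc_faithful (emb := .nc) rfl

instance : (evalNc E (symNcAlg M)).Full := evalNc_full (emb := fun g => g) rfl fun _ h => h

instance : (evalNc E (symLocAlg M)).Full :=
  evalNc_full (emb := .nc) rfl (locGen_naturality E fun _ _ _ _ h => .inl (.inr (.inr (.inr h))))

end

lemma exists_evalNc_symNcAlg (D : NcAlg M E) (h : D.IsCommutative) :
    ∃ F : StrongSymmetricFunctor (SymNcPlusGcp M) E, (evalNc E (symNcAlg M)).obj F = D :=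
  ⟨(wordFamily D.obj).liftSymmetric (ncGen D.toNcData) fun _ _ _ _ hfg => hfg.elim
      (ncRel_sound D _ _) (NcOps.interpret_commRel ((ncOps_values D.toNcData).symm ▸ h)),
    NcAlg.ext_data (((ncOps M).data_map_lift _).trans (ncOps_values D.toNcData))⟩

lemma exists_evalNc_symLocAlg (D : NcAlg M E) (hD : D.IsStrong) (h : D.IsCommutative) :
    ∃ F : StrongSymmetricFunctor (SymLocPlusGcp M) E, (evalNc E (symLocAlg M)).obj F = D :=
  ⟨(wordFamily D.obj).liftSymmetric (locGen D.toNcData hD) fun _ _ _ _ hfg => hfg.elim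
      (locRel_sound D hD _ _) (NcOps.interpret_commRel ((locOps_values D.toNcData hD).symm ▸ h)),
    NcAlg.ext_data (((locOps M).data_map_lift _).trans (locOps_values D.toNcData hD))⟩

lemma isCommutative_evalNc_symNcAlg (F : StrongSymmetricFunctor (SymNcPlusGcp M) E) :
    ((evalNc E (symNcAlg M)).obj F).IsCommutative :=
  ((ncOps M).isCommutative_data (R := symNcRel M) fun _ _ _ _ h => .inr h).map F.obj.toFunctor

lemma isCommutative_evalNc_symLocAlg (F : StrongSymmetricFunctor (SymLocPlusGcp M) E) :
    ((evalNc E (symLocAlg M)).obj F).IsCommutative :=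
  ((locOps M).isCommutative_data (R := symLocRel M) fun _ _ _ _ h => .inr h).map F.obj.toFunctor

end Symmetric

lemma isStrong_evalNc_locAlg (F : StrongSymmetricFunctor (LocPlusGcp M) E) :
    ((evalNc E (locAlg M)).obj F).IsStrong :=
  isStrong_map_data (fun _ _ _ _ h => .inr (.inr (.inr h))) F

lemma isStrong_evalNc_symLocAlg [SymmetricCategory M]
    (F : StrongSymmetricFunctor (SymLocPlusGcp M) E) :
    ((evalNc E (symLocAlg M)).obj F).IsStrong :=
  isStrong_map_data (fun _ _ _ _ h => .inl (.inr (.inr (.inr h)))) F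

end NcWords


/-! ## Strong monoidal functors on the plus construction of a symmetric monoidal category -/

section Unit

variable {P : Type*} [Category P] [MonoidalCategory P]

/-- On the unit object `i ⊗ i` is `i ≫ i` up to unit constraints, so `h` says that `i` is
idempotent. By `h'` it is the first factor of an isomorphism, hence a monomorphism, and a monic
idempotent is the identity. -/
lemma eq_id_of_tensor_self {i : 𝟙_ P ⟶ 𝟙_ P} (h : (λ_ (𝟙_ P)).inv ≫ (i ⊗ₘ i) ≫ (λ_ (𝟙_ P)).hom = i)
    {Z : P} (r : 𝟙_ P ⊗ 𝟙_ P ⟶ Z) (h' : IsIso ((λ_ (𝟙_ P)).inv ≫ (i ⊗ₘ 𝟙 (𝟙_ P)) ≫ r)) :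
    i = 𝟙 _ := by
  have h₁ : (λ_ (𝟙_ P)).inv ≫ (i ⊗ₘ 𝟙 (𝟙_ P)) ≫ r = i ≫ (ρ_ (𝟙_ P)).inv ≫ r := by
    rw [unitors_inv_equal, tensorHom_id, rightUnitor_inv_naturality_assoc]
  have h₂ : (λ_ (𝟙_ P)).inv ≫ (i ⊗ₘ i) ≫ (λ_ (𝟙_ P)).hom = i ≫ i := by
    rw [MonoidalCategory.tensorHom_def, Category.assoc, leftUnitor_naturality, unitors_inv_equal,
      ← rightUnitor_inv_naturality_assoc, ← unitors_inv_equal, Iso.inv_hom_id_assoc]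
  rw [h₁] at h'
  have : Mono i := mono_of_mono i ((ρ_ (𝟙_ P)).inv ≫ r)
  rw [h₂] at h
  rw [← cancel_mono i, h, Category.id_comp]

/-- Cancelling `u ▷ D` shows that the idempotent `c ≫ u` becomes the identity after whiskering with
`D`. Since `u` and `c` exhibit `𝟙` as a retract of `D`, the object `D` is a retract of `D ⊗ D`, and
the identity descends to `c ≫ u` itself. -/
lemma isIso_of_whiskerRight {D : P} {u : 𝟙_ P ⟶ D} {c : D ⟶ 𝟙_ P} (h : u ≫ c = 𝟙 _)
    (hu : IsIso (u ▷ D)) : IsIso u := by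
  have h₁ : (c ≫ u) ▷ D = 𝟙 _ := by
    rw [← cancel_epi (u ▷ D), ← comp_whiskerRight, reassoc_of% h, Category.comp_id]
  -- The exchange law moves `c ≫ u` past `D ◁ u`, and then `u ≫ c = 𝟙` removes the second factor.
  have h₂ : c ≫ u = (ρ_ D).inv ≫ D ◁ u ≫ (c ≫ u) ▷ D ≫ D ◁ c ≫ (ρ_ D).hom := by
    rw [whisker_exchange_assoc, ← MonoidalCategory.whiskerLeft_comp_assoc, h,
      MonoidalCategory.whiskerLeft_id, Category.id_comp, rightUnitor_naturality,
      Iso.inv_hom_id_assoc]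
  refine ⟨c, h, ?_⟩
  rw [h₂, h₁, Category.id_comp, ← MonoidalCategory.whiskerLeft_comp_assoc, h,
      MonoidalCategory.whiskerLeft_id, Category.id_comp, Iso.inv_hom_id]

end Unit

lemma PlusData.IsAlgebra.isIso_iso {C : Type u} [Category.{v} C] {E : Type uE} [Category.{vE} E]
    [MonoidalCategory E] {d : PlusData C E} (h : d.IsAlgebra) {f g : Arrow C} (e : f ≅ g) :
    IsIso (d.iso e) :=
  ⟨d.iso e.symm, by rw [← h.iso_comp, Iso.self_symm_id, h.iso_id],
    by rw [← h.iso_comp, Iso.symm_self_id, h.iso_id]⟩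

/-- The left unit law of `μ` at `id_𝟙` exhibits `u ▷ D(id_𝟙)` as invertible, because `μ` and the
action are. The counit gives the retraction of `u`, and `isIso_of_whiskerRight` applies. -/
lemma NcAlg.isIso_unit {M : Type u} [Category.{v} M] [MonoidalCategory M] {E : Type uE}
    [Category.{vE} E] [MonoidalCategory E] [BraidedCategory E] {D : NcAlg M E}
    (hD : D.IsStrong) (p : D ⟶ trivialNcAlg M E) : IsIso (D.unit (Iso.refl (𝟙_ M))) := by
  let f : Arrow M := Arrow.mk (𝟙 (𝟙_ M))
  have i : IsIso (D.mu f f) := hD f f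
  have i' : IsIso (D.iso (arrowLeftUnitor f)) := D.isAlgebra.isIso_iso _
  have h₁ : D.unit (Iso.refl (𝟙_ M)) ≫ p.app f = 𝟙 _ := p.unit_app _
  refine isIso_of_whiskerRight h₁ ?_
  have h₂ := D.isMultiplicative.unit_left f
  rw [Iso.inv_comp_eq, Category.comp_id, tensorHom_id, ← IsIso.eq_comp_inv] at h₂
  have h₃ : D.unit (Iso.refl (𝟙_ M)) ▷ D.obj f =
    (λ_ (D.obj f)).hom ≫ inv (D.mu f f ≫ D.iso (arrowLeftUnitor f)) := h₂
  exact h₃ ▸ inferInstance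

variable {M : Type u} [Category.{v} M] [MonoidalCategory M] [SymmetricCategory M]

/-! ### The tautological algebra of `M^{+,gcp}` -/

section Tautological

variable (M)

/-- The generators, with identities as products. -/
def strongData : NcData M (StrongPlusGcp M) where
  toPlusData := (strongOps M).data (strongRel M)
  mu f g := CategoryStruct.id (obj := StrongPlusGcp M) (arrowTensor f g)

lemma strongData_isAlgebra : (strongData M).IsAlgebra :=
  (strongOps M).isAlgebra_data (fun _ _ _ _ h => .inl h) (fun _ _ _ _ h => .inr (.inl h))

variable {M} in
lemma strong_sound {X Y : Arrow M} {f g : Term _ arrowTensor (StrongGen M) true X Y}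
    (h : StrongRel M f g) : Presented.mk (strongRel M) f = Presented.mk (strongRel M) g :=
  Quotient.sound (.of (.inr (.inr h)))

lemma strongData_unit_tensor {X Y X' Y' : M} (σ : X ≅ Y) (σ' : X' ≅ Y') :
    (λ_ (𝟙_ (StrongPlusGcp M))).inv ≫ ((strongData M).unit σ ⊗ₘ (strongData M).unit σ') =
      (strongData M).unit (σ ⊗ᵢ σ') :=
  strong_sound (.unit_tensor σ σ')

lemma strongData_leftUnitor (f : Arrow M) :
    (strongData M).iso (arrowLeftUnitor f) =
      (MonoidalCategoryStruct.leftUnitor (C := StrongPlusGcp M) f).hom :=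
  (strong_sound (.leftUnitor f)).symm

lemma strongData_rightUnitor (f : Arrow M) :
    (strongData M).iso (arrowRightUnitor f) =
      (MonoidalCategoryStruct.rightUnitor (C := StrongPlusGcp M) f).hom :=
  (strong_sound (.rightUnitor f)).symm

/-- That `i_{id}` at the monoidal unit is the identity of the unit object is not among the relations
but follows from them. Multiplicativity and equivariance along `λ_𝟙` make this endomorphism
idempotent, and the left unit relation for `γ` makes it a first factor of the isomorphism `(id ⇓
id)`. -/
lemma strongData_unit : (strongData M).unit (Iso.refl (𝟙_ M)) = 𝟙 (𝟙_ (StrongPlusGcp M)) := by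
  have h := (strongData_isAlgebra M).unit_equivariance (Iso.refl (𝟙_ M) ⊗ᵢ Iso.refl (𝟙_ M))
    (Iso.refl (𝟙_ M)) (λ_ (𝟙_ M)) (λ_ (𝟙_ M)) (by simp)
  refine eq_id_of_tensor_self (P := StrongPlusGcp M) ?_
    ((strongData M).comp (Iso.refl (𝟙_ M)).hom (𝟙 (𝟙_ M))) ?_
  · refine (Category.assoc _ _ _).symm.trans (Eq.trans ?_ h)
    exact congrArg₂ (CategoryStruct.comp (obj := StrongPlusGcp M)) (strongData_unit_tensor M _ _)
      (strongData_leftUnitor M (Arrow.mk (𝟙 (𝟙_ M)))).symm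
  · have h' := (strongData_isAlgebra M).unit_left (Iso.refl (𝟙_ M)) (𝟙 (𝟙_ M))
    have i := (strongData_isAlgebra M).isIso_iso (square (Iso.refl (𝟙_ M)) (Iso.refl (𝟙_ M))
      (φ := 𝟙 (𝟙_ M)) (φ' := 𝟙 (𝟙_ M) ≫ (Iso.refl (𝟙_ M)).hom) (by simp))
    rw [← h'] at i
    exact i

/-- The tautological algebra. -/
def strongAlg : NcAlg M (StrongPlusGcp M) where
  toNcData := strongData M
  isAlgebra := strongData_isAlgebra M
  isMultiplicative :=
    { equivariance := fun e e' => (Category.comp_id (obj := StrongPlusGcp M) _).trans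
        ((strong_sound (.iso_tensor e e')).trans
          (Category.id_comp (obj := StrongPlusGcp M) _).symm)
      assoc := fun f g h => by
        have h₁ := id_tensorHom_id (C := StrongPlusGcp M) (arrowTensor f g) h
        have h₂ := id_tensorHom_id (C := StrongPlusGcp M) f (arrowTensor g h)
        refine (congrArg₂ (CategoryStruct.comp (obj := StrongPlusGcp M)) h₁
          (Category.id_comp (obj := StrongPlusGcp M) _)).trans ?_
        refine (Category.id_comp (obj := StrongPlusGcp M) _).trans ?_
        refine (strong_sound (.assoc f g h)).symm.trans ?_
        refine (Category.comp_id (obj := StrongPlusGcp M) _).symm.trans ?_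
        exact congrArg (CategoryStruct.comp (obj := StrongPlusGcp M) _)
          ((Category.comp_id (obj := StrongPlusGcp M) _).trans h₂).symm
      -- With identities as products this is the interchange relation of the presentation, up to
      -- rewriting the formal middle exchange as `tensorμ`.
      interchange := fun {X Y Z X' Y' Z'} φ₁ φ₀ ψ₁ ψ₀ => by
        refine (Category.comp_id (obj := StrongPlusGcp M) _).trans ?_
        refine (strong_sound (.interchange φ₁ φ₀ ψ₁ ψ₀)).trans ?_
        have h₁ := id_tensorHom_id (C := StrongPlusGcp M) (arrowTensor (Arrow.mk φ₁) (Arrow.mk ψ₁))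
          (arrowTensor (Arrow.mk φ₀) (Arrow.mk ψ₀))
        have h₂ : Presented.mk (strongRel M) (.middleSwap (Arrow.mk φ₁) (Arrow.mk φ₀)
            (Arrow.mk ψ₁) (Arrow.mk ψ₀)) = tensorμ (C := StrongPlusGcp M) (Arrow.mk φ₁)
              (Arrow.mk φ₀) (Arrow.mk ψ₁) (Arrow.mk ψ₀) :=
          (tensorμ_eq (Q := StrongPlusGcp M) _ _ _ _).symm
        refine (congrArg (fun t => CategoryStruct.comp (obj := StrongPlusGcp M) t
          (Presented.mk (strongRel M) (.comp (.gen (.comp (φ₁ ⊗ₘ ψ₁) (φ₀ ⊗ₘ ψ₀)))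
            (.gen (.iso (arrowInterchange φ₁ φ₀ ψ₁ ψ₀)))))) h₂).trans ?_
        refine congrArg (CategoryStruct.comp (obj := StrongPlusGcp M) _) ?_
        exact (Category.id_comp (obj := StrongPlusGcp M) _).symm.trans
          (congrArg (fun t => CategoryStruct.comp (obj := StrongPlusGcp M) t _) h₁.symm)
      unit_tensor := fun σ σ' => (congrArg (CategoryStruct.comp (obj := StrongPlusGcp M) _)
        (Category.comp_id (obj := StrongPlusGcp M) _)).trans (strongData_unit_tensor M σ σ')
      unit_left := fun f => by
        have h₁ := id_tensorHom_id (C := StrongPlusGcp M) (𝟙_ (StrongPlusGcp M)) f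
        rw [strongData_unit]
        refine (Iso.inv_comp_eq _).2 ?_
        refine (congrArg₂ (CategoryStruct.comp (obj := StrongPlusGcp M)) h₁
          (Category.id_comp (obj := StrongPlusGcp M) _)).trans ?_
        refine (Category.id_comp (obj := StrongPlusGcp M) _).trans ?_
        exact (strongData_leftUnitor M f).trans (Category.comp_id (obj := StrongPlusGcp M) _).symm
      unit_right := fun f => by
        have h₁ := id_tensorHom_id (C := StrongPlusGcp M) f (𝟙_ (StrongPlusGcp M))
        rw [strongData_unit]
        refine (Iso.inv_comp_eq _).2 ?_
        refine (congrArg₂ (CategoryStruct.comp (obj := StrongPlusGcp M)) h₁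
          (Category.id_comp (obj := StrongPlusGcp M) _)).trans ?_
        refine (Category.id_comp (obj := StrongPlusGcp M) _).trans ?_
        exact (strongData_rightUnitor M f).trans
          (Category.comp_id (obj := StrongPlusGcp M) _).symm }

lemma strongAlg_isCommutative : (strongAlg M).IsCommutative := fun f g =>
  (Category.id_comp (obj := StrongPlusGcp M) _).trans ((strong_sound (.braiding f g)).symm.trans
    (Category.comp_id (obj := StrongPlusGcp M) _).symm)

end Tautological

/-! ### Evaluation of functors on `M^{+,gcp}` -/

section Evaluation

open Functor.LaxMonoidal

variable {E : Type uE} [Category.{vE} E] [MonoidalCategory E] [SymmetricCategory E]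

/-- Every object is a letter, so no induction on words is needed. -/
instance : (evalNc E (strongAlg M)).Faithful where
  map_injective {F F'} τ τ' h := (forgetSymmetric _ E).map_injective <| by
    apply InducedCategory.hom_ext
    apply LaxMonoidalFunctor.hom_ext
    apply NatTrans.ext
    funext a
    exact congrArg (fun t => PlusData.Hom.app (NcAlg.Hom.toHom t) a) h

instance : (evalNc E (strongAlg M)).Full where
  map_surjective {F F'} p := by
    have i : ∀ X Y, IsIso (Functor.LaxMonoidal.μ F.obj.toFunctor X Y) := F.property.2
    have i' : IsIso (Functor.LaxMonoidal.ε F.obj.toFunctor) := F.property.1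
    -- Since the tautological unit and products are identities, the algebra of `F` has `ε F` and `μ
    -- F` as its unit at `id_𝟙` and its products. Compatibility of `p` with these is therefore
    -- precisely monoidality of the family `p.app`.
    have hu : ∀ F : StrongSymmetricFunctor (StrongPlusGcp M) E,
        ((evalNc E (strongAlg M)).obj F).unit (Iso.refl (𝟙_ M)) = ε F.obj.toFunctor := fun F =>
      (congrArg (fun t => ε F.obj.toFunctor ≫ F.obj.map t) (strongData_unit M)).trans
        ((congrArg (ε F.obj.toFunctor ≫ ·) (F.obj.map_id _)).trans (Category.comp_id _))
    have hm : ∀ (F : StrongSymmetricFunctor (StrongPlusGcp M) E) (f g : Arrow M),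
        ((evalNc E (strongAlg M)).obj F).mu f g =
          μ F.obj.toFunctor (f : StrongPlusGcp M) (g : StrongPlusGcp M) := fun F f g =>
      (congrArg (μ F.obj.toFunctor (f : StrongPlusGcp M) (g : StrongPlusGcp M) ≫ ·)
        (F.obj.map_id _)).trans (Category.comp_id _)
    have hε := p.unit_app (Iso.refl (𝟙_ M))
    rw [hu, hu] at hε
    have hμ := p.mu_app
    simp only [hm] at hμ
    obtain ⟨α, hα⟩ := Presented.exists_symmetric_hom (F := F) (F' := F') p.app hε hμ
      (fun X Y g => by
        cases g with
        | iso e => exact p.iso_app e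
        | comp φ₁ φ₀ =>
          have h := p.comp_app φ₁ φ₀
          have j : IsIso (μ F.obj.toFunctor (Arrow.mk φ₁ : StrongPlusGcp M)
            (Arrow.mk φ₀ : StrongPlusGcp M)) := i _ _
          refine (@cancel_epi _ _ _ _ _ (μ F.obj.toFunctor (Arrow.mk φ₁ : StrongPlusGcp M)
            (Arrow.mk φ₀ : StrongPlusGcp M)) (@IsIso.epi_of_iso _ _ _ _ _ j) _ _).1 ?_
          refine ((Category.assoc _ _ _).symm.trans h).trans ?_
          refine (Category.assoc _ _ _).symm.trans (Eq.trans ?_ (Category.assoc _ _ _))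
          exact congrArg (· ≫ F'.obj.map _) (hμ (Arrow.mk φ₁) (Arrow.mk φ₀)).symm
        | unit σ =>
          refine (cancel_epi (ε F.obj.toFunctor)).1 ?_
          refine ((Category.assoc _ _ _).symm.trans (p.unit_app σ)).trans ?_
          exact (congrArg (· ≫ F'.obj.map _) hε.symm).trans (Category.assoc _ _ _))
    exact ⟨α, NcAlg.hom_ext fun f => hα _⟩

lemma isStrong_evalNc_strongAlg (F : StrongSymmetricFunctor (StrongPlusGcp M) E) :
    ((evalNc E (strongAlg M)).obj F).IsStrong := fun f g => by
  have h₁ : IsIso (μ F.obj.toFunctor (f : StrongPlusGcp M) (g : StrongPlusGcp M)) :=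
    F.property.2 _ _
  have h₂ : IsIso (F.obj.map (CategoryStruct.id (obj := StrongPlusGcp M) (arrowTensor f g))) :=
    (F.obj.map_id _).symm ▸ inferInstance
  exact @IsIso.comp_isIso _ _ _ _ _ _ _ h₁ h₂

lemma isCommutative_evalNc_strongAlg (F : StrongSymmetricFunctor (StrongPlusGcp M) E) :
    ((evalNc E (strongAlg M)).obj F).IsCommutative :=
  (strongAlg_isCommutative M).map F.obj.toFunctor

/-! ### Functors on `M^{+,gcp}` from algebras -/

section Lift

variable (D : NcAlg M E) (hD : D.IsStrong) (hu : IsIso (D.unit (Iso.refl (𝟙_ M))))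

/-- The values of an algebra whose products and unit are invertible. -/
noncomputable def strongFamily : TensorFamily (Arrow.mk (𝟙 (𝟙_ M))) arrowTensor E where
  obj := D.obj
  unit := @asIso _ _ _ _ (D.unit (Iso.refl (𝟙_ M))) hu
  tensor f g := @asIso _ _ _ _ (D.mu f g) (hD f g)

/-- The values of the generators that are given by an algebra. -/
noncomputable def strongGen : ∀ {X Y : Arrow M}, StrongGen M X Y →
    ((strongFamily D hD hu).obj X ⟶ (strongFamily D hD hu).obj Y)
  | _, _, .iso e => D.iso e
  | _, _, .comp φ₁ φ₀ => ((strongFamily D hD hu).tensor _ _).inv ≫ D.comp φ₁ φ₀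
  | _, _, .unit σ => (strongFamily D hD hu).unit.inv ≫ D.unit σ

lemma strongOps_values :
    (strongOps M).values (strongFamily D hD hu) (strongGen D hD hu) = D.toPlusData := by
  have h₁ : (fun {X Y Z : M} (φ₁ : Y ⟶ Z) (φ₀ : X ⟶ Y) =>
      ((strongOps M).values (strongFamily D hD hu) (strongGen D hD hu)).comp φ₁ φ₀) = @D.comp := by
    funext X Y Z φ₁ φ₀
    exact Iso.hom_inv_id_assoc ((strongFamily D hD hu).tensor (Arrow.mk φ₁) (Arrow.mk φ₀))
      (D.comp φ₁ φ₀)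
  have h₂ : (fun {X Y : M} (σ : X ≅ Y) =>
      ((strongOps M).values (strongFamily D hD hu) (strongGen D hD hu)).unit σ) = @D.unit := by
    funext X Y σ
    exact Iso.hom_inv_id_assoc (strongFamily D hD hu).unit (D.unit σ)
  exact congrArg₂ (fun a b => PlusData.mk (E := E) D.obj D.iso a b) h₁ h₂

/-- The values of the generators as morphisms of indices, with identities as products. -/
noncomputable def strongPullData : NcData M (strongFamily D hD hu).Pull where
  toPlusData := (strongOps M).pullData (N := strongFamily D hD hu) (gen := strongGen D hD hu)
  mu f g := CategoryStruct.id (obj := (strongFamily D hD hu).Pull) (arrowTensor f g)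

/-- In the category of indices the product of `D` becomes an identity, because `D.mu` is itself the
tensor constraint of the family. -/
lemma strongPullData_map : (strongPullData D hD hu).map (strongFamily D hD hu).eval = D.toNcData :=
  NcData.ext_of_eq (strongOps_values D hD hu) fun _ _ => heq_of_eq (Category.comp_id _)

lemma strongPullData_unit : (strongPullData D hD hu).unit (Iso.refl (𝟙_ M)) =
    𝟙 (𝟙_ (strongFamily D hD hu).Pull) :=
  (strongFamily D hD hu).unit.inv_hom_id

/-- The laws of `D` are transferred to the indices, where all products are identities and the unit
at `id_𝟙` is an identity. With these substitutions the laws for `μ` become the additional relations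
of `M^{+,gcp}`. -/
lemma strongRel_sound (hc : D.IsCommutative) ⦃X Y : Arrow M⦄
    (f g : Term _ arrowTensor (StrongGen M) true X Y) (h : strongRel M f g) :
    (strongFamily D hD hu).interpret (strongGen D hD hu) f =
      (strongFamily D hD hu).interpret (strongGen D hD hu) g := by
  have h₁ : ((strongOps M).values (strongFamily D hD hu) (strongGen D hD hu)).IsAlgebra :=
    (strongOps_values D hD hu).symm ▸ D.isAlgebra
  have h₂ : (strongPullData D hD hu).IsMultiplicative :=
    .of_map (strongFamily D hD hu).eval ((strongPullData_map D hD hu).symm ▸ D.isMultiplicative)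
  have h₃ : (strongPullData D hD hu).IsCommutative :=
    .of_map (strongFamily D hD hu).eval ((strongPullData_map D hD hu).symm ▸ hc)
  obtain h | h | h := h
  · exact PlusOps.interpret_plusRel h₁ h
  · exact PlusOps.interpret_pointingRel h₁ h
  -- In each remaining case one law of the transferred algebra is taken and the identities standing
  -- for `μ` or for the unit are removed.
  let N := strongFamily D hD hu
  cases h with
  | iso_tensor e e' =>
    exact (Category.comp_id (obj := N.Pull) _).symm.trans ((h₂.equivariance e e').trans
      (Category.id_comp (obj := N.Pull) _))
  | assoc f g h =>
    have h₄ := id_tensorHom_id (C := N.Pull) (arrowTensor f g) h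
    have h₅ := id_tensorHom_id (C := N.Pull) f (arrowTensor g h)
    refine Eq.symm ?_
    refine Eq.trans ?_ ((h₂.assoc f g h).trans ?_)
    · refine Eq.symm ((congrArg₂ (CategoryStruct.comp (obj := N.Pull)) h₄
          (Category.id_comp (obj := N.Pull) _)).trans ?_)
      exact Category.id_comp (obj := N.Pull) _
    · refine (congrArg (CategoryStruct.comp (obj := N.Pull) _)
          ((Category.comp_id (obj := N.Pull) _).trans h₅)).trans ?_
      exact Category.comp_id (obj := N.Pull) _
  | leftUnitor f =>
    have h₄ := id_tensorHom_id (C := N.Pull) (𝟙_ N.Pull) Y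
    have h := h₂.unit_left Y
    rw [strongPullData_unit] at h
    have h' := ((Iso.inv_comp_eq _).1 h).trans (Category.comp_id (obj := N.Pull) _)
    refine h'.symm.trans ?_
    refine (congrArg₂ (CategoryStruct.comp (obj := N.Pull)) h₄
          (Category.id_comp (obj := N.Pull) _)).trans ?_
    exact Category.id_comp (obj := N.Pull) _
  | rightUnitor f =>
    have h₄ := id_tensorHom_id (C := N.Pull) Y (𝟙_ N.Pull)
    have h := h₂.unit_right Y
    rw [strongPullData_unit] at h
    have h' := ((Iso.inv_comp_eq _).1 h).trans (Category.comp_id (obj := N.Pull) _)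
    refine h'.symm.trans ?_
    refine (congrArg₂ (CategoryStruct.comp (obj := N.Pull)) h₄
          (Category.id_comp (obj := N.Pull) _)).trans ?_
    exact Category.id_comp (obj := N.Pull) _
  | braiding f g =>
    exact (Category.comp_id (obj := N.Pull) _).symm.trans ((h₃ f g).symm.trans
      (Category.id_comp (obj := N.Pull) _))
  | interchange φ₁ φ₀ ψ₁ ψ₀ =>
    have h₄ := id_tensorHom_id (C := N.Pull) (arrowTensor (Arrow.mk φ₁) (Arrow.mk ψ₁))
          (arrowTensor (Arrow.mk φ₀) (Arrow.mk ψ₀))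
    refine (Category.comp_id (obj := N.Pull) _).symm.trans
      ((h₂.interchange φ₁ φ₀ ψ₁ ψ₀).trans ?_)
    refine congrArg₂ (CategoryStruct.comp (obj := N.Pull))
      (interpret_middleSwap (N := N) (gen := strongGen D hD hu) _ _ _ _).symm ?_
    exact (congrArg (fun t => CategoryStruct.comp (obj := N.Pull) t _) h₄).trans
      (Category.id_comp (obj := N.Pull) _)
  | unit_tensor σ σ' =>
    exact (congrArg (CategoryStruct.comp (obj := N.Pull) _)
        (Category.comp_id (obj := N.Pull) _)).symm.trans (h₂.unit_tensor σ σ')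

end Lift

lemma exists_evalNc_strongAlg (D : NcAlg M E) (hD : D.IsStrong)
    (hu : IsIso (D.unit (Iso.refl (𝟙_ M)))) (hc : D.IsCommutative) :
    ∃ F : StrongSymmetricFunctor (StrongPlusGcp M) E, (evalNc E (strongAlg M)).obj F = D := by
  refine ⟨(strongFamily D hD hu).liftSymmetric (strongGen D hD hu)
    (strongRel_sound D hD hu hc), NcAlg.ext_data (NcData.ext_of_eq
      (((strongOps M).data_map_lift _).trans (strongOps_values D hD hu)) fun f g => heq_of_eq ?_)⟩
  -- The product of the tautological algebra is an identity, so only the tensor constraint of the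
  -- constructed functor remains; this is `D.mu`.
  refine (congrArg (_ ≫ ·) (CategoryTheory.Functor.map_id _ _)).trans ((Category.comp_id _).trans ?_)
  exact (strongFamily D hD hu).comp_eval_μ (strongRel_sound D hD hu hc) f g

end Evaluation


/-! ## Fully faithful functors with the same essential image -/

section EssImage

variable {A B X : Type*} [Category A] [Category B] [Category X]

/-- Both sources are equivalent to the same full subcategory of `X`; the isomorphism is the counit
of the second equivalence. -/
theorem exists_equivalence_of_essImage (F : A ⥤ X) [F.Full] [F.Faithful] (G : B ⥤ X) [G.Full]
    [G.Faithful] (h : ∀ x, F.essImage x ↔ G.essImage x) :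
    ∃ e : A ≌ B, ∀ a, Nonempty (G.obj (e.functor.obj a) ≅ F.obj a) := by
  let H : A ⥤ G.EssImageSubcategory :=
    G.essImage.lift F fun a => (h _).1 (F.obj_mem_essImage a)
  have : H.EssSurj := ⟨fun x => by
    obtain ⟨a, ⟨i⟩⟩ := (h _).2 x.property
    exact ⟨a, ⟨ObjectProperty.isoMk _ i⟩⟩⟩
  have : H.Full := inferInstanceAs (G.essImage.lift F _).Full
  have : H.Faithful := inferInstanceAs (G.essImage.lift F _).Faithful
  have : H.IsEquivalence := { }
  have : G.toEssImage.IsEquivalence := { }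
  refine ⟨H.asEquivalence.trans G.toEssImage.asEquivalence.symm, fun a => ⟨?_⟩⟩
  exact G.essImage.ι.mapIso (G.toEssImage.asEquivalence.counitIso.app (H.obj a))

/-- The functor on slice categories that is induced by a functor. -/
abbrev overFunctor (F : A ⥤ X) {T : A} {T' : X} (i : F.obj T ≅ T') : Over T ⥤ Over T' :=
  Over.post F ⋙ Over.map i.hom

/-- Fullness lifts the structure morphism to `T'`, so a slice object is in the image as soon as its
source is. Counits thus add no condition on the functor side. -/
lemma essImage_overFunctor (F : A ⥤ X) [F.Full] {T : A} {T' : X} (i : F.obj T ≅ T')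
    (Y : Over T') : (overFunctor F i).essImage Y ↔ F.essImage Y.left := by
  constructor
  · rintro ⟨Z, ⟨e⟩⟩
    exact ⟨Z.left, ⟨(Over.forget _).mapIso e⟩⟩
  · rintro ⟨Z, ⟨e⟩⟩
    obtain ⟨f, hf⟩ := F.map_surjective (e.hom ≫ Y.hom ≫ i.inv)
    exact ⟨.mk f, ⟨Over.isoMk e (by
      change e.hom ≫ Y.hom = F.map f ≫ i.hom
      rw [hf, Category.assoc, Category.assoc, Iso.inv_hom_id, Category.comp_id])⟩⟩

end EssImage

/-! ## Coproducts -/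

section Coproducts

variable (E : Type uE) [Category.{vE} E]

/-- The inclusions of summands into coproducts are monomorphisms. -/
class MonoInclusions : Prop where
  mono {J : Type v} {X : J → E} {c : Cofan X} (hc : IsColimit c) (j : J) : Mono (c.inj j)

instance [HasCoproducts.{v} E] [MonoCoprod E] : MonoInclusions.{v} E where
  mono hc j := MonoCoprod.mono_inj _ _ hc j

/-- Inclusions into van Kampen coproducts are monic. Hence the comparison with algebras, which uses
`MonoInclusions`, applies in the Cartesian part as well. -/
instance [HasCoproducts.{v} E] [ExtensiveCoproducts.{v} E] :
    MonoInclusions.{v} E where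
  mono {J X c} hc j := by
    have : HasFiniteCoproducts E := hasFiniteCoproducts_of_hasCoproducts E
    exact mono_of_cofan_isVanKampen (ExtensiveCoproducts.isVanKampen _ _ hc) ⟨j⟩

variable {E} [MonoidalCategory E] [TensorPreservesCoproducts.{v} E]

section

variable {J K : Type v} {X : J → E} {Y : K → E} {c : Cofan X} {c' : Cofan Y}

lemma cofan_tensor_ext (hc : IsColimit c) (hc' : IsColimit c') {A : E} {f g : c.pt ⊗ c'.pt ⟶ A}
    (h : ∀ j k, (c.inj j ⊗ₘ c'.inj k) ≫ f = (c.inj j ⊗ₘ c'.inj k) ≫ g) : f = g := by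
  have := TensorPreservesCoproducts.right (E := E) c'.pt J
  refine (isColimitOfPreserves (tensorRight c'.pt) hc).hom_ext fun ⟨j⟩ => ?_
  have := TensorPreservesCoproducts.left (E := E) (X j) K
  refine (isColimitOfPreserves (tensorLeft (X j)) hc').hom_ext fun ⟨k⟩ => ?_
  have := h j k
  rw [MonoidalCategory.tensorHom_def', Category.assoc, Category.assoc] at this
  exact this

lemma exists_cofan_tensor_desc (hc : IsColimit c) (hc' : IsColimit c') {A : E}
    (f : ∀ j k, X j ⊗ Y k ⟶ A) :
    ∃ g : c.pt ⊗ c'.pt ⟶ A, ∀ j k, (c.inj j ⊗ₘ c'.inj k) ≫ g = f j k := by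
  have := TensorPreservesCoproducts.right (E := E) c'.pt J
  have := fun j => TensorPreservesCoproducts.left (E := E) (X j) K
  let hX := isColimitOfPreserves (tensorRight c'.pt) hc
  let hY := fun j => isColimitOfPreserves (tensorLeft (X j)) hc'
  let g := fun j => (hY j).desc ⟨A, Discrete.natTrans fun ⟨k⟩ => f j k⟩
  have hg : ∀ j k, (X j ◁ c'.inj k) ≫ g j = f j k := fun j k => (hY j).fac _ ⟨k⟩
  refine ⟨hX.desc ⟨A, Discrete.natTrans fun ⟨j⟩ => g j⟩, fun j k => ?_⟩
  rw [MonoidalCategory.tensorHom_def', Category.assoc]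
  have : (c.inj j ▷ c'.pt) ≫ hX.desc ⟨A, Discrete.natTrans fun ⟨j⟩ => g j⟩ = g j :=
    hX.fac _ ⟨j⟩
  rw [this, hg]

/-- The tensor product of two coproducts as a coproduct. -/
noncomputable def isColimitCofanTensor (hc : IsColimit c) (hc' : IsColimit c') :
    IsColimit (Cofan.mk (c.pt ⊗ c'.pt) fun p : J × K => c.inj p.1 ⊗ₘ c'.inj p.2) :=
  Cofan.IsColimit.mk _
    (fun s => (exists_cofan_tensor_desc hc hc' fun j k => s.inj (j, k)).choose)
    (fun s p => (exists_cofan_tensor_desc hc hc' fun j k => s.inj (j, k)).choose_spec p.1 p.2)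
    (fun s _ hm => cofan_tensor_ext hc hc' fun j k => (hm (j, k)).trans
      ((exists_cofan_tensor_desc hc hc' fun j k => s.inj (j, k)).choose_spec j k).symm)

/-- The tensor product of two coproducts is a coproduct over pairs, so joint epimorphy on threefold,
and below on fourfold, products reduces to the case of two factors. -/
lemma cofan_tensor_ext₃ {L : Type v} {Z : L → E} {c'' : Cofan Z} (hc : IsColimit c)
    (hc' : IsColimit c') (hc'' : IsColimit c'') {A : E} {f g : (c.pt ⊗ c'.pt) ⊗ c''.pt ⟶ A}
    (h : ∀ j k l, ((c.inj j ⊗ₘ c'.inj k) ⊗ₘ c''.inj l) ≫ f =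
      ((c.inj j ⊗ₘ c'.inj k) ⊗ₘ c''.inj l) ≫ g) : f = g :=
  cofan_tensor_ext (isColimitCofanTensor hc hc') hc'' fun p l => h p.1 p.2 l

lemma cofan_tensor_ext₄ {J' K' : Type v} {X' : J' → E} {Y' : K' → E} {d : Cofan X'}
    {d' : Cofan Y'} (hc : IsColimit c) (hc' : IsColimit c') (hd : IsColimit d)
    (hd' : IsColimit d') {A : E} {f g : (c.pt ⊗ c'.pt) ⊗ (d.pt ⊗ d'.pt) ⟶ A}
    (h : ∀ j k j' k', ((c.inj j ⊗ₘ c'.inj k) ⊗ₘ (d.inj j' ⊗ₘ d'.inj k')) ≫ f =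
      ((c.inj j ⊗ₘ c'.inj k) ⊗ₘ (d.inj j' ⊗ₘ d'.inj k')) ≫ g) : f = g :=
  cofan_tensor_ext (isColimitCofanTensor hc hc') (isColimitCofanTensor hd hd')
    fun p q => h p.1 p.2 q.1 q.2

end

end Coproducts

/-! ## The action of isomorphisms on bimodules -/

section Bimodules

variable {C : Type u} [Category.{v} C] {E : Type uE} [Category.{vE} E]

lemma Bimodule.act_refl (ρ : Bimodule C E) (X Y : C) :
    ρ.act (Iso.refl X) (Iso.refl Y) = 𝟙 _ := by
  have : coreMap (Iso.refl Y) = 𝟙 (Core.mk Y) := rfl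
  rw [Bimodule.act_refl_left, this, CategoryTheory.Functor.map_id]

lemma Bimodule.act_trans (ρ : Bimodule C E) {X X' X'' Y Y' Y'' : C} (a : X ≅ X') (a' : X' ≅ X'')
    (b : Y ≅ Y') (b' : Y' ≅ Y'') :
    ρ.act (a ≪≫ a') (b ≪≫ b') = ρ.act a b ≫ ρ.act a' b' := by
  have h₁ : (coreMap (a ≪≫ a').symm).op = (coreMap a.symm).op ≫ (coreMap a'.symm).op := rfl
  have h₂ : coreMap (b ≪≫ b') = coreMap b ≫ coreMap b' := rfl
  simp only [Bimodule.act, h₁, h₂, Functor.map_comp, NatTrans.comp_app, Category.assoc,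
    NatTrans.naturality_assoc]

/-- A morphism of bimodules from an equivariant family. -/
def Bimodule.homMk {ρ ρ' : Bimodule C E} (k : ∀ X Y : C, ρ.at X Y ⟶ ρ'.at X Y)
    (h : ∀ {X X' Y Y' : C} (a : X ≅ X') (b : Y ≅ Y'),
      ρ.act a b ≫ k X' Y' = k X Y ≫ ρ'.act a b) : ρ ⟶ ρ' where
  app X :=
    { app := fun Y => k X.unop.of Y.of
      naturality := fun Y Y' b => by
        have := h (Iso.refl X.unop.of) b.iso
        rwa [Bimodule.act_refl_left, Bimodule.act_refl_left] at this }
  naturality X X' a := by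
    ext Y
    have := h a.unop.iso.symm (Iso.refl Y.of)
    rwa [Bimodule.act_refl_right, Bimodule.act_refl_right] at this

lemma Bimodule.hom_ext {ρ ρ' : Bimodule C E} {f g : ρ ⟶ ρ'}
    (h : ∀ X Y : C, Bimodule.comp f X Y = Bimodule.comp g X Y) : f = g := by
  ext X Y
  exact h X.unop.of Y.of

/-- A bimodule from a family of objects with an action of the isomorphisms. -/
def Bimodule.ofAct (D : C → C → E)
    (act : ∀ {X X' Y Y' : C} (_ : X ≅ X') (_ : Y ≅ Y'), D X Y ⟶ D X' Y')
    (refl : ∀ X Y, act (Iso.refl X) (Iso.refl Y) = 𝟙 _)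
    (trans : ∀ {X X' X'' Y Y' Y'' : C} (a : X ≅ X') (a' : X' ≅ X'')
      (b : Y ≅ Y') (b' : Y' ≅ Y''), act (a ≪≫ a') (b ≪≫ b') = act a b ≫ act a' b') :
    Bimodule C E where
  obj X :=
    { obj := fun Y => D X.unop.of Y.of
      map := fun b => act (Iso.refl _) b.iso
      map_id := fun Y => refl _ _
      map_comp := fun b b' => by
        have := trans (Iso.refl X.unop.of) (Iso.refl _) b.iso b'.iso
        rwa [Iso.refl_trans] at this }
  map {X X'} a :=
    { app := fun Y => act a.unop.iso.symm (Iso.refl _)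
      naturality := fun Y Y' b => by
        -- Both orders of the two one-sided actions equal the action of the pair.
        rw [← trans, ← trans]
        congr 1
        · rw [Iso.refl_trans, Iso.trans_refl]
        · rw [Iso.refl_trans, Iso.trans_refl] }
  map_id X := by
    ext Y
    exact refl _ _
  map_comp a a' := by
    ext Y
    have := trans a.unop.iso.symm a'.unop.iso.symm (Iso.refl Y.of) (Iso.refl _)
    rwa [Iso.refl_trans] at this

lemma Bimodule.ofAct_act (D : C → C → E)
    (act : ∀ {X X' Y Y' : C} (_ : X ≅ X') (_ : Y ≅ Y'), D X Y ⟶ D X' Y')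
    (refl : ∀ X Y, act (Iso.refl X) (Iso.refl Y) = 𝟙 _)
    (trans : ∀ {X X' X'' Y Y' Y'' : C} (a : X ≅ X') (a' : X' ≅ X'')
      (b : Y ≅ Y') (b' : Y' ≅ Y''), act (a ≪≫ a') (b ≪≫ b') = act a b ≫ act a' b')
    {X X' Y Y' : C} (a : X ≅ X') (b : Y ≅ Y') :
    (Bimodule.ofAct D act refl trans).act a b = act a b := by
  change act a.symm.symm (Iso.refl _) ≫ act (Iso.refl _) b = _
  rw [← trans]
  exact congrArg₂ act (Iso.trans_refl a) (Iso.refl_trans b)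

variable [MonoidalCategory E] [∀ F : (Core C)ᵒᵖ ⥤ Core C ⥤ E, HasCoend F]

/-- The actions of `a` and `c` are those induced on the coend. The isomorphism `b` acts on both
tensor factors, and the coend relation makes the two actions cancel. -/
lemma plethysmι_equivariant (P Q : Bimodule C E) :
    IsEquivariant (P := P) (Q := Q) (R := plethysm P Q) (plethysmι P Q) := by
  intro X Y Z X' Y' Z' a b c
  have h₁ : plethysmι P Q X Y Z ≫ (plethysm P Q).act a c =
      (P.at Y Z ◁ (Q.map (coreMap a.symm).op).app ⟨Y⟩) ≫
        ((P.obj (op ⟨Y⟩)).map (coreMap c) ▷ Q.at X' Y) ≫ plethysmι P Q X' Y Z' := by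
    have h₂ : plethysmι P Q X Y Z ≫ ((plethysm P Q).map (coreMap a.symm).op).app ⟨Z⟩ =
        (P.at Y Z ◁ (Q.map (coreMap a.symm).op).app ⟨Y⟩) ≫ plethysmι P Q X' Y Z :=
      coend.ι_map _ _
    have h₃ : plethysmι P Q X' Y Z ≫ ((plethysm P Q).obj (op ⟨X'⟩)).map (coreMap c) =
        ((P.obj (op ⟨Y⟩)).map (coreMap c) ▷ Q.at X' Y) ≫ plethysmι P Q X' Y Z' :=
      coend.ι_map _ _
    rw [Bimodule.act, reassoc_of% h₂, h₃]
  -- The defining relation of the coend for `b`.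
  have h₄ : (P.map (coreMap b).op).app ⟨Z'⟩ ▷ Q.at X' Y ≫ plethysmι P Q X' Y Z' =
      P.at Y' Z' ◁ (Q.obj (op ⟨X'⟩)).map (coreMap b) ≫ plethysmι P Q X' Y' Z' :=
    coend.condition (plethysmIntegrand P Q (op ⟨X'⟩) ⟨Z'⟩) (coreMap b)
  have h₅ : P.act b c ≫ (P.map (coreMap b).op).app ⟨Z'⟩ = (P.obj (op ⟨Y⟩)).map (coreMap c) := by
    have h₆ : (coreMap b.symm).op ≫ (coreMap b).op = 𝟙 (op (Core.mk Y)) :=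
      congrArg Quiver.Hom.op (Groupoid.comp_inv (coreMap b))
    rw [Bimodule.act, Category.assoc, NatTrans.naturality, ← NatTrans.comp_app_assoc,
      ← P.map_comp, h₆, P.map_id, NatTrans.id_app, Category.id_comp]
  have h₇ : Q.act a b = (Q.map (coreMap a.symm).op).app ⟨Y⟩ ≫
    (Q.obj (op ⟨X'⟩)).map (coreMap b) := rfl
  rw [h₁, MonoidalCategory.tensorHom_def, Category.assoc, h₇,
    MonoidalCategory.whiskerLeft_comp, Category.assoc, ← h₄, whisker_exchange_assoc,
    ← comp_whiskerRight_assoc, h₅, whisker_exchange_assoc]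

variable [HasCoproducts.{v} E]

/-- Equivariance of the composition is contained in the fact that `γ` is a morphism of bimodules on
the plethysm product; it corresponds to the equivariance relation of the plus construction. -/
lemma BimoduleMonoidData.mul_equivariant (ρ : BimoduleMonoidData C E) :
    IsEquivariant (P := ρ.carrier) (Q := ρ.carrier) (R := ρ.carrier) ρ.mul := by
  intro X Y Z X' Y' Z' a b c
  rw [BimoduleMonoidData.mul, ← Category.assoc, plethysmι_equivariant ρ.carrier ρ.carrier a b c,
    Category.assoc, Bimodule.act_comp, BimoduleMonoidData.mul, Category.assoc]

lemma isoι_act {X Y X' Y' : C} (σ : X ≅ Y) (a : X ≅ X') (b : Y ≅ Y') :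
    isoι E σ ≫ (isoBimodule C E).act a b = isoι E (a.symm ≪≫ σ ≪≫ b) := by
  have h₁ := copowι_map (E := E) (((isoSet C).map
    (Quiver.Hom.op (X := Core.mk X') (Y := Core.mk X) ⟨a.symm⟩)).app ⟨Y⟩) ⟨σ⟩
  have h₂ := copowι_map (E := E) (((isoSet C).obj (op ⟨X'⟩)).map
    (X := Core.mk Y) (Y := Core.mk Y') ⟨b⟩) ⟨a.symm ≪≫ σ⟩
  refine (Category.assoc _ _ _).symm.trans ?_
  refine (congrArg (· ≫ _) h₁).trans (h₂.trans ?_)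
  exact congrArg (isoι E) (Iso.trans_assoc _ _ _)

/-- Naturality of `u` gives the equivariance of the pointings, as the square forces `τ'` to be the
conjugate of `τ`. -/
lemma BimoduleMonoidData.elt_act (ρ : BimoduleMonoidData C E) {X Y X' Y' : C} (τ : X ≅ Y)
    (τ' : X' ≅ Y') (a : X ≅ X') (b : Y ≅ Y') (h : a.hom ≫ τ'.hom = τ.hom ≫ b.hom) :
    ρ.elt τ ≫ ρ.carrier.act a b = ρ.elt τ' := by
  have h' : a.symm ≪≫ τ ≪≫ b = τ' := by
    ext
    simp [← h]
  rw [BimoduleMonoidData.elt, Category.assoc, ← Bimodule.act_comp, ← Category.assoc, isoι_act, h']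
  rfl

lemma iso_ext {X Y : C} {A : E} {f g : (isoBimodule C E).at X Y ⟶ A}
    (h : ∀ σ : X ≅ Y, isoι E σ ≫ f = isoι E σ ≫ g) : f = g :=
  Sigma.hom_ext _ _ fun σ => h σ.iso

end Bimodules


/-! ## The algebra of a decomposed bimodule monoid -/

/-- The source component of an isomorphism of arrows. -/
abbrev arrowLeftIso {C : Type u} [Category.{v} C] {f g : Arrow C} (e : f ≅ g) :
    f.left ≅ g.left :=
  ⟨e.hom.left, e.inv.left, congrArg CommaMorphism.left e.hom_inv_id,
    congrArg CommaMorphism.left e.inv_hom_id⟩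

/-- The target component of an isomorphism of arrows. -/
abbrev arrowRightIso {C : Type u} [Category.{v} C] {f g : Arrow C} (e : f ≅ g) :
    f.right ≅ g.right :=
  ⟨e.hom.right, e.inv.right, congrArg CommaMorphism.right e.hom_inv_id,
    congrArg CommaMorphism.right e.inv_hom_id⟩

lemma arrowIso_w {C : Type u} [Category.{v} C] {f g : Arrow C} (e : f ≅ g) :
    (arrowLeftIso e).inv ≫ f.hom ≫ (arrowRightIso e).hom = g.hom := by
  rw [Iso.inv_comp_eq]
  exact (Arrow.w e.hom).symm

section Decompositions

variable {C : Type u} [Category.{v} C] {E : Type uE} [Category.{vE} E] [MonoidalCategory E]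
  [HasCoproducts.{v} E] [TensorPreservesCoproducts.{v} E]
  [∀ F : (Core C)ᵒᵖ ⥤ Core C ⥤ E, HasCoend F] [MonoInclusions.{v} E]

instance {X Y : C} (φ : X ⟶ Y) : Mono (homι E φ) :=
  MonoInclusions.mono (coproductIsCoproduct fun _ : X ⟶ Y => 𝟙_ E) φ

namespace Decomposition

variable {ρ : BimoduleMonoid C E} {b : ρ ⟶ homMonoid C E} (d : Decomposition ρ b)

instance mono_ι {X Y : C} (φ : X ⟶ Y) : Mono (d.ι φ) :=
  MonoInclusions.mono (d.isColimit X Y) φ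

lemma cancel_ι {X Y : C} (φ : X ⟶ Y) {A : E} {f g : A ⟶ d.D φ}
    (h : f ≫ d.ι φ = g ≫ d.ι φ) : f = g :=
  (cancel_mono (d.ι φ)).1 h

lemma hom_ext {X Y : C} {A : E} {f g : ρ.carrier.at X Y ⟶ A}
    (h : ∀ φ : X ⟶ Y, d.ι φ ≫ f = d.ι φ ≫ g) : f = g :=
  Cofan.IsColimit.hom_ext (d.isColimit X Y) _ _ h

/-- A decomposition provides the action with target `D(a⁻¹ φ b)`. An isomorphism of arrows has a
target that only equals this composite, hence the free variable `ψ`. -/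
lemma exists_iso_aux {X Y X' Y' : C} (φ : X ⟶ Y) (a : X ≅ X') (b' : Y ≅ Y') (ψ : X' ⟶ Y')
    (h : a.inv ≫ φ ≫ b'.hom = ψ) :
    ∃ g : d.D φ ⟶ d.D ψ, g ≫ d.ι ψ = d.ι φ ≫ ρ.carrier.act a b' := by
  subst h
  obtain ⟨g, hg⟩ := d.exists_act φ a b'
  exact ⟨g, hg.symm⟩

lemma exists_iso {f g : Arrow C} (e : f ≅ g) : ∃ k : d.D f.hom ⟶ d.D g.hom,
    k ≫ d.ι g.hom = d.ι f.hom ≫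
      ρ.carrier.act (arrowLeftIso e) (arrowRightIso e) :=
  d.exists_iso_aux _ _ _ _ (arrowIso_w e)

/-- The action of the isomorphisms on the summands. -/
noncomputable def isoMap {f g : Arrow C} (e : f ≅ g) : d.D f.hom ⟶ d.D g.hom :=
  (d.exists_iso e).choose

/-- The composition of the summands. -/
noncomputable def compMap {X Y Z : C} (φ₁ : Y ⟶ Z) (φ₀ : X ⟶ Y) :
    d.D φ₁ ⊗ d.D φ₀ ⟶ d.D (φ₀ ≫ φ₁) :=
  (d.exists_mul φ₁ φ₀).choose

/-- The unit elements of the summands. -/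
noncomputable def unitMap {X Y : C} (σ : X ≅ Y) : 𝟙_ E ⟶ d.D σ.hom := (d.exists_elt σ).choose

/-- The operations of `ρ` on the summands. -/
noncomputable abbrev data : PlusData C E where
  obj f := d.D f.hom
  iso e := d.isoMap e
  comp φ₁ φ₀ := d.compMap φ₁ φ₀
  unit σ := d.unitMap σ

lemma iso_ι {f g : Arrow C} (e : f ≅ g) : d.data.iso e ≫ d.ι g.hom = d.ι f.hom ≫
    ρ.carrier.act (arrowLeftIso e) (arrowRightIso e) :=
  (d.exists_iso e).choose_spec

lemma square_ι {X Y X' Y' : C} {φ : X ⟶ Y} {φ' : X' ⟶ Y'}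
    (a : X ≅ X') (b : Y ≅ Y') (h : a.hom ≫ φ' = φ ≫ b.hom) :
    d.data.iso (square a b h) ≫ d.ι φ' = d.ι φ ≫ ρ.carrier.act a b :=
  d.iso_ι (square a b h)

lemma comp_ι {X Y Z : C} (φ₁ : Y ⟶ Z) (φ₀ : X ⟶ Y) :
    d.data.comp φ₁ φ₀ ≫ d.ι (φ₀ ≫ φ₁) = (d.ι φ₁ ⊗ₘ d.ι φ₀) ≫ ρ.mul X Y Z :=
  (d.exists_mul φ₁ φ₀).choose_spec.symm

lemma unit_ι {X Y : C} (σ : X ≅ Y) : d.data.unit σ ≫ d.ι σ.hom = ρ.elt σ :=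
  (d.exists_elt σ).choose_spec.symm

/-- Every relation is checked after composition with the monomorphism `d.ι`, where it becomes the
law of `ρ` of the same name, restricted to summands. -/
theorem isAlgebra : d.data.IsAlgebra where
  iso_id f := by
    rw [← cancel_mono (d.ι f.hom), d.iso_ι]
    refine (congrArg (_ ≫ ·) (Bimodule.act_refl _ _ _)).trans ?_
    exact (Category.comp_id _).trans (Category.id_comp _).symm
  iso_comp {f g h} e e' := by
    rw [← cancel_mono (d.ι h.hom), d.iso_ι, Category.assoc, d.iso_ι]
    refine (congrArg (d.ι f.hom ≫ ·) (ρ.carrier.act_trans (arrowLeftIso e) (arrowLeftIso e')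
      (arrowRightIso e) (arrowRightIso e'))).trans ?_
    exact (Category.assoc _ _ _).symm.trans ((congrArg (· ≫ _) (d.iso_ι e).symm).trans
      (Category.assoc _ _ _))
  equivariance a b c φ₁ φ₁' φ₀ φ₀' h₁ h₀ := by
    rw [← cancel_mono (d.ι (φ₀' ≫ φ₁')), Category.assoc, Category.assoc]
    refine (congrArg (_ ≫ ·) (d.comp_ι φ₁' φ₀')).trans ?_
    refine Eq.trans ?_ (congrArg (_ ≫ ·) (d.square_ι a c _)).symm
    rw [← Category.assoc (d.data.comp φ₁ φ₀), d.comp_ι, Category.assoc, ← ρ.mul_equivariant a b c,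
      ← Category.assoc, ← Category.assoc, tensorHom_comp_tensorHom, tensorHom_comp_tensorHom]
    exact congrArg₂ (fun s t => (s ⊗ₘ t) ≫ _) (d.square_ι b c h₁) (d.square_ι a b h₀)
  assoc {W X Y Z} φ₂ φ₁ φ₀ := by
    rw [← cancel_mono (d.ι ((φ₀ ≫ φ₁) ≫ φ₂))]
    simp only [Category.assoc]
    -- The isomorphism that corrects the bracketing has identities as its sides and acts trivially
    -- on `ρ`.
    have h₁ : d.data.iso (square (Iso.refl W) (Iso.refl Z) (φ := φ₀ ≫ φ₁ ≫ φ₂)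
        (φ' := (φ₀ ≫ φ₁) ≫ φ₂) (by simp)) ≫ d.ι ((φ₀ ≫ φ₁) ≫ φ₂) = d.ι (φ₀ ≫ φ₁ ≫ φ₂) := by
      rw [d.square_ι, Bimodule.act_refl, Category.comp_id]
    have h₂ : (d.data.comp φ₂ φ₁ ⊗ₘ 𝟙 (d.D φ₀)) ≫ (d.ι (φ₁ ≫ φ₂) ⊗ₘ d.ι φ₀) =
        ((d.ι φ₂ ⊗ₘ d.ι φ₁) ⊗ₘ d.ι φ₀) ≫ (ρ.mul X Y Z ▷ _) := by
      rw [← tensorHom_id, tensorHom_comp_tensorHom, tensorHom_comp_tensorHom, d.comp_ι,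
        Category.id_comp, Category.comp_id]
    have h₃ : (𝟙 (d.D φ₂) ⊗ₘ d.data.comp φ₁ φ₀) ≫ (d.ι φ₂ ⊗ₘ d.ι (φ₀ ≫ φ₁)) =
        (d.ι φ₂ ⊗ₘ (d.ι φ₁ ⊗ₘ d.ι φ₀)) ≫ (_ ◁ ρ.mul W X Y) := by
      rw [← id_tensorHom, tensorHom_comp_tensorHom, tensorHom_comp_tensorHom, d.comp_ι,
        Category.id_comp, Category.comp_id]
    have h₄ := ρ.mul_assoc W X Y Z
    refine (congrArg (fun t => _ ≫ _ ≫ t) h₁).trans ?_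
    refine (congrArg (_ ≫ ·) (d.comp_ι (φ₁ ≫ φ₂) φ₀)).trans ?_
    refine Eq.trans ?_ (congrArg (fun t => _ ≫ _ ≫ t) (d.comp_ι φ₂ (φ₀ ≫ φ₁))).symm
    refine (Category.assoc _ _ _).symm.trans ((congrArg (· ≫ _) h₂).trans ?_)
    refine Eq.trans ?_ (congrArg ((α_ (d.D φ₂) (d.D φ₁) (d.D φ₀)).hom ≫ ·)
      ((Category.assoc _ _ _).symm.trans ((congrArg (· ≫ ρ.mul W Y Z) h₃).trans
        (Category.assoc _ _ _)))).symm
    rw [Category.assoc, h₄, ← associator_naturality_assoc]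
  unit_equivariance τ τ' a b h := by
    rw [← cancel_mono (d.ι τ'.hom), Category.assoc]
    refine (congrArg (_ ≫ ·) (d.square_ι a b h)).trans ?_
    rw [← Category.assoc, d.unit_ι, ρ.elt_act τ τ' a b h, d.unit_ι]
  unit_right {X Y Z} φ σ := by
    rw [← cancel_mono (d.ι (σ.hom ≫ φ))]
    simp only [Category.assoc]
    refine (congrArg (fun t => _ ≫ _ ≫ t) (d.comp_ι φ σ.hom)).trans ?_
    rw [tensorHom_comp_tensorHom_assoc, Category.id_comp, d.unit_ι]
    refine Eq.trans ?_ (d.square_ι σ.symm (Iso.refl Z) (by simp)).symm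
    rw [← ρ.mul_one, rightUnitor_inv_naturality_assoc, MonoidalCategory.tensorHom_def,
      Category.assoc]
    rfl
  unit_left {X Y Z} σ φ := by
    rw [← cancel_mono (d.ι (φ ≫ σ.hom))]
    simp only [Category.assoc]
    refine (congrArg (fun t => _ ≫ _ ≫ t) (d.comp_ι σ.hom φ)).trans ?_
    rw [tensorHom_comp_tensorHom_assoc, Category.id_comp, d.unit_ι]
    refine Eq.trans ?_ (d.square_ι (Iso.refl X) σ (by simp)).symm
    rw [← ρ.one_mul, leftUnitor_inv_naturality_assoc, MonoidalCategory.tensorHom_def',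
      Category.assoc]
    rfl

/-- The algebra of summands. -/
noncomputable abbrev alg : PlusAlg C E := ⟨d.data, d.isAlgebra⟩

/-- The counit of the algebra of summands. -/
def counit : PlusData.Hom d.data (trivialData C E) where
  app f := d.ε f.hom
  iso_app {f g} e := by
    -- As `homι` is monic, compatibility of the counits can be verified in `Hom_C`, where it is the
    -- compatibility of `b` with the operation.
    rw [← cancel_mono (homι E g.hom)]
    have h₁ := congrArg (d.data.iso e ≫ ·) (d.ι_comp g.hom)
    have h₂ := congrArg (· ≫ Bimodule.comp b.hom _ _) (d.iso_ι e)
    have h₃ := congrArg (· ≫ (homMonoid C E).carrier.act (arrowLeftIso e) (arrowRightIso e))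
      (d.ι_comp f.hom)
    have h₄ := congrArg (d.ε f.hom ≫ ·) (homι_act (E := E) f.hom (arrowLeftIso e) (arrowRightIso e))
    refine (Category.assoc _ _ _).trans (h₁.symm.trans ((Category.assoc _ _ _).symm.trans
      (h₂.trans ((Category.assoc _ _ _).trans ?_))))
    refine (congrArg (_ ≫ ·) (Bimodule.act_comp b.hom _ _)).trans ?_
    refine (Category.assoc _ _ _).symm.trans (h₃.trans ((Category.assoc _ _ _).trans
      (h₄.trans ?_)))
    rw [arrowIso_w, Category.comp_id]
  comp_app {X Y Z} φ₁ φ₀ := by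
    rw [← cancel_mono (homι E (φ₀ ≫ φ₁))]
    have h₁ := congrArg (d.data.comp φ₁ φ₀ ≫ ·) (d.ι_comp (φ₀ ≫ φ₁))
    have h₂ := congrArg (· ≫ Bimodule.comp b.hom _ _) (d.comp_ι φ₁ φ₀)
    have h₃ := (b.mul_hom X Y Z).trans
      (congrArg ((Bimodule.comp b.hom Y Z ⊗ₘ Bimodule.comp b.hom X Y) ≫ ·)
        (homMonoidData_mul (E := E) X Y Z))
    refine (Category.assoc _ _ _).trans (h₁.symm.trans ((Category.assoc _ _ _).symm.trans
      (h₂.trans ((Category.assoc _ _ _).trans ((congrArg (_ ≫ ·) h₃).trans ?_)))))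
    refine (tensorHom_comp_tensorHom_assoc _ _ _ _ _).trans ?_
    refine (congrArg₂ (fun s t => (s ⊗ₘ t) ≫ homMul E X Y Z) (d.ι_comp φ₁) (d.ι_comp φ₀)).trans ?_
    refine (tensorHom_comp_tensorHom_assoc _ _ _ _ _).symm.trans ?_
    exact (congrArg (_ ≫ ·) (homι_homMul φ₁ φ₀)).trans (Category.assoc _ _ _).symm
  unit_app σ := by
    rw [← cancel_mono (homι E σ.hom)]
    have h₁ := congrArg (d.data.unit σ ≫ ·) (d.ι_comp σ.hom)
    have h₂ := congrArg (· ≫ Bimodule.comp b.hom _ _) (d.unit_ι σ)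
    exact (Category.assoc _ _ _).trans (h₁.symm.trans ((Category.assoc _ _ _).symm.trans
      (h₂.trans ((b.elt_hom σ).trans ((homMonoidData_elt σ).trans (Category.id_comp _).symm)))))

/-! ### Morphisms of bimodule monoids and of their summands -/

section Maps

/-- The component at `φ` of a morphism that respects the decompositions. -/
noncomputable def homMap {ρ' : BimoduleMonoid C E} {b' : ρ' ⟶ homMonoid C E}
    (d' : Decomposition ρ' b') (f : ρ ⟶ ρ') {X Y : C} {φ : X ⟶ Y}
    (hf : ∃ g : d.D φ ⟶ d'.D φ, d.ι φ ≫ Bimodule.comp f.hom X Y = g ≫ d'.ι φ) :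
    d.D φ ⟶ d'.D φ := hf.choose

lemma homMap_ι {ρ' : BimoduleMonoid C E} {b' : ρ' ⟶ homMonoid C E}
    (d' : Decomposition ρ' b') (f : ρ ⟶ ρ') {X Y : C} {φ : X ⟶ Y}
    (hf : ∃ g : d.D φ ⟶ d'.D φ, d.ι φ ≫ Bimodule.comp f.hom X Y = g ≫ d'.ι φ) :
    d.homMap d' f hf ≫ d'.ι φ = d.ι φ ≫ Bimodule.comp f.hom X Y := hf.choose_spec.symm

variable {d} {ρ' : BimoduleMonoid C E} {b' : ρ' ⟶ homMonoid C E} {d' : Decomposition ρ' b'}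

/-- The morphism of the summands that is induced by a morphism of bimodule monoids which respects
the decompositions. -/
noncomputable def homData (f : ρ ⟶ ρ') (hf : ∀ {X Y : C} (φ : X ⟶ Y), ∃ g : d.D φ ⟶ d'.D φ,
    d.ι φ ≫ Bimodule.comp f.hom X Y = g ≫ d'.ι φ) : PlusData.Hom d.data d'.data where
  app φ := d.homMap d' f (hf φ.hom)
  iso_app {φ ψ} e := by
    rw [← cancel_mono (d'.ι ψ.hom), Category.assoc, Category.assoc, d'.iso_ι, homMap_ι]
    have h₁ := congrArg (· ≫ Bimodule.comp f.hom _ _) (d.iso_ι e)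
    have h₂ := congrArg (· ≫ ρ'.carrier.act (arrowLeftIso e) (arrowRightIso e))
      (d.homMap_ι d' f (hf φ.hom))
    refine (Category.assoc _ _ _).symm.trans (h₁.trans ((Category.assoc _ _ _).trans ?_))
    refine (congrArg (_ ≫ ·) (Bimodule.act_comp f.hom _ _)).trans ?_
    exact (Category.assoc _ _ _).symm.trans (h₂.symm.trans (Category.assoc _ _ _))
  comp_app {X Y Z} φ₁ φ₀ := by
    rw [← cancel_mono (d'.ι (φ₀ ≫ φ₁)), Category.assoc, Category.assoc, d'.comp_ι]
    refine (congrArg (_ ≫ ·) (d.homMap_ι d' f (hf (φ₀ ≫ φ₁)))).trans ?_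
    have h₁ := congrArg (· ≫ Bimodule.comp f.hom _ _) (d.comp_ι φ₁ φ₀)
    refine (Category.assoc _ _ _).symm.trans (h₁.trans ((Category.assoc _ _ _).trans ?_))
    refine (congrArg (_ ≫ ·) (f.mul_hom X Y Z)).trans ?_
    rw [tensorHom_comp_tensorHom_assoc, tensorHom_comp_tensorHom_assoc]
    exact congrArg₂ (fun s t => (s ⊗ₘ t) ≫ _) (d.homMap_ι d' f (hf φ₁)).symm
      (d.homMap_ι d' f (hf φ₀)).symm
  unit_app σ := by
    rw [← cancel_mono (d'.ι σ.hom), Category.assoc, d'.unit_ι]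
    refine (congrArg (_ ≫ ·) (d.homMap_ι d' f (hf σ.hom))).trans ?_
    have h₁ := congrArg (· ≫ Bimodule.comp f.hom _ _) (d.unit_ι σ)
    exact (Category.assoc _ _ _).symm.trans (h₁.trans (f.elt_hom σ))

lemma homData_ι (f : ρ ⟶ ρ') (hf : ∀ {X Y : C} (φ : X ⟶ Y), ∃ g : d.D φ ⟶ d'.D φ,
    d.ι φ ≫ Bimodule.comp f.hom X Y = g ≫ d'.ι φ) (φ : Arrow C) :
    (homData f hf).app φ ≫ d'.ι φ.hom = d.ι φ.hom ≫ Bimodule.comp f.hom _ _ :=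
  d.homMap_ι d' f (hf φ.hom)

/-- A morphism over `Hom_C` preserves counits, because `homι` is monic. -/
lemma homData_counit (f : ρ ⟶ ρ') (hf : ∀ {X Y : C} (φ : X ⟶ Y), ∃ g : d.D φ ⟶ d'.D φ,
    d.ι φ ≫ Bimodule.comp f.hom X Y = g ≫ d'.ι φ) (h : f ≫ b' = b) (φ : Arrow C) :
    (homData f hf).app φ ≫ d'.ε φ.hom = d.ε φ.hom := by
  rw [← cancel_mono (homι E φ.hom)]
  have h₁ := congrArg ((homData f hf).app φ ≫ ·) (d'.ι_comp φ.hom)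
  have h₂ := congrArg (· ≫ Bimodule.comp b'.hom _ _) (homData_ι f hf φ)
  refine (Category.assoc _ _ _).trans (h₁.symm.trans ((Category.assoc _ _ _).symm.trans
    (h₂.trans ((Category.assoc _ _ _).trans ?_))))
  refine Eq.trans ?_ (d.ι_comp φ.hom)
  subst h
  rfl

/-- The components of the morphism of bimodule monoids that is given by a morphism of the
summands. -/
noncomputable def descAt (p : PlusData.Hom d.data d'.data) (X Y : C) :
    ρ.carrier.at X Y ⟶ ρ'.carrier.at X Y :=
  Cofan.IsColimit.desc (d.isColimit X Y) fun φ => p.app (Arrow.mk φ) ≫ d'.ι φ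

lemma ι_descAt (p : PlusData.Hom d.data d'.data) {X Y : C} (φ : X ⟶ Y) :
    d.ι φ ≫ descAt p X Y = p.app (Arrow.mk φ) ≫ d'.ι φ :=
  Cofan.IsColimit.fac (d.isColimit X Y) _ φ

lemma act_descAt (p : PlusData.Hom d.data d'.data) {X X' Y Y' : C} (a : X ≅ X') (b : Y ≅ Y') :
    ρ.carrier.act a b ≫ descAt p X' Y' = descAt p X Y ≫ ρ'.carrier.act a b := by
  apply d.hom_ext
  intro φ
  have h : a.hom ≫ a.inv ≫ φ ≫ b.hom = φ ≫ b.hom := a.hom_inv_id_assoc _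
  -- Only the commutative square is kept, so that the algebra law for `square a b h` applies as it
  -- stands.
  generalize a.inv ≫ φ ≫ b.hom = ψ at h
  refine (Category.assoc _ _ _).symm.trans ((congrArg (· ≫ _) (d.square_ι a b h)).symm.trans ?_)
  rw [Category.assoc, ι_descAt, ← Category.assoc, ← Category.assoc, ι_descAt]
  refine (congrArg (· ≫ _) (p.iso_app (square a b h))).trans ((Category.assoc _ _ _).trans ?_)
  exact (congrArg (_ ≫ ·) (d'.square_ι a b h)).trans (Category.assoc _ _ _).symm

lemma tensor_ext {X Y X' Y' : C} {A : E}
    {f g : ρ.carrier.at X Y ⊗ ρ'.carrier.at X' Y' ⟶ A}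
    (h : ∀ (φ : X ⟶ Y) (ψ : X' ⟶ Y'), (d.ι φ ⊗ₘ d'.ι ψ) ≫ f = (d.ι φ ⊗ₘ d'.ι ψ) ≫ g) : f = g :=
  cofan_tensor_ext (d.isColimit X Y) (d'.isColimit X' Y') h

/-- The morphism of bimodule monoids that is given by a morphism of the summands. -/
noncomputable def desc (p : PlusData.Hom d.data d'.data) : ρ ⟶ ρ' where
  hom := Bimodule.homMk (descAt p) (act_descAt p)
  mul_hom X Y Z := by
    apply d.tensor_ext (d' := d)
    intro φ₁ φ₀
    change _ ≫ _ ≫ descAt p X Z = _ ≫ (descAt p Y Z ⊗ₘ descAt p X Y) ≫ _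
    rw [← Category.assoc, ← d.comp_ι, Category.assoc, ι_descAt, tensorHom_comp_tensorHom_assoc,
      ι_descAt, ι_descAt, ← tensorHom_comp_tensorHom_assoc, ← d'.comp_ι, ← Category.assoc,
      p.comp_app, Category.assoc]
  elt_hom {X Y} σ := by
    change _ ≫ descAt p X Y = _
    rw [← d.unit_ι, Category.assoc, ι_descAt, ← Category.assoc, p.unit_app, d'.unit_ι]

lemma ι_desc (p : PlusData.Hom d.data d'.data) {X Y : C} (φ : X ⟶ Y) :
    d.ι φ ≫ Bimodule.comp (desc p).hom X Y = p.app (Arrow.mk φ) ≫ d'.ι φ :=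
  ι_descAt p φ

lemma desc_comp (p : PlusData.Hom d.data d'.data)
    (h : ∀ φ : Arrow C, p.app φ ≫ d'.ε φ.hom = d.ε φ.hom) : desc p ≫ b' = b := by
  apply BimoduleMonoid.Hom.ext
  apply Bimodule.hom_ext
  intro X Y
  apply d.hom_ext
  intro φ
  refine (Category.assoc _ _ _).symm.trans ((congrArg (· ≫ _) (ι_desc p φ)).trans ?_)
  refine Eq.trans ?_ (d.ι_comp φ).symm
  refine (Category.assoc _ _ _).trans ((congrArg (_ ≫ ·) (d'.ι_comp φ)).trans ?_)
  exact (Category.assoc _ _ _).symm.trans (congrArg (· ≫ _) (h (Arrow.mk φ)))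

end Maps

end Decomposition

/-- The algebra of summands of a counital bimodule monoid, over the trivial algebra. -/
noncomputable abbrev CounitalBimoduleMonoid.overAlg (A : CounitalBimoduleMonoid C E) :
    Over (trivialAlg C E) :=
  Over.mk (X := trivialAlg C E) (Y := A.dec.alg) A.dec.counit

/-- The morphism of the algebras of summands that is induced by a morphism. -/
noncomputable def CounitalBimoduleMonoid.Hom.algHom {A B : CounitalBimoduleMonoid C E}
    (f : CounitalBimoduleMonoid.Hom A B) : A.dec.alg ⟶ B.dec.alg :=
  Decomposition.homData f.hom.left f.exists_hom

lemma CounitalBimoduleMonoid.Hom.algHom_ι {A B : CounitalBimoduleMonoid C E}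
    (f : CounitalBimoduleMonoid.Hom A B) (φ : Arrow C) :
    PlusData.Hom.app f.algHom φ ≫ B.dec.ι φ.hom =
      A.dec.ι φ.hom ≫ Bimodule.comp f.hom.left.hom _ _ :=
  Decomposition.homData_ι f.hom.left f.exists_hom φ

/-- The components of `algHom` are chosen, but the equation with the monic inclusions determines
them. Functoriality and fullness of `summands` are read off from this criterion. -/
lemma CounitalBimoduleMonoid.Hom.algHom_eq_iff {A B : CounitalBimoduleMonoid C E}
    (f : CounitalBimoduleMonoid.Hom A B) (p : A.dec.alg ⟶ B.dec.alg) :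
    f.algHom = p ↔ ∀ φ : Arrow C, A.dec.ι φ.hom ≫ Bimodule.comp f.hom.left.hom _ _ =
      PlusData.Hom.app p φ ≫ B.dec.ι φ.hom := by
  constructor
  · rintro rfl φ
    exact (f.algHom_ι φ).symm
  · intro h
    apply PlusAlg.hom_ext
    intro φ
    rw [← cancel_mono (B.dec.ι φ.hom)]
    exact (f.algHom_ι φ).trans (h φ)

variable (C E) in
/-- The algebra of summands of a counital bimodule monoid. -/
noncomputable def summands : CounitalBimoduleMonoid C E ⥤ Over (trivialAlg C E) where
  obj A := A.overAlg
  map {A B} f := Over.homMk (U := A.overAlg) (V := B.overAlg)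
    (CounitalBimoduleMonoid.Hom.algHom f) (PlusAlg.hom_ext
      (Decomposition.homData_counit f.hom.left f.exists_hom (Over.w f.hom)))
  map_id A := by
    apply Over.OverMorphism.ext
    refine (CounitalBimoduleMonoid.Hom.algHom_eq_iff (𝟙 A : A ⟶ A) (𝟙 A.dec.alg)).2 fun φ => ?_
    exact (Category.comp_id _).trans (Category.id_comp _).symm
  map_comp {A B D} f g := by
    apply Over.OverMorphism.ext
    refine (CounitalBimoduleMonoid.Hom.algHom_eq_iff (f ≫ g : A ⟶ D)
      (f.algHom ≫ g.algHom : A.dec.alg ⟶ D.dec.alg)).2 fun φ => ?_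
    have h₁ := congrArg (· ≫ Bimodule.comp g.hom.left.hom _ _) (f.algHom_ι φ)
    have h₂ := congrArg (PlusData.Hom.app f.algHom φ ≫ ·) (g.algHom_ι φ)
    refine (Category.assoc _ _ _).symm.trans (h₁.symm.trans ((Category.assoc _ _ _).trans
      (h₂.symm.trans (Category.assoc _ _ _).symm)))

/-- A morphism out of the coproduct `ρ(X, Y)` is determined by its restrictions to the summands. -/
instance : (summands C E).Faithful where
  map_injective {A B} f g h := by
    have h' : f.algHom = g.algHom := congrArg (fun t => t.left) h
    apply CounitalBimoduleMonoid.Hom.ext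
    apply Over.OverMorphism.ext
    apply BimoduleMonoid.Hom.ext
    apply Bimodule.hom_ext
    intro X Y
    apply A.dec.hom_ext
    intro φ
    refine (f.algHom_ι (Arrow.mk φ)).symm.trans (Eq.trans ?_ (g.algHom_ι (Arrow.mk φ)))
    rw [h']

/-- A morphism of summands extends to the coproducts; it lies over `Hom_C` because it preserves the
counits. -/
instance : (summands C E).Full where
  map_surjective {A B} p := by
    let p' : PlusData.Hom A.dec.data B.dec.data := p.left
    have hp : ∀ φ : Arrow C, p'.app φ ≫ B.dec.ε φ.hom = A.dec.ε φ.hom := fun φ =>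
      congrArg (fun t : A.dec.alg ⟶ trivialAlg C E => PlusData.Hom.app t φ) (Over.w p)
    let f : CounitalBimoduleMonoid.Hom A B :=
      ⟨Over.homMk (Decomposition.desc p') (Decomposition.desc_comp p' hp),
        fun φ => ⟨p'.app (Arrow.mk φ), Decomposition.ι_desc p' φ⟩⟩
    refine ⟨f, ?_⟩
    apply Over.OverMorphism.ext
    exact (f.algHom_eq_iff p').2 fun φ => Decomposition.ι_desc p' φ.hom

end Decompositions


/-! ## The algebra of a decomposed lax monoidal bimodule monoid -/

section LaxDecompositions

variable {M : Type u} [Category.{v} M] [MonoidalCategory M] {E : Type uE} [Category.{vE} E]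
  [MonoidalCategory E] [BraidedCategory E] [HasCoproducts.{v} E] [TensorPreservesCoproducts.{v} E]
  [∀ F : (Core M)ᵒᵖ ⥤ Core M ⥤ E, HasCoend F] [MonoInclusions.{v} E]

namespace Decomposition

variable {ρ : LaxMonoidalBimoduleMonoid M E} {b : ρ.toBimoduleMonoid ⟶ homMonoid M E}
  (d : Decomposition ρ.toBimoduleMonoid b)

/-- The monoidal product respects the decomposition. -/
def RespectsTensor : Prop :=
  ∀ {X Y X' Y' : M} (φ : X ⟶ Y) (ψ : X' ⟶ Y'), ∃ g : d.D φ ⊗ d.D ψ ⟶ d.D (φ ⊗ₘ ψ),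
    (d.ι φ ⊗ₘ d.ι ψ) ≫ ρ.tensor X Y X' Y' = g ≫ d.ι _

variable {d} (ht : d.RespectsTensor)

/-- The monoidal product of the summands. -/
noncomputable def muMap {X Y X' Y' : M} (φ : X ⟶ Y) (ψ : X' ⟶ Y') :
    d.D φ ⊗ d.D ψ ⟶ d.D (φ ⊗ₘ ψ) := (ht φ ψ).choose

lemma muMap_ι {X Y X' Y' : M} (φ : X ⟶ Y) (ψ : X' ⟶ Y') :
    muMap ht φ ψ ≫ d.ι (φ ⊗ₘ ψ) = (d.ι φ ⊗ₘ d.ι ψ) ≫ ρ.tensor X Y X' Y' :=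
  (ht φ ψ).choose_spec.symm

/-- The operations of `ρ` on the summands. -/
noncomputable abbrev ncData : NcData M E where
  toPlusData := d.data
  mu f g := muMap ht f.hom g.hom

lemma mu_ι (f g : Arrow M) : (ncData ht).mu f g ≫ d.ι (f.hom ⊗ₘ g.hom) =
    (d.ι f.hom ⊗ₘ d.ι g.hom) ≫ ρ.tensor _ _ _ _ :=
  muMap_ι ht f.hom g.hom

/-- As for the plain relations: each law of the monoidal product of `ρ` is restricted to summands
and the monic inclusion is cancelled. -/
theorem isMultiplicative : (ncData ht).IsMultiplicative where
  equivariance {f g f' g'} e e' := by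
    rw [← cancel_mono (d.ι (g.hom ⊗ₘ g'.hom)), Category.assoc, Category.assoc]
    refine (congrArg (_ ≫ ·) (mu_ι ht g g')).trans ?_
    refine Eq.trans ?_ (congrArg (_ ≫ ·) (d.iso_ι (arrowTensorIso e e'))).symm
    refine Eq.trans ?_ ((Category.assoc _ _ _).symm.trans
      ((congrArg (· ≫ _) (mu_ι ht f f')).trans (Category.assoc _ _ _))).symm
    refine Eq.trans ?_ (congrArg (_ ≫ ·) (ρ.act_tensor (arrowLeftIso e) (arrowRightIso e)
      (arrowLeftIso e') (arrowRightIso e')))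
    refine (tensorHom_comp_tensorHom_assoc _ _ _ _ _).trans
      (Eq.trans ?_ (tensorHom_comp_tensorHom_assoc _ _ _ _ _).symm)
    exact congrArg₂ (fun s t => (s ⊗ₘ t) ≫ _) (d.iso_ι e) (d.iso_ι e')
  assoc f g h := by
    rw [← cancel_mono (d.ι (f.hom ⊗ₘ (g.hom ⊗ₘ h.hom)))]
    simp only [Category.assoc]
    have h₁ := congrArg ((ncData ht).mu (arrowTensor f g) h ≫ ·) (d.iso_ι (arrowAssoc f g h))
    have h₂ := congrArg (· ≫ ρ.carrier.act (arrowLeftIso (arrowAssoc f g h))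
      (arrowRightIso (arrowAssoc f g h))) (mu_ι ht (arrowTensor f g) h)
    have h₃ : ((ncData ht).mu f g ⊗ₘ 𝟙 (d.D h.hom)) ≫ (d.ι (f.hom ⊗ₘ g.hom) ⊗ₘ d.ι h.hom) =
        ((d.ι f.hom ⊗ₘ d.ι g.hom) ⊗ₘ d.ι h.hom) ≫ (ρ.tensor _ _ _ _ ▷ _) := by
      rw [← tensorHom_id, tensorHom_comp_tensorHom, tensorHom_comp_tensorHom, Category.id_comp,
        Category.comp_id]
      exact congrArg (· ⊗ₘ _) (mu_ι ht f g)
    have h₄ : (𝟙 (d.D f.hom) ⊗ₘ (ncData ht).mu g h) ≫ (d.ι f.hom ⊗ₘ d.ι (g.hom ⊗ₘ h.hom)) =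
        (d.ι f.hom ⊗ₘ (d.ι g.hom ⊗ₘ d.ι h.hom)) ≫ (_ ◁ ρ.tensor _ _ _ _) := by
      rw [← id_tensorHom, tensorHom_comp_tensorHom, tensorHom_comp_tensorHom, Category.id_comp,
        Category.comp_id]
      exact congrArg (_ ⊗ₘ ·) (mu_ι ht g h)
    have h₅ := ρ.tensor_assoc f.left f.right g.left g.right h.left h.right
    refine (congrArg (_ ≫ ·) (h₁.trans ((Category.assoc _ _ _).symm.trans
      (h₂.trans (Category.assoc _ _ _))))).trans ?_
    refine (Category.assoc _ _ _).symm.trans ((congrArg (· ≫ _) h₃).trans ?_)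
    refine ((Category.assoc _ _ _).trans (congrArg (_ ≫ ·) h₅)).trans ?_
    refine Eq.trans ?_ (congrArg (fun t => (α_ _ _ _).hom ≫ _ ≫ t)
      (mu_ι ht f (arrowTensor g h))).symm
    refine Eq.trans ?_ (congrArg (fun t => (α_ (d.D f.hom) (d.D g.hom) (d.D h.hom)).hom ≫ t)
      ((Category.assoc _ _ _).symm.trans ((congrArg (· ≫ ρ.tensor f.left f.right _ _) h₄).trans
        (Category.assoc _ _ _)))).symm
    exact associator_naturality_assoc _ _ _ _
  interchange {X Y Z X' Y' Z'} φ₁ φ₀ ψ₁ ψ₀ := by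
    rw [← cancel_mono (d.ι ((φ₀ ≫ φ₁) ⊗ₘ (ψ₀ ≫ ψ₁)))]
    simp only [Category.assoc]
    -- The two morphisms compared by `arrowInterchange` are equal in `M`, and the isomorphism
    -- between them acts trivially on `ρ`.
    have h₁ : d.data.iso (arrowInterchange φ₁ φ₀ ψ₁ ψ₀) ≫ d.ι ((φ₀ ≫ φ₁) ⊗ₘ (ψ₀ ≫ ψ₁)) =
        d.ι ((φ₀ ⊗ₘ ψ₀) ≫ (φ₁ ⊗ₘ ψ₁)) := by
      refine (d.iso_ι (arrowInterchange φ₁ φ₀ ψ₁ ψ₀)).trans ?_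
      exact (congrArg (_ ≫ ·) (ρ.carrier.act_refl _ _)).trans (Category.comp_id _)
    refine (congrArg (_ ≫ ·) (muMap_ι ht (φ₀ ≫ φ₁) (ψ₀ ≫ ψ₁))).trans ?_
    refine Eq.trans ?_ (congrArg (fun t => tensorμ _ _ _ _ ≫ _ ≫ t)
      ((congrArg (_ ≫ ·) h₁).trans (d.comp_ι (φ₁ ⊗ₘ ψ₁) (φ₀ ⊗ₘ ψ₀)))).symm
    refine (tensorHom_comp_tensorHom_assoc _ _ _ _ _).trans ?_
    refine (congrArg₂ (fun s t => (s ⊗ₘ t) ≫ _) (d.comp_ι φ₁ φ₀) (d.comp_ι ψ₁ ψ₀)).trans ?_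
    refine (tensorHom_comp_tensorHom_assoc _ _ _ _ _).symm.trans ?_
    refine (congrArg (_ ≫ ·) (ρ.interchange X Y Z X' Y' Z')).trans ?_
    refine (tensorμ_natural_assoc _ _ _ _ _).trans ?_
    refine congrArg (_ ≫ ·) ?_
    refine (tensorHom_comp_tensorHom_assoc _ _ _ _ _).trans
      (Eq.trans ?_ (tensorHom_comp_tensorHom_assoc _ _ _ _ _).symm)
    exact congrArg₂ (fun s t => (s ⊗ₘ t) ≫ _) (muMap_ι ht φ₁ ψ₁).symm (muMap_ι ht φ₀ ψ₀).symm
  unit_tensor {X Y X' Y'} σ σ' := by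
    refine d.cancel_ι (σ.hom ⊗ₘ σ'.hom) ?_
    refine (Category.assoc _ _ _).trans ((congrArg (_ ≫ ·) (Category.assoc _ _ _)).trans ?_)
    refine (congrArg (fun t => _ ≫ _ ≫ t) (muMap_ι ht σ.hom σ'.hom)).trans ?_
    refine (congrArg (_ ≫ ·) (tensorHom_comp_tensorHom_assoc _ _ _ _ _)).trans ?_
    refine (congrArg₂ (fun s t => (λ_ (𝟙_ E)).inv ≫ (s ⊗ₘ t) ≫ ρ.tensor X Y X' Y')
      (d.unit_ι σ) (d.unit_ι σ')).trans ?_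
    exact (ρ.elt_tensor_elt σ σ').trans (d.unit_ι (σ ⊗ᵢ σ')).symm
  unit_left f := by
    rw [← cancel_mono (d.ι f.hom)]
    simp only [Category.assoc]
    have h₁ := congrArg ((ncData ht).mu (Arrow.mk (𝟙 (𝟙_ M))) f ≫ ·)
      (d.iso_ι (arrowLeftUnitor f))
    have h₂ := congrArg (· ≫ ρ.carrier.act (arrowLeftIso (arrowLeftUnitor f))
      (arrowRightIso (arrowLeftUnitor f))) (mu_ι ht (Arrow.mk (𝟙 (𝟙_ M))) f)
    refine (congrArg (fun t => _ ≫ _ ≫ t) (h₁.trans ((Category.assoc _ _ _).symm.trans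
      (h₂.trans (Category.assoc _ _ _))))).trans ?_
    refine (congrArg (_ ≫ ·) (tensorHom_comp_tensorHom_assoc _ _ _ _ _)).trans ?_
    have h₃ : (d.unitMap (Iso.refl (𝟙_ M)) ≫ d.ι (𝟙 (𝟙_ M)) ⊗ₘ 𝟙 _ ≫ d.ι f.hom) =
        (𝟙_ E ◁ d.ι f.hom) ≫ (ρ.elt (Iso.refl (𝟙_ M)) ▷ _) := by
      rw [← MonoidalCategory.tensorHom_def', Category.id_comp]
      exact congrArg (· ⊗ₘ _) (d.unit_ι (Iso.refl (𝟙_ M)))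
    refine (congrArg (fun t => _ ≫ t ≫ _) h₃).trans ?_
    rw [Category.assoc, ← leftUnitor_inv_naturality_assoc]
    refine (congrArg (_ ≫ ·) (ρ.one_tensor f.left f.right)).trans ?_
    exact (Category.comp_id _).trans (Category.id_comp _).symm
  unit_right f := by
    rw [← cancel_mono (d.ι f.hom)]
    simp only [Category.assoc]
    have h₁ := congrArg ((ncData ht).mu f (Arrow.mk (𝟙 (𝟙_ M))) ≫ ·)
      (d.iso_ι (arrowRightUnitor f))
    have h₂ := congrArg (· ≫ ρ.carrier.act (arrowLeftIso (arrowRightUnitor f))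
      (arrowRightIso (arrowRightUnitor f))) (mu_ι ht f (Arrow.mk (𝟙 (𝟙_ M))))
    refine (congrArg (fun t => _ ≫ _ ≫ t) (h₁.trans ((Category.assoc _ _ _).symm.trans
      (h₂.trans (Category.assoc _ _ _))))).trans ?_
    refine (congrArg (_ ≫ ·) (tensorHom_comp_tensorHom_assoc _ _ _ _ _)).trans ?_
    have h₃ : (𝟙 _ ≫ d.ι f.hom ⊗ₘ d.unitMap (Iso.refl (𝟙_ M)) ≫ d.ι (𝟙 (𝟙_ M))) =
        (d.ι f.hom ▷ 𝟙_ E) ≫ (_ ◁ ρ.elt (Iso.refl (𝟙_ M))) := by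
      rw [← MonoidalCategory.tensorHom_def, Category.id_comp]
      exact congrArg (_ ⊗ₘ ·) (d.unit_ι (Iso.refl (𝟙_ M)))
    refine (congrArg (fun t => _ ≫ t ≫ _) h₃).trans ?_
    rw [Category.assoc, ← rightUnitor_inv_naturality_assoc]
    refine (congrArg (_ ≫ ·) (ρ.tensor_one f.left f.right)).trans ?_
    exact (Category.comp_id _).trans (Category.id_comp _).symm

/-- The nc algebra of summands. -/
noncomputable abbrev ncAlg : NcAlg M E := ⟨ncData ht, d.isAlgebra, isMultiplicative ht⟩

end Decomposition

namespace CounitalLaxBimoduleMonoid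

variable (A B : CounitalLaxBimoduleMonoid M E)

lemma respectsTensor : A.dec.RespectsTensor := A.exists_tensor

/-- The nc algebra of summands of a counital lax monoidal bimodule monoid. -/
noncomputable abbrev alg : NcAlg M E := Decomposition.ncAlg A.respectsTensor

/-- The counit of the nc algebra of summands. -/
noncomputable def counit : A.alg ⟶ trivialNcAlg M E where
  toHom := A.dec.counit
  mu_app f g := by
    have h₁ := congrArg (A.alg.mu f g ≫ ·) (A.dec.ι_comp (f.hom ⊗ₘ g.hom))
    have h₂ := congrArg (· ≫ Bimodule.comp A.obj.hom.hom _ _)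
      (Decomposition.mu_ι A.respectsTensor f g)
    have h₃ := A.obj.hom.tensor_hom f.left f.right g.left g.right
    refine (cancel_mono (homι E (f.hom ⊗ₘ g.hom))).1 ?_
    refine (Category.assoc _ _ _).trans (h₁.symm.trans ((Category.assoc _ _ _).symm.trans
      (h₂.trans ((Category.assoc _ _ _).trans ((congrArg (_ ≫ ·) h₃).trans ?_)))))
    refine (tensorHom_comp_tensorHom_assoc _ _ _ _ _).trans ?_
    refine (congrArg₂ (fun s t => (s ⊗ₘ t) ≫ homTensor E _ _ _ _) (A.dec.ι_comp f.hom)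
      (A.dec.ι_comp g.hom)).trans ?_
    refine (tensorHom_comp_tensorHom_assoc _ _ _ _ _).symm.trans ?_
    exact (congrArg (_ ≫ ·) (homι_homTensor f.hom g.hom)).trans (Category.assoc _ _ _).symm

/-- The nc algebra of summands, over the trivial algebra. -/
noncomputable abbrev overAlg : Over (trivialNcAlg M E) :=
  Over.mk (X := trivialNcAlg M E) (Y := A.alg) A.counit

variable {A B}

/-- The morphism of the algebras of summands that is induced by a morphism. -/
noncomputable def Hom.algHom (f : Hom A B) : A.alg ⟶ B.alg where
  toHom := Decomposition.homData f.hom.left.toHom f.exists_hom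
  mu_app φ ψ := by
    refine B.dec.cancel_ι (φ.hom ⊗ₘ ψ.hom) ?_
    have h₁ := congrArg (A.alg.mu φ ψ ≫ ·)
      (Decomposition.homData_ι f.hom.left.toHom f.exists_hom (arrowTensor φ ψ))
    have h₂ := congrArg (· ≫ Bimodule.comp f.hom.left.hom _ _)
      (Decomposition.mu_ι A.respectsTensor φ ψ)
    have h₃ := f.hom.left.tensor_hom φ.left φ.right ψ.left ψ.right
    refine (Category.assoc _ _ _).trans (h₁.trans ((Category.assoc _ _ _).symm.trans
      (h₂.trans ((Category.assoc _ _ _).trans ((congrArg (_ ≫ ·) h₃).trans ?_)))))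
    refine Eq.trans ?_ ((congrArg (_ ≫ ·) (Decomposition.mu_ι B.respectsTensor φ ψ)).symm.trans
      (Category.assoc _ _ _).symm)
    refine (tensorHom_comp_tensorHom_assoc _ _ _ _ _).trans
      (Eq.trans ?_ (tensorHom_comp_tensorHom_assoc _ _ _ _ _).symm)
    exact congrArg₂ (fun s t => (s ⊗ₘ t) ≫ B.obj.left.tensor _ _ _ _)
      (Decomposition.homData_ι f.hom.left.toHom f.exists_hom φ).symm
      (Decomposition.homData_ι f.hom.left.toHom f.exists_hom ψ).symm

lemma Hom.algHom_ι (f : Hom A B) (φ : Arrow M) :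
    f.algHom.app φ ≫ B.dec.ι φ.hom =
      A.dec.ι φ.hom ≫ Bimodule.comp f.hom.left.hom _ _ :=
  Decomposition.homData_ι f.hom.left.toHom f.exists_hom φ

lemma Hom.algHom_eq_iff (f : Hom A B) (p : A.alg ⟶ B.alg) :
    f.algHom = p ↔ ∀ φ : Arrow M, A.dec.ι φ.hom ≫ Bimodule.comp f.hom.left.hom _ _ =
      p.app φ ≫ B.dec.ι φ.hom := by
  constructor
  · rintro rfl φ
    exact (f.algHom_ι φ).symm
  · intro h
    apply NcAlg.hom_ext
    intro φ
    refine B.dec.cancel_ι φ.hom ?_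
    exact (f.algHom_ι φ).trans (h φ)

/-- The morphism of lax monoidal bimodule monoids that is given by a morphism of the summands. -/
noncomputable def desc (p : A.alg ⟶ B.alg) : A.obj.left ⟶ B.obj.left where
  toHom := Decomposition.desc p.toHom
  tensor_hom X Y X' Y' := by
    apply A.dec.tensor_ext (d' := A.dec)
    intro φ ψ
    have h₁ := congrArg (· ≫ Bimodule.comp (Decomposition.desc p.toHom).hom _ _)
      (Decomposition.muMap_ι A.respectsTensor φ ψ)
    have h₂ := congrArg (Decomposition.muMap A.respectsTensor φ ψ ≫ ·)
      (Decomposition.ι_desc p.toHom (φ ⊗ₘ ψ))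
    have h₃ := congrArg (· ≫ B.dec.ι (φ ⊗ₘ ψ)) (p.mu_app (Arrow.mk φ) (Arrow.mk ψ))
    refine (Category.assoc _ _ _).symm.trans (h₁.symm.trans ((Category.assoc _ _ _).trans
      (h₂.trans ((Category.assoc _ _ _).symm.trans (h₃.trans ?_)))))
    refine (Category.assoc _ _ _).trans ((congrArg (_ ≫ ·)
      (Decomposition.muMap_ι B.respectsTensor φ ψ)).trans ?_)
    refine (tensorHom_comp_tensorHom_assoc _ _ _ _ _).trans
      (Eq.trans ?_ (tensorHom_comp_tensorHom_assoc _ _ _ _ _).symm)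
    exact congrArg₂ (fun s t => (s ⊗ₘ t) ≫ B.obj.left.tensor X Y X' Y')
      (Decomposition.ι_desc p.toHom φ).symm (Decomposition.ι_desc p.toHom ψ).symm

end CounitalLaxBimoduleMonoid

variable (M E) in
/-- The nc algebra of summands of a counital lax monoidal bimodule monoid. -/
noncomputable def laxSummands : CounitalLaxBimoduleMonoid M E ⥤ Over (trivialNcAlg M E) where
  obj A := A.overAlg
  map {A B} f := Over.homMk (U := A.overAlg) (V := B.overAlg)
    (CounitalLaxBimoduleMonoid.Hom.algHom f) (NcAlg.hom_ext
      (Decomposition.homData_counit f.hom.left.toHom f.exists_hom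
        (congrArg LaxMonoidalBimoduleMonoid.Hom.toHom (Over.w f.hom))))
  map_id A := by
    apply Over.OverMorphism.ext
    refine (CounitalLaxBimoduleMonoid.Hom.algHom_eq_iff (𝟙 A : A ⟶ A) (𝟙 A.alg)).2 fun φ => ?_
    exact (Category.comp_id _).trans (Category.id_comp _).symm
  map_comp {A B D} f g := by
    apply Over.OverMorphism.ext
    refine (CounitalLaxBimoduleMonoid.Hom.algHom_eq_iff (f ≫ g : A ⟶ D)
      (f.algHom ≫ g.algHom : A.alg ⟶ D.alg)).2 fun φ => ?_
    have h₁ := congrArg (· ≫ Bimodule.comp g.hom.left.hom _ _) (f.algHom_ι φ)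
    have h₂ := congrArg (f.algHom.app φ ≫ ·) (g.algHom_ι φ)
    refine (Category.assoc _ _ _).symm.trans (h₁.symm.trans ((Category.assoc _ _ _).trans
      (h₂.symm.trans (Category.assoc _ _ _).symm)))

instance : (laxSummands M E).Faithful where
  map_injective {A B} f g h := by
    have h' : f.algHom = g.algHom := congrArg (fun t => t.left) h
    apply CounitalLaxBimoduleMonoid.Hom.ext
    apply Over.OverMorphism.ext
    apply LaxMonoidalBimoduleMonoid.Hom.ext
    apply Bimodule.hom_ext
    intro X Y
    apply A.dec.hom_ext
    intro φ
    refine (f.algHom_ι (Arrow.mk φ)).symm.trans (Eq.trans ?_ (g.algHom_ι (Arrow.mk φ)))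
    rw [h']

instance : (laxSummands M E).Full where
  map_surjective {A B} p := by
    let p' : A.alg ⟶ B.alg := p.left
    have hp : ∀ φ : Arrow M, p'.app φ ≫ B.dec.ε φ.hom = A.dec.ε φ.hom := fun φ =>
      congrArg (fun t : A.alg ⟶ trivialNcAlg M E => t.app φ) (Over.w p)
    have hw : CounitalLaxBimoduleMonoid.desc p' ≫ B.obj.hom = A.obj.hom :=
      LaxMonoidalBimoduleMonoid.Hom.ext
        (congrArg BimoduleMonoid.Hom.hom (Decomposition.desc_comp p'.toHom hp))
    let f : CounitalLaxBimoduleMonoid.Hom A B :=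
      ⟨Over.homMk (CounitalLaxBimoduleMonoid.desc p') hw,
        fun φ => ⟨p'.app (Arrow.mk φ), Decomposition.ι_desc p'.toHom φ⟩⟩
    refine ⟨f, ?_⟩
    apply Over.OverMorphism.ext
    exact (f.algHom_eq_iff p').2 fun φ => Decomposition.ι_desc p'.toHom φ.hom

/-- The restriction of `μ` to summands is unique because `ι` is monic, so the invertible one whose
existence is required is the chosen one. -/
lemma CounitalLaxBimoduleMonoid.isStrong_iff (A : CounitalLaxBimoduleMonoid M E) :
    CounitalLaxBimoduleMonoid.IsStrong A ↔ A.alg.IsStrong := by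
  constructor
  · intro h f g
    obtain ⟨k, hk, hk'⟩ := h f.hom g.hom
    have : A.alg.mu f g = k := by
      refine A.dec.cancel_ι (f.hom ⊗ₘ g.hom) (Eq.trans ?_ hk')
      exact Decomposition.mu_ι A.respectsTensor f g
    rwa [this]
  · intro h X Y X' Y' φ ψ
    exact ⟨_, h (Arrow.mk φ) (Arrow.mk ψ), (Decomposition.muMap_ι A.respectsTensor φ ψ).symm⟩

/-- The two sides of the commutativity law for summands, composed with the inclusion, are the
restrictions of the two sides of the law for `ρ`. One direction cancels the inclusion; the other
uses that the inclusions of `D(φ) ⊗ D(ψ)` are jointly epic. -/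
lemma CounitalLaxBimoduleMonoid.isSymmetric_iff [SymmetricCategory M]
    (A : CounitalLaxBimoduleMonoid M E) :
    CounitalLaxBimoduleMonoid.IsSymmetric A ↔ A.alg.IsCommutative := by
  have h₁ : ∀ f g : Arrow M, (A.alg.mu f g ≫ A.alg.iso (arrowBraiding f g)) ≫
      A.dec.ι (g.hom ⊗ₘ f.hom) = (A.dec.ι f.hom ⊗ₘ A.dec.ι g.hom) ≫
        A.obj.left.tensor _ _ _ _ ≫ A.obj.left.carrier.act (β_ f.left g.left)
          (β_ f.right g.right) := fun f g => by
    refine (Category.assoc _ _ _).trans ((congrArg (_ ≫ ·)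
      (A.dec.iso_ι (arrowBraiding f g))).trans ?_)
    exact (Category.assoc _ _ _).symm.trans ((congrArg (· ≫ _)
      (Decomposition.mu_ι A.respectsTensor f g)).trans (Category.assoc _ _ _))
  have h₂ : ∀ f g : Arrow M, ((β_ _ _).hom ≫ A.alg.mu g f) ≫
      A.dec.ι (g.hom ⊗ₘ f.hom) = (A.dec.ι f.hom ⊗ₘ A.dec.ι g.hom) ≫
        (β_ _ _).hom ≫ A.obj.left.tensor _ _ _ _ := fun f g => by
    refine (Category.assoc _ _ _).trans ((congrArg (_ ≫ ·)
      (Decomposition.mu_ι A.respectsTensor g f)).trans ?_)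
    exact (BraidedCategory.braiding_naturality_assoc _ _ _).symm
  constructor
  · intro h f g
    refine A.dec.cancel_ι (g.hom ⊗ₘ f.hom) ?_
    exact (h₁ f g).trans ((congrArg (_ ≫ ·) (h _ _ _ _)).trans (h₂ f g).symm)
  · intro h X Y X' Y'
    apply A.dec.tensor_ext (d' := A.dec)
    intro φ ψ
    refine (h₁ (Arrow.mk φ) (Arrow.mk ψ)).symm.trans (Eq.trans ?_ (h₂ (Arrow.mk φ) (Arrow.mk ψ)))
    exact congrArg (· ≫ _) (h (Arrow.mk φ) (Arrow.mk ψ))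

end LaxDecompositions


/-! ## The bimodule monoid of an algebra -/

section Realization

variable {C : Type u} [Category.{v} C] {E : Type uE} [Category.{vE} E] [MonoidalCategory E]
  [HasCoproducts.{v} E]

namespace PlusAlg

variable (A : PlusAlg C E)

/-- The coproduct of the values of an algebra on all morphisms `X ⟶ Y`. -/
noncomputable abbrev total (X Y : C) : E := ∐ fun φ : X ⟶ Y => A.obj (Arrow.mk φ)

/-- The inclusion of a summand. -/
noncomputable abbrev totalι {X Y : C} (φ : X ⟶ Y) : A.obj (Arrow.mk φ) ⟶ A.total X Y :=
  Sigma.ι (fun φ : X ⟶ Y => A.obj (Arrow.mk φ)) φ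

variable {A} in
lemma total_ext {X Y : C} {Z : E} {f g : A.total X Y ⟶ Z}
    (h : ∀ φ : X ⟶ Y, A.totalι φ ≫ f = A.totalι φ ≫ g) : f = g :=
  Sigma.hom_ext _ _ h

/-- The action of the isomorphisms on the coproducts. -/
noncomputable def totalAct {X X' Y Y' : C} (a : X ≅ X') (b : Y ≅ Y') :
    A.total X Y ⟶ A.total X' Y' :=
  Sigma.desc fun φ => A.iso (square a b (φ := φ) (φ' := a.inv ≫ φ ≫ b.hom) (by simp)) ≫ A.totalι _

/-- Stated for any `ψ` that completes the square, so that no transport along `a⁻¹ φ b = ψ` is needed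
in later use. -/
lemma totalι_totalAct {X X' Y Y' : C} (a : X ≅ X') (b : Y ≅ Y') {φ : X ⟶ Y} {ψ : X' ⟶ Y'}
    (h : a.hom ≫ ψ = φ ≫ b.hom) :
    A.totalι φ ≫ A.totalAct a b = A.iso (square a b h) ≫ A.totalι ψ := by
  obtain rfl : a.inv ≫ φ ≫ b.hom = ψ := by rw [← h, Iso.inv_hom_id_assoc]
  exact Sigma.ι_desc _ _

lemma totalAct_refl (X Y : C) : A.totalAct (Iso.refl X) (Iso.refl Y) = 𝟙 _ := by
  apply total_ext
  intro φ
  rw [A.totalι_totalAct (Iso.refl X) (Iso.refl Y) (φ := φ) (ψ := φ) (by simp)]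
  exact (congrArg (· ≫ _) (A.isAlgebra.iso_id (Arrow.mk φ))).trans
    ((Category.id_comp _).trans (Category.comp_id _).symm)

lemma totalAct_trans {X X' X'' Y Y' Y'' : C} (a : X ≅ X') (a' : X' ≅ X'')
    (b : Y ≅ Y') (b' : Y' ≅ Y'') :
    A.totalAct (a ≪≫ a') (b ≪≫ b') = A.totalAct a b ≫ A.totalAct a' b' := by
  apply total_ext
  intro φ
  have h : a.hom ≫ a.inv ≫ φ ≫ b.hom = φ ≫ b.hom := a.hom_inv_id_assoc _
  generalize a.inv ≫ φ ≫ b.hom = ψ at h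
  have h' : a'.hom ≫ a'.inv ≫ ψ ≫ b'.hom = ψ ≫ b'.hom := a'.hom_inv_id_assoc _
  generalize a'.inv ≫ ψ ≫ b'.hom = χ at h'
  have h'' : (a ≪≫ a').hom ≫ χ = φ ≫ (b ≪≫ b').hom := by
    rw [Iso.trans_hom, Iso.trans_hom, Category.assoc, h', ← Category.assoc, h, Category.assoc]
  rw [← Category.assoc, A.totalι_totalAct a b h, Category.assoc, A.totalι_totalAct a' b' h',
    A.totalι_totalAct (a ≪≫ a') (b ≪≫ b') h'', ← Category.assoc]
  exact congrArg (· ≫ _) (A.isAlgebra.iso_comp (square a b h) (square a' b' h'))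

/-- The bimodule of an algebra. -/
noncomputable abbrev bimodule : Bimodule C E :=
  Bimodule.ofAct A.total A.totalAct A.totalAct_refl A.totalAct_trans

lemma bimodule_act {X X' Y Y' : C} (a : X ≅ X') (b : Y ≅ Y') :
    A.bimodule.act a b = A.totalAct a b :=
  Bimodule.ofAct_act _ _ _ _ a b

lemma totalι_act {X X' Y Y' : C} (a : X ≅ X') (b : Y ≅ Y') {φ : X ⟶ Y} {ψ : X' ⟶ Y'}
    (h : a.hom ≫ ψ = φ ≫ b.hom) :
    A.totalι φ ≫ A.bimodule.act a b = A.iso (square a b h) ≫ A.totalι ψ :=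
  (congrArg (_ ≫ ·) (A.bimodule_act a b)).trans (A.totalι_totalAct a b h)

/-- If the sides of a square are identities then `φ = ψ`, and the isomorphism between the summands
is invisible in the coproduct. In this way the bracketing isomorphisms in the relations disappear.
-/
lemma totalι_eq {X Y : C} {φ ψ : X ⟶ Y}
    (h : (Iso.refl X).hom ≫ ψ = φ ≫ (Iso.refl Y).hom) :
    A.iso (square (Iso.refl X) (Iso.refl Y) h) ≫ A.totalι ψ = A.totalι φ := by
  rw [← A.totalι_totalAct _ _ h, A.totalAct_refl, Category.comp_id]

variable [TensorPreservesCoproducts.{v} E]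

/-- The composition on the coproducts. -/
noncomputable def totalMul (X Y Z : C) : A.total Y Z ⊗ A.total X Y ⟶ A.total X Z :=
  (exists_tensor_desc fun (φ₁ : Y ⟶ Z) (φ₀ : X ⟶ Y) =>
    A.comp φ₁ φ₀ ≫ A.totalι (φ₀ ≫ φ₁)).choose

lemma totalι_totalMul {X Y Z : C} (φ₁ : Y ⟶ Z) (φ₀ : X ⟶ Y) :
    (A.totalι φ₁ ⊗ₘ A.totalι φ₀) ≫ A.totalMul X Y Z = A.comp φ₁ φ₀ ≫ A.totalι (φ₀ ≫ φ₁) :=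
  (exists_tensor_desc fun (φ₁ : Y ⟶ Z) (φ₀ : X ⟶ Y) =>
    A.comp φ₁ φ₀ ≫ A.totalι (φ₀ ≫ φ₁)).choose_spec φ₁ φ₀

/-- Equivariance of `γ` on each pair of summands, which is what makes the composition descend to the
plethysm product. -/
lemma totalMul_equivariant : IsEquivariant (P := A.bimodule) (Q := A.bimodule) (R := A.bimodule)
    A.totalMul := by
  intro X Y Z X' Y' Z' a b c
  apply tensor_hom_ext
  intro (φ₁ : Y ⟶ Z) (φ₀ : X ⟶ Y)
  have h₁ : b.hom ≫ b.inv ≫ φ₁ ≫ c.hom = φ₁ ≫ c.hom := b.hom_inv_id_assoc _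
  generalize b.inv ≫ φ₁ ≫ c.hom = φ₁' at h₁
  have h₀ : a.hom ≫ a.inv ≫ φ₀ ≫ b.hom = φ₀ ≫ b.hom := a.hom_inv_id_assoc _
  generalize a.inv ≫ φ₀ ≫ b.hom = φ₀' at h₀
  have h₂ : a.hom ≫ φ₀' ≫ φ₁' = (φ₀ ≫ φ₁) ≫ c.hom := by
    rw [← Category.assoc, h₀, Category.assoc, h₁, Category.assoc]
  refine (tensorHom_comp_tensorHom_assoc _ _ _ _ _).trans ?_
  refine (congrArg₂ (fun s t => (s ⊗ₘ t) ≫ A.totalMul X' Y' Z') (A.totalι_act b c h₁)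
    (A.totalι_act a b h₀)).trans ?_
  refine (tensorHom_comp_tensorHom_assoc _ _ _ _ _).symm.trans ?_
  refine (congrArg (_ ≫ ·) (A.totalι_totalMul φ₁' φ₀')).trans ?_
  refine Eq.trans ?_ ((Category.assoc _ _ _).symm.trans
    ((congrArg (· ≫ _) (A.totalι_totalMul φ₁ φ₀)).trans (Category.assoc _ _ _))).symm
  refine Eq.trans ?_ (congrArg (_ ≫ ·) (A.totalι_act a c h₂)).symm
  exact (Category.assoc _ _ _).symm.trans ((congrArg (· ≫ _)
    (A.isAlgebra.equivariance a b c φ₁ φ₁' φ₀ φ₀' h₁ h₀)).trans (Category.assoc _ _ _))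

variable [∀ F : (Core C)ᵒᵖ ⥤ Core C ⥤ E, HasCoend F]

/-- The components of the unit on the coproducts. -/
noncomputable def totalUnitAt (X Y : C) : (isoBimodule C E).at X Y ⟶ A.total X Y :=
  Sigma.desc fun σ : Core.mk X ⟶ Core.mk Y => A.unit σ.iso ≫ A.totalι σ.iso.hom

lemma isoι_totalUnitAt {X Y : C} (σ : X ≅ Y) :
    isoι E σ ≫ A.totalUnitAt X Y = A.unit σ ≫ A.totalι σ.hom :=
  Sigma.ι_desc _ _

/-- The unit on the coproducts. -/
noncomputable def totalUnit : isoBimodule C E ⟶ A.bimodule :=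
  Bimodule.homMk A.totalUnitAt fun {X X' Y Y'} a b => by
    apply iso_ext
    intro σ
    have h : a.hom ≫ (a.symm ≪≫ σ ≪≫ b).hom = σ.hom ≫ b.hom := by simp
    refine (Category.assoc _ _ _).symm.trans ((congrArg (· ≫ _) (isoι_act σ a b)).trans ?_)
    refine (A.isoι_totalUnitAt _).trans ?_
    refine Eq.trans ?_ ((Category.assoc _ _ _).symm.trans
      ((congrArg (· ≫ _) (A.isoι_totalUnitAt σ)).trans (Category.assoc _ _ _))).symm
    refine Eq.trans ?_ (congrArg (_ ≫ ·) (A.totalι_act a b h)).symm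
    exact (congrArg (· ≫ _) (A.isAlgebra.unit_equivariance σ _ a b h)).symm.trans
      (Category.assoc _ _ _)

/-- The composition and the unit on the bimodule of an algebra. -/
noncomputable abbrev bimoduleMonoidData : BimoduleMonoidData C E where
  carrier := A.bimodule
  γ := plethysmDesc A.totalMul A.totalMul_equivariant
  u := A.totalUnit

lemma bimoduleMonoidData_mul (X Y Z : C) : A.bimoduleMonoidData.mul X Y Z = A.totalMul X Y Z :=
  plethysmι_desc (P := A.bimodule) (Q := A.bimodule) (R := A.bimodule) A.totalMul
    A.totalMul_equivariant X Y Z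

lemma bimoduleMonoidData_elt {X Y : C} (σ : X ≅ Y) :
    A.bimoduleMonoidData.elt σ = A.unit σ ≫ A.totalι σ.hom :=
  A.isoι_totalUnitAt σ

lemma totalι_mul {X Y Z : C} (φ₁ : Y ⟶ Z) (φ₀ : X ⟶ Y) :
    (A.totalι φ₁ ⊗ₘ A.totalι φ₀) ≫ A.bimoduleMonoidData.mul X Y Z =
      A.comp φ₁ φ₀ ≫ A.totalι (φ₀ ≫ φ₁) :=
  (congrArg (_ ≫ ·) (A.bimoduleMonoidData_mul X Y Z)).trans (A.totalι_totalMul φ₁ φ₀)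

lemma totalMul_assoc (W X Y Z : C) :
    (A.totalMul X Y Z ▷ A.total W X) ≫ A.totalMul W X Z =
      (α_ _ _ _).hom ≫ (A.total Y Z ◁ A.totalMul W X Y) ≫ A.totalMul W Y Z := by
  refine cofan_tensor_ext₃ (coproductIsCoproduct _) (coproductIsCoproduct _)
    (coproductIsCoproduct _) ?_
  intro φ₂ φ₁ φ₀
  change ((A.totalι φ₂ ⊗ₘ A.totalι φ₁) ⊗ₘ A.totalι φ₀) ≫ _ =
    ((A.totalι φ₂ ⊗ₘ A.totalι φ₁) ⊗ₘ A.totalι φ₀) ≫ _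
  rw [← tensorHom_id, ← id_tensorHom, tensorHom_comp_tensorHom_assoc, associator_naturality_assoc,
    tensorHom_comp_tensorHom_assoc, A.totalι_totalMul, A.totalι_totalMul, Category.comp_id,
    Category.comp_id]
  have h₁ : (A.comp φ₂ φ₁ ≫ A.totalι (φ₁ ≫ φ₂) ⊗ₘ A.totalι φ₀) ≫ A.totalMul W X Z =
      (A.comp φ₂ φ₁ ⊗ₘ 𝟙 _) ≫ A.comp (φ₁ ≫ φ₂) φ₀ ≫ A.totalι (φ₀ ≫ φ₁ ≫ φ₂) := by
    rw [← A.totalι_totalMul (φ₁ ≫ φ₂), tensorHom_comp_tensorHom_assoc, Category.id_comp]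
  have h₂ : (A.totalι φ₂ ⊗ₘ A.comp φ₁ φ₀ ≫ A.totalι (φ₀ ≫ φ₁)) ≫ A.totalMul W Y Z =
      (𝟙 _ ⊗ₘ A.comp φ₁ φ₀) ≫ A.comp φ₂ (φ₀ ≫ φ₁) ≫ A.totalι ((φ₀ ≫ φ₁) ≫ φ₂) := by
    rw [← A.totalι_totalMul φ₂, tensorHom_comp_tensorHom_assoc, Category.id_comp]
  -- The associativity relation of the algebra, with the comparison of the two bracketings absorbed
  -- by the inclusion into the coproduct.
  have h₃ := congrArg (· ≫ A.totalι ((φ₀ ≫ φ₁) ≫ φ₂)) (A.isAlgebra.assoc φ₂ φ₁ φ₀)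
  simp only [Category.assoc] at h₃
  rw [A.totalι_eq] at h₃
  rw [h₁, h₂]
  exact h₃

lemma one_totalMul (X : C) {Y Z : C} (σ : Y ≅ Z) :
    (λ_ (A.total X Y)).inv ≫ ((A.unit σ ≫ A.totalι σ.hom) ▷ A.total X Y) ≫ A.totalMul X Y Z =
      A.bimodule.act (Iso.refl X) σ := by
  apply total_ext
  intro φ
  refine Eq.trans ?_ (A.totalι_act (Iso.refl X) σ (φ := φ) (ψ := φ ≫ σ.hom) (by simp)).symm
  rw [leftUnitor_inv_naturality_assoc, ← tensorHom_def'_assoc]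
  have h : (A.unit σ ≫ A.totalι σ.hom ⊗ₘ A.totalι φ) ≫ A.totalMul X Y Z =
      (A.unit σ ⊗ₘ 𝟙 _) ≫ A.comp σ.hom φ ≫ A.totalι (φ ≫ σ.hom) := by
    rw [← A.totalι_totalMul, tensorHom_comp_tensorHom_assoc, Category.id_comp]
  rw [h]
  have := congrArg (· ≫ A.totalι (φ ≫ σ.hom)) (A.isAlgebra.unit_left σ φ)
  simpa only [Category.assoc] using this

lemma totalMul_one {X Y : C} (σ : X ≅ Y) (Z : C) :
    (ρ_ (A.total Y Z)).inv ≫ (A.total Y Z ◁ (A.unit σ ≫ A.totalι σ.hom)) ≫ A.totalMul X Y Z =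
      A.bimodule.act σ.symm (Iso.refl Z) := by
  apply total_ext
  intro φ
  refine Eq.trans ?_ (A.totalι_act σ.symm (Iso.refl Z) (φ := φ) (ψ := σ.hom ≫ φ) (by simp)).symm
  rw [rightUnitor_inv_naturality_assoc, ← MonoidalCategory.tensorHom_def_assoc]
  have h : (A.totalι φ ⊗ₘ A.unit σ ≫ A.totalι σ.hom) ≫ A.totalMul X Y Z =
      (𝟙 _ ⊗ₘ A.unit σ) ≫ A.comp φ σ.hom ≫ A.totalι (σ.hom ≫ φ) := by
    rw [← A.totalι_totalMul, tensorHom_comp_tensorHom_assoc, Category.id_comp]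
  rw [h]
  have := congrArg (· ≫ A.totalι (σ.hom ≫ φ)) (A.isAlgebra.unit_right φ σ)
  simpa only [Category.assoc] using this

/-- The bimodule monoid of an algebra. -/
noncomputable abbrev bimoduleMonoid : BimoduleMonoid C E where
  toBimoduleMonoidData := A.bimoduleMonoidData
  mul_assoc W X Y Z := by
    simp only [bimoduleMonoidData_mul]
    exact A.totalMul_assoc W X Y Z
  one_mul X {Y Z} σ := by
    rw [bimoduleMonoidData_mul, bimoduleMonoidData_elt]
    exact A.one_totalMul X σ
  mul_one σ Z := by
    rw [bimoduleMonoidData_mul, bimoduleMonoidData_elt]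
    exact A.totalMul_one σ Z

variable {A} (p : PlusData.Hom A.toPlusData (trivialData C E))

/-- The components of the morphism from the bimodule monoid of an algebra to `Hom_C`. -/
noncomputable def totalCounit (X Y : C) : A.total X Y ⟶ (homBimodule C E).at X Y :=
  Sigma.desc fun φ => p.app (Arrow.mk φ) ≫ homι E φ

lemma totalι_totalCounit {X Y : C} (φ : X ⟶ Y) :
    A.totalι φ ≫ totalCounit p X Y = p.app (Arrow.mk φ) ≫ homι E φ :=
  Sigma.ι_desc _ _

/-- The morphism from the bimodule monoid of an algebra to `Hom_C`. -/
noncomputable def bimoduleMonoidCounit : A.bimoduleMonoid ⟶ homMonoid C E where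
  hom := Bimodule.homMk (totalCounit p) fun a b => by
    apply total_ext
    intro φ
    have h : a.hom ≫ a.inv ≫ φ ≫ b.hom = φ ≫ b.hom := a.hom_inv_id_assoc _
    refine (Category.assoc _ _ _).symm.trans ((congrArg (· ≫ _) (A.totalι_act a b h)).trans ?_)
    refine (Category.assoc _ _ _).trans ((congrArg (_ ≫ ·) (totalι_totalCounit p _)).trans ?_)
    refine Eq.trans ?_ ((Category.assoc _ _ _).symm.trans
      ((congrArg (· ≫ _) (totalι_totalCounit p φ)).trans (Category.assoc _ _ _))).symm
    refine Eq.trans ?_ (congrArg (_ ≫ ·) (homι_act φ a b)).symm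
    refine (Category.assoc _ _ _).symm.trans (congrArg (· ≫ _) ?_)
    exact (p.iso_app (square a b h)).trans (Category.comp_id _)
  mul_hom X Y Z := by
    apply tensor_hom_ext
    intro (φ₁ : Y ⟶ Z) (φ₀ : X ⟶ Y)
    refine (Category.assoc _ _ _).symm.trans ((congrArg (· ≫ _) (A.totalι_mul φ₁ φ₀)).trans ?_)
    refine (Category.assoc _ _ _).trans ((congrArg (_ ≫ ·) (totalι_totalCounit p _)).trans ?_)
    refine Eq.trans ?_ (congrArg (fun t => _ ≫ _ ≫ t) (homMonoidData_mul X Y Z)).symm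
    refine Eq.trans ?_ (tensorHom_comp_tensorHom_assoc _ _ _ _ _).symm
    refine Eq.trans ?_ (congrArg₂ (fun s t => (s ⊗ₘ t) ≫ homMul E X Y Z)
      (totalι_totalCounit p φ₁) (totalι_totalCounit p φ₀)).symm
    refine Eq.trans ?_ (tensorHom_comp_tensorHom_assoc _ _ _ _ _)
    refine Eq.trans ?_ (congrArg (_ ≫ ·) (homι_homMul φ₁ φ₀)).symm
    exact (Category.assoc _ _ _).symm.trans ((congrArg (· ≫ _) (p.comp_app φ₁ φ₀)).trans
      (Category.assoc _ _ _))
  elt_hom σ := by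
    refine (congrArg (· ≫ _) (A.bimoduleMonoidData_elt σ)).trans ?_
    refine (Category.assoc _ _ _).trans ((congrArg (_ ≫ ·) (totalι_totalCounit p _)).trans ?_)
    refine (Category.assoc _ _ _).symm.trans ((congrArg (· ≫ _) (p.unit_app σ)).trans ?_)
    exact (Category.id_comp _).trans (homMonoidData_elt σ).symm

/-- The decomposition of the bimodule monoid of an algebra. -/
noncomputable abbrev decomposition : Decomposition A.bimoduleMonoid (bimoduleMonoidCounit p) where
  D φ := A.obj (Arrow.mk φ)
  ι φ := A.totalι φ
  isColimit _ _ := coproductIsCoproduct _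
  ε φ := p.app (Arrow.mk φ)
  ι_comp φ := totalι_totalCounit p φ
  exists_act _ a b := ⟨_, A.totalι_act a b (a.hom_inv_id_assoc _)⟩
  exists_mul φ₁ φ₀ := ⟨_, A.totalι_mul φ₁ φ₀⟩
  exists_elt σ := ⟨_, A.bimoduleMonoidData_elt σ⟩

variable [MonoInclusions.{v} E]

/-- The restricted operations are unique since the inclusions are monic, so passing to coproducts
and back to summands returns the operations of `A`; likewise for the composition and the unit below.
-/
lemma decomposition_iso {f g : Arrow C} (e : f ≅ g) : (decomposition p).data.iso e = A.iso e := by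
  refine (decomposition p).cancel_ι g.hom (((decomposition p).iso_ι e).trans ?_)
  exact A.totalι_act (arrowLeftIso e) (arrowRightIso e) (Arrow.w e.hom)

lemma decomposition_comp {X Y Z : C} (φ₁ : Y ⟶ Z) (φ₀ : X ⟶ Y) :
    (decomposition p).data.comp φ₁ φ₀ = A.comp φ₁ φ₀ :=
  (decomposition p).cancel_ι (φ₀ ≫ φ₁) (((decomposition p).comp_ι φ₁ φ₀).trans
    (A.totalι_mul φ₁ φ₀))

lemma decomposition_unit {X Y : C} (σ : X ≅ Y) : (decomposition p).data.unit σ = A.unit σ :=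
  (decomposition p).cancel_ι σ.hom (((decomposition p).unit_ι σ).trans
    (A.bimoduleMonoidData_elt σ))

/-- The algebra of summands of the bimodule monoid of an algebra. -/
noncomputable def decompositionHom : PlusData.Hom (decomposition p).data A.toPlusData where
  app f := 𝟙 (A.obj f)
  iso_app e := (Category.comp_id _).trans ((decomposition_iso p e).trans (Category.id_comp _).symm)
  comp_app φ₁ φ₀ := (Category.comp_id _).trans ((decomposition_comp p φ₁ φ₀).trans
    ((congrArg (· ≫ _) (id_tensorHom_id _ _)).trans (Category.id_comp _)).symm)
  unit_app σ := (Category.comp_id _).trans (decomposition_unit p σ)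

end PlusAlg

variable [TensorPreservesCoproducts.{v} E]
  [∀ F : (Core C)ᵒᵖ ⥤ Core C ⥤ E, HasCoend F] [MonoInclusions.{v} E]

/-- The coproducts of the values form a bimodule monoid with the same summands; the comparison with
the given algebra consists of identities. -/
instance : (summands C E).EssSurj where
  mem_essImage Y := by
    let A : PlusAlg C E := Y.left
    let p : A ⟶ trivialAlg C E := Y.hom
    let i : (PlusAlg.decomposition p).alg ≅ A :=
      PlusAlg.isoMk (PlusAlg.decompositionHom p) (fun f => 𝟙 (A.obj f))
        (fun f => Category.id_comp _) (fun f => Category.id_comp _)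
    let S : CounitalBimoduleMonoid C E :=
      ⟨Over.mk (PlusAlg.bimoduleMonoidCounit p), PlusAlg.decomposition p⟩
    refine ⟨S, ⟨Over.isoMk (f := S.overAlg) i ?_⟩⟩
    exact PlusAlg.hom_ext fun f => Category.id_comp _

end Realization


/-! ## The lax monoidal bimodule monoid of an nc algebra -/

section LaxRealization

variable {M : Type u} [Category.{v} M] [MonoidalCategory M] {E : Type uE} [Category.{vE} E]
  [MonoidalCategory E] [BraidedCategory E] [HasCoproducts.{v} E] [TensorPreservesCoproducts.{v} E]

namespace NcAlg

variable (A : NcAlg M E)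

/-- The inclusion of the summand of a morphism. -/
noncomputable abbrev totalι {X Y : M} (φ : X ⟶ Y) :
    A.obj (Arrow.mk φ) ⟶ A.toPlusAlg.total X Y :=
  A.toPlusAlg.totalι φ

/-- The monoidal product on the coproducts. -/
noncomputable def totalTensor (X Y X' Y' : M) :
    A.toPlusAlg.total X Y ⊗ A.toPlusAlg.total X' Y' ⟶ A.toPlusAlg.total (X ⊗ X') (Y ⊗ Y') :=
  (exists_tensor_desc fun (φ : X ⟶ Y) (ψ : X' ⟶ Y') =>
    A.mu (Arrow.mk φ) (Arrow.mk ψ) ≫ A.totalι (φ ⊗ₘ ψ)).choose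

lemma totalι_totalTensor {X Y X' Y' : M} (φ : X ⟶ Y) (ψ : X' ⟶ Y') :
    (A.totalι φ ⊗ₘ A.totalι ψ) ≫ A.totalTensor X Y X' Y' =
      A.mu (Arrow.mk φ) (Arrow.mk ψ) ≫ A.totalι (φ ⊗ₘ ψ) :=
  (exists_tensor_desc fun (φ : X ⟶ Y) (ψ : X' ⟶ Y') =>
    A.mu (Arrow.mk φ) (Arrow.mk ψ) ≫ A.totalι (φ ⊗ₘ ψ)).choose_spec φ ψ

lemma totalTensor_act {X₁ X₂ Y₁ Y₂ X₁' X₂' Y₁' Y₂' : M} (a : X₁ ≅ X₂) (b : Y₁ ≅ Y₂)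
    (a' : X₁' ≅ X₂') (b' : Y₁' ≅ Y₂') :
    (A.toPlusAlg.bimodule.act a b ⊗ₘ A.toPlusAlg.bimodule.act a' b') ≫
        A.totalTensor X₂ Y₂ X₂' Y₂' =
      A.totalTensor X₁ Y₁ X₁' Y₁' ≫ A.toPlusAlg.bimodule.act (a ⊗ᵢ a') (b ⊗ᵢ b') := by
  apply tensor_hom_ext
  intro (φ : X₁ ⟶ Y₁) (ψ : X₁' ⟶ Y₁')
  have h : a.hom ≫ a.inv ≫ φ ≫ b.hom = φ ≫ b.hom := a.hom_inv_id_assoc _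
  generalize a.inv ≫ φ ≫ b.hom = φ' at h
  have h' : a'.hom ≫ a'.inv ≫ ψ ≫ b'.hom = ψ ≫ b'.hom := a'.hom_inv_id_assoc _
  generalize a'.inv ≫ ψ ≫ b'.hom = ψ' at h'
  have h'' : (a ⊗ᵢ a').hom ≫ (φ' ⊗ₘ ψ') = (φ ⊗ₘ ψ) ≫ (b ⊗ᵢ b').hom := by
    simp [tensorHom_comp_tensorHom, h, h']
  refine (tensorHom_comp_tensorHom_assoc _ _ _ _ _).trans ?_
  refine (congrArg₂ (fun s t => (s ⊗ₘ t) ≫ A.totalTensor X₂ Y₂ X₂' Y₂')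
    (A.toPlusAlg.totalι_act a b h) (A.toPlusAlg.totalι_act a' b' h')).trans ?_
  refine (tensorHom_comp_tensorHom_assoc _ _ _ _ _).symm.trans ?_
  refine (congrArg (_ ≫ ·) (A.totalι_totalTensor φ' ψ')).trans ?_
  refine Eq.trans ?_ ((Category.assoc _ _ _).symm.trans
    ((congrArg (· ≫ _) (A.totalι_totalTensor φ ψ)).trans (Category.assoc _ _ _))).symm
  refine Eq.trans ?_ (congrArg (_ ≫ ·)
    (A.toPlusAlg.totalι_act (a ⊗ᵢ a') (b ⊗ᵢ b') h'')).symm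
  exact (Category.assoc _ _ _).symm.trans ((congrArg (· ≫ _)
    (A.isMultiplicative.equivariance (square a b h) (square a' b' h'))).trans
      (Category.assoc _ _ _))

lemma totalTensor_assoc (X Y X' Y' X'' Y'' : M) :
    (A.totalTensor X Y X' Y' ▷ A.toPlusAlg.total X'' Y'') ≫
        A.totalTensor (X ⊗ X') (Y ⊗ Y') X'' Y'' ≫
        A.toPlusAlg.bimodule.act (α_ X X' X'') (α_ Y Y' Y'') =
      (α_ _ _ _).hom ≫ (A.toPlusAlg.total X Y ◁ A.totalTensor X' Y' X'' Y'') ≫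
        A.totalTensor X Y (X' ⊗ X'') (Y' ⊗ Y'') := by
  refine cofan_tensor_ext₃ (coproductIsCoproduct _) (coproductIsCoproduct _)
    (coproductIsCoproduct _) ?_
  intro φ ψ χ
  change ((A.totalι φ ⊗ₘ A.totalι ψ) ⊗ₘ A.totalι χ) ≫ _ =
    ((A.totalι φ ⊗ₘ A.totalι ψ) ⊗ₘ A.totalι χ) ≫ _
  have h₁ : ((A.totalι φ ⊗ₘ A.totalι ψ) ⊗ₘ A.totalι χ) ≫
      (A.totalTensor X Y X' Y' ▷ A.toPlusAlg.total X'' Y'') =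
      (A.mu (Arrow.mk φ) (Arrow.mk ψ) ⊗ₘ 𝟙 _) ≫ (A.totalι (φ ⊗ₘ ψ) ⊗ₘ A.totalι χ) := by
    rw [← tensorHom_id, tensorHom_comp_tensorHom, tensorHom_comp_tensorHom, Category.comp_id,
      A.totalι_totalTensor, Category.id_comp]
  have h₂ : (A.totalι φ ⊗ₘ (A.totalι ψ ⊗ₘ A.totalι χ)) ≫
      (A.toPlusAlg.total X Y ◁ A.totalTensor X' Y' X'' Y'') =
      (𝟙 _ ⊗ₘ A.mu (Arrow.mk ψ) (Arrow.mk χ)) ≫ (A.totalι φ ⊗ₘ A.totalι (ψ ⊗ₘ χ)) := by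
    rw [← id_tensorHom, tensorHom_comp_tensorHom, tensorHom_comp_tensorHom, Category.comp_id,
      A.totalι_totalTensor, Category.id_comp]
  have h₃ := A.toPlusAlg.totalι_act (α_ X X' X'') (α_ Y Y' Y'') (φ := (φ ⊗ₘ ψ) ⊗ₘ χ)
    (ψ := φ ⊗ₘ ψ ⊗ₘ χ) (by simp)
  have h₄ := congrArg (· ≫ A.totalι (φ ⊗ₘ ψ ⊗ₘ χ))
    (A.isMultiplicative.assoc (Arrow.mk φ) (Arrow.mk ψ) (Arrow.mk χ))
  refine (Category.assoc _ _ _).symm.trans ((congrArg (· ≫ _) h₁).trans ?_)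
  refine (Category.assoc _ _ _).trans ((congrArg (_ ≫ ·) (Category.assoc _ _ _).symm).trans ?_)
  refine (congrArg (fun t => _ ≫ t ≫ _) (A.totalι_totalTensor (φ ⊗ₘ ψ) χ)).trans ?_
  refine (congrArg (_ ≫ ·) ((Category.assoc _ _ _).trans (congrArg (_ ≫ ·) h₃))).trans ?_
  refine Eq.trans ?_ (associator_naturality_assoc _ _ _ _).symm
  refine Eq.trans ?_ (congrArg (_ ≫ ·) ((Category.assoc _ _ _).symm.trans ((congrArg (· ≫ _)
    h₂).trans (Category.assoc _ _ _)))).symm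
  refine Eq.trans ?_ (congrArg (fun t => _ ≫ _ ≫ t) (A.totalι_totalTensor φ (ψ ⊗ₘ χ))).symm
  simp only [Category.assoc] at h₄
  exact h₄

lemma one_totalTensor (X Y : M) :
    (λ_ (A.toPlusAlg.total X Y)).inv ≫
      ((A.unit (Iso.refl (𝟙_ M)) ≫ A.totalι (𝟙 (𝟙_ M))) ▷ A.toPlusAlg.total X Y) ≫
        A.totalTensor (𝟙_ M) (𝟙_ M) X Y ≫ A.toPlusAlg.bimodule.act (λ_ X) (λ_ Y) = 𝟙 _ := by
  apply PlusAlg.total_ext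
  intro φ
  have h₁ : (A.unit (Iso.refl (𝟙_ M)) ≫ A.totalι (𝟙 (𝟙_ M)) ⊗ₘ A.totalι φ) =
      (A.unit (Iso.refl (𝟙_ M)) ⊗ₘ 𝟙 _) ≫ (A.totalι (𝟙 (𝟙_ M)) ⊗ₘ A.totalι φ) := by
    rw [tensorHom_comp_tensorHom, Category.id_comp]
  have h₂ := A.toPlusAlg.totalι_act (λ_ X) (λ_ Y) (φ := 𝟙 (𝟙_ M) ⊗ₘ φ) (ψ := φ) (by simp)
  have h₃ := congrArg (· ≫ A.totalι φ) (A.isMultiplicative.unit_left (Arrow.mk φ))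
  simp only [Category.assoc] at h₃
  rw [leftUnitor_inv_naturality_assoc, ← tensorHom_def'_assoc]
  refine (congrArg (fun t => _ ≫ t ≫ _) h₁).trans ?_
  refine (congrArg (_ ≫ ·) ((Category.assoc _ _ _).trans
    (congrArg (_ ≫ ·) ((Category.assoc _ _ _).symm.trans
      ((congrArg (· ≫ _) (A.totalι_totalTensor (𝟙 (𝟙_ M)) φ)).trans
        ((Category.assoc _ _ _).trans (congrArg (_ ≫ ·) h₂))))))).trans ?_
  exact h₃.trans ((Category.id_comp _).trans (Category.comp_id _).symm)

lemma totalTensor_one (X Y : M) :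
    (ρ_ (A.toPlusAlg.total X Y)).inv ≫
      (A.toPlusAlg.total X Y ◁ (A.unit (Iso.refl (𝟙_ M)) ≫ A.totalι (𝟙 (𝟙_ M)))) ≫
        A.totalTensor X Y (𝟙_ M) (𝟙_ M) ≫ A.toPlusAlg.bimodule.act (ρ_ X) (ρ_ Y) = 𝟙 _ := by
  apply PlusAlg.total_ext
  intro φ
  have h₁ : (A.totalι φ ⊗ₘ A.unit (Iso.refl (𝟙_ M)) ≫ A.totalι (𝟙 (𝟙_ M))) =
      (𝟙 _ ⊗ₘ A.unit (Iso.refl (𝟙_ M))) ≫ (A.totalι φ ⊗ₘ A.totalι (𝟙 (𝟙_ M))) := by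
    rw [tensorHom_comp_tensorHom, Category.id_comp]
  have h₂ := A.toPlusAlg.totalι_act (ρ_ X) (ρ_ Y) (φ := φ ⊗ₘ 𝟙 (𝟙_ M)) (ψ := φ) (by simp)
  have h₃ := congrArg (· ≫ A.totalι φ) (A.isMultiplicative.unit_right (Arrow.mk φ))
  simp only [Category.assoc] at h₃
  rw [rightUnitor_inv_naturality_assoc, ← MonoidalCategory.tensorHom_def_assoc]
  refine (congrArg (fun t => _ ≫ t ≫ _) h₁).trans ?_
  refine (congrArg (_ ≫ ·) ((Category.assoc _ _ _).trans
    (congrArg (_ ≫ ·) ((Category.assoc _ _ _).symm.trans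
      ((congrArg (· ≫ _) (A.totalι_totalTensor φ (𝟙 (𝟙_ M)))).trans
        ((Category.assoc _ _ _).trans (congrArg (_ ≫ ·) h₂))))))).trans ?_
  exact h₃.trans ((Category.id_comp _).trans (Category.comp_id _).symm)

lemma unit_totalTensor {X Y X' Y' : M} (σ : X ≅ Y) (σ' : X' ≅ Y') :
    (λ_ (𝟙_ E)).inv ≫ (A.unit σ ≫ A.totalι σ.hom ⊗ₘ A.unit σ' ≫ A.totalι σ'.hom) ≫
      A.totalTensor X Y X' Y' = A.unit (σ ⊗ᵢ σ') ≫ A.totalι (σ ⊗ᵢ σ').hom := by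
  rw [← tensorHom_comp_tensorHom_assoc, A.totalι_totalTensor σ.hom σ'.hom]
  have h := congrArg (· ≫ A.totalι (σ ⊗ᵢ σ').hom) (A.isMultiplicative.unit_tensor σ σ')
  exact ((congrArg (_ ≫ ·) (Category.assoc _ _ _).symm).trans (Category.assoc _ _ _).symm).trans h

lemma totalMul_totalTensor (X Y Z X' Y' Z' : M) :
    (A.toPlusAlg.totalMul X Y Z ⊗ₘ A.toPlusAlg.totalMul X' Y' Z') ≫ A.totalTensor X Z X' Z' =
      tensorμ _ _ _ _ ≫ (A.totalTensor Y Z Y' Z' ⊗ₘ A.totalTensor X Y X' Y') ≫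
        A.toPlusAlg.totalMul (X ⊗ X') (Y ⊗ Y') (Z ⊗ Z') := by
  refine cofan_tensor_ext₄ (coproductIsCoproduct _) (coproductIsCoproduct _)
    (coproductIsCoproduct _) (coproductIsCoproduct _) ?_
  intro φ₁ φ₀ ψ₁ ψ₀
  change ((A.totalι φ₁ ⊗ₘ A.totalι φ₀) ⊗ₘ (A.totalι ψ₁ ⊗ₘ A.totalι ψ₀)) ≫ _ =
    ((A.totalι φ₁ ⊗ₘ A.totalι φ₀) ⊗ₘ (A.totalι ψ₁ ⊗ₘ A.totalι ψ₀)) ≫ _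
  have h := congrArg (· ≫ A.totalι ((φ₀ ≫ φ₁) ⊗ₘ (ψ₀ ≫ ψ₁)))
    (A.isMultiplicative.interchange φ₁ φ₀ ψ₁ ψ₀)
  simp only [Category.assoc] at h
  have h₁ : A.iso (arrowInterchange φ₁ φ₀ ψ₁ ψ₀) ≫ A.totalι ((φ₀ ≫ φ₁) ⊗ₘ (ψ₀ ≫ ψ₁)) =
      A.totalι ((φ₀ ⊗ₘ ψ₀) ≫ (φ₁ ⊗ₘ ψ₁)) := A.toPlusAlg.totalι_eq _
  refine (tensorHom_comp_tensorHom_assoc _ _ _ _ _).trans ?_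
  refine (congrArg₂ (fun s t => (s ⊗ₘ t) ≫ A.totalTensor X Z X' Z')
    (A.toPlusAlg.totalι_totalMul φ₁ φ₀) (A.toPlusAlg.totalι_totalMul ψ₁ ψ₀)).trans ?_
  refine (tensorHom_comp_tensorHom_assoc _ _ _ _ _).symm.trans ?_
  refine (congrArg (_ ≫ ·) (A.totalι_totalTensor (φ₀ ≫ φ₁) (ψ₀ ≫ ψ₁))).trans (h.trans ?_)
  refine (congrArg (fun t => _ ≫ _ ≫ _ ≫ t) h₁).trans ?_
  refine Eq.trans ?_ (tensorμ_natural_assoc _ _ _ _ _).symm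
  refine congrArg (_ ≫ ·) ?_
  refine Eq.trans ?_ (tensorHom_comp_tensorHom_assoc _ _ _ _ _).symm
  refine Eq.trans ?_ (congrArg₂ (fun s t => (s ⊗ₘ t) ≫ A.toPlusAlg.totalMul _ _ _)
    (A.totalι_totalTensor φ₁ ψ₁) (A.totalι_totalTensor φ₀ ψ₀)).symm
  refine Eq.trans ?_ (tensorHom_comp_tensorHom_assoc _ _ _ _ _)
  exact congrArg (_ ≫ ·) (A.toPlusAlg.totalι_totalMul (φ₁ ⊗ₘ ψ₁) (φ₀ ⊗ₘ ψ₀)).symm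

variable [∀ F : (Core M)ᵒᵖ ⥤ Core M ⥤ E, HasCoend F]

/-- The lax monoidal bimodule monoid of an nc algebra. -/
noncomputable abbrev laxMonoid : LaxMonoidalBimoduleMonoid M E where
  toBimoduleMonoid := A.toPlusAlg.bimoduleMonoid
  tensor := A.totalTensor
  act_tensor := A.totalTensor_act
  tensor_assoc := A.totalTensor_assoc
  one_tensor X Y := by
    rw [PlusAlg.bimoduleMonoidData_elt]
    exact A.one_totalTensor X Y
  tensor_one X Y := by
    rw [PlusAlg.bimoduleMonoidData_elt]
    exact A.totalTensor_one X Y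
  elt_tensor_elt σ σ' := by
    rw [PlusAlg.bimoduleMonoidData_elt, PlusAlg.bimoduleMonoidData_elt,
      PlusAlg.bimoduleMonoidData_elt]
    exact A.unit_totalTensor σ σ'
  interchange X Y Z X' Y' Z' := by
    rw [PlusAlg.bimoduleMonoidData_mul, PlusAlg.bimoduleMonoidData_mul,
      PlusAlg.bimoduleMonoidData_mul]
    exact A.totalMul_totalTensor X Y Z X' Y' Z'

variable {A}

/-- The morphism to the trivial algebra, without the monoidal product. -/
abbrev plusCounit (p : A ⟶ trivialNcAlg M E) :
    PlusData.Hom A.toPlusAlg.toPlusData (trivialData M E) :=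
  p.toHom

/-- The morphism from the lax monoidal bimodule monoid of an nc algebra to `Hom_M`. -/
noncomputable def laxMonoidCounit (p : A ⟶ trivialNcAlg M E) : A.laxMonoid ⟶ homLax M E where
  toHom := PlusAlg.bimoduleMonoidCounit (plusCounit p)
  tensor_hom X Y X' Y' := by
    apply tensor_hom_ext
    intro (φ : X ⟶ Y) (ψ : X' ⟶ Y')
    have h := p.mu_app (Arrow.mk φ) (Arrow.mk ψ)
    refine (Category.assoc _ _ _).symm.trans
      ((congrArg (· ≫ _) (A.totalι_totalTensor φ ψ)).trans ?_)
    refine (Category.assoc _ _ _).trans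
      ((congrArg (_ ≫ ·) (PlusAlg.totalι_totalCounit (plusCounit p) _)).trans ?_)
    refine Eq.trans ?_ (tensorHom_comp_tensorHom_assoc _ _ _ _ _).symm
    refine Eq.trans ?_ (congrArg₂ (fun s t => (s ⊗ₘ t) ≫ homTensor E X Y X' Y')
      (PlusAlg.totalι_totalCounit (plusCounit p) φ) (PlusAlg.totalι_totalCounit (plusCounit p) ψ)).symm
    refine Eq.trans ?_ (tensorHom_comp_tensorHom_assoc _ _ _ _ _)
    refine Eq.trans ?_ (congrArg (_ ≫ ·) (homι_homTensor φ ψ)).symm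
    exact (Category.assoc _ _ _).symm.trans ((congrArg (· ≫ _) h).trans (Category.assoc _ _ _))

/-- The counital lax monoidal bimodule monoid of an nc algebra over the trivial algebra. -/
noncomputable abbrev counitalMonoid (p : A ⟶ trivialNcAlg M E) : CounitalLaxBimoduleMonoid M E where
  obj := Over.mk (Y := A.laxMonoid) (laxMonoidCounit p)
  dec := PlusAlg.decomposition (plusCounit p)
  exists_tensor φ ψ := ⟨A.mu (Arrow.mk φ) (Arrow.mk ψ), A.totalι_totalTensor φ ψ⟩

end NcAlg

variable [∀ F : (Core M)ᵒᵖ ⥤ Core M ⥤ E, HasCoend F] [MonoInclusions.{v} E]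

/-- As in the plain case, and the restricted monoidal product agrees with `A.mu` because the
inclusion is monic. -/
instance : (laxSummands M E).EssSurj where
  mem_essImage Y := by
    let A : NcAlg M E := Y.left
    let p : A ⟶ trivialNcAlg M E := Y.hom
    let S := NcAlg.counitalMonoid p
    let k : S.alg ⟶ A :=
      { toHom := PlusAlg.decompositionHom (NcAlg.plusCounit p)
        mu_app := fun f g => by
          refine (Category.comp_id _).trans ?_
          refine Eq.trans ?_ ((congrArg (· ≫ _) (id_tensorHom_id _ _)).trans
            (Category.id_comp _)).symm
          refine S.dec.cancel_ι (f.hom ⊗ₘ g.hom)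
            ((Decomposition.mu_ι S.respectsTensor f g).trans ?_)
          exact A.totalι_totalTensor f.hom g.hom }
    let i : S.alg ≅ A :=
      NcAlg.isoMk k (fun f => 𝟙 (A.obj f)) (fun f => Category.id_comp _)
        (fun f => Category.id_comp _)
    refine ⟨S, ⟨Over.isoMk (f := S.overAlg) i ?_⟩⟩
    exact NcAlg.hom_ext fun f => Category.id_comp _

end LaxRealization


/-! ## Splittings -/

section Transport

variable {C : Type u} [Category.{v} C] {E : Type uE} [Category.{vE} E] [MonoidalCategory E]

/-- An isomorphism of families of objects that respects products and unit elements. -/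
structure Fibres.Equiv (𝒟 𝒟' : Fibres C E) where
  θ {X Y : C} (φ : X ⟶ Y) : 𝒟.D φ ≅ 𝒟'.D φ
  isProd_iff {X Y Z : C} {φ₁ : Y ⟶ Z} {φ₀ : X ⟶ Y} (x : 𝟙_ E ⟶ 𝒟.D φ₁) (y : 𝟙_ E ⟶ 𝒟.D φ₀)
    (z : 𝟙_ E ⟶ 𝒟.D (φ₀ ≫ φ₁)) :
    𝒟'.IsProd (x ≫ (θ φ₁).hom) (y ≫ (θ φ₀).hom) (z ≫ (θ _).hom) ↔ 𝒟.IsProd x y z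
  isOne_iff {X Y : C} (σ : X ≅ Y) (x : 𝟙_ E ⟶ 𝒟.D σ.hom) :
    𝒟'.IsOne σ (x ≫ (θ σ.hom).hom) ↔ 𝒟.IsOne σ x

namespace Fibres.Equiv

variable {𝒟 𝒟' : Fibres C E} (e : Fibres.Equiv 𝒟 𝒟')

/-- The bijection on elements. -/
def elements {X Y : C} (φ : X ⟶ Y) : (𝟙_ E ⟶ 𝒟.D φ) ≃ (𝟙_ E ⟶ 𝒟'.D φ) where
  toFun x := x ≫ (e.θ φ).hom
  invFun x := x ≫ (e.θ φ).inv
  left_inv x := by simp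
  right_inv x := by simp

/-- The inverse isomorphism. -/
def symm : Fibres.Equiv 𝒟' 𝒟 where
  θ φ := (e.θ φ).symm
  isProd_iff {X Y Z φ₁ φ₀} x y z := by
    have := e.isProd_iff ((e.elements φ₁).symm x) ((e.elements φ₀).symm y)
      ((e.elements _).symm z)
    refine this.symm.trans (iff_of_eq ?_)
    have h := fun {X Y : C} (φ : X ⟶ Y) (x : 𝟙_ E ⟶ 𝒟'.D φ) =>
      (e.elements φ).apply_symm_apply x
    change 𝒟'.IsProd (e.elements φ₁ _) (e.elements φ₀ _) (e.elements _ _) = _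
    rw [h, h, h]
  isOne_iff {X Y} σ x := by
    have := e.isOne_iff σ ((e.elements _).symm x)
    refine this.symm.trans (iff_of_eq ?_)
    change 𝒟'.IsOne σ (e.elements _ _) = _
    rw [Equiv.apply_symm_apply]

lemma isInvertible {X Y : C} {σ : X ≅ Y} {x : 𝟙_ E ⟶ 𝒟.D σ.hom} (h : 𝒟.IsInvertible σ x) :
    𝒟'.IsInvertible σ (x ≫ (e.θ σ.hom).hom) := by
  obtain ⟨y, ⟨a, ha, ha'⟩, b, hb, hb'⟩ := h
  exact ⟨y ≫ (e.θ _).hom, ⟨a ≫ (e.θ _).hom, (e.isOne_iff _ _).2 ha, (e.isProd_iff _ _ _).2 ha'⟩,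
    b ≫ (e.θ _).hom, (e.isOne_iff _ _).2 hb, (e.isProd_iff _ _ _).2 hb'⟩

lemma isInvertible_iff {X Y : C} {σ : X ≅ Y} {x : 𝟙_ E ⟶ 𝒟.D σ.hom} :
    𝒟'.IsInvertible σ (x ≫ (e.θ σ.hom).hom) ↔ 𝒟.IsInvertible σ x := by
  refine ⟨fun h => ?_, e.isInvertible⟩
  have := e.symm.isInvertible h
  change 𝒟.IsInvertible σ ((e.elements σ.hom).symm (e.elements σ.hom x)) at this
  rwa [Equiv.symm_apply_apply] at this

/-- A splitting is transported along an isomorphism. -/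
def splitting (S : 𝒟.Splitting) : 𝒟'.Splitting where
  I σ := {x | (e.elements σ.hom).symm x ∈ S.I σ}
  S := S.S
  R := S.R
  s σ := S.s σ ≫ (e.θ σ.hom).hom
  r σ := S.r σ ≫ (e.θ σ.hom).hom
  isColimit σ := (S.isColimit σ).ofIsoColimit (BinaryCofan.ext (e.θ σ.hom) rfl rfl)
  c σ x := S.c σ ⟨_, x.2⟩
  c_s σ x := by
    rw [← Category.assoc, S.c_s]
    exact (e.elements σ.hom).apply_symm_apply x.1
  isColimit_c σ := by
    have h : ∀ x : S.I σ, (e.elements σ.hom).symm (e.elements σ.hom x.1) ∈ S.I σ := fun x => by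
      rw [Equiv.symm_apply_apply]
      exact x.2
    -- The new cofan is the old one reindexed along the bijection of elements.
    refine Cofan.IsColimit.mk _ (fun t => Cofan.IsColimit.desc (S.isColimit_c σ)
      fun x => t.inj ⟨e.elements σ.hom x.1, h x⟩) (fun t x => ?_) (fun t m hm => ?_)
    · refine (Cofan.IsColimit.fac (S.isColimit_c σ) _ _).trans ?_
      exact congrArg (fun j => (t.inj j : 𝟙_ E ⟶ t.pt))
        (Subtype.ext ((e.elements σ.hom).apply_symm_apply x.1))
    · refine Cofan.IsColimit.hom_ext (S.isColimit_c σ) _ _ fun x => ?_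
      refine Eq.trans ?_ (Cofan.IsColimit.fac (S.isColimit_c σ) _ _).symm
      refine Eq.trans ?_ (hm _)
      exact congrArg (fun j => (S.c σ j : 𝟙_ E ⟶ S.S σ) ≫ m)
        (Subtype.ext ((e.elements σ.hom).symm_apply_apply x.1).symm)
  exists_of_isInvertible σ x hx := by
    obtain ⟨y, hy⟩ := S.exists_of_isInvertible σ _ (e.symm.isInvertible hx)
    refine ⟨y, ?_⟩
    rw [← Category.assoc, ← hy]
    exact ((e.elements σ.hom).apply_symm_apply x).symm
  not_isInvertible σ y h := by
    rw [← Category.assoc, e.isInvertible_iff] at h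
    exact S.not_isInvertible σ y h
  exists_prod {X Y Z} σ τ x y hx hy := by
    obtain ⟨z, hz, h⟩ := S.exists_prod σ τ hx hy
    refine ⟨e.elements _ z, ?_, ?_⟩
    · change (e.elements _).symm (e.elements _ z) ∈ S.I (τ ≪≫ σ)
      rwa [Equiv.symm_apply_apply]
    · have := (e.isProd_iff _ _ _).2 h
      change 𝒟'.IsProd (e.elements _ ((e.elements _).symm x)) (e.elements _ ((e.elements _).symm y))
        _ at this
      rwa [Equiv.apply_symm_apply, Equiv.apply_symm_apply] at this
  existsUnique_right {X Y Z} σ τ x z hx hz := by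
    obtain ⟨y, ⟨hy, h⟩, h'⟩ := S.existsUnique_right σ τ hx hz
    refine ⟨e.elements _ y, ⟨?_, ?_⟩, ?_⟩
    · change (e.elements _).symm (e.elements _ y) ∈ S.I τ
      rwa [Equiv.symm_apply_apply]
    · have := (e.isProd_iff _ _ _).2 h
      change 𝒟'.IsProd (e.elements _ ((e.elements _).symm x)) _
        (e.elements _ ((e.elements _).symm z)) at this
      rwa [Equiv.apply_symm_apply, Equiv.apply_symm_apply] at this
    · rintro y' ⟨hy', h''⟩
      rw [← Equiv.symm_apply_eq]
      exact h' _ ⟨hy', (e.symm.isProd_iff _ _ _).2 h''⟩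
  existsUnique_left {X Y Z} σ τ x z hx hz := by
    obtain ⟨y, ⟨hy, h⟩, h'⟩ := S.existsUnique_left σ τ hx hz
    refine ⟨e.elements _ y, ⟨?_, ?_⟩, ?_⟩
    · change (e.elements _).symm (e.elements _ y) ∈ S.I σ
      rwa [Equiv.symm_apply_apply]
    · have := (e.isProd_iff _ _ _).2 h
      change 𝒟'.IsProd _ (e.elements _ ((e.elements _).symm x))
        (e.elements _ ((e.elements _).symm z)) at this
      rwa [Equiv.apply_symm_apply, Equiv.apply_symm_apply] at this
    · rintro y' ⟨hy', h''⟩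
      rw [← Equiv.symm_apply_eq]
      exact h' _ ⟨hy', (e.symm.isProd_iff _ _ _).2 h''⟩
  exists_one σ := by
    obtain ⟨w, B, j, h, h'⟩ := S.exists_one σ
    refine ⟨w, B, j, ?_, h'⟩
    rw [← Category.assoc, e.isOne_iff]
    exact h

end Fibres.Equiv

end Transport

/-! ### Elements of a splitting are invertible -/

section Invertibility

variable {C : Type u} [Category.{v} C] {E : Type uE} [Category.{vE} E] [MonoidalCategory E]
  [HasCoproducts.{v} E] [∀ F : (Core C)ᵒᵖ ⥤ Core C ⥤ E, HasCoend F]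

namespace BimoduleMonoid

variable (ρ : BimoduleMonoid C E)

/-- The product of an element with a generalized element. -/
noncomputable def leftMul {X Y Z : C} (x : 𝟙_ E ⟶ ρ.carrier.at Y Z) {A : E}
    (y : A ⟶ ρ.carrier.at X Y) : A ⟶ ρ.carrier.at X Z :=
  (λ_ A).inv ≫ (x ⊗ₘ y) ≫ ρ.mul X Y Z

/-- Multiplication is natural in the generalized element. Sources other than `𝟙` are needed in order
to multiply a whole summand at once. -/
lemma comp_leftMul {X Y Z : C} (x : 𝟙_ E ⟶ ρ.carrier.at Y Z) {A B : E} (f : B ⟶ A)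
    (y : A ⟶ ρ.carrier.at X Y) : f ≫ ρ.leftMul x y = ρ.leftMul x (f ≫ y) := by
  rw [leftMul, leftUnitor_inv_naturality_assoc, ← id_tensorHom, tensorHom_comp_tensorHom_assoc,
    Category.id_comp]
  rfl

lemma leftMul_assoc {W X Y Z : C} (x : 𝟙_ E ⟶ ρ.carrier.at Y Z) (y : 𝟙_ E ⟶ ρ.carrier.at X Y)
    {A : E} (z : A ⟶ ρ.carrier.at W X) :
    ρ.leftMul (ρ.leftMul x y) z = ρ.leftMul x (ρ.leftMul y z) := by
  have h₁ : (ρ.leftMul x y ⊗ₘ z) = ((λ_ (𝟙_ E)).inv ▷ A) ≫ ((x ⊗ₘ y) ⊗ₘ z) ≫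
      (ρ.mul X Y Z ▷ ρ.carrier.at W X) := by
    rw [leftMul, ← tensorHom_id, ← tensorHom_id, tensorHom_comp_tensorHom,
      tensorHom_comp_tensorHom, Category.id_comp, Category.comp_id]
  have h₂ : (x ⊗ₘ ρ.leftMul y z) = (𝟙_ E ◁ (λ_ A).inv) ≫ (x ⊗ₘ (y ⊗ₘ z)) ≫
      (ρ.carrier.at Y Z ◁ ρ.mul W X Y) := by
    rw [leftMul, ← id_tensorHom, ← id_tensorHom, tensorHom_comp_tensorHom,
      tensorHom_comp_tensorHom, Category.id_comp, Category.comp_id]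
  change (λ_ A).inv ≫ (ρ.leftMul x y ⊗ₘ z) ≫ ρ.mul W X Z =
    (λ_ A).inv ≫ (x ⊗ₘ ρ.leftMul y z) ≫ ρ.mul W Y Z
  rw [h₁, h₂]
  simp only [Category.assoc]
  rw [ρ.mul_assoc, associator_naturality_assoc]
  have h₃ : (λ_ A).inv ≫ ((λ_ (𝟙_ E)).inv ▷ A) ≫ (α_ _ _ _).hom =
      (λ_ A).inv ≫ (𝟙_ E ◁ (λ_ A).inv) := by
    monoidal
  rw [reassoc_of% h₃]

lemma elt_leftMul {X Y : C} {A : E} (y : A ⟶ ρ.carrier.at X Y) :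
    ρ.leftMul (ρ.elt (Iso.refl Y)) y = y := by
  have h := congrArg (y ≫ ·) (ρ.one_mul X (Iso.refl Y))
  rw [Bimodule.act_refl, Category.comp_id] at h
  rw [leftMul, MonoidalCategory.tensorHom_def', Category.assoc, ← leftUnitor_inv_naturality_assoc]
  exact h

lemma leftMul_elt {X Y : C} (x : 𝟙_ E ⟶ ρ.carrier.at X Y) :
    ρ.leftMul x (ρ.elt (Iso.refl X)) = x := by
  have h := congrArg (x ≫ ·) (ρ.mul_one (Iso.refl X) Y)
  have h' : ρ.carrier.act (Iso.refl X).symm (Iso.refl Y) = 𝟙 _ := ρ.carrier.act_refl X Y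
  rw [h', Category.comp_id] at h
  rw [leftMul, MonoidalCategory.tensorHom_def, Category.assoc, unitors_inv_equal,
    ← rightUnitor_inv_naturality_assoc]
  exact h

end BimoduleMonoid

variable [TensorPreservesCoproducts.{v} E] [MonoInclusions.{v} E]

namespace Decomposition

variable {ρ : BimoduleMonoid C E} {b : ρ ⟶ homMonoid C E} {d : Decomposition ρ b}
  (S : d.fibres.Splitting)

/-- The elements of `I(σ)` as elements of `ρ`. -/
def IsBasic {X Y : C} (σ : X ≅ Y) (x : 𝟙_ E ⟶ ρ.carrier.at X Y) : Prop :=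
  ∃ x' ∈ S.I σ, x' ≫ d.ι σ.hom = x

variable {S}

lemma IsBasic.mul {X Y Z : C} {σ : Y ≅ Z} {τ : X ≅ Y} {x : 𝟙_ E ⟶ ρ.carrier.at Y Z}
    {y : 𝟙_ E ⟶ ρ.carrier.at X Y} (hx : IsBasic S σ x) (hy : IsBasic S τ y) :
    IsBasic S (τ ≪≫ σ) (ρ.leftMul x y) := by
  obtain ⟨x, hx, rfl⟩ := hx
  obtain ⟨y, hy, rfl⟩ := hy
  obtain ⟨z, hz, h⟩ := S.exists_prod σ τ hx hy
  exact ⟨z, hz, h.symm⟩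

/-- The composite is a variable `υ` with an equation, so that identities and inverses can be
supplied as composites that are only propositionally equal to `υ`. -/
lemma IsBasic.exists_right {X Y Z : C} {σ : Y ≅ Z} {τ : X ≅ Y} {υ : X ≅ Z}
    {x : 𝟙_ E ⟶ ρ.carrier.at Y Z} {z : 𝟙_ E ⟶ ρ.carrier.at X Z} (hx : IsBasic S σ x)
    (hz : IsBasic S υ z) (h : τ ≪≫ σ = υ) : ∃ y, IsBasic S τ y ∧ ρ.leftMul x y = z := by
  subst h
  obtain ⟨x, hx, rfl⟩ := hx
  obtain ⟨z, hz, rfl⟩ := hz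
  obtain ⟨y, ⟨hy, h⟩, -⟩ := S.existsUnique_right σ τ hx hz
  exact ⟨_, ⟨y, hy, rfl⟩, h⟩

lemma IsBasic.left_cancel {X Y Z : C} {σ : Y ≅ Z} {τ : X ≅ Y}
    {x : 𝟙_ E ⟶ ρ.carrier.at Y Z} {y y' : 𝟙_ E ⟶ ρ.carrier.at X Y} (hx : IsBasic S σ x)
    (hy : IsBasic S τ y) (hy' : IsBasic S τ y') (h : ρ.leftMul x y = ρ.leftMul x y') :
    y = y' := by
  obtain ⟨z, hz, hz'⟩ := hx.mul hy
  obtain ⟨x, hx, rfl⟩ := hx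
  obtain ⟨y, hy, rfl⟩ := hy
  obtain ⟨y', hy', rfl⟩ := hy'
  exact congrArg (· ≫ _) ((S.existsUnique_right σ τ hx hz).unique ⟨hy, hz'.symm⟩
    ⟨hy', h.symm.trans hz'.symm⟩)

lemma IsBasic.exists_left {X Y Z : C} {σ : Y ≅ Z} {τ : X ≅ Y} {υ : X ≅ Z}
    {y : 𝟙_ E ⟶ ρ.carrier.at X Y} {z : 𝟙_ E ⟶ ρ.carrier.at X Z} (hy : IsBasic S τ y)
    (hz : IsBasic S υ z) (h : τ ≪≫ σ = υ) : ∃ x, IsBasic S σ x ∧ ρ.leftMul x y = z := by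
  subst h
  obtain ⟨y, hy, rfl⟩ := hy
  obtain ⟨z, hz, rfl⟩ := hz
  obtain ⟨x, ⟨hx, h⟩, -⟩ := S.existsUnique_left σ τ hy hz
  exact ⟨_, ⟨x, hx, rfl⟩, h⟩

/-- The unit element of `D(id)` belongs to `I(id)`, although a splitting only asks that it be a
summand of the coproduct over `I(id)`. Solve `x e = x` in `I`; cancellation shows that `e` is a left
identity for all elements of `I(id)`, hence for the inclusion of their coproduct. The unit element
factors through this coproduct, so `e u = u`, while `e u = e` because `u` is a unit of `ρ`. -/
lemma IsBasic.one {X Y : C} {σ : X ≅ Y} {x : 𝟙_ E ⟶ ρ.carrier.at X Y} (hx : IsBasic S σ x) :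
    IsBasic S (Iso.refl X) (ρ.elt (Iso.refl X)) := by
  obtain ⟨e, he, hxe⟩ := hx.exists_right (τ := Iso.refl X) hx (Iso.refl_trans σ)
  have hr : Iso.refl X ≪≫ Iso.refl X = Iso.refl X := Iso.refl_trans _
  have hmul : ∀ {z z'}, IsBasic S (Iso.refl X) z → IsBasic S (Iso.refl X) z' →
      IsBasic S (Iso.refl X) (ρ.leftMul z z') := fun h h' => by
    have := h.mul h'
    rwa [hr] at this
  -- From `x (e e) = (x e) e = x e`, cancelling `x`.
  have hee : ρ.leftMul e e = e := hx.left_cancel (hmul he he) he (by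
    rw [← ρ.leftMul_assoc, hxe, hxe])
  have hez : ∀ z, IsBasic S (Iso.refl X) z → ρ.leftMul e z = z := fun z hz =>
    he.left_cancel (hmul he hz) hz (by rw [← ρ.leftMul_assoc, hee])
  -- The passage from elements to the whole summand uses that `S(id)` is the coproduct over `I(id)`.
  have hs : ρ.leftMul e (S.s (Iso.refl X) ≫ d.ι (Iso.refl X).hom) =
      S.s (Iso.refl X) ≫ d.ι (Iso.refl X).hom := by
    refine Cofan.IsColimit.hom_ext (S.isColimit_c (Iso.refl X)) _ _ fun i => ?_
    have hi : S.c (Iso.refl X) i ≫ S.s (Iso.refl X) ≫ d.ι (Iso.refl X).hom =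
        i.1 ≫ d.ι (Iso.refl X).hom :=
      (Category.assoc _ _ _).symm.trans (congrArg (· ≫ d.ι _) (S.c_s (Iso.refl X) i))
    change S.c (Iso.refl X) i ≫ ρ.leftMul e (S.s (Iso.refl X) ≫ d.ι (Iso.refl X).hom) =
      S.c (Iso.refl X) i ≫ S.s (Iso.refl X) ≫ d.ι (Iso.refl X).hom
    rw [ρ.comp_leftMul, hi]
    exact hez _ ⟨i.1, i.2, rfl⟩
  obtain ⟨w, -, -, hw, -⟩ := S.exists_one (Iso.refl X)
  have hw' : w ≫ S.s (Iso.refl X) ≫ d.ι (Iso.refl X).hom = ρ.elt (Iso.refl X) :=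
    (Category.assoc _ _ _).symm.trans hw
  -- Both are equal to the product of `e` and the unit element.
  have : e = ρ.elt (Iso.refl X) := by
    rw [← ρ.leftMul_elt e, ← hw', ← ρ.comp_leftMul, hs]
  rwa [← this]

/-- The units at both ends lie in `I`, so `y x = 1` and then `x y' = 1` can be solved in `I`;
associativity shows that the left inverse `y` and the right inverse `y'` of `x` coincide. -/
lemma IsBasic.isInvertible {X Y : C} {σ : X ≅ Y} {x : 𝟙_ E ⟶ d.D σ.hom} (hx : x ∈ S.I σ) :
    d.fibres.IsInvertible σ x := by
  have hx' : IsBasic S σ (x ≫ d.ι σ.hom) := ⟨x, hx, rfl⟩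
  obtain ⟨y, hy, hyx⟩ := hx'.exists_left (σ := σ.symm) hx'.one σ.self_symm_id
  obtain ⟨y', hy', hxy'⟩ := hx'.exists_right (τ := σ.symm) hy.one σ.symm_self_id
  obtain rfl : y = y' := by
    rw [← ρ.leftMul_elt y, ← hxy', ← ρ.leftMul_assoc, hyx, ρ.elt_leftMul]
  obtain ⟨y, -, rfl⟩ := hy
  refine ⟨y, ⟨d.unitMap (σ ≪≫ σ.symm), d.unit_ι _, ?_⟩, d.unitMap (σ.symm ≪≫ σ), d.unit_ι _, ?_⟩
  · refine hyx.trans (Eq.trans ?_ (d.unit_ι (σ ≪≫ σ.symm)).symm)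
    rw [Iso.self_symm_id]
  · refine hxy'.trans (Eq.trans ?_ (d.unit_ι (σ.symm ≪≫ σ)).symm)
    rw [Iso.symm_self_id]

/-- The invertibility demanded of an isomorphism splitting is automatic. -/
lemma isIsomorphismSplit_iff : d.IsIsomorphismSplit ↔ Nonempty d.fibres.Splitting :=
  ⟨fun ⟨S, _⟩ => ⟨S⟩, fun ⟨S⟩ => ⟨S, fun _ _ hx => IsBasic.isInvertible hx⟩⟩

end Decomposition

end Invertibility

/-! ### Values of a functor compared with summands -/

section Correspondences

open Functor.LaxMonoidal

variable {C : Type u} [Category.{v} C] {E : Type uE} [Category.{vE} E] [MonoidalCategory E]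
  [HasCoproducts.{v} E] [∀ F : (Core C)ᵒᵖ ⥤ Core C ⥤ E, HasCoend F]
  [TensorPreservesCoproducts.{v} E] [MonoInclusions.{v} E]
  {P : Type w} [Category.{w} P] [MonoidalCategory P]

/-- An isomorphism between the values of a functor and the summands of a bimodule monoid, which
respects compositions and unit elements. -/
structure ValueIso (K : PlusMorphisms C P) (F : P ⥤ E) [F.LaxMonoidal] {ρ : BimoduleMonoid C E}
    {b : ρ ⟶ homMonoid C E} (d : Decomposition ρ b) where
  θ (f : Arrow C) : F.obj (K.letter f) ≅ d.D f.hom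
  comp_θ {X Y Z : C} (φ₁ : Y ⟶ Z) (φ₀ : X ⟶ Y) :
    (μ F _ _ ≫ F.map (K.comp φ₁ φ₀)) ≫ (θ (Arrow.mk (φ₀ ≫ φ₁))).hom =
      ((θ (Arrow.mk φ₁)).hom ⊗ₘ (θ (Arrow.mk φ₀)).hom) ≫ d.compMap φ₁ φ₀
  unit_θ {X Y : C} (σ : X ≅ Y) :
    (ε F ≫ F.map (K.unit σ)) ≫ (θ (Arrow.mk σ.hom)).hom = d.unitMap σ

namespace ValueIso

variable {K : PlusMorphisms C P} {F : P ⥤ E} [F.LaxMonoidal] {ρ : BimoduleMonoid C E}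
    {b : ρ ⟶ homMonoid C E} {d : Decomposition ρ b} (t : ValueIso K F d)

lemma isRealization : IsRealization K F ρ fun φ => (t.θ (Arrow.mk φ)).hom ≫ d.ι φ := by
  constructor
  · intro X Y Z φ₁ φ₀
    have h := congrArg (· ≫ d.ι (φ₀ ≫ φ₁)) (t.comp_θ φ₁ φ₀)
    have h' := d.comp_ι φ₁ φ₀
    simp only [Category.assoc] at h
    refine h.trans ((congrArg (_ ≫ ·) h').trans ?_)
    exact tensorHom_comp_tensorHom_assoc _ _ _ _ _
  · intro X Y σ
    have h := congrArg (· ≫ d.ι σ.hom) (t.unit_θ σ)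
    simp only [Category.assoc] at h
    exact h.trans (d.unit_ι σ)

/-- Products of elements in the functor and in `ρ` agree under `θ`; this is why `θ` respects the
relation `IsProd`. -/
lemma leftMul_comp {X Y Z : C} {φ₁ : Y ⟶ Z} {φ₀ : X ⟶ Y}
    (x : 𝟙_ E ⟶ F.obj (K.letter (Arrow.mk φ₁))) (y : 𝟙_ E ⟶ F.obj (K.letter (Arrow.mk φ₀))) :
    (λ_ (𝟙_ E)).inv ≫ ((x ≫ (t.θ (Arrow.mk φ₁)).hom) ≫ d.ι φ₁ ⊗ₘ
        (y ≫ (t.θ (Arrow.mk φ₀)).hom) ≫ d.ι φ₀) ≫ ρ.mul X Y Z =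
      (((λ_ (𝟙_ E)).inv ≫ (x ⊗ₘ y) ≫ μ F _ _ ≫ F.map (K.comp φ₁ φ₀)) ≫
        (t.θ (Arrow.mk (φ₀ ≫ φ₁))).hom) ≫ d.ι (φ₀ ≫ φ₁) := by
  have h : _ = _ := t.isRealization.1 φ₁ φ₀
  dsimp only at h
  rw [Category.assoc x, Category.assoc y, ← tensorHom_comp_tensorHom_assoc, ← h]
  simp only [Category.assoc]

/-- The isomorphism of families of objects. -/
def equiv : Fibres.Equiv (K.fibres F) d.fibres where
  θ φ := t.θ (Arrow.mk φ)
  isProd_iff {X Y Z φ₁ φ₀} x y z := by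
    have h' := t.leftMul_comp x y
    constructor
    · intro h''
      have h₁ := d.cancel_ι _ (h'.symm.trans h'')
      exact (cancel_mono (t.θ (Arrow.mk (φ₀ ≫ φ₁))).hom).1 h₁
    · intro h''
      exact h'.trans (congrArg (fun s => (s ≫ _) ≫ _) h'')
  isOne_iff {X Y} σ x := by
    have h : ((ε F ≫ F.map (K.unit σ)) ≫ (t.θ (Arrow.mk σ.hom)).hom) ≫ d.ι σ.hom = ρ.elt σ :=
      (congrArg (· ≫ d.ι σ.hom) (t.unit_θ σ)).trans (d.unit_ι σ)
    constructor
    · intro h'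
      have h₁ := d.cancel_ι _ (Eq.trans h' h.symm)
      exact (cancel_mono (t.θ (Arrow.mk σ.hom)).hom).1 h₁
    · intro h'
      exact (congrArg (fun s => (s ≫ _) ≫ _) h').trans h

/-- Splittings are transported in both directions along `equiv`, and on the side of `ρ` any
splitting is an isomorphism splitting. -/
lemma isSplit_iff (t : ValueIso K F d) : K.IsSplit F ↔ d.IsIsomorphismSplit :=
  Iff.trans ⟨fun ⟨S⟩ => ⟨t.equiv.splitting S⟩, fun ⟨S⟩ => ⟨t.equiv.symm.splitting S⟩⟩
    Decomposition.isIsomorphismSplit_iff.symm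

end ValueIso

end Correspondences


/-! ## Counital functors and counital bimodule monoids -/

section Correspondences

open Functor.LaxMonoidal

variable {C : Type u} [Category.{v} C] {E : Type uE} [Category.{vE} E] [MonoidalCategory E]
  {P : Type w} [Category.{w} P] [MonoidalCategory P]

/-- The letters, compositions and unit elements of an algebra. -/
abbrev PlusData.morphisms (d : PlusData C P) : PlusMorphisms C P where
  letter := d.obj
  comp φ₁ φ₀ := d.comp φ₁ φ₀
  unit σ := d.unit σ

variable (E) in
/-- The algebra of the trivial functor is trivial. -/
def evalPlusTrivial (A : PlusAlg C P) :
    (evalPlus E A).obj (trivialFunctor P E) ≅ trivialAlg C E :=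
  PlusAlg.isoMk
    { app _ := 𝟙 (𝟙_ E)
      iso_app _ := rfl
      comp_app _ _ := by
        change ((λ_ (𝟙_ E)).hom ≫ 𝟙 _) ≫ 𝟙 _ = (𝟙 _ ⊗ₘ 𝟙 _) ≫ (λ_ (𝟙_ E)).hom
        simp
      unit_app _ := (Category.comp_id _).trans (Category.comp_id _) }
    (fun _ => 𝟙 (𝟙_ E)) (fun _ => Category.comp_id _) fun _ => Category.comp_id _

variable [HasCoproducts.{v} E] [∀ F : (Core C)ᵒᵖ ⥤ Core C ⥤ E, HasCoend F]
  [TensorPreservesCoproducts.{v} E] [MonoInclusions.{v} E]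

/-- An isomorphism of algebras compares the values of a functor with the summands. -/
noncomputable def ValueIso.ofIso {A₀ : PlusAlg C P} {F : StrongFunctor P E}
    {ρ : BimoduleMonoid C E} {b : ρ ⟶ homMonoid C E} {d : Decomposition ρ b}
    (e : d.alg ≅ (evalPlus E A₀).obj F) :
    ValueIso A₀.toPlusData.morphisms F.obj.toFunctor d where
  θ f :=
    { hom := PlusData.Hom.app e.inv f
      inv := PlusData.Hom.app e.hom f
      hom_inv_id := congrArg (fun t => PlusData.Hom.app t f) e.inv_hom_id
      inv_hom_id := congrArg (fun t => PlusData.Hom.app t f) e.hom_inv_id }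
  comp_θ φ₁ φ₀ := PlusData.Hom.comp_app e.inv φ₁ φ₀
  unit_θ σ := PlusData.Hom.unit_app e.inv σ

/-- An isomorphism in the slice over the trivial algebra carries all the information: its components
compare the values, and its compatibility with the structure morphisms compares the counits. -/
lemma corresponds_of_iso {A₀ : PlusAlg C P} {F : StrongFunctor P E}
    {p : (evalPlus E A₀).obj F ⟶ trivialAlg C E} {A : CounitalBimoduleMonoid C E}
    (e : A.overAlg ≅ Over.mk p) {c : ∀ x, F.obj.toFunctor.obj x ⟶ 𝟙_ E}
    (hc : ∀ f, PlusData.Hom.app p f = c (A₀.obj f)) :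
    Corresponds A₀.toPlusData.morphisms F.obj.toFunctor c A := by
  let t := ValueIso.ofIso (d := A.dec) ((Over.forget _).mapIso e)
  exact ⟨⟨fun φ => t.θ (Arrow.mk φ), t.isRealization, fun φ => (congrArg
    (fun t => PlusData.Hom.app t (Arrow.mk φ)) (Over.w e.inv)).trans (hc _)⟩, t.isSplit_iff⟩

end Correspondences

section LaxCorrespondences

open Functor.LaxMonoidal

variable {M : Type u} [Category.{v} M] [MonoidalCategory M] {E : Type uE} [Category.{vE} E]
  [MonoidalCategory E] [BraidedCategory E] {P : Type w} [Category.{w} P] [MonoidalCategory P]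

/-- The letters, compositions, unit elements and products of an algebra. -/
abbrev NcData.morphisms (d : NcData M P) : NcMorphisms M P where
  toPlusMorphisms := d.toPlusData.morphisms
  mu f g := d.mu f g

variable [BraidedCategory P]

variable (E) in
/-- The algebra of the trivial functor is trivial. -/
def evalNcTrivial (A : NcAlg M P) :
    (evalNc E A).obj (trivialSymmetricFunctor P E) ≅ trivialNcAlg M E :=
  NcAlg.isoMk
    { toHom := (evalPlusTrivial E A.toPlusAlg).hom
      mu_app := fun _ _ => by
        change ((λ_ (𝟙_ E)).hom ≫ 𝟙 _) ≫ 𝟙 _ = (𝟙 _ ⊗ₘ 𝟙 _) ≫ (λ_ (𝟙_ E)).hom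
        simp }
    (fun _ => 𝟙 (𝟙_ E)) (fun _ => Category.comp_id _) fun _ => Category.comp_id _

variable [HasCoproducts.{v} E] [∀ F : (Core M)ᵒᵖ ⥤ Core M ⥤ E, HasCoend F]
  [TensorPreservesCoproducts.{v} E] [MonoInclusions.{v} E]

/-- The underlying isomorphism of algebras over the plus construction. -/
def NcAlg.plusIso {A B : NcAlg M E} (e : A ≅ B) : A.toPlusAlg ≅ B.toPlusAlg where
  hom := e.hom.toHom
  inv := e.inv.toHom
  hom_inv_id := congrArg NcAlg.Hom.toHom e.hom_inv_id
  inv_hom_id := congrArg NcAlg.Hom.toHom e.inv_hom_id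

lemma isTensorRealization_of_iso {A₀ : NcAlg M P} {F : StrongSymmetricFunctor P E}
    {A : CounitalLaxBimoduleMonoid M E} (e : A.alg ≅ (evalNc E A₀).obj F) :
    IsTensorRealization A₀.toNcData.morphisms F.obj.toFunctor A.obj.left
      fun φ => e.inv.app (Arrow.mk φ) ≫ A.dec.ι φ := by
  intro X Y X' Y' φ ψ
  have h₁ := congrArg (· ≫ A.dec.ι (φ ⊗ₘ ψ)) (e.inv.mu_app (Arrow.mk φ) (Arrow.mk ψ))
  have h₂ := Decomposition.mu_ι A.respectsTensor (Arrow.mk φ) (Arrow.mk ψ)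
  refine (Eq.trans ?_ h₁).trans ((Category.assoc _ _ _).trans ((congrArg (_ ≫ ·) h₂).trans ?_))
  · exact (Category.assoc _ _ _).symm.trans (Category.assoc _ _ _).symm
  · exact tensorHom_comp_tensorHom_assoc _ _ _ _ _

lemma laxCorresponds_of_iso {A₀ : NcAlg M P} {F : StrongSymmetricFunctor P E}
    {p : (evalNc E A₀).obj F ⟶ trivialNcAlg M E} {A : CounitalLaxBimoduleMonoid M E}
    (e : A.overAlg ≅ Over.mk p) {c : ∀ x, F.obj.toFunctor.obj x ⟶ 𝟙_ E}
    (hc : ∀ f, p.app f = c (A₀.obj f)) :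
    LaxCorresponds A₀.toNcData.morphisms F.obj.toFunctor c A := by
  let e' : A.alg ≅ (evalNc E A₀).obj F := (Over.forget _).mapIso e
  let t := ValueIso.ofIso (F := (forgetSymmetric P E).obj F) (A₀ := A₀.toPlusAlg) (d := A.dec)
    (NcAlg.plusIso e')
  exact ⟨⟨fun φ => t.θ (Arrow.mk φ), ⟨t.isRealization, fun φ => (congrArg
    (fun t : _ ⟶ trivialNcAlg M E => t.app (Arrow.mk φ)) (Over.w e.inv)).trans (hc _)⟩,
    isTensorRealization_of_iso e'⟩, t.isSplit_iff⟩

end LaxCorrespondences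

/-! ### The equivalences with counits -/

section Equivalences

lemma exists_equivalence_over {A : Type*} [Category A] {B : Type*} [Category B] {X : Type*}
    [Category X] (F : A ⥤ X) [F.Full] [F.Faithful] {T : A} {T' : X} (i : F.obj T ≅ T')
    (G : B ⥤ Over T') [G.Full] [G.Faithful]
    (h : ∀ Y, F.essImage Y.left ↔ G.essImage Y) :
    ∃ e : Over T ≌ B, ∀ a, Nonempty (G.obj (e.functor.obj a) ≅ (overFunctor F i).obj a) :=
  exists_equivalence_of_essImage (overFunctor F i) G fun Y =>
    (essImage_overFunctor F i Y).trans (h Y)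

variable {E : Type uE} [Category.{vE} E] [MonoidalCategory E] [SymmetricCategory E]
  [HasCoproducts.{v} E] [TensorPreservesCoproducts.{v} E] [MonoInclusions.{v} E]

section Plain

variable (C : Type u) [Category.{v} C] [∀ F : (Core C)ᵒᵖ ⥤ Core C ⥤ E, HasCoend F]

/-- Both essential images are the whole slice: every algebra is the value of a functor, and every
algebra over the trivial one is an algebra of summands. -/
theorem exists_equivalence_counitalFunctor :
    ∃ e : CounitalFunctor (CPlusGcp C false) E ≌ CounitalBimoduleMonoid C E,
      ∀ F, Corresponds ((plusOps C).morphisms (plusRel C false)) F.left.obj.toFunctor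
        F.hom.hom.hom.app (e.functor.obj F) := by
  obtain ⟨e, he⟩ := exists_equivalence_over (evalPlus E (plusAlg C false))
    (evalPlusTrivial E (plusAlg C false)) (summands C E) fun Y =>
      iff_of_true (by
        obtain ⟨F, hF⟩ := exists_evalPlus_eq false Y.left
        exact ⟨F, ⟨eqToIso hF⟩⟩) (Functor.EssSurj.mem_essImage _ Y)
  refine ⟨e, fun F => ?_⟩
  obtain ⟨t⟩ := he F
  exact corresponds_of_iso t fun _ => Category.comp_id _

theorem exists_equivalence_counitalSymmetricFunctor :
    ∃ e : CounitalSymmetricFunctor (CPlusGcp C true) E ≌ CounitalBimoduleMonoid C E,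
      ∀ F, Corresponds ((plusOps C).morphisms (plusRel C true)) F.left.obj.toFunctor
        F.hom.hom.hom.hom.app (e.functor.obj F) := by
  obtain ⟨e, he⟩ := exists_equivalence_over
    (forgetSymmetric (CPlusGcp C true) E ⋙ evalPlus E (plusAlg C true))
    (T := trivialSymmetricFunctor (CPlusGcp C true) E)
    (evalPlusTrivial E (plusAlg C true)) (summands C E) fun Y =>
      iff_of_true (by
        obtain ⟨F, hF⟩ := exists_evalPlus_symmetric_eq Y.left
        exact ⟨F, ⟨eqToIso hF⟩⟩) (Functor.EssSurj.mem_essImage _ Y)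
  refine ⟨e, fun F => ?_⟩
  obtain ⟨t⟩ := he F
  exact corresponds_of_iso (F := (forgetSymmetric (CPlusGcp C true) E).obj F.left) t
    fun _ => Category.comp_id _

end Plain

section Lax

variable (M : Type u) [Category.{v} M] [MonoidalCategory M]
  [∀ F : (Core M)ᵒᵖ ⥤ Core M ⥤ E, HasCoend F]

/-- The essential image of a full subcategory of the counital lax monoidal bimodule monoids. -/
lemma essImage_laxSummands (Q : ObjectProperty (CounitalLaxBimoduleMonoid M E))
    (Q' : NcAlg M E → Prop) (hQ : ∀ A, Q A ↔ Q' A.alg) (hQ' : ∀ {A B}, (A ≅ B) → Q' A → Q' B)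
    (Y : Over (trivialNcAlg M E)) : (Q.ι ⋙ laxSummands M E).essImage Y ↔ Q' Y.left := by
  constructor
  · rintro ⟨A, ⟨t⟩⟩
    exact hQ' ((Over.forget _).mapIso t) ((hQ A.obj).1 A.property)
  · intro h
    obtain ⟨A, ⟨t⟩⟩ := Functor.EssSurj.mem_essImage (F := laxSummands M E) Y
    exact ⟨⟨A, (hQ A).2 (hQ' ((Over.forget _).mapIso t.symm) h)⟩, ⟨t⟩⟩

/-- The common form of the cases with a condition: `Q` on bimodule monoids matches `Q'` on algebras,
and `Q'` describes the algebras of functors. A counit is available when a functor has to be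
constructed; for `M^{+,gcp}` it is needed to invert the unit. -/
lemma exists_equivalence_lax {P : Type w} [Category.{w} P] [MonoidalCategory P]
    [BraidedCategory P] (A₀ : NcAlg M P) [(evalNc E A₀).Full] [(evalNc E A₀).Faithful]
    (Q : ObjectProperty (CounitalLaxBimoduleMonoid M E))
    (Q' : NcAlg M E → Prop) (hQ : ∀ A, Q A ↔ Q' A.alg) (hQ' : ∀ {A B}, (A ≅ B) → Q' A → Q' B)
    (h : ∀ F, Q' ((evalNc E A₀).obj F))
    (h' : ∀ D : NcAlg M E, (D ⟶ trivialNcAlg M E) → Q' D → ∃ F, (evalNc E A₀).obj F = D) :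
    ∃ e : CounitalSymmetricFunctor P E ≌ Q.FullSubcategory,
      ∀ F, LaxCorresponds A₀.toNcData.morphisms F.left.obj.toFunctor
        F.hom.hom.hom.hom.app (e.functor.obj F).obj := by
  obtain ⟨e, he⟩ := exists_equivalence_over (evalNc E A₀) (evalNcTrivial E A₀)
    (Q.ι ⋙ laxSummands M E) fun Y => by
      rw [essImage_laxSummands M Q Q' hQ hQ']
      constructor
      · rintro ⟨F, ⟨t⟩⟩
        exact hQ' t (h F)
      · intro hY
        obtain ⟨F, hF⟩ := h' Y.left Y.hom hY
        exact ⟨F, ⟨eqToIso hF⟩⟩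
  refine ⟨e, fun F => ?_⟩
  obtain ⟨t⟩ := he F
  exact laxCorresponds_of_iso t fun _ => Category.comp_id _

theorem exists_equivalence_ncPlusGcp :
    ∃ e : CounitalSymmetricFunctor (NcPlusGcp M) E ≌ CounitalLaxBimoduleMonoid M E,
      ∀ F, LaxCorresponds ((ncOps M).morphisms (ncRel M)) F.left.obj.toFunctor
        F.hom.hom.hom.hom.app (e.functor.obj F) := by
  obtain ⟨e, he⟩ := exists_equivalence_over (evalNc E (ncAlg M)) (evalNcTrivial E (ncAlg M))
    (laxSummands M E) fun Y => iff_of_true (by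
      obtain ⟨F, hF⟩ := exists_evalNc_ncAlg Y.left
      exact ⟨F, ⟨eqToIso hF⟩⟩) (Functor.EssSurj.mem_essImage _ Y)
  refine ⟨e, fun F => ?_⟩
  obtain ⟨t⟩ := he F
  exact laxCorresponds_of_iso t fun _ => Category.comp_id _

theorem exists_equivalence_locPlusGcp :
    ∃ e : CounitalSymmetricFunctor (LocPlusGcp M) E ≌
        (CounitalLaxBimoduleMonoid.IsStrong (M := M) (E := E)).FullSubcategory,
      ∀ F, LaxCorresponds ((locOps M).morphisms (locRel M)) F.left.obj.toFunctor
        F.hom.hom.hom.hom.app (e.functor.obj F).obj :=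
  exists_equivalence_lax M (locAlg M) _ (fun D => D.IsStrong)
    CounitalLaxBimoduleMonoid.isStrong_iff NcData.IsStrong.of_iso
    isStrong_evalNc_locAlg fun D _ h => exists_evalNc_locAlg D h

variable [SymmetricCategory M]

theorem exists_equivalence_symNcPlusGcp :
    ∃ e : CounitalSymmetricFunctor (SymNcPlusGcp M) E ≌
        (CounitalLaxBimoduleMonoid.IsSymmetric (M := M) (E := E)).FullSubcategory,
      ∀ F, LaxCorresponds ((ncOps M).morphisms (symNcRel M)) F.left.obj.toFunctor
        F.hom.hom.hom.hom.app (e.functor.obj F).obj :=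
  exists_equivalence_lax M (symNcAlg M) _ (fun D => D.IsCommutative)
    CounitalLaxBimoduleMonoid.isSymmetric_iff NcData.IsCommutative.of_iso
    isCommutative_evalNc_symNcAlg fun D _ h => exists_evalNc_symNcAlg D h

lemma isStrongSymmetric_iff (A : CounitalLaxBimoduleMonoid M E) :
    CounitalLaxBimoduleMonoid.IsStrongSymmetric A ↔ A.alg.IsStrong ∧ A.alg.IsCommutative :=
  and_congr A.isStrong_iff A.isSymmetric_iff

theorem exists_equivalence_symLocPlusGcp :
    ∃ e : CounitalSymmetricFunctor (SymLocPlusGcp M) E ≌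
        (CounitalLaxBimoduleMonoid.IsStrongSymmetric (M := M) (E := E)).FullSubcategory,
      ∀ F, LaxCorresponds ((locOps M).morphisms (symLocRel M)) F.left.obj.toFunctor
        F.hom.hom.hom.hom.app (e.functor.obj F).obj :=
  exists_equivalence_lax M (symLocAlg M) _ (fun D => D.IsStrong ∧ D.IsCommutative)
    (isStrongSymmetric_iff M) (fun e h => ⟨.of_iso e h.1, .of_iso e h.2⟩)
    (fun F => ⟨isStrong_evalNc_symLocAlg F, isCommutative_evalNc_symLocAlg F⟩)
    fun D _ h => exists_evalNc_symLocAlg D h.1 h.2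

theorem exists_equivalence_strongPlusGcp :
    ∃ e : CounitalSymmetricFunctor (StrongPlusGcp M) E ≌
        (CounitalLaxBimoduleMonoid.IsStrongSymmetric (M := M) (E := E)).FullSubcategory,
      ∀ F, LaxCorresponds (strongMorphisms M) F.left.obj.toFunctor
        F.hom.hom.hom.hom.app (e.functor.obj F).obj :=
  exists_equivalence_lax M (strongAlg M) _ (fun D => D.IsStrong ∧ D.IsCommutative)
    (isStrongSymmetric_iff M) (fun e h => ⟨.of_iso e h.1, .of_iso e h.2⟩)
    (fun F => ⟨isStrong_evalNc_strongAlg F, isCommutative_evalNc_strongAlg F⟩)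
    -- The counit `p` makes the unit at `id_𝟙` invertible, as the universal property of `M^{+,gcp}`
    -- requires.
    fun D p h => exists_evalNc_strongAlg D h.1 (NcAlg.isIso_unit h.1 p) h.2

end Lax

end Equivalences


/-! ## The Cartesian case -/

section Extensive

variable {E : Type uE} [Category.{vE} E] [ExtensiveCoproducts.{v} E]

/-- The van Kampen property for discrete diagrams, where naturality squares are automatically
pullbacks. One direction is disjointness, the other universality. -/
lemma nonempty_isColimit_cofan_iff {J : Type v} {X Y : J → E} {c : Cofan X} (hc : IsColimit c)
    {c' : Cofan Y} (a : ∀ j, Y j ⟶ X j) (f : c'.pt ⟶ c.pt)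
    (h : ∀ j, c'.inj j ≫ f = a j ≫ c.inj j) :
    Nonempty (IsColimit c') ↔ ∀ j, IsPullback (c'.inj j) (a j) f (c.inj j) := by
  refine (ExtensiveCoproducts.isVanKampen _ _ hc c' (Discrete.natTrans fun j => a j.as) f ?_
    (.of_discrete _)).trans ?_
  · ext ⟨j⟩
    exact (h j).symm
  · exact ⟨fun k j => k ⟨j⟩, fun k j => k j.as⟩

/-- A square out of a coproduct is a pullback if its restriction to each summand is. By universality
the actual pullback is the coproduct of its restrictions, which are the `Y j`; it is therefore
identified with `c'.pt`. -/
lemma isPullback_of_cofan [HasPullbacks E] {J : Type v} {X Y : J → E} {c : Cofan X}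
    (hc : IsColimit c) {c' : Cofan Y} (hc' : IsColimit c') (a : ∀ j, Y j ⟶ X j) {S T : E}
    (t : c'.pt ⟶ S) (l : c'.pt ⟶ c.pt) (f : S ⟶ T) (g : c.pt ⟶ T)
    (hl : ∀ j, c'.inj j ≫ l = a j ≫ c.inj j)
    (h : ∀ j, IsPullback (c'.inj j ≫ t) (a j) f (c.inj j ≫ g)) : IsPullback t l f g := by
  have hP : IsPullback (pullback.fst f g) (pullback.snd f g) f g := .of_hasPullback f g
  let k j : Y j ⟶ pullback f g := hP.lift (c'.inj j ≫ t) (a j ≫ c.inj j) (by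
    rw [(h j).w, Category.assoc])
  -- Cancelling the pullback square `hP` from the pullback over the summand `j`.
  have hk j : IsPullback (k j) (a j) (pullback.snd f g) (c.inj j) := (h j).of_right' hP
  obtain ⟨hc''⟩ := (nonempty_isColimit_cofan_iff hc (c' := Cofan.mk (pullback f g) k) a
    (pullback.snd f g) fun j => (hk j).w).2 hk
  let e := hc'.coconePointUniqueUpToIso hc''
  have he j : c'.inj j ≫ e.hom = k j := hc'.comp_coconePointUniqueUpToIso_hom hc'' ⟨j⟩
  have h₁ : e.hom ≫ pullback.fst f g = t := Cofan.IsColimit.hom_ext hc' _ _ fun j => by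
    rw [reassoc_of% he j]
    exact hP.lift_fst _ _ _
  have h₂ : e.hom ≫ pullback.snd f g = l := Cofan.IsColimit.hom_ext hc' _ _ fun j => by
    rw [reassoc_of% he j, hl]
    exact hP.lift_snd _ _ _
  exact .of_iso_pullback ⟨by rw [← h₁, ← h₂, Category.assoc, Category.assoc, hP.w]⟩ e h₁ h₂

end Extensive

/-! ### Decompositions into fibres -/

section OverHom

variable {C : Type u} [Category.{v} C] {E : Type uE} [Category.{vE} E] [MonoidalCategory E]
  [HasCoproducts.{v} E] [TensorPreservesCoproducts.{v} E]
  [∀ F : (Core C)ᵒᵖ ⥤ Core C ⥤ E, HasCoend F] [ExtensiveCoproducts.{v} E]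

/-- Disjointness forces the summands of any decomposition to be the fibres, so a decomposition is
unique up to isomorphism. -/
lemma Decomposition.isPullback {ρ : BimoduleMonoid C E} {b : ρ ⟶ homMonoid C E}
    (d : Decomposition ρ b) {X Y : C} (φ : X ⟶ Y) :
    IsPullback (d.ι φ) (d.ε φ) (Bimodule.comp b.hom X Y) (homι E φ) :=
  (nonempty_isColimit_cofan_iff (coproductIsCoproduct fun _ : X ⟶ Y => 𝟙_ E)
    (c' := Cofan.mk (ρ.carrier.at X Y) fun φ : X ⟶ Y => d.ι φ) (fun φ => d.ε φ)
    (Bimodule.comp b.hom X Y) fun φ => d.ι_comp φ).1 ⟨d.isColimit X Y⟩ φ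

section Fibres

variable [HasPullbacks E] (ρ : BimoduleMonoid C E) (b : ρ ⟶ homMonoid C E)

/-- The fibre of a bimodule monoid over `Hom_C` at a morphism. -/
noncomputable abbrev fibre {X Y : C} (φ : X ⟶ Y) : E :=
  pullback (Bimodule.comp b.hom X Y) (homι E φ)

variable {ρ b}

/-- The inclusion of a fibre. -/
noncomputable abbrev fibreι {X Y : C} (φ : X ⟶ Y) : fibre ρ b φ ⟶ ρ.carrier.at X Y :=
  pullback.fst _ _

lemma fibre_condition {X Y : C} (φ : X ⟶ Y) :
    fibreι φ ≫ Bimodule.comp b.hom X Y = pullback.snd (Bimodule.comp b.hom X Y) (homι E φ) ≫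
      homι E φ :=
  pullback.condition

lemma exists_fibre_lift {X Y : C} (φ : X ⟶ Y) {A : E} (f : A ⟶ ρ.carrier.at X Y) (k : A ⟶ 𝟙_ E)
    (h : f ≫ Bimodule.comp b.hom X Y = k ≫ homι E φ) :
    ∃ g : A ⟶ fibre ρ b φ, f = g ≫ fibreι φ :=
  ⟨pullback.lift f k h, (pullback.lift_fst _ _ _).symm⟩

variable (ρ b) in
/-- A bimodule monoid over `Hom_C` is decomposed into its fibres. -/
noncomputable def fibreDecomposition : Decomposition ρ b where
  D φ := fibre ρ b φ
  ι φ := fibreι φ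
  isColimit X Y := ((nonempty_isColimit_cofan_iff (coproductIsCoproduct fun _ : X ⟶ Y => 𝟙_ E)
    (c' := Cofan.mk (ρ.carrier.at X Y) fun φ : X ⟶ Y => fibreι φ) (fun φ => pullback.snd _ _)
    (Bimodule.comp b.hom X Y) fun φ => fibre_condition φ).2
      fun φ => IsPullback.of_hasPullback (Bimodule.comp b.hom X Y) (homι E φ)).some
  ε φ := pullback.snd _ _
  ι_comp φ := fibre_condition φ
  exists_act {X Y X' Y'} φ a a' := by
    have h₁ := congrArg (fibreι (b := b) φ ≫ ·) (Bimodule.act_comp b.hom a a')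
    have h₂ := congrArg (· ≫ (homBimodule C E).act a a') (fibre_condition (b := b) φ)
    exact exists_fibre_lift _ _ (pullback.snd _ _) ((Category.assoc _ _ _).trans (h₁.trans
      ((Category.assoc _ _ _).symm.trans (h₂.trans ((Category.assoc _ _ _).trans
        (congrArg (_ ≫ ·) (homι_act φ a a')))))))
  exists_mul {X Y Z} φ₁ φ₀ := by
    have h₁ := congrArg ((fibreι (b := b) φ₁ ⊗ₘ fibreι (b := b) φ₀) ≫ ·) ((b.mul_hom X Y Z).trans
      (congrArg (_ ≫ ·) (homMonoidData_mul X Y Z)))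
    refine exists_fibre_lift _ _ ((pullback.snd _ _ ⊗ₘ pullback.snd _ _) ≫ (λ_ (𝟙_ E)).hom)
      ((Category.assoc _ _ _).trans (h₁.trans ?_))
    refine (tensorHom_comp_tensorHom_assoc _ _ _ _ _).trans ?_
    refine (congrArg₂ (fun s t => (s ⊗ₘ t) ≫ homMul E X Y Z) (fibre_condition φ₁)
      (fibre_condition φ₀)).trans ?_
    refine (tensorHom_comp_tensorHom_assoc _ _ _ _ _).symm.trans ?_
    exact (congrArg (_ ≫ ·) (homι_homMul φ₁ φ₀)).trans (Category.assoc _ _ _).symm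
  exists_elt {X Y} σ :=
    exists_fibre_lift _ _ (𝟙 _) ((b.elt_hom σ).trans ((homMonoidData_elt σ).trans
      (Category.id_comp _).symm))

end Fibres

/-- The summands of the target are fibres, so a morphism over `Hom_C` automatically respects the
decompositions. -/
lemma exists_hom_of_over {ρ ρ' : BimoduleMonoid C E} {b : ρ ⟶ homMonoid C E}
    {b' : ρ' ⟶ homMonoid C E} (d : Decomposition ρ b) (d' : Decomposition ρ' b') (f : ρ ⟶ ρ')
    (h : f ≫ b' = b) {X Y : C} (φ : X ⟶ Y) : ∃ g : d.D φ ⟶ d'.D φ,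
      d.ι φ ≫ Bimodule.comp f.hom X Y = g ≫ d'.ι φ := by
  subst h
  refine ⟨(d'.isPullback φ).lift (d.ι φ ≫ Bimodule.comp f.hom X Y) (d.ε φ) ?_,
    ((d'.isPullback φ).lift_fst _ _ _).symm⟩
  exact (Category.assoc _ _ _).trans (d.ι_comp φ)

/-- The underlying bimodule monoid over `Hom_C`. -/
noncomputable def forgetDecomposition : CounitalBimoduleMonoid C E ⥤ Over (homMonoid C E) where
  obj A := A.obj
  map f := CounitalBimoduleMonoid.Hom.hom f

instance : (forgetDecomposition (C := C) (E := E)).Faithful where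
  map_injective h := CounitalBimoduleMonoid.Hom.ext h

instance : (forgetDecomposition (C := C) (E := E)).Full where
  map_surjective {A B} f := ⟨⟨f, exists_hom_of_over A.dec B.dec f.left (Over.w f)⟩, rfl⟩

/-- Universality makes every bimodule monoid over `Hom_C` the coproduct of its fibres. With the
fullness above, decompositions carry no information in this case. -/
instance [HasPullbacks E] : (forgetDecomposition (C := C) (E := E)).EssSurj :=
  Functor.essSurj_of_surj fun B => ⟨⟨B, fibreDecomposition B.left B.hom⟩, rfl⟩

instance [HasPullbacks E] : (forgetDecomposition (C := C) (E := E)).IsEquivalence where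

end OverHom

/-! ### Fibres of lax monoidal bimodule monoids -/

section LaxOverHom

variable {M : Type u} [Category.{v} M] [MonoidalCategory M] {E : Type uE} [Category.{vE} E]
  [MonoidalCategory E] [BraidedCategory E] [HasCoproducts.{v} E] [TensorPreservesCoproducts.{v} E]
  [∀ F : (Core M)ᵒᵖ ⥤ Core M ⥤ E, HasCoend F] [ExtensiveCoproducts.{v} E]

/-- The underlying lax monoidal bimodule monoid over `Hom_M`. -/
noncomputable def forgetLaxDecomposition : CounitalLaxBimoduleMonoid M E ⥤ Over (homLax M E) where
  obj A := A.obj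
  map f := CounitalLaxBimoduleMonoid.Hom.hom f

instance : (forgetLaxDecomposition (M := M) (E := E)).Faithful where
  map_injective h := CounitalLaxBimoduleMonoid.Hom.ext h

instance : (forgetLaxDecomposition (M := M) (E := E)).Full where
  map_surjective {A B} f := ⟨⟨f, exists_hom_of_over A.dec B.dec f.left.toHom
    (congrArg LaxMonoidalBimoduleMonoid.Hom.toHom (Over.w f))⟩, rfl⟩

/-- The product of elements over `φ` and `ψ` lies over `φ ⊗ ψ`; hence `μ` maps the product of two
fibres to a fibre. -/
lemma tensor_over (B : Over (homLax M E)) (d : Decomposition B.left.toBimoduleMonoid B.hom.toHom)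
    {X Y X' Y' : M} (φ : X ⟶ Y) (ψ : X' ⟶ Y') :
    ((d.ι φ ⊗ₘ d.ι ψ) ≫ B.left.tensor X Y X' Y') ≫ Bimodule.comp B.hom.hom _ _ =
      ((d.ε φ ⊗ₘ d.ε ψ) ≫ (λ_ (𝟙_ E)).hom) ≫ homι E (φ ⊗ₘ ψ) := by
  have h₁ := congrArg ((d.ι φ ⊗ₘ d.ι ψ) ≫ ·) (B.hom.tensor_hom X Y X' Y')
  refine (Category.assoc _ _ _).trans (h₁.trans ?_)
  refine (tensorHom_comp_tensorHom_assoc _ _ _ _ _).trans ?_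
  refine (congrArg₂ (fun s t => (s ⊗ₘ t) ≫ homTensor E X Y X' Y') (d.ι_comp φ)
    (d.ι_comp ψ)).trans ?_
  refine (tensorHom_comp_tensorHom_assoc _ _ _ _ _).symm.trans ?_
  exact (congrArg (_ ≫ ·) (homι_homTensor φ ψ)).trans (Category.assoc _ _ _).symm

lemma forgetLaxDecomposition_surjective [HasPullbacks E] (B : Over (homLax M E)) :
    ∃ A : CounitalLaxBimoduleMonoid M E, forgetLaxDecomposition.obj A = B :=
  let d := fibreDecomposition B.left.toBimoduleMonoid B.hom.toHom
  ⟨⟨B, d, fun φ ψ => exists_fibre_lift _ _ _ (tensor_over B d φ ψ)⟩, rfl⟩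

namespace CounitalLaxBimoduleMonoid

variable (A : CounitalLaxBimoduleMonoid M E)

/-- The products of the morphisms of `M`, as a cofan. -/
noncomputable abbrev homTensorCofan (E : Type uE) [Category.{vE} E] [MonoidalCategory E]
    [HasCoproducts.{v} E] (X Y X' Y' : M) :
    Cofan fun _ : (X ⟶ Y) × (X' ⟶ Y') => 𝟙_ E ⊗ 𝟙_ E :=
  Cofan.mk ((homBimodule M E).at X Y ⊗ (homBimodule M E).at X' Y') fun p =>
    homι E p.1 ⊗ₘ homι E p.2

/-- `Hom(X, Y) ⊗ Hom(X', Y')` is a coproduct. -/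
noncomputable def isColimitHomTensorCofan (X Y X' Y' : M) :
    IsColimit (homTensorCofan E X Y X' Y') :=
  isColimitCofanTensor (coproductIsCoproduct fun _ : X ⟶ Y => 𝟙_ E)
    (coproductIsCoproduct fun _ : X' ⟶ Y' => 𝟙_ E)

/-- A tensor product of coproducts is the coproduct over pairs, so the fibre of the tensor product
over `(φ, ψ)` is the tensor product of the fibres. -/
lemma isPullback_tensor {X Y X' Y' : M} (φ : X ⟶ Y) (ψ : X' ⟶ Y') :
    IsPullback (A.dec.ι φ ⊗ₘ A.dec.ι ψ) (A.dec.ε φ ⊗ₘ A.dec.ε ψ)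
      (Bimodule.comp A.obj.hom.hom X Y ⊗ₘ Bimodule.comp A.obj.hom.hom X' Y')
      (homι E φ ⊗ₘ homι E ψ) :=
  (nonempty_isColimit_cofan_iff (isColimitHomTensorCofan X Y X' Y')
    (c' := Cofan.mk (A.obj.left.carrier.at X Y ⊗ A.obj.left.carrier.at X' Y')
      fun p : (X ⟶ Y) × (X' ⟶ Y') => A.dec.ι p.1 ⊗ₘ A.dec.ι p.2)
    (fun p => A.dec.ε p.1 ⊗ₘ A.dec.ε p.2)
    (Bimodule.comp A.obj.hom.hom X Y ⊗ₘ Bimodule.comp A.obj.hom.hom X' Y') fun p =>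
      (tensorHom_comp_tensorHom _ _ _ _).trans ((congrArg₂ (fun s t => s ⊗ₘ t) (A.dec.ι_comp p.1)
        (A.dec.ι_comp p.2)).trans (tensorHom_comp_tensorHom _ _ _ _).symm)).1
    ⟨isColimitCofanTensor (A.dec.isColimit X Y) (A.dec.isColimit X' Y')⟩ (φ, ψ)

/-- The square factors into the one of `muMap` over the isomorphism `𝟙 ⊗ 𝟙 ≅ 𝟙` and the pullback
square of the fibre at `φ ⊗ ψ`. Pasting gives both directions. -/
lemma isIso_muMap_iff {X Y X' Y' : M} (φ : X ⟶ Y) (ψ : X' ⟶ Y') :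
    IsIso (Decomposition.muMap A.respectsTensor φ ψ) ↔
      IsPullback ((A.dec.ι φ ⊗ₘ A.dec.ι ψ) ≫ A.obj.left.tensor X Y X' Y')
        (A.dec.ε φ ⊗ₘ A.dec.ε ψ) (Bimodule.comp A.obj.hom.hom _ _)
        ((homι E φ ⊗ₘ homι E ψ) ≫ homTensor E X Y X' Y') := by
  have h : Decomposition.muMap A.respectsTensor φ ψ ≫ A.dec.ε (φ ⊗ₘ ψ) =
      (A.dec.ε φ ⊗ₘ A.dec.ε ψ) ≫ (λ_ (𝟙_ E)).hom :=
    congrArg (fun t => t) (A.counit.mu_app (Arrow.mk φ) (Arrow.mk ψ))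
  -- The two composites are replaced by variables so that their factorizations can be substituted.
  have key : ∀ (g : 𝟙_ E ⊗ 𝟙_ E ⟶ (homBimodule M E).at (X ⊗ X') (Y ⊗ Y'))
      (g' : A.dec.D φ ⊗ A.dec.D ψ ⟶ A.obj.left.carrier.at (X ⊗ X') (Y ⊗ Y')),
      g = (λ_ (𝟙_ E)).hom ≫ homι E (φ ⊗ₘ ψ) →
      Decomposition.muMap A.respectsTensor φ ψ ≫ A.dec.ι (φ ⊗ₘ ψ) = g' →
      (IsIso (Decomposition.muMap A.respectsTensor φ ψ) ↔
        IsPullback g' (A.dec.ε φ ⊗ₘ A.dec.ε ψ) (Bimodule.comp A.obj.hom.hom _ _) g) := by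
    rintro g g' rfl rfl
    exact ⟨fun i => (IsPullback.of_horiz_isIso ⟨h⟩).paste_horiz (A.dec.isPullback (φ ⊗ₘ ψ)),
      fun k => (k.of_right h (A.dec.isPullback (φ ⊗ₘ ψ))).isIso_fst_of_isIso⟩
  exact key _ _ (homι_homTensor φ ψ) (Decomposition.muMap_ι A.respectsTensor φ ψ)

end CounitalLaxBimoduleMonoid

/-- The square of `μ` is a pullback if and only if its restrictions to the pairs `(φ, ψ)` are:
`isPullback_of_cofan` assembles them, pasting with `isPullback_tensor` restricts. -/
lemma isStrong_iff_isStrongOverHom [HasPullbacks E] (A : CounitalLaxBimoduleMonoid M E) :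
    CounitalLaxBimoduleMonoid.IsStrong A ↔ IsStrongOverHom A.obj := by
  rw [A.isStrong_iff]
  constructor
  · intro h X Y X' Y'
    exact isPullback_of_cofan (CounitalLaxBimoduleMonoid.isColimitHomTensorCofan (E := E) X Y X' Y')
      (isColimitCofanTensor (A.dec.isColimit X Y) (A.dec.isColimit X' Y'))
      (fun p => A.dec.ε p.1 ⊗ₘ A.dec.ε p.2) _ _ _ _ (fun p => (A.isPullback_tensor p.1 p.2).w)
      fun p => (A.isIso_muMap_iff p.1 p.2).1 (h (Arrow.mk p.1) (Arrow.mk p.2))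
  · intro h f g
    exact (A.isIso_muMap_iff f.hom g.hom).2
      ((A.isPullback_tensor f.hom g.hom).paste_horiz (h _ _ _ _))

end LaxOverHom


/-! ### Functors and fibres in the Cartesian case -/

section CartesianCorrespondences

variable {E : Type uE} [Category.{vE} E] [CartesianMonoidalCategory E]

open CartesianMonoidalCategory

variable (E) in
/-- In the Cartesian case, the trivial algebra is terminal. -/
def isTerminalTrivialAlg (C : Type u) [Category.{v} C] : IsTerminal (trivialAlg C E) :=
  IsTerminal.ofUniqueHom (fun D =>
    ({ app f := toUnit (D.obj f)
       iso_app _ := toUnit_unique _ _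
       comp_app _ _ := toUnit_unique _ _
       unit_app _ := toUnit_unique _ _ } : PlusData.Hom D.toPlusData (trivialData C E)))
    fun _ _ => PlusAlg.hom_ext fun _ => toUnit_unique _ _

variable (E) in
/-- In the Cartesian case, the trivial algebra is terminal. -/
def isTerminalTrivialNcAlg [BraidedCategory E] (M : Type u) [Category.{v} M]
    [MonoidalCategory M] : IsTerminal (trivialNcAlg M E) :=
  IsTerminal.ofUniqueHom (fun D =>
    ({ toHom := (isTerminalTrivialAlg E M).from D.toPlusAlg
       mu_app _ _ := toUnit_unique _ _ } : NcAlg.Hom D (trivialNcAlg M E)))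
    fun _ _ => NcAlg.hom_ext fun _ => toUnit_unique _ _

variable [HasCoproducts.{v} E] [TensorPreservesCoproducts.{v} E] [ExtensiveCoproducts.{v} E]
  {P : Type w} [Category.{w} P] [MonoidalCategory P]

section Plain

variable {C : Type u} [Category.{v} C] [∀ F : (Core C)ᵒᵖ ⥤ Core C ⥤ E, HasCoend F]

/-- The summand at `φ` is the fibre, and its counit can only be the morphism to the terminal object.
-/
lemma ValueIso.isPullback {K : PlusMorphisms C P} {F : P ⥤ E} [F.LaxMonoidal]
    {ρ : BimoduleMonoid C E} {b : ρ ⟶ homMonoid C E} {d : Decomposition ρ b} (t : ValueIso K F d)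
    {X Y : C} (φ : X ⟶ Y) : IsPullback ((t.θ (Arrow.mk φ)).hom ≫ d.ι φ) (toUnit _)
      (Bimodule.comp b.hom X Y) (homι E φ) := by
  have h : IsPullback (t.θ (Arrow.mk φ)).hom (toUnit _) (d.ε φ) (𝟙 (𝟙_ E)) :=
    .of_horiz_isIso ⟨toUnit_unique _ _⟩
  exact (congrArg (IsPullback _ _ _) (Category.id_comp _)).mp (h.paste_horiz (d.isPullback φ))

lemma cartesianCorresponds_of_iso {A₀ : PlusAlg C P} {F : StrongFunctor P E}
    {A : CounitalBimoduleMonoid C E} (e : A.dec.alg ≅ (evalPlus E A₀).obj F) :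
    CartesianCorresponds A₀.toPlusData.morphisms F.obj.toFunctor A.obj :=
  let t := ValueIso.ofIso e
  ⟨fun φ => (t.θ (Arrow.mk φ)).hom ≫ A.dec.ι φ, t.isRealization, t.isPullback⟩

end Plain

section Lax

variable {M : Type u} [Category.{v} M] [MonoidalCategory M] [BraidedCategory E]
  [∀ F : (Core M)ᵒᵖ ⥤ Core M ⥤ E, HasCoend F] [BraidedCategory P]

lemma cartesianLaxCorresponds_of_iso {A₀ : NcAlg M P} {F : StrongSymmetricFunctor P E}
    {A : CounitalLaxBimoduleMonoid M E} (e : A.alg ≅ (evalNc E A₀).obj F) :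
    CartesianLaxCorresponds A₀.toNcData.morphisms F.obj.toFunctor A.obj :=
  let t := ValueIso.ofIso (F := (forgetSymmetric P E).obj F) (A₀ := A₀.toPlusAlg) (d := A.dec)
    (NcAlg.plusIso e)
  ⟨fun φ => (t.θ (Arrow.mk φ)).hom ≫ A.dec.ι φ, t.isRealization, isTensorRealization_of_iso e,
    t.isPullback⟩

end Lax

end CartesianCorrespondences

/-! ### The equivalences in the Cartesian case -/

section CartesianEquivalences

variable {E : Type uE} [Category.{vE} E] [CartesianMonoidalCategory E] [BraidedCategory E]
  [HasPullbacks E] [HasCoproducts.{v} E] [TensorPreservesCoproducts.{v} E]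
  [ExtensiveCoproducts.{v} E]

section Plain

variable (C : Type u) [Category.{v} C] [∀ F : (Core C)ᵒᵖ ⥤ Core C ⥤ E, HasCoend F]

/-- The trivial algebra is terminal, so the slice over it is the category of algebras and counits
may be dropped; on the other side the decompositions are forgotten. -/
theorem exists_equivalence_strongFunctor :
    ∃ e : StrongFunctor (CPlusGcp C false) E ≌ Over (homMonoid C E),
      ∀ F, CartesianCorresponds ((plusOps C).morphisms (plusRel C false)) F.obj.toFunctor
        (e.functor.obj F) := by
  obtain ⟨e, he⟩ := exists_equivalence_of_essImage (evalPlus E (plusAlg C false))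
    (summands C E ⋙ (Over.equivalenceOfIsTerminal (isTerminalTrivialAlg E C)).functor)
    fun D => iff_of_true (by
      obtain ⟨F, hF⟩ := exists_evalPlus_eq false D
      exact ⟨F, ⟨eqToIso hF⟩⟩) (Functor.EssSurj.mem_essImage _ D)
  refine ⟨e.trans forgetDecomposition.asEquivalence, fun F => ?_⟩
  obtain ⟨t⟩ := he F
  exact cartesianCorresponds_of_iso t

theorem exists_equivalence_strongSymmetricFunctor :
    ∃ e : StrongSymmetricFunctor (CPlusGcp C true) E ≌ Over (homMonoid C E),
      ∀ F, CartesianCorresponds ((plusOps C).morphisms (plusRel C true)) F.obj.toFunctor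
        (e.functor.obj F) := by
  obtain ⟨e, he⟩ := exists_equivalence_of_essImage
    (forgetSymmetric (CPlusGcp C true) E ⋙ evalPlus E (plusAlg C true))
    (summands C E ⋙ (Over.equivalenceOfIsTerminal (isTerminalTrivialAlg E C)).functor)
    fun D => iff_of_true (by
      obtain ⟨F, hF⟩ := exists_evalPlus_symmetric_eq D
      exact ⟨F, ⟨eqToIso hF⟩⟩) (Functor.EssSurj.mem_essImage _ D)
  refine ⟨e.trans forgetDecomposition.asEquivalence, fun F => ?_⟩
  obtain ⟨t⟩ := he F
  exact cartesianCorresponds_of_iso (F := (forgetSymmetric (CPlusGcp C true) E).obj F) t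

end Plain

section Lax

variable (M : Type u) [Category.{v} M] [MonoidalCategory M]
  [∀ F : (Core M)ᵒᵖ ⥤ Core M ⥤ E, HasCoend F]

/-- The Cartesian counterpart of `exists_equivalence_lax`. After the equivalence with decomposed
monoids satisfying `Q`, the forgetful functor identifies these with the monoids over `Hom_M`
satisfying `R`. -/
lemma exists_equivalence_cartesian {P : Type w} [Category.{w} P] [MonoidalCategory P]
    [BraidedCategory P] (A₀ : NcAlg M P) [(evalNc E A₀).Full] [(evalNc E A₀).Faithful]
    (Q : ObjectProperty (CounitalLaxBimoduleMonoid M E))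
    (Q' : NcAlg M E → Prop) (hQ : ∀ A, Q A ↔ Q' A.alg) (hQ' : ∀ {A B}, (A ≅ B) → Q' A → Q' B)
    (h : ∀ F, Q' ((evalNc E A₀).obj F))
    (h' : ∀ D : NcAlg M E, Q' D → ∃ F, (evalNc E A₀).obj F = D)
    (R : ObjectProperty (Over (homLax M E))) (hR : ∀ A, Q A ↔ R A.obj) :
    ∃ e : StrongSymmetricFunctor P E ≌ R.FullSubcategory,
      ∀ F, CartesianLaxCorresponds A₀.toNcData.morphisms F.obj.toFunctor
        (e.functor.obj F).obj := by
  obtain ⟨e, he⟩ := exists_equivalence_of_essImage (evalNc E A₀)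
    ((Q.ι ⋙ laxSummands M E) ⋙
      (Over.equivalenceOfIsTerminal (isTerminalTrivialNcAlg E M)).functor) fun D => by
      constructor
      · rintro ⟨F, ⟨t⟩⟩
        obtain ⟨A, ⟨s⟩⟩ := (essImage_laxSummands M Q Q' hQ hQ'
          (Over.mk ((isTerminalTrivialNcAlg E M).from D))).2 (hQ' t (h F))
        exact ⟨A, ⟨(Over.forget _).mapIso s⟩⟩
      · rintro ⟨A, ⟨t⟩⟩
        obtain ⟨F, hF⟩ := h' D (hQ' t ((hQ A.obj).1 A.property))
        exact ⟨F, ⟨eqToIso hF⟩⟩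
  let V : Q.FullSubcategory ⥤ Over (homLax M E) := Q.ι ⋙ forgetLaxDecomposition
  have : V.Full := Functor.Full.comp _ _
  have : V.Faithful := Functor.Faithful.comp _ _
  let U : Q.FullSubcategory ⥤ R.FullSubcategory :=
    R.lift V fun A => (hR A.obj).1 A.property
  -- The fibres provide a decomposition of any object, and `hR` translates the condition.
  have : U.EssSurj := Functor.essSurj_of_surj fun B => by
    obtain ⟨A, hA⟩ := forgetLaxDecomposition_surjective B.obj
    obtain ⟨B, hB⟩ := B
    obtain rfl : A.obj = B := hA
    exact ⟨⟨A, (hR A).2 hB⟩, rfl⟩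
  have : U.Full := Functor.Full.of_comp_faithful_iso (R.liftCompιIso V _)
  have : U.Faithful := Functor.Faithful.of_comp_iso (R.liftCompιIso V _)
  have : U.IsEquivalence := { }
  refine ⟨e.trans U.asEquivalence, fun F => ?_⟩
  obtain ⟨t⟩ := he F
  exact cartesianLaxCorresponds_of_iso t

theorem exists_equivalence_cartesian_ncPlusGcp :
    ∃ e : StrongSymmetricFunctor (NcPlusGcp M) E ≌ Over (homLax M E),
      ∀ F, CartesianLaxCorresponds ((ncOps M).morphisms (ncRel M)) F.obj.toFunctor
        (e.functor.obj F) := by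
  obtain ⟨e, he⟩ := exists_equivalence_of_essImage (evalNc E (ncAlg M))
    (laxSummands M E ⋙ (Over.equivalenceOfIsTerminal (isTerminalTrivialNcAlg E M)).functor)
    fun D => iff_of_true (by
      obtain ⟨F, hF⟩ := exists_evalNc_ncAlg D
      exact ⟨F, ⟨eqToIso hF⟩⟩) (Functor.EssSurj.mem_essImage _ D)
  have : (forgetLaxDecomposition (M := M) (E := E)).EssSurj :=
    Functor.essSurj_of_surj forgetLaxDecomposition_surjective
  have : (forgetLaxDecomposition (M := M) (E := E)).IsEquivalence := { }
  refine ⟨e.trans forgetLaxDecomposition.asEquivalence, fun F => ?_⟩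
  obtain ⟨t⟩ := he F
  exact cartesianLaxCorresponds_of_iso t

theorem exists_equivalence_cartesian_locPlusGcp :
    ∃ e : StrongSymmetricFunctor (LocPlusGcp M) E ≌
        (IsStrongOverHom (M := M) (E := E)).FullSubcategory,
      ∀ F, CartesianLaxCorresponds ((locOps M).morphisms (locRel M)) F.obj.toFunctor
        (e.functor.obj F).obj :=
  exists_equivalence_cartesian M (locAlg M) _ (fun D => D.IsStrong)
    CounitalLaxBimoduleMonoid.isStrong_iff NcData.IsStrong.of_iso
    isStrong_evalNc_locAlg (fun D h => exists_evalNc_locAlg D h) _ isStrong_iff_isStrongOverHom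

variable [SymmetricCategory M]

theorem exists_equivalence_cartesian_symNcPlusGcp :
    ∃ e : StrongSymmetricFunctor (SymNcPlusGcp M) E ≌
        (IsSymmetricOverHom (M := M) (E := E)).FullSubcategory,
      ∀ F, CartesianLaxCorresponds ((ncOps M).morphisms (symNcRel M)) F.obj.toFunctor
        (e.functor.obj F).obj :=
  exists_equivalence_cartesian M (symNcAlg M) _ (fun D => D.IsCommutative)
    CounitalLaxBimoduleMonoid.isSymmetric_iff NcData.IsCommutative.of_iso
    isCommutative_evalNc_symNcAlg (fun D h => exists_evalNc_symNcAlg D h) _ fun _ => Iff.rfl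

lemma isStrongSymmetric_iff_isStrongSymmetricOverHom (A : CounitalLaxBimoduleMonoid M E) :
    CounitalLaxBimoduleMonoid.IsStrongSymmetric A ↔ IsStrongSymmetricOverHom A.obj :=
  and_congr (isStrong_iff_isStrongOverHom A) Iff.rfl

theorem exists_equivalence_cartesian_symLocPlusGcp :
    ∃ e : StrongSymmetricFunctor (SymLocPlusGcp M) E ≌
        (IsStrongSymmetricOverHom (M := M) (E := E)).FullSubcategory,
      ∀ F, CartesianLaxCorresponds ((locOps M).morphisms (symLocRel M)) F.obj.toFunctor
        (e.functor.obj F).obj :=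
  exists_equivalence_cartesian M (symLocAlg M) _ (fun D => D.IsStrong ∧ D.IsCommutative)
    (isStrongSymmetric_iff M) (fun e h => ⟨.of_iso e h.1, .of_iso e h.2⟩)
    (fun F => ⟨isStrong_evalNc_symLocAlg F, isCommutative_evalNc_symLocAlg F⟩)
    (fun D h => exists_evalNc_symLocAlg D h.1 h.2) _
    (isStrongSymmetric_iff_isStrongSymmetricOverHom M)

theorem exists_equivalence_cartesian_strongPlusGcp :
    ∃ e : StrongSymmetricFunctor (StrongPlusGcp M) E ≌
        (IsStrongSymmetricOverHom (M := M) (E := E)).FullSubcategory,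
      ∀ F, CartesianLaxCorresponds (strongMorphisms M) F.obj.toFunctor
        (e.functor.obj F).obj :=
  exists_equivalence_cartesian M (strongAlg M) _ (fun D => D.IsStrong ∧ D.IsCommutative)
    (isStrongSymmetric_iff M) (fun e h => ⟨.of_iso e h.1, .of_iso e h.2⟩)
    (fun F => ⟨isStrong_evalNc_strongAlg F, isCommutative_evalNc_strongAlg F⟩)
    (fun D h => exists_evalNc_strongAlg D h.1
      -- The counit required for the invertibility of the unit is the unique morphism to the
      -- terminal algebra.
      (NcAlg.isIso_unit h.1 ((isTerminalTrivialNcAlg E M).from D)) h.2) _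
    (isStrongSymmetric_iff_isStrongSymmetricOverHom M)

end Lax

end CartesianEquivalences

end PlusConstruction

theorem theorem4p5 :
    (∀ (E : Type uE) [Category.{vE} E] [MonoidalCategory E] [SymmetricCategory E]
      [HasCoproducts.{v} E] [TensorPreservesCoproducts.{v} E] [MonoCoprod E],
      (∀ (C : Type u) [Category.{v} C] [∀ F : (Core C)ᵒᵖ ⥤ Core C ⥤ E, HasCoend F],
        (∃ e : CounitalFunctor (CPlusGcp C false) E ≌ CounitalBimoduleMonoid C E,
          ∀ F, Corresponds ((plusOps C).morphisms (plusRel C false)) F.left.obj.toFunctor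
            F.hom.hom.hom.app (e.functor.obj F)) ∧
        (∃ e : CounitalSymmetricFunctor (CPlusGcp C true) E ≌ CounitalBimoduleMonoid C E,
          ∀ F, Corresponds ((plusOps C).morphisms (plusRel C true)) F.left.obj.toFunctor
            F.hom.hom.hom.hom.app (e.functor.obj F))) ∧
      (∀ (M : Type u) [Category.{v} M] [MonoidalCategory M]
        [∀ F : (Core M)ᵒᵖ ⥤ Core M ⥤ E, HasCoend F],
        (∃ e : CounitalSymmetricFunctor (NcPlusGcp M) E ≌ CounitalLaxBimoduleMonoid M E,
          ∀ F, LaxCorresponds ((ncOps M).morphisms (ncRel M)) F.left.obj.toFunctor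
            F.hom.hom.hom.hom.app (e.functor.obj F)) ∧
        (∃ e : CounitalSymmetricFunctor (LocPlusGcp M) E ≌
            (CounitalLaxBimoduleMonoid.IsStrong (M := M) (E := E)).FullSubcategory,
          ∀ F, LaxCorresponds ((locOps M).morphisms (locRel M)) F.left.obj.toFunctor
            F.hom.hom.hom.hom.app (e.functor.obj F).obj)) ∧
      (∀ (M : Type u) [Category.{v} M] [MonoidalCategory M] [SymmetricCategory M]
        [∀ F : (Core M)ᵒᵖ ⥤ Core M ⥤ E, HasCoend F],
        (∃ e : CounitalSymmetricFunctor (SymNcPlusGcp M) E ≌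
            (CounitalLaxBimoduleMonoid.IsSymmetric (M := M) (E := E)).FullSubcategory,
          ∀ F, LaxCorresponds ((ncOps M).morphisms (symNcRel M)) F.left.obj.toFunctor
            F.hom.hom.hom.hom.app (e.functor.obj F).obj) ∧
        (∃ e : CounitalSymmetricFunctor (SymLocPlusGcp M) E ≌
            (CounitalLaxBimoduleMonoid.IsStrongSymmetric (M := M) (E := E)).FullSubcategory,
          ∀ F, LaxCorresponds ((locOps M).morphisms (symLocRel M)) F.left.obj.toFunctor
            F.hom.hom.hom.hom.app (e.functor.obj F).obj) ∧
        (∃ e : CounitalSymmetricFunctor (StrongPlusGcp M) E ≌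
            (CounitalLaxBimoduleMonoid.IsStrongSymmetric (M := M) (E := E)).FullSubcategory,
          ∀ F, LaxCorresponds (strongMorphisms M) F.left.obj.toFunctor
            F.hom.hom.hom.hom.app (e.functor.obj F).obj))) ∧
    (∀ (E : Type uE) [Category.{vE} E] [CartesianMonoidalCategory E] [BraidedCategory E]
      [HasPullbacks E] [HasCoproducts.{v} E] [TensorPreservesCoproducts.{v} E]
      [ExtensiveCoproducts.{v} E],
      (∀ (C : Type u) [Category.{v} C] [∀ F : (Core C)ᵒᵖ ⥤ Core C ⥤ E, HasCoend F],
        (∃ e : StrongFunctor (CPlusGcp C false) E ≌ Over (homMonoid C E),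
          ∀ F, CartesianCorresponds ((plusOps C).morphisms (plusRel C false)) F.obj.toFunctor
            (e.functor.obj F)) ∧
        (∃ e : StrongSymmetricFunctor (CPlusGcp C true) E ≌ Over (homMonoid C E),
          ∀ F, CartesianCorresponds ((plusOps C).morphisms (plusRel C true)) F.obj.toFunctor
            (e.functor.obj F))) ∧
      (∀ (M : Type u) [Category.{v} M] [MonoidalCategory M]
        [∀ F : (Core M)ᵒᵖ ⥤ Core M ⥤ E, HasCoend F],
        (∃ e : StrongSymmetricFunctor (NcPlusGcp M) E ≌ Over (homLax M E),
          ∀ F, CartesianLaxCorresponds ((ncOps M).morphisms (ncRel M)) F.obj.toFunctor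
            (e.functor.obj F)) ∧
        (∃ e : StrongSymmetricFunctor (LocPlusGcp M) E ≌
            (IsStrongOverHom (M := M) (E := E)).FullSubcategory,
          ∀ F, CartesianLaxCorresponds ((locOps M).morphisms (locRel M)) F.obj.toFunctor
            (e.functor.obj F).obj)) ∧
      (∀ (M : Type u) [Category.{v} M] [MonoidalCategory M] [SymmetricCategory M]
        [∀ F : (Core M)ᵒᵖ ⥤ Core M ⥤ E, HasCoend F],
        (∃ e : StrongSymmetricFunctor (SymNcPlusGcp M) E ≌
            (IsSymmetricOverHom (M := M) (E := E)).FullSubcategory,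
          ∀ F, CartesianLaxCorresponds ((ncOps M).morphisms (symNcRel M)) F.obj.toFunctor
            (e.functor.obj F).obj) ∧
        (∃ e : StrongSymmetricFunctor (SymLocPlusGcp M) E ≌
            (IsStrongSymmetricOverHom (M := M) (E := E)).FullSubcategory,
          ∀ F, CartesianLaxCorresponds ((locOps M).morphisms (symLocRel M)) F.obj.toFunctor
            (e.functor.obj F).obj) ∧
        (∃ e : StrongSymmetricFunctor (StrongPlusGcp M) E ≌
            (IsStrongSymmetricOverHom (M := M) (E := E)).FullSubcategory,
          ∀ F, CartesianLaxCorresponds (strongMorphisms M) F.obj.toFunctor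
            (e.functor.obj F).obj))) := by
  refine ⟨?_, ?_⟩
  · intro E _ _ _ _ _ _
    exact ⟨fun C _ _ => ⟨exists_equivalence_counitalFunctor C,
        exists_equivalence_counitalSymmetricFunctor C⟩,
      fun M _ _ _ => ⟨exists_equivalence_ncPlusGcp M, exists_equivalence_locPlusGcp M⟩,
      fun M _ _ _ _ => ⟨exists_equivalence_symNcPlusGcp M, exists_equivalence_symLocPlusGcp M,
        exists_equivalence_strongPlusGcp M⟩⟩
  · intro E _ _ _ _ _ _ _
    exact ⟨fun C _ _ => ⟨exists_equivalence_strongFunctor C,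
        exists_equivalence_strongSymmetricFunctor C⟩,
      fun M _ _ _ => ⟨exists_equivalence_cartesian_ncPlusGcp M,
        exists_equivalence_cartesian_locPlusGcp M⟩,
      fun M _ _ _ _ => ⟨exists_equivalence_cartesian_symNcPlusGcp M,
        exists_equivalence_cartesian_symLocPlusGcp M,
        exists_equivalence_cartesian_strongPlusGcp M⟩⟩
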